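/- Let $U=\mathbb R^3/\mathbb Z^3$ be the unit torus with its uniform measure and Euclidean distance, and let $0<T<\infty$. Let $f_0\in L^1(U\times\mathbb R^3)$ and $g_0\in L^1(\mathbb R^3)$ be probability densities that are admissible, i.e. $$\int_{U\times\mathbb R^3} f_0(x,v)(1+|v|^2)\,dx\,dv<\infty,\quad \int_{\mathbb R^3} g_0(v)(1+|v|^2)\,dv<\infty,\quad \operatorname*{ess\,sup}_{v\in\mathbb R^3} g_0(v)(1+|v|^4)<\infty .$$ **Particle system.** For $N\in\mathbb N$ let $\varepsilon>0$ be given by $N\varepsilon^2=1$. A tagged particle has random initial position and velocity with density $f_0$; independently, $N$ background particles have independent initial data $(x_j,v_j)$, with $x_j$ uniform in $U$ and $v_j$ of density $g_0$. The background particles move freely, $x_j(t)=x_j+tv_j$. A motion $(x(t),v(t))$ of the tagged particle on $[0,T]$ starts from its initial data, satisfies $\dot x=v$ with $v$ right-continuous and piecewise constant with finitely many jumps, keeps $|x(t)-x_j(t)|\ge\varepsilon$ for all $t\in[0,T]$ and all $j$, and for $0<t\le T$ satisfies: $v(t)=v(t^-)$ if $|x(t)-x_j(t)|>\varepsilon$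 for all $j$, and $$v(t)=v(t^-)-\big(\nu\cdot(v(t^-)-v_j)\big)\nu,\qquad \nu=\frac{x(t)-x_j(t)}{|x(t)-x_j(t)|},$$ whenever $|x(t)-x_j(t)|=\varepsilon$. Let $\hat f^N_t$ be the law of $(x(t),v(t))$, where the state is set equal to its initial value in the event that no such motion on $[0,T]$ exists (for example, if particles overlap initially). **Linear Boltzmann equation.** Let $$Q^+[f](x,v)=\int_{\mathbb S^2}\int_{\mathbb R^3} f(x,v')g_0(\bar v')[(v-\bar v)\cdot\nu]_+\,d\bar v\,d\nu,\qquad Q^-[f](x,v)=f(x,v)\int_{\mathbb S^2}\int_{\mathbb R^3} g_0(\bar v)[(v-\bar v)\cdot\nu]_+\,d\bar v\,d\nu,$$ with $v'=v+(\nu\cdot(\bar v-v))\nu$ and $\bar v'=\bar v-(\nu\cdot(\bar v-v))\nu$. Let $Af=-v\cdot\partial_xf-Q^-[f]$ (in the sense of distributions) and $Bf=Q^+[f]$, with domains the sets of $f\in L^1(U\times\mathbb R^3)$ for which the result lies in $L^1(U\times\mathbb R^3)$. A mild solution on $[0,T]$ of $$\partial_t f_t=-v\cdot\partial_xf_t+Q^+[f_t]-Q^-[f_t],\qquad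 f_{t=0}=f_0,$$ is a continuous $f:[0,T]\to L^1(U\times\mathbb R^3)$ such that for all $t\in[0,T]$ one has $\int_0^tf_\theta\,d\theta\in D(A)\cap D(B)$ and $(A+B)\int_0^tf_\theta\,d\theta=f_t-f_0$. **Theorem.** There is exactly one mild solution $f$ on $[0,T]$, and every $f_t$ is a probability density. As $N\to\infty$, the probability that a motion of the tagged particle on $[0,T]$ exists tends to $1$, and $\hat f^N_t$ converges to $f_t$ in total variation, uniformly in $t\in[0,T]$: $$\lim_{N\to\infty}\ \sup_{t\in[0,T]}\ \sup_{\Omega\subset U\times\mathbb R^3\ \text{measurable}}\Big|\hat f^N_t(\Omega)-\int_\Omega f_t(x,v)\,dx\,dv\Big|=0 .$$ -/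

import Mathlib

open MeasureTheory Filter Topology Set

noncomputable section

namespace Rayleigh

/-- Velocity space `ℝ³` with the Euclidean norm. -/
abbrev V3 : Type := EuclideanSpace ℝ (Fin 3)

/-- The flat torus `[0,1]³` with periodic boundary conditions, with its uniform measure. -/
abbrev Torus : Type := UnitAddTorus (Fin 3)

/-- One-particle phase space: position and velocity. -/
abbrev Phase : Type := Torus × V3

/-- `L¹(U × ℝ³)`. -/
abbrev L1Phase : Type := Phase →₁[(volume : Measure Phase)] ℝ

/-- `L¹(ℝ³)`. -/
abbrev L1V : Type := V3 →₁[(volume : Measure V3)] ℝ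

/-- The unit sphere of `ℝ³`. -/
abbrev S2 : Type := Metric.sphere (0 : V3) 1

/-- The surface measure on the unit sphere (of total mass `4π`). -/
def surf : Measure S2 := (volume : Measure V3).toSphere

/-- The projection `ℝ³ → ℝ³/ℤ³`. -/
def toTorus (x : V3) : Torus := fun i => (x i : UnitAddCircle)

/-- The Euclidean distance on the torus. -/
def torusDist (x y : Torus) : ℝ := √(∑ i, ‖x i - y i‖ ^ 2)

/-! ### Admissible data -/

/-- `f₀`, `g₀` are probability densities with finite second moments, and
`g₀(v)(1+|v|⁴)` is essentially bounded. -/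
structure Admissible (f₀ : L1Phase) (g₀ : L1V) : Prop where
  f_nonneg : ∀ᵐ z, 0 ≤ f₀ z
  f_mass : ∫ z, f₀ z = 1
  g_nonneg : ∀ᵐ v, 0 ≤ g₀ v
  g_mass : ∫ v, g₀ v = 1
  f_moment : Integrable (fun z : Phase => f₀ z * (1 + ‖z.2‖ ^ 2))
  g_moment : Integrable (fun v : V3 => g₀ v * (1 + ‖v‖ ^ 2))
  g_bound : ∃ C : ℝ, ∀ᵐ v, g₀ v * (1 + ‖v‖ ^ 4) ≤ C

/-! ### The particle system -/

/-- Initial configurations: the tagged particle and `N` background particles. -/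
abbrev Config (N : ℕ) : Type := Phase × (Fin N → Phase)

/-- The tagged particle has density `f₀`; the background particles are independent of it and of
each other, uniform in space and with velocity density `g₀`. -/
def initialLaw (f₀ : L1Phase) (g₀ : L1V) (N : ℕ) : Measure (Config N) :=
  (volume.withDensity fun z => ENNReal.ofReal (f₀ z)).prod
    (Measure.pi fun _ : Fin N =>
      (volume : Measure Torus).prod (volume.withDensity fun v => ENNReal.ofReal (g₀ v)))

/-- The diameter `ε` determined by `N ε² = 1`. -/
def diam (N : ℕ) : ℝ := (√(N : ℝ))⁻¹

/-- The position at time `t` of a background particle that starts at `b`. -/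
def bgPos (b : Phase) (t : ℝ) : Torus := b.1 + toTorus (t • b.2)

/-- `p = (x, v)` is the motion on `[0,T]` of the tagged particle, started from `ω.1`, among
background particles in free flow, started from `ω.2`, for particles of diameter `ε`. -/
structure IsTrajectory (T ε : ℝ) {N : ℕ} (ω : Config N) (p : ℝ → Phase) : Prop where
  init : p 0 = ω.1
  /-- Apart from finitely many times the motion is free; velocities are right-continuous. -/
  free_flight : ∃ C : Finset ℝ, ∀ s t, 0 ≤ s → s < t → t ≤ T → (∀ c ∈ C, c ∉ Ioo s t) →
    (∀ r ∈ Icc s t, (p r).1 = (p s).1 + toTorus ((r - s) • (p s).2)) ∧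
    (∀ r ∈ Ico s t, (p r).2 = (p s).2)
  /-- The tagged particle never comes closer than `ε` to a background particle. -/
  exclusion : ∀ t ∈ Icc 0 T, ∀ j, ε ≤ torusDist (p t).1 (bgPos (ω.2 j) t)
  /-- The velocity does not jump at a time without contact; `w` is the velocity `v(t⁻)`. -/
  no_contact : ∀ t ∈ Ioc 0 T, (∀ j, ε < torusDist (p t).1 (bgPos (ω.2 j) t)) →
    ∀ w, Tendsto (fun s => (p s).2) (𝓝[<] t) (𝓝 w) → (p t).2 = w
  /-- At a contact with particle `j`, where `x(t) - x_j(t) = ε ν`, the velocity jumps by the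
  collision rule `v(t) = v(t⁻) - (ν · (v(t⁻) - v_j)) ν`. -/
  contact : ∀ t ∈ Ioc 0 T, ∀ j, ∀ ν : V3, ‖ν‖ = 1 →
    (p t).1 - bgPos (ω.2 j) t = toTorus (ε • ν) →
    ∀ w, Tendsto (fun s => (p s).2) (𝓝[<] t) (𝓝 w) →
      (p t).2 = w - (inner ℝ ν (w - (ω.2 j).2)) • ν

/-- The hard-sphere dynamics with the given initial configuration is defined up to time `T`. -/
def WellPosed (T ε : ℝ) {N : ℕ} (ω : Config N) : Prop := ∃ p, IsTrajectory T ε ω p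

open Classical in
/-- The state of the tagged particle at time `t ∈ [0,T]`. Where the dynamics is not defined
up to time `T` (for instance if particles overlap initially) the initial state is used. -/
def taggedState (T ε : ℝ) {N : ℕ} (ω : Config N) (t : ℝ) : Phase :=
  if h : WellPosed T ε ω then h.choose t else ω.1

/-- The law of the tagged particle among `N` background particles at time `t`:
the probability that its state lies in `A`. -/
def taggedLaw (T : ℝ) (f₀ : L1Phase) (g₀ : L1V) (N : ℕ) (t : ℝ) (A : Set Phase) : ℝ :=
  (initialLaw f₀ g₀ N).real {ω | taggedState T (diam N) ω t ∈ A}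

/-! ### The linear Boltzmann equation -/

/-- `∫_{S²} ∫_{ℝ³} g₀(w) [(v - w) · ν]₊ dw dν`. -/
def collFreq (g₀ : L1V) (v : V3) : ℝ :=
  ∫ ν : S2, (∫ w : V3, g₀ w * max (inner ℝ (v - w) (ν : V3)) 0) ∂surf

/-- The loss term `Q⁻[f]`. -/
def lossTerm (g₀ : L1V) (f : Phase → ℝ) (z : Phase) : ℝ := f z * collFreq g₀ z.2

/-- The integrand of the gain term, `f(x,v') g₀(w') [(v - w) · ν]₊`, where
`v' = v + (ν · (w - v)) ν` and `w' = w - (ν · (w - v)) ν`. -/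
def gainIntegrand (g₀ : L1V) (f : Phase → ℝ) (z : Phase) (ν : S2) (w : V3) : ℝ :=
  f (z.1, z.2 + (inner ℝ (ν : V3) (w - z.2)) • (ν : V3)) *
    g₀ (w - (inner ℝ (ν : V3) (w - z.2)) • (ν : V3)) *
    max (inner ℝ (z.2 - w) (ν : V3)) 0

/-- The gain term `Q⁺[f]`. -/
def gainTerm (g₀ : L1V) (f : Phase → ℝ) (z : Phase) : ℝ :=
  ∫ ν : S2, (∫ w : V3, gainIntegrand g₀ f z ν w) ∂surf

/-- Smooth compactly supported functions on `U × ℝ³` (smoothness is that of the lift to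
`ℝ³ × ℝ³`). -/
structure IsTest (φ : Phase → ℝ) : Prop where
  smooth : ContDiff ℝ ((⊤ : ℕ∞) : WithTop ℕ∞) (fun q : V3 × V3 => φ (toTorus q.1, q.2))
  compact : HasCompactSupport φ

/-- `v · ∂ₓ φ`. -/
def stream (φ : Phase → ℝ) (z : Phase) : ℝ :=
  deriv (fun s : ℝ => φ (z.1 + toTorus (s • z.2), z.2)) 0

/-- `f ∈ D(A)` and `A f = a`, that is, `a = - v · ∂ₓ f - Q⁻[f]` in the sense of distributions,
with `a ∈ L¹`. -/
def IsA (g₀ : L1V) (f a : L1Phase) : Prop :=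
  ∀ φ, IsTest φ → ∫ z, f z * stream φ z = ∫ z, (a z + lossTerm g₀ f z) * φ z

/-- `f ∈ D(B)` and `B f = b`, that is, `b = Q⁺[f]` with `b ∈ L¹`. -/
def IsB (g₀ : L1V) (f b : L1Phase) : Prop :=
  (∀ᵐ z : Phase, Integrable (fun q : S2 × V3 => gainIntegrand g₀ f z q.1 q.2)
    (surf.prod volume)) ∧
  ∀ᵐ z : Phase, b z = gainTerm g₀ f z

/-- `u` is a mild solution on `[0,T]` of `∂ₜ u = - v · ∂ₓ u + Q⁺[u] - Q⁻[u]`, `u(0) = f₀`: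
it is continuous with values in `L¹`, and `∫₀ᵗ u` lies in the domain of `A + B` with
`(A + B) ∫₀ᵗ u = u(t) - f₀`. -/
structure IsMildSolution (T : ℝ) (g₀ : L1V) (f₀ : L1Phase) (u : ℝ → L1Phase) : Prop where
  cont : ContinuousOn u (Icc 0 T)
  eqn : ∀ t ∈ Icc 0 T, ∃ a b : L1Phase,
    IsA g₀ (∫ θ in (0 : ℝ)..t, u θ) a ∧ IsB g₀ (∫ θ in (0 : ℝ)..t, u θ) b ∧ a + b = u t - f₀

end Rayleigh

end

/-! ### Geometry and measure: the torus, the unit sphere, volumes swept by a ball. -/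

noncomputable section

namespace Rayleigh

/-! ### The torus -/

/-! The limit equation is the forward equation of a jump process. The tagged particle flies freely
and, at velocity v, collides at rate `collFreq g₀ v` with a background velocity w and a direction ν
whose joint density is proportional to g₀(w)[(v - w)·ν]₊. A realization is a collision history in
`Tree n`. The measures `tau` weigh histories without the survival factor, which `sw` supplies as
exp(-`acc`). The sum over n gives the law `Ff` of the state at a given time. The fundamental theorem
of calculus along each free flight yields a balance in [0, ∞], and summation over n turns it into
the weak equation `Ff_identity`. The collision rate is unbounded in v, so mass could escape to
infinitely many collisions. The first moment bound `exists_moment` makes the loss and gain terms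
finite, they cancel, and the mass stays one (`Ff_one`). The law charges no null set (`ev_eq_zero`),
and its density `sol` is a mild solution.

Uniqueness holds because A + B is dissipative in L¹ (`dissipative`). At fixed velocity, A is
transport on the torus with constant damping, and Fourier coefficients give a resolvent estimate in
which the full loss term appears (`IsA.resolvent`). By duality the gain has at most the L¹ norm of
the loss (`IsB.lintegral_le`). The time integral H of the difference of two solutions satisfies (A +
B)H = H' and H(0) = 0, so an implicit Euler comparison gives H = 0.

For the particles, the path of a history is made independent of ε: the i-th background particle is
placed so that at its collision time it sits at displacement εν from the tagged particle. If the
collisions are separated (`GoodT`), point particles have no recollisions, quantitatively (`Sep`), ε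
is small and the other particles are missed, then this path is exactly the motion
(`Realizes.isTrajectory`). Since the motion is unique, the configuration determines the history
(`Realizes.unique`). The map from (t, ν) to the position of a background particle has Jacobian ε²[(v
- w)·ν]₊ (`lintegral_cylinder`), so each choice of n labels contributes at least ε²ⁿ `tau`. There
are about Nⁿ = ε⁻²ⁿ ordered choices, and the remaining particles are all missed with probability at
least about (1 - ε² `acc`)^(N - n), which tends to exp(-`acc`).

Hence the particle law dominates, up to a factor tending to one, the jump process restricted to
regular histories, and almost every history is regular (`ae_regular`). Both laws have mass one. A
lower bound on all sets, applied also to complements, therefore gives convergence in total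
variation, uniformly in time, and existence of the motion with probability tending to one.
Recollisions never have to be estimated: they are part of what is missing from the lower bound. -/

@[simp] lemma toTorus_apply (x : V3) (i : Fin 3) : toTorus x i = (x i : UnitAddCircle) := rfl

lemma toTorus_add (x y : V3) : toTorus (x + y) = toTorus x + toTorus y := by
  ext i; simp

@[simp] lemma toTorus_zero : toTorus 0 = 0 := by
  ext i; simp

lemma toTorus_neg (x : V3) : toTorus (-x) = -toTorus x := by
  ext i; simp

lemma toTorus_sub (x y : V3) : toTorus (x - y) = toTorus x - toTorus y := by
  ext i; simp

lemma continuous_toTorus : Continuous toTorus := by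
  refine continuous_pi fun i => ?_
  exact (AddCircle.continuous_mk' 1).comp (by fun_prop)

lemma measurable_toTorus : Measurable toTorus := continuous_toTorus.measurable

lemma toTorus_surjective : Function.Surjective toTorus := by
  intro x
  choose a ha using fun i => QuotientAddGroup.mk_surjective (x i)
  exact ⟨WithLp.toLp 2 a, by ext i; exact ha i⟩

/-- Lattice vectors. -/
def lat (m : Fin 3 → ℤ) : V3 := WithLp.toLp 2 fun i => (m i : ℝ)

@[simp] lemma lat_apply (m : Fin 3 → ℤ) (i : Fin 3) : lat m i = m i := rfl

@[simp] lemma toTorus_lat (m : Fin 3 → ℤ) : toTorus (lat m) = 0 := by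
  ext i
  simp only [toTorus_apply, lat_apply, Pi.zero_apply]
  exact (AddCircle.coe_eq_zero_iff 1).2 ⟨m i, by simp⟩

lemma toTorus_eq_zero_iff (x : V3) : toTorus x = 0 ↔ ∃ m, x = lat m := by
  constructor
  · intro h
    have h' : ∀ i, ∃ n : ℤ, n • (1 : ℝ) = x i := fun i =>
      (AddCircle.coe_eq_zero_iff 1).1 (by simpa using congrFun h i)
    choose m hm using h'
    refine ⟨m, ?_⟩
    ext i; simp [← hm i]
  · rintro ⟨m, rfl⟩; simp

lemma toTorus_eq_iff (x y : V3) : toTorus x = toTorus y ↔ ∃ m, x = y + lat m := by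
  rw [← sub_eq_zero, ← toTorus_sub, toTorus_eq_zero_iff]
  simp [sub_eq_iff_eq_add, add_comm]

lemma torusDist_eq_norm (x y : Torus) :
    torusDist x y = ‖(WithLp.toLp 2 (fun i => ‖x i - y i‖) : V3)‖ := by
  simp [torusDist, EuclideanSpace.norm_eq]

lemma torusDist_nonneg (x y : Torus) : 0 ≤ torusDist x y := Real.sqrt_nonneg _

lemma torusDist_comm (x y : Torus) : torusDist x y = torusDist y x := by
  simp [torusDist, norm_sub_rev]

lemma norm_le_norm_of_abs_le {a b : V3} (h : ∀ i, |a i| ≤ b i) : ‖a‖ ≤ ‖b‖ := by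
  rw [EuclideanSpace.norm_eq, EuclideanSpace.norm_eq]
  refine Real.sqrt_le_sqrt (Finset.sum_le_sum fun i _ => ?_)
  have h0 := (abs_nonneg _).trans (h i)
  rw [Real.norm_eq_abs, Real.norm_eq_abs, abs_of_nonneg h0]
  exact pow_le_pow_left₀ (abs_nonneg _) (h i) 2

lemma torusDist_triangle (x y z : Torus) :
    torusDist x z ≤ torusDist x y + torusDist y z := by
  simp only [torusDist_eq_norm]
  refine le_trans (norm_le_norm_of_abs_le (b := (WithLp.toLp 2 (fun i => ‖x i - y i‖) : V3) +
    WithLp.toLp 2 (fun i => ‖y i - z i‖)) fun i => ?_) (norm_add_le _ _)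
  simpa using norm_sub_le_norm_sub_add_norm_sub (x i) (y i) (z i)

lemma torusDist_sub (x y : Torus) : torusDist x y = torusDist (x - y) 0 := by
  simp [torusDist]

lemma norm_coe_le (a : ℝ) : ‖(a : UnitAddCircle)‖ ≤ |a| := by
  rw [UnitAddCircle.norm_eq]
  simpa using round_le a 0

lemma torusDist_toTorus_le (a : V3) : torusDist (toTorus a) 0 ≤ ‖a‖ := by
  rw [torusDist, EuclideanSpace.norm_eq]
  refine Real.sqrt_le_sqrt (Finset.sum_le_sum fun i _ => ?_)
  simpa [sq_abs] using pow_le_pow_left₀ (norm_nonneg _) (norm_coe_le (a i)) 2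

lemma abs_apply_le_norm (a : V3) (i : Fin 3) : |a i| ≤ ‖a‖ := by
  simpa using PiLp.norm_apply_le a i

/-- Each coordinate of `a` lies in [-1/2, 1/2], where the norm of the circle is the absolute value.
This makes the geometry of a collision Euclidean at small scales. -/
lemma torusDist_toTorus_eq {a : V3} (ha : ‖a‖ ≤ 1 / 2) : torusDist (toTorus a) 0 = ‖a‖ := by
  rw [torusDist, EuclideanSpace.norm_eq]
  congr 1
  refine Finset.sum_congr rfl fun i _ => ?_
  have h : ‖(a i : UnitAddCircle)‖ = |a i| := by
    refine (AddCircle.norm_coe_eq_abs_iff 1 one_ne_zero).2 ?_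
    simpa using (abs_apply_le_norm a i).trans ha
  simp [h, sq_abs]

lemma torusDist_self_add (x : Torus) {a : V3} (ha : ‖a‖ ≤ 1 / 2) :
    torusDist x (x + toTorus a) = ‖a‖ := by
  rw [torusDist_comm, torusDist_sub, add_sub_cancel_left, torusDist_toTorus_eq ha]

lemma torusDist_self_add_le (x : Torus) (a : V3) :
    torusDist x (x + toTorus a) ≤ ‖a‖ := by
  rw [torusDist_comm, torusDist_sub, add_sub_cancel_left]; exact torusDist_toTorus_le a

/-- Subtracting the nearest integer from every coordinate of a lift of y - x gives a vector that
realizes the distance. -/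
lemma exists_lift_torusDist (x y : Torus) : ∃ a : V3, y = x + toTorus a ∧ ‖a‖ = torusDist x y := by
  have h : ∀ i, ∃ r : ℝ, (r : UnitAddCircle) = y i - x i ∧ |r| = ‖y i - x i‖ := by
    intro i
    obtain ⟨r, hr⟩ := QuotientAddGroup.mk_surjective (y i - x i)
    refine ⟨r - round r, ?_, ?_⟩
    · rw [← hr, AddCircle.coe_sub]
      have : ((round r : ℝ) : UnitAddCircle) = 0 :=
        (AddCircle.coe_eq_zero_iff 1).2 ⟨round r, by simp⟩
      rw [this, sub_zero]
    · rw [← hr]; exact (UnitAddCircle.norm_eq (x := r)).symm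
  choose r hr hr' using h
  refine ⟨WithLp.toLp 2 r, ?_, ?_⟩
  · ext i; simp [hr]
  · rw [torusDist_comm, torusDist, EuclideanSpace.norm_eq]
    simp [hr']

lemma torusDist_pos {x y : Torus} (h : x ≠ y) : 0 < torusDist x y := by
  refine lt_of_le_of_ne (torusDist_nonneg _ _) fun h0 => h ?_
  obtain ⟨a, ha, ha'⟩ := exists_lift_torusDist x y
  rw [← h0, norm_eq_zero] at ha'
  simp [ha, ha']

@[fun_prop]
lemma Continuous.torusDist {α : Type*} [TopologicalSpace α] {f g : α → Torus}
    (hf : Continuous f) (hg : Continuous g) : Continuous fun a => torusDist (f a) (g a) := by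
  unfold Rayleigh.torusDist; fun_prop

@[fun_prop]
lemma Measurable.torusDist {α : Type*} [MeasurableSpace α] {f g : α → Torus}
    (hf : Measurable f) (hg : Measurable g) : Measurable fun a => torusDist (f a) (g a) := by
  unfold Rayleigh.torusDist
  refine (Finset.measurable_sum _ fun i _ => ?_).sqrt
  exact (((measurable_pi_apply i).comp hf).sub ((measurable_pi_apply i).comp hg)).norm.pow_const 2

/-- Two short vectors with the same image in the torus agree. -/
lemma eq_of_toTorus_eq {a b : V3} (ha : ‖a‖ < 1 / 2) (hb : ‖b‖ < 1 / 2)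
    (h : toTorus a = toTorus b) : a = b := by
  obtain ⟨m, hm⟩ := (toTorus_eq_iff a b).1 h
  ext i
  have h1 := congrArg (fun z : V3 => z i) hm
  simp only [PiLp.add_apply, lat_apply] at h1
  have h2 := (abs_lt.1 ((abs_apply_le_norm a i).trans_lt ha))
  have h3 := (abs_lt.1 ((abs_apply_le_norm b i).trans_lt hb))
  have h4 : (m i : ℝ) < 1 := by linarith
  have h5 : (-1 : ℝ) < m i := by linarith
  have h6 : m i = 0 := by
    have h4' : m i < 1 := by exact_mod_cast h4
    have h5' : -1 < m i := by exact_mod_cast h5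
    omega
  rw [h1, h6]; simp

/-- The unit cube. -/
def cube : Set V3 := {y | ∀ i, y i ∈ Ioc (0 : ℝ) 1}

lemma measurableSet_cube : MeasurableSet cube := by
  have : cube = ⋂ i, (fun y : V3 => y i) ⁻¹' Ioc 0 1 := by ext; simp [cube]
  rw [this]
  exact MeasurableSet.iInter fun i => measurableSet_Ioc.preimage (by fun_prop)

lemma measurePreserving_toTorus :
    MeasurePreserving toTorus ((volume : Measure V3).restrict cube) volume := by
  have h1 : MeasurePreserving (fun (y : Fin 3 → ℝ) (i : Fin 3) => (y i : UnitAddCircle))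
      (Measure.pi fun _ => volume.restrict (Ioc (0 : ℝ) (0 + 1)))
      (Measure.pi fun _ => volume) :=
    measurePreserving_pi _ _ fun _ => UnitAddCircle.measurePreserving_mk 0
  rw [← Measure.restrict_pi_pi] at h1
  have h2 := (PiLp.volume_preserving_ofLp (Fin 3)).restrict_preimage
    (s := univ.pi fun _ : Fin 3 => Ioc (0 : ℝ) (0 + 1))
    (MeasurableSet.univ_pi fun _ => measurableSet_Ioc)
  have h3 := h1.comp h2
  have hc : cube = WithLp.ofLp ⁻¹' (univ.pi fun _ : Fin 3 => Ioc (0 : ℝ) (0 + 1)) := by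
    ext y; simp [cube]
  rw [hc]
  exact h3

lemma lintegral_torus {f : Torus → ENNReal} (hf : Measurable f) :
    ∫⁻ x, f x = ∫⁻ y in cube, f (toTorus y) :=
  (measurePreserving_toTorus.lintegral_comp hf).symm

/-- The lattice translates of the unit cube tile space, and Lebesgue measure is translation
invariant. Together with `lintegral_torus` this compares volumes in the torus and in ℝ³. -/
lemma lintegral_unfold {h : V3 → ENNReal} (hh : Measurable h) :
    ∫⁻ y, h y = ∫⁻ y in cube, ∑' m : Fin 3 → ℤ, h (y + lat m) := by
  have hcov : (⋃ m : Fin 3 → ℤ, (fun y => y - lat m) ⁻¹' cube) = univ := by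
    -- The cube is a product of intervals (0, 1], so the integer to subtract is ⌈y⌉ - 1 and not ⌊y⌋.
    refine eq_univ_of_forall fun y => mem_iUnion.2 ⟨fun i => ⌈y i⌉ - 1, fun i => ?_⟩
    have h1 := Int.ceil_lt_add_one (y i)
    have h2 := Int.le_ceil (y i)
    simp only [PiLp.sub_apply, lat_apply, Int.cast_sub, Int.cast_one]
    constructor <;> linarith
  have hdis : Pairwise (Function.onFun Disjoint fun m : Fin 3 → ℤ =>
      (fun y => y - lat m) ⁻¹' cube) := by
    intro m m' hne
    refine Set.disjoint_left.2 fun y h1 h2 => hne (funext fun i => ?_)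
    have h1 := h1 i
    have h2 := h2 i
    simp only [PiLp.sub_apply, lat_apply, mem_Ioc] at h1 h2
    have h3 : (m i : ℝ) < m' i + 1 := by linarith
    have h4 : (m' i : ℝ) < m i + 1 := by linarith
    have h3' : m i < m' i + 1 := by exact_mod_cast h3
    have h4' : m' i < m i + 1 := by exact_mod_cast h4
    omega
  rw [← setLIntegral_univ, ← hcov, lintegral_iUnion
    (fun m => measurableSet_cube.preimage (by fun_prop)) hdis]
  rw [lintegral_tsum (f := fun (m : Fin 3 → ℤ) y => h (y + lat m))
    (fun m => (hh.comp (measurable_id.add_const (lat m))).aemeasurable)]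
  refine tsum_congr fun m => ?_
  have := (measurePreserving_add_right (volume : Measure V3) (lat m)).setLIntegral_comp_preimage_emb
    (MeasurableEquiv.addRight (lat m)).measurableEmbedding h ((fun y => y - lat m) ⁻¹' cube)
  rw [← this]
  congr 2
  ext y; simp

/-- The projection to the torus does not increase the volume of a set on which it is injective. -/
lemma volume_inter_preimage_toTorus_le {G : Set V3} (hG : MeasurableSet G)
    (hinj : InjOn toTorus G) {S : Set Torus} (hS : MeasurableSet S) :
    volume (G ∩ toTorus ⁻¹' S) ≤ volume S := by
  have hm : MeasurableSet (G ∩ toTorus ⁻¹' S) := hG.inter (measurable_toTorus hS)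
  rw [← lintegral_indicator_one hm, ← lintegral_indicator_one hS,
    lintegral_unfold (measurable_one.indicator hm),
    lintegral_torus (measurable_one.indicator hS)]
  refine lintegral_mono fun y => ?_
  -- Injectivity allows at most one lattice translate of y in the set, so the sum over the lattice
  -- has at most one nonzero term.
  by_cases hy : ∃ m, y + lat m ∈ G ∩ toTorus ⁻¹' S
  · obtain ⟨m, hm⟩ := hy
    rw [tsum_eq_single m]
    · have h2 := hm.2
      rw [mem_preimage, toTorus_add, toTorus_lat, add_zero] at h2
      rw [indicator_of_mem hm, indicator_of_mem h2]
      simp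
    · intro m' hne
      refine indicator_of_notMem (fun h' => hne ?_) _
      have := hinj h'.1 hm.1 (by simp [toTorus_add])
      have h2 : lat m' = lat m := add_left_cancel this
      ext i
      have := congrArg (fun z : V3 => z i) h2
      simpa using this
  · push Not at hy
    rw [ENNReal.tsum_eq_zero.2 fun m => indicator_of_notMem (hy m) _]
    exact zero_le

/-- The volume of a set in the torus is at most that of any set of representatives. -/
lemma volume_le_of_subset_image {A : Set Torus} {S : Set V3} (hS : MeasurableSet S)
    (h : A ⊆ toTorus '' S) : volume A ≤ volume S := by
  have key : volume (toTorus '' S) ≤ volume S := by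
    have hmeas : MeasurableSet (toTorus '' S) := by
      -- For measurability, S is cut along the lattice cubes and the pieces are moved into the unit
      -- cube. There the projection is injective, so the image of each piece is measurable.
      have : toTorus '' S = ⋃ m : Fin 3 → ℤ,
          toTorus '' ((fun y => y + lat m) ⁻¹' S ∩ cube) := by
        ext x
        simp only [mem_image, mem_iUnion, mem_inter_iff, mem_preimage]
        constructor
        · rintro ⟨y, hy, rfl⟩
          refine ⟨fun i => ⌈y i⌉ - 1, y - lat (fun i => ⌈y i⌉ - 1), ⟨by simpa using hy, ?_⟩,
            by simp [toTorus_sub]⟩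
          intro i
          have h1 := Int.ceil_lt_add_one (y i)
          have h2 := Int.le_ceil (y i)
          simp only [PiLp.sub_apply, lat_apply, Int.cast_sub, Int.cast_one]
          constructor <;> linarith
        · rintro ⟨m, y, ⟨hy, -⟩, rfl⟩
          exact ⟨_, hy, by simp [toTorus_add]⟩
      rw [this]
      refine MeasurableSet.iUnion fun m => MeasurableSet.image_of_continuousOn_injOn
        ((hS.preimage (by fun_prop)).inter measurableSet_cube) continuous_toTorus.continuousOn ?_
      rintro x ⟨-, hx⟩ y ⟨-, hy⟩ hxy
      obtain ⟨m, hm⟩ := (toTorus_eq_iff x y).1 hxy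
      ext i
      have h1 := congrArg (fun z : V3 => z i) hm
      have h2 := hx i
      have h3 := hy i
      simp only [PiLp.add_apply, lat_apply, mem_Ioc] at h1 h2 h3
      have h4 : (m i : ℝ) < 1 := by linarith
      have h5 : (-1 : ℝ) < m i := by linarith
      have h4' : m i < 1 := by exact_mod_cast h4
      have h5' : -1 < m i := by exact_mod_cast h5
      have h6 : m i = 0 := by omega
      rw [h1, h6]; simp
    have hnull : ∫⁻ x, (toTorus '' S).indicator 1 x ≤ volume S := by
      rw [lintegral_torus (measurable_one.indicator hmeas), ← lintegral_indicator_one hS,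
        lintegral_unfold (measurable_one.indicator hS)]
      refine lintegral_mono fun y => ?_
      by_cases hy : toTorus y ∈ toTorus '' S
      · obtain ⟨x, hx, hxy⟩ := hy
        obtain ⟨m, rfl⟩ := (toTorus_eq_iff x y).1 hxy
        refine le_trans ?_ (ENNReal.le_tsum m)
        rw [indicator_of_mem hx]
        exact indicator_le_self' (by simp) _
      · rw [indicator_of_notMem hy]; exact zero_le
    rwa [lintegral_indicator_one hmeas] at hnull
  exact (measure_mono h).trans key

end Rayleigh

end

noncomputable section

namespace Rayleigh

/-! ### The surface measure of the sphere -/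

instance : IsFiniteMeasure surf := by unfold surf; infer_instance

lemma norm_S2 (ν : S2) : ‖(ν : V3)‖ = 1 := by simp

lemma finrank_V3 : Module.finrank ℝ V3 = 3 := by simp

/-- Polar coordinates. -/
lemma lintegral_polar {H : V3 → ENNReal} (hH : Measurable H) :
    ∫⁻ y, H y = ∫⁻ ν : S2, (∫⁻ r in Ioi (0 : ℝ), ENNReal.ofReal (r ^ 2) * H (r • (ν : V3))) ∂surf := by
  have h1 := (Measure.measurePreserving_homeomorphUnitSphereProd (volume : Measure V3))
  have h2 : ∫⁻ y, H y = ∫⁻ y : ({0}ᶜ : Set V3), H y ∂(volume.comap Subtype.val) := by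
    rw [lintegral_subtype_comap (measurableSet_singleton _).compl,
      Measure.restrict_eq_self_of_ae_mem]
    exact compl_mem_ae_iff.2 (by simp)
  have h3 := h1.lintegral_comp (f := fun q : S2 × Ioi (0 : ℝ) => H ((q.2 : ℝ) • (q.1 : V3)))
    (by fun_prop)
  have h4 : ∀ y : ({0}ᶜ : Set V3), H (((homeomorphUnitSphereProd V3 y).2 : ℝ) •
      ((homeomorphUnitSphereProd V3 y).1 : V3)) = H y := by
    intro y
    congr 1
    have := (homeomorphUnitSphereProd V3).symm_apply_apply y
    have := congrArg Subtype.val this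
    rwa [homeomorphUnitSphereProd_symm_apply_coe] at this
  simp only [h4] at h3
  rw [h2, h3, lintegral_prod _ (by fun_prop)]
  refine lintegral_congr fun ν => ?_
  rw [finrank_V3, Measure.volumeIoiPow, lintegral_withDensity_eq_lintegral_mul₀ (by fun_prop)
    (by fun_prop), ← lintegral_subtype_comap measurableSet_Ioi]
  rfl

/-- The radial part of the volume of the unit ball; its inverse is the factor 3 in `lintegral_surf`.
-/
lemma lintegral_Ioo_sq : ∫⁻ r in Ioi (0 : ℝ), ENNReal.ofReal (r ^ 2) * (Iio (1 : ℝ)).indicator 1 r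
    = ENNReal.ofReal (1 / 3) := by
  have : ∀ r : ℝ, ENNReal.ofReal (r ^ 2) * (Iio (1 : ℝ)).indicator 1 r
      = (Iio (1 : ℝ)).indicator (fun r => ENNReal.ofReal (r ^ 2)) r := by
    intro r; by_cases h : r ∈ Iio (1 : ℝ) <;> simp [h]
  simp only [this]
  rw [lintegral_indicator measurableSet_Iio, Measure.restrict_restrict measurableSet_Iio,
    inter_comm, Ioi_inter_Iio, Measure.restrict_congr_set Ioo_ae_eq_Ioc,
    ← ofReal_integral_eq_lintegral_ofReal, ← intervalIntegral.integral_of_le zero_le_one]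
  · norm_num
  · exact (continuous_pow 2).integrableOn_Ioc
  · exact Eventually.of_forall fun r => sq_nonneg r

/-- Integrals over the sphere as integrals over the ball. -/
lemma lintegral_surf {G : V3 → ENNReal} (hG : Measurable G) :
    ∫⁻ ν : S2, G ν ∂surf
      = 3 * ∫⁻ y : V3, (Iio (1 : ℝ)).indicator 1 ‖y‖ * G (‖y‖⁻¹ • y) := by
  have hm : Measurable fun y : V3 => (Iio (1 : ℝ)).indicator (1 : ℝ → ENNReal) ‖y‖ * G (‖y‖⁻¹ • y) :=
    ((measurable_one.indicator measurableSet_Iio).comp measurable_norm).mul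
      (hG.comp (by fun_prop))
  rw [lintegral_polar hm]
  have : ∀ ν : S2, ∫⁻ r in Ioi (0 : ℝ), ENNReal.ofReal (r ^ 2) *
      ((Iio (1 : ℝ)).indicator 1 ‖r • (ν : V3)‖ * G (‖r • (ν : V3)‖⁻¹ • (r • (ν : V3))))
      = ENNReal.ofReal (1 / 3) * G ν := by
    intro ν
    rw [← lintegral_Ioo_sq, ← lintegral_mul_const _ (by
      exact (by fun_prop : Measurable fun r : ℝ => ENNReal.ofReal (r ^ 2)).mul
        (measurable_one.indicator measurableSet_Iio))]
    refine setLIntegral_congr_fun measurableSet_Ioi fun r hr => ?_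
    have hr : 0 < r := hr
    have h1 : ‖r • (ν : V3)‖ = r := by rw [norm_smul, norm_S2, mul_one, Real.norm_of_nonneg hr.le]
    simp only [h1, smul_smul, inv_mul_cancel₀ hr.ne', one_smul, mul_assoc]
  simp only [this]
  rw [lintegral_const_mul' _ _ ENNReal.ofReal_ne_top, ← mul_assoc]
  have : (3 : ENNReal) * ENNReal.ofReal (1 / 3) = 1 := by
    rw [show (3 : ENNReal) = ENNReal.ofReal 3 by simp, ← ENNReal.ofReal_mul (by norm_num)]
    norm_num
  rw [this, one_mul]

lemma lintegral_surf_neg {G : V3 → ENNReal} (hG : Measurable G) :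
    ∫⁻ ν : S2, G (-ν) ∂surf = ∫⁻ ν : S2, G ν ∂surf := by
  rw [lintegral_surf hG, lintegral_surf (G := fun y => G (-y)) (hG.comp measurable_neg),
    ← lintegral_neg_eq_self (μ := (volume : Measure V3))]
  simp

/-- Sections of the sphere by proper subspaces are null. -/
lemma surf_submodule (p : Submodule ℝ V3) (hp : p ≠ ⊤) : surf {ν : S2 | (ν : V3) ∈ p} = 0 := by
  have hpm : MeasurableSet (p : Set V3) := p.closed_of_finiteDimensional.measurableSet
  have h1 : surf {ν : S2 | (ν : V3) ∈ p} = ∫⁻ ν : S2, (p : Set V3).indicator 1 (ν : V3) ∂surf := by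
    exact (lintegral_indicator_one (hpm.preimage measurable_subtype_coe)).symm
  rw [h1, lintegral_surf (measurable_one.indicator hpm)]
  -- A vector lies in p as soon as its direction does, so the sector over the section is contained
  -- in p, which has volume zero.
  have h2 : ∫⁻ y : V3, (Iio (1 : ℝ)).indicator 1 ‖y‖ * (p : Set V3).indicator 1 (‖y‖⁻¹ • y)
      ≤ ∫⁻ y : V3, (p : Set V3).indicator 1 y := by
    refine lintegral_mono fun y => ?_
    refine (mul_le_mul_left (indicator_le_self' (by simp) _) _).trans ?_
    simp only [Pi.one_apply, one_mul]
    by_cases hy : y ∈ p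
    · rw [indicator_of_mem (show y ∈ (p : Set V3) from hy)]
      exact indicator_le_self' (by simp) _
    · rw [indicator_of_notMem]
      · exact zero_le
      · intro h
        by_cases h0 : ‖y‖ = 0
        · rw [norm_eq_zero] at h0; exact hy (h0 ▸ p.zero_mem)
        · exact hy ((p.smul_mem_iff (inv_ne_zero h0)).1 h)
  rw [lintegral_indicator_one hpm, Measure.addHaar_submodule _ _ hp] at h2
  simp [nonpos_iff_eq_zero.1 h2]

lemma span_pair_ne_top (a b : V3) : Submodule.span ℝ {a, b} ≠ ⊤ := by
  intro h
  have h1 : Module.finrank ℝ (Submodule.span ℝ ({a, b} : Set V3)) ≤ 2 := by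
    classical
    refine (finrank_span_le_card ({a, b} : Set V3)).trans ?_
    rw [Set.toFinset_insert, Set.toFinset_singleton]
    exact Finset.card_le_two
  rw [h, finrank_top, finrank_V3] at h1
  omega

/-! ### Cylinders -/

section Cylinder

variable {e : V3}

/-- Coordinates along and orthogonal to a unit vector. -/
lemma measurePreserving_axis (he : ‖e‖ = 1) :
    MeasurePreserving (fun q : ℝ × (ℝ ∙ e)ᗮ => q.1 • e + (q.2 : V3))
      (volume.prod volume) volume := by
  have h1 := (LinearIsometryEquiv.toSpanUnitSingleton (𝕜 := ℝ) e he).measurePreserving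
  have h2 := (h1.prod (MeasurePreserving.id (volume : Measure (ℝ ∙ e)ᗮ)))
  have h3 := (WithLp.volume_preserving_toLp (U := (ℝ ∙ e)) (V := (ℝ ∙ e)ᗮ)).comp h2
  have h4 := ((ℝ ∙ e).orthogonalDecomposition.symm.measurePreserving).comp h3
  have h5 : ∀ q : ℝ × (ℝ ∙ e)ᗮ, ((ℝ ∙ e).orthogonalDecomposition.symm ∘ WithLp.toLp 2 ∘
      Prod.map (LinearIsometryEquiv.toSpanUnitSingleton (𝕜 := ℝ) e he) id) q
      = q.1 • e + (q.2 : V3) := by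
    intro q
    rfl
  exact (funext h5) ▸ h4

lemma inner_axis (q : (ℝ ∙ e)ᗮ) : inner ℝ e (q : V3) = 0 :=
  Submodule.mem_orthogonal_singleton_iff_inner_right.1 q.2

lemma norm_axis_sq (he : ‖e‖ = 1) (a : ℝ) (q : (ℝ ∙ e)ᗮ) :
    ‖a • e + (q : V3)‖ ^ 2 = a ^ 2 + ‖q‖ ^ 2 := by
  rw [norm_add_sq_real, inner_smul_left, inner_axis, norm_smul, he]
  simp

lemma norm_axis (he : ‖e‖ = 1) (a : ℝ) (q : (ℝ ∙ e)ᗮ) :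
    ‖a • e + (q : V3)‖ = √(a ^ 2 + ‖q‖ ^ 2) := by
  rw [← norm_axis_sq he, Real.sqrt_sq (norm_nonneg _)]

lemma finrank_axis (he : ‖e‖ = 1) : Module.finrank ℝ (ℝ ∙ e)ᗮ = 2 := by
  have : Fact (Module.finrank ℝ V3 = 2 + 1) := ⟨finrank_V3⟩
  exact Submodule.finrank_orthogonal_span_singleton (by rintro rfl; simp at he)

lemma lintegral_axis_scale (he : ‖e‖ = 1) {g : (ℝ ∙ e)ᗮ → ENNReal} (hg : Measurable g) {c : ℝ}
    (hc : 0 < c) : ∫⁻ p, g (c • p) = ENNReal.ofReal ((c ^ 2)⁻¹) * ∫⁻ p, g p := by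
  have h := Measure.map_addHaar_smul (volume : Measure (ℝ ∙ e)ᗮ) hc.ne'
  rw [← lintegral_map hg (measurable_const_smul c), h, finrank_axis he, lintegral_smul_measure,
    abs_of_nonneg (by positivity), smul_eq_mul]

/-- Here r is the norm of a point at height a and at distance c from the axis. The Jacobian a / r is
the cosine of the angle to the axis, which is the factor e·ν of the flux integral. -/
lemma lintegral_sqrt_subst {c : ℝ} (hc : 0 ≤ c) (H : ℝ → ENNReal) :
    ∫⁻ a in Ioi (0 : ℝ), ENNReal.ofReal (a / √(a ^ 2 + c ^ 2)) * H (√(a ^ 2 + c ^ 2))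
      = ∫⁻ r in Ioi c, H r := by
  have himg : (fun a : ℝ => √(a ^ 2 + c ^ 2)) '' Ioi 0 = Ioi c := by
    ext r
    simp only [mem_image, mem_Ioi]
    constructor
    · rintro ⟨a, ha, rfl⟩
      exact Real.lt_sqrt_of_sq_lt (by nlinarith)
    · intro hr
      refine ⟨√(r ^ 2 - c ^ 2), Real.sqrt_pos.2 (by nlinarith), ?_⟩
      rw [Real.sq_sqrt (by nlinarith), sub_add_cancel, Real.sqrt_sq (hc.trans hr.le)]
  rw [← himg, lintegral_image_eq_lintegral_abs_deriv_mul (f' := fun a => a / √(a ^ 2 + c ^ 2))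
    measurableSet_Ioi]
  · refine setLIntegral_congr_fun measurableSet_Ioi fun a ha => ?_
    have ha : 0 < a := ha
    simp only [abs_of_nonneg (div_nonneg ha.le (Real.sqrt_nonneg _))]
  · intro a ha
    have ha : 0 < a := ha
    have h := ((hasDerivAt_pow 2 a).add_const (c ^ 2)).sqrt (by positivity)
    refine (h.congr_deriv ?_).hasDerivWithinAt
    have : √(a ^ 2 + c ^ 2) ≠ 0 := (Real.sqrt_pos.2 (by positivity)).ne'
    field_simp
    simp
  · intro a ha b hb hab
    have ha : 0 < a := ha
    have hb : 0 < b := hb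
    have h : a ^ 2 + c ^ 2 = b ^ 2 + c ^ 2 :=
      (Real.sqrt_inj (by positivity) (by positivity)).1 hab
    nlinarith

/-- The point of the axis nearest to a e + q has height a. It is reached at τ = a / L and lies at
distance ‖q‖. -/
lemma exists_norm_sub_lt_iff (he : ‖e‖ = 1) {L : ℝ} (hL : 0 < L) {ε : ℝ} (a : ℝ)
    (q : (ℝ ∙ e)ᗮ) : (∃ τ : ℝ, ‖a • e + (q : V3) - τ • L • e‖ < ε) ↔ ‖q‖ < ε := by
  have key : ∀ τ : ℝ, a • e + (q : V3) - τ • L • e = (a - τ * L) • e + (q : V3) := by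
    intro τ; rw [sub_smul, mul_smul]; abel
  constructor
  · rintro ⟨τ, h⟩
    rw [key, norm_axis he] at h
    refine lt_of_le_of_lt ?_ h
    exact Real.le_sqrt_of_sq_le (by nlinarith [sq_nonneg (a - τ * L)])
  · intro h
    refine ⟨a / L, ?_⟩
    rw [key, norm_axis he, div_mul_cancel₀ _ hL.ne']
    simpa using h

/-- The flux through a moving sphere: `(τ, ν) ↦ τ u + ε ν` transports `ε² [u·ν]₊ dτ dν` to
Lebesgue measure on the infinite cylinder of radius `ε` and axis `u`. -/
lemma lintegral_cylinder {u : V3} (hu : u ≠ 0) {ε : ℝ} (hε : 0 < ε) {F : V3 → ENNReal}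
    (hF : Measurable F) :
    ∫⁻ ν : S2, (∫⁻ τ : ℝ, ENNReal.ofReal (ε ^ 2 * max (inner ℝ u (ν : V3)) 0) *
      F (τ • u + ε • (ν : V3))) ∂surf = ∫⁻ y in {y : V3 | ∃ τ : ℝ, ‖y - τ • u‖ < ε}, F y := by
  obtain ⟨L, e, hL, he, rfl⟩ : ∃ (L : ℝ) (e : V3), 0 < L ∧ ‖e‖ = 1 ∧ u = L • e :=
    ⟨‖u‖, ‖u‖⁻¹ • u, norm_pos_iff.2 hu, by simp [norm_smul, hu], by simp [hu]⟩
  have hcyl : MeasurableSet {y : V3 | ∃ τ : ℝ, ‖y - τ • L • e‖ < ε} := by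
    refine IsOpen.measurableSet ?_
    rw [ofPred_exists]
    exact isOpen_iUnion fun τ => isOpen_lt (by fun_prop) continuous_const
  -- The integral of F over the line through p parallel to the axis. It depends only on the
  -- component of p orthogonal to the axis, so both sides reduce to integrals over a disc.
  set Ft : V3 → ENNReal := fun p => ∫⁻ a : ℝ, F (a • e + p) with hFt
  have hFtm : Measurable Ft := by
    refine Measurable.lintegral_prod_right' (f := fun q : V3 × ℝ => F (q.2 • e + q.1)) ?_
    exact hF.comp (by fun_prop)
  have hshift : ∀ (c : ℝ) (p : V3), Ft (c • e + p) = Ft p := by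
    intro c p
    simp only [hFt]
    rw [← lintegral_add_right_eq_self (fun a : ℝ => F (a • e + p)) c]
    simp only [add_smul, add_assoc]
  have hscale : ∀ p : V3, ∫⁻ τ : ℝ, F (τ • L • e + p) = ENNReal.ofReal L⁻¹ * Ft p := by
    intro p
    have h := Real.map_volume_mul_right hL.ne'
    have hm : Measurable fun a : ℝ => F (a • e + p) := hF.comp (by fun_prop)
    have h2 := lintegral_map (μ := volume) hm (measurable_mul_const L)
    rw [h, lintegral_smul_measure, smul_eq_mul, abs_of_pos (inv_pos.2 hL)] at h2
    simp only [hFt, h2, smul_smul]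
  -- both sides equal the integral of `Ft` over the disc
  have hR : ∫⁻ y in {y : V3 | ∃ τ : ℝ, ‖y - τ • L • e‖ < ε}, F y
      = ∫⁻ q : (ℝ ∙ e)ᗮ, (Iio ε).indicator 1 ‖q‖ * Ft (q : V3) := by
    rw [← lintegral_indicator hcyl, ← (measurePreserving_axis he).lintegral_comp
      (hF.indicator hcyl), lintegral_prod_symm]
    swap
    · exact ((hF.indicator hcyl).comp (measurePreserving_axis he).measurable).aemeasurable
    refine lintegral_congr fun q => ?_
    by_cases hq : ‖q‖ < ε
    · rw [indicator_of_mem (show ‖q‖ ∈ Iio ε from hq), Pi.one_apply, one_mul]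
      refine lintegral_congr fun a => indicator_of_mem ?_ _
      exact (exists_norm_sub_lt_iff he hL a q).2 hq
    · rw [indicator_of_notMem (show ‖q‖ ∉ Iio ε from hq), zero_mul]
      refine (lintegral_congr fun a => indicator_of_notMem ?_ _).trans lintegral_zero
      exact fun h => hq ((exists_norm_sub_lt_iff he hL a q).1 h)
  rw [hR]
  have h1 : ∀ ν : S2, ∫⁻ τ : ℝ, ENNReal.ofReal (ε ^ 2 * max (inner ℝ (L • e) (ν : V3)) 0) *
      F (τ • L • e + ε • (ν : V3))
      = ENNReal.ofReal (ε ^ 2) * (ENNReal.ofReal (inner ℝ e (ν : V3)) * Ft (ε • (ν : V3))) := by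
    intro ν
    rw [lintegral_const_mul' _ _ ENNReal.ofReal_ne_top, hscale, ← mul_assoc, ← mul_assoc,
      ← ENNReal.ofReal_mul' (by positivity)]
    congr 1
    rw [inner_smul_left, ENNReal.ofReal_mul (by positivity), ENNReal.ofReal_mul' (by positivity),
      ENNReal.ofReal_max, mul_assoc]
    congr 1
    simp only [ENNReal.ofReal_zero, RCLike.conj_to_real, zero_le, sup_of_le_left]
    rw [ENNReal.ofReal_mul hL.le, mul_right_comm, ← ENNReal.ofReal_mul hL.le,
      mul_inv_cancel₀ hL.ne', ENNReal.ofReal_one, one_mul]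
  simp only [h1]
  have hGm : Measurable fun y : V3 => ENNReal.ofReal (inner ℝ e y) * Ft (ε • y) :=
    (by fun_prop : Measurable fun y : V3 => ENNReal.ofReal (inner ℝ e y)).mul
      (hFtm.comp (by fun_prop))
  rw [lintegral_const_mul' _ _ ENNReal.ofReal_ne_top, lintegral_surf hGm]
  have hIm : Measurable ((Iio (1 : ℝ)).indicator (1 : ℝ → ENNReal)) :=
    measurable_one.indicator measurableSet_Iio
  have hHm : Measurable fun y : V3 => (Iio (1 : ℝ)).indicator 1 ‖y‖ *
      (ENNReal.ofReal (inner ℝ e (‖y‖⁻¹ • y)) * Ft (ε • ‖y‖⁻¹ • y)) :=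
    (hIm.comp measurable_norm).mul (hGm.comp (by fun_prop))
  rw [← (measurePreserving_axis he).lintegral_comp hHm, lintegral_prod_symm]
  swap
  · exact (hHm.comp (measurePreserving_axis he).measurable).aemeasurable
  have h2 : ∀ q : (ℝ ∙ e)ᗮ, ∫⁻ a : ℝ, (Iio (1 : ℝ)).indicator 1 ‖a • e + (q : V3)‖ *
      (ENNReal.ofReal (inner ℝ e (‖a • e + (q : V3)‖⁻¹ • (a • e + (q : V3)))) *
        Ft (ε • ‖a • e + (q : V3)‖⁻¹ • (a • e + (q : V3))))
      = ∫⁻ r in Ioi ‖q‖, (Iio (1 : ℝ)).indicator 1 r * Ft ((ε / r) • (q : V3)) := by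
    intro q
    rw [← lintegral_sqrt_subst (norm_nonneg q), ← lintegral_indicator measurableSet_Ioi]
    refine lintegral_congr fun a => ?_
    have hin : inner ℝ e (‖a • e + (q : V3)‖⁻¹ • (a • e + (q : V3)))
        = a / √(a ^ 2 + ‖q‖ ^ 2) := by
      rw [inner_smul_right, inner_add_right, inner_smul_right, inner_axis,
        real_inner_self_eq_norm_sq, he, norm_axis he]
      simp [div_eq_inv_mul]
    rw [hin]
    by_cases ha : 0 < a
    · rw [indicator_of_mem (show a ∈ Ioi 0 from ha), norm_axis he]
      rw [mul_left_comm]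
      congr 2
      rw [smul_smul, smul_add, smul_smul, hshift, div_eq_mul_inv]
    · rw [indicator_of_notMem (show a ∉ Ioi 0 from ha), ENNReal.ofReal_of_nonpos, zero_mul, mul_zero]
      exact div_nonpos_of_nonpos_of_nonneg (not_lt.1 ha) (Real.sqrt_nonneg _)
  have h3 : ∫⁻ q : (ℝ ∙ e)ᗮ, ∫⁻ r in Ioi ‖q‖,
      (Iio (1 : ℝ)).indicator 1 r * Ft ((ε / r) • (q : V3))
      = ∫⁻ r in Ioi (0 : ℝ), ∫⁻ q : (ℝ ∙ e)ᗮ, (Iio (1 : ℝ)).indicator 1 r *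
        ((Iio r).indicator 1 ‖q‖ * Ft ((ε / r) • (q : V3))) := by
    have hm1 : Measurable fun z : ℝ × (ℝ ∙ e)ᗮ => (Iio z.1).indicator (1 : ℝ → ENNReal) ‖z.2‖ := by
      have : (fun z : ℝ × (ℝ ∙ e)ᗮ => (Iio z.1).indicator (1 : ℝ → ENNReal) ‖z.2‖)
          = {z : ℝ × (ℝ ∙ e)ᗮ | ‖z.2‖ < z.1}.indicator 1 := by
        ext z; simp [indicator_apply]
      rw [this]
      exact measurable_one.indicator (measurableSet_lt (by fun_prop) (by fun_prop))
    rw [lintegral_lintegral_swap]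
    · refine lintegral_congr fun q => ?_
      rw [← lintegral_indicator measurableSet_Ioi, ← lintegral_indicator measurableSet_Ioi]
      refine lintegral_congr fun r => ?_
      by_cases h : ‖q‖ < r
      · rw [indicator_of_mem (show r ∈ Ioi ‖q‖ from h),
          indicator_of_mem (show r ∈ Ioi 0 from (norm_nonneg q).trans_lt h),
          indicator_of_mem (show ‖q‖ ∈ Iio r from h)]
        simp
      · rw [indicator_of_notMem (show r ∉ Ioi ‖q‖ from h), indicator_apply]
        split_ifs
        · rw [indicator_of_notMem (show ‖q‖ ∉ Iio r from h)]; simp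
        · rfl
    · refine Measurable.aemeasurable ?_
      exact (hIm.comp measurable_fst).mul (hm1.mul (hFtm.comp (by fun_prop)))
  have hdm : Measurable fun q : (ℝ ∙ e)ᗮ => (Iio ε).indicator (1 : ℝ → ENNReal) ‖q‖ * Ft (q : V3) :=
    ((measurable_one.indicator measurableSet_Iio).comp measurable_norm).mul
      (hFtm.comp measurable_subtype_coe)
  -- Scaling by ε / r maps the disc of radius r onto the disc of radius ε and costs the factor r² /
  -- ε². The remaining radial integral is 1/3 and cancels the factor 3 of `lintegral_surf`.
  have h4 : ∀ r ∈ Ioi (0 : ℝ), ∫⁻ q : (ℝ ∙ e)ᗮ, (Iio (1 : ℝ)).indicator 1 r *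
        ((Iio r).indicator 1 ‖q‖ * Ft ((ε / r) • (q : V3)))
      = ENNReal.ofReal (r ^ 2) * (Iio (1 : ℝ)).indicator 1 r * (ENNReal.ofReal (ε ^ 2)⁻¹ *
        ∫⁻ q : (ℝ ∙ e)ᗮ, (Iio ε).indicator 1 ‖q‖ * Ft (q : V3)) := by
    intro r hr
    have hr : 0 < r := hr
    have h5 := lintegral_axis_scale he hdm (div_pos hε hr)
    have h6 : ∀ q : (ℝ ∙ e)ᗮ, (Iio ε).indicator (1 : ℝ → ENNReal) ‖(ε / r) • q‖ *
        Ft (((ε / r) • q : (ℝ ∙ e)ᗮ) : V3) = (Iio r).indicator 1 ‖q‖ * Ft ((ε / r) • (q : V3)) := by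
      intro q
      congr 1
      have : ‖(ε / r) • q‖ < ε ↔ ‖q‖ < r := by
        rw [norm_smul, Real.norm_of_nonneg (by positivity), div_mul_eq_mul_div, div_lt_iff₀ hr,
          mul_lt_mul_iff_right₀ hε]
      simp only [indicator_apply, mem_Iio, this, Pi.one_apply]
    simp only [h6] at h5
    have hm2 : Measurable fun q : (ℝ ∙ e)ᗮ => (Iio r).indicator (1 : ℝ → ENNReal) ‖q‖ *
        Ft ((ε / r) • (q : V3)) :=
      ((measurable_one.indicator measurableSet_Iio).comp measurable_norm).mul
        (hFtm.comp (by fun_prop))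
    rw [lintegral_const_mul _ hm2, h5, ← mul_assoc, ← mul_assoc, mul_comm (ENNReal.ofReal (r ^ 2)),
      mul_assoc _ (ENNReal.ofReal (r ^ 2)), ← ENNReal.ofReal_mul (by positivity)]
    congr 3
    field_simp
  simp only [h2]
  rw [h3, setLIntegral_congr_fun measurableSet_Ioi h4, lintegral_mul_const, lintegral_Ioo_sq]
  · simp only [← mul_assoc]
    rw [show (3 : ENNReal) = ENNReal.ofReal 3 by simp, ← ENNReal.ofReal_mul (by positivity),
      ← ENNReal.ofReal_mul (by positivity), ← ENNReal.ofReal_mul (by positivity)]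
    have : ε ^ 2 * 3 * (1 / 3) * (ε ^ 2)⁻¹ = 1 := by field_simp
    rw [this]; simp
  · exact (by fun_prop : Measurable fun r : ℝ => ENNReal.ofReal (r ^ 2)).mul hIm

end Cylinder

end Rayleigh

end

/-! ### Collision rates, their growth in the velocity, and the duality of gain and jump operators.
-/

noncomputable section

namespace Rayleigh

/-! ### The collision kernel -/

/-- The velocity law of a background particle. -/
def gam (g₀ : L1V) : Measure V3 := volume.withDensity fun v => ENNReal.ofReal (g₀ v)

/-- The initial law of the tagged particle. -/
def mu0 (f₀ : L1Phase) : Measure Phase := volume.withDensity fun z => ENNReal.ofReal (f₀ z)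

instance (g₀ : L1V) : IsFiniteMeasure (gam g₀) :=
  isFiniteMeasure_withDensity_ofReal (L1.integrable_coeFn g₀).2

instance (f₀ : L1Phase) : IsFiniteMeasure (mu0 f₀) :=
  isFiniteMeasure_withDensity_ofReal (L1.integrable_coeFn f₀).2

lemma measurable_L1V (g₀ : L1V) : Measurable g₀ := (Lp.stronglyMeasurable g₀).measurable

lemma measurable_L1Phase (f₀ : L1Phase) : Measurable f₀ := (Lp.stronglyMeasurable f₀).measurable

lemma measurable_ofReal_L1V (g₀ : L1V) : Measurable fun v => ENNReal.ofReal (g₀ v) :=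
  (measurable_L1V g₀).ennreal_ofReal

lemma lintegral_gam (g₀ : L1V) {φ : V3 → ENNReal} (hφ : Measurable φ) :
    ∫⁻ w, φ w ∂gam g₀ = ∫⁻ w, ENNReal.ofReal (g₀ w) * φ w :=
  lintegral_withDensity_eq_lintegral_mul _ (measurable_ofReal_L1V g₀) hφ

variable {f₀ : L1Phase} {g₀ : L1V}

lemma Admissible.gam_univ (h : Admissible f₀ g₀) : gam g₀ univ = 1 := by
  rw [gam, withDensity_apply _ MeasurableSet.univ, setLIntegral_univ,
    ← ofReal_integral_eq_lintegral_ofReal (L1.integrable_coeFn g₀) h.g_nonneg, h.g_mass,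
    ENNReal.ofReal_one]

lemma Admissible.mu0_univ (h : Admissible f₀ g₀) : mu0 f₀ univ = 1 := by
  rw [mu0, withDensity_apply _ MeasurableSet.univ, setLIntegral_univ,
    ← ofReal_integral_eq_lintegral_ofReal (L1.integrable_coeFn f₀) h.f_nonneg, h.f_mass,
    ENNReal.ofReal_one]

/-- The second moment of the background. -/
lemma Admissible.gam_sq (h : Admissible f₀ g₀) :
    ∫⁻ w, ENNReal.ofReal (1 + ‖w‖ ^ 2) ∂gam g₀ < ⊤ := by
  rw [lintegral_gam g₀ (by fun_prop)]
  have := h.g_moment.lintegral_lt_top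
  refine lt_of_eq_of_lt (lintegral_congr_ae ?_) this
  filter_upwards [h.g_nonneg] with w hw
  rw [← ENNReal.ofReal_mul hw]

lemma Admissible.mu0_first (h : Admissible f₀ g₀) :
    ∫⁻ z, ENNReal.ofReal (1 + ‖z.2‖) ∂mu0 f₀ < ⊤ := by
  rw [mu0, lintegral_withDensity_eq_lintegral_mul _ (measurable_L1Phase f₀).ennreal_ofReal
    (by fun_prop)]
  have := (h.f_moment.const_mul 2).lintegral_lt_top
  refine lt_of_le_of_lt (lintegral_mono_ae ?_) this
  filter_upwards [h.f_nonneg] with z hz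
  simp only [Pi.mul_apply]
  rw [← ENNReal.ofReal_mul hz]
  refine ENNReal.ofReal_le_ofReal ?_
  nlinarith [sq_nonneg (‖z.2‖ - 1), mul_nonneg hz (sq_nonneg (‖z.2‖ - 1)),
    mul_nonneg hz (sq_nonneg ‖z.2‖)]

lemma two_mul_ofReal (x : ℝ) : 2 * ENNReal.ofReal x = ENNReal.ofReal (2 * x) := by
  rw [ENNReal.ofReal_mul (by norm_num)]; simp

/-- The collision rate. -/
def rate (v w : V3) (ν : S2) : ENNReal := ENNReal.ofReal (inner ℝ (v - w) (ν : V3))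

/-- The velocity of the tagged particle after a collision. -/
def post (v w : V3) (ν : V3) : V3 := v - (inner ℝ ν (v - w)) • ν

@[fun_prop]
lemma measurable_rate {α : Type*} [MeasurableSpace α] {a b : α → V3} {c : α → S2}
    (ha : Measurable a) (hb : Measurable b) (hc : Measurable c) :
    Measurable fun x => rate (a x) (b x) (c x) := by
  unfold rate; fun_prop

@[fun_prop]
lemma measurable_post {α : Type*} [MeasurableSpace α] {a b c : α → V3}
    (ha : Measurable a) (hb : Measurable b) (hc : Measurable c) :
    Measurable fun x => post (a x) (b x) (c x) := by
  unfold post; fun_prop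

lemma rate_le (v w : V3) (ν : S2) : rate v w ν ≤ ENNReal.ofReal (‖v‖ + ‖w‖) := by
  refine ENNReal.ofReal_le_ofReal ?_
  refine (real_inner_le_norm _ _).trans ?_
  rw [norm_S2, mul_one]
  exact norm_sub_le v w

/-- A collision replaces the component of v along ν by that of w and leaves the tangential part
unchanged. -/
lemma norm_post_le (v w : V3) (ν : S2) : ‖post v w ν‖ ≤ ‖v‖ + ‖w‖ := by
  have hn := norm_S2 ν
  have h1 : ‖post v w ν‖ ^ 2 = ‖v‖ ^ 2 - (inner ℝ (ν : V3) v) ^ 2 + (inner ℝ (ν : V3) w) ^ 2 := by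
    rw [post, norm_sub_sq_real, inner_smul_right, norm_smul, hn, inner_sub_right,
      real_inner_comm (ν : V3) v, mul_one, Real.norm_eq_abs, sq_abs]
    ring
  have h2 : |inner ℝ (ν : V3) w| ≤ ‖w‖ := by
    simpa [hn] using abs_real_inner_le_norm (ν : V3) w
  have h3 : (inner ℝ (ν : V3) w) ^ 2 ≤ ‖w‖ ^ 2 := by
    rw [← sq_abs]; exact pow_le_pow_left₀ (abs_nonneg _) h2 2
  refine abs_le_of_sq_le_sq' ?_ (by positivity) |>.2
  nlinarith [sq_nonneg (inner ℝ (ν : V3) v), norm_nonneg v, norm_nonneg w,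
    mul_nonneg (norm_nonneg v) (norm_nonneg w)]

/-- The (adjoint) collision operator `φ ↦ ∫∫ φ(x, v*) [(v - w)·ν]₊ dν g₀(w) dw`. -/
def coll (g₀ : L1V) (φ : Phase → ENNReal) (z : Phase) : ENNReal :=
  ∫⁻ w, (∫⁻ ν, rate z.2 w ν * φ (z.1, post z.2 w ν) ∂surf) ∂gam g₀

/-- The collision frequency as a lower integral. -/
def freq (g₀ : L1V) (v : V3) : ENNReal := ∫⁻ w, (∫⁻ ν, rate v w ν ∂surf) ∂gam g₀

lemma measurable_coll {φ : Phase → ENNReal} (hφ : Measurable φ) : Measurable (coll g₀ φ) := by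
  unfold coll
  refine Measurable.lintegral_prod_right' (f := fun q : Phase × V3 =>
    ∫⁻ ν, rate q.1.2 q.2 ν * φ (q.1.1, post q.1.2 q.2 ν) ∂surf) ?_
  refine Measurable.lintegral_prod_right' (f := fun q : (Phase × V3) × S2 =>
    rate q.1.1.2 q.1.2 q.2 * φ (q.1.1.1, post q.1.1.2 q.1.2 q.2)) ?_
  fun_prop

@[fun_prop]
lemma measurable_freq : Measurable (freq g₀) := by
  unfold freq
  refine Measurable.lintegral_prod_right' (f := fun q : V3 × V3 => ∫⁻ ν, rate q.1 q.2 ν ∂surf) ?_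
  refine Measurable.lintegral_prod_right' (f := fun q : (V3 × V3) × S2 => rate q.1.1 q.1.2 q.2) ?_
  fun_prop

lemma coll_one (z : Phase) : coll g₀ (fun _ => 1) z = freq g₀ z.2 := by
  simp [coll, freq]

/-- The rate is at most ‖v‖ + ‖w‖ ≤ 2 (1 + ‖v‖)(1 + ‖w‖²), and the background has finite second
moments. -/
lemma Admissible.exists_freq_le (h : Admissible f₀ g₀) :
    ∃ C : ℝ, 0 ≤ C ∧ ∀ v, freq g₀ v ≤ ENNReal.ofReal (C * (1 + ‖v‖)) := by
  have hg := h.gam_sq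
  set M := ∫⁻ w, ENNReal.ofReal (1 + ‖w‖ ^ 2) ∂gam g₀
  refine ⟨(surf univ * (2 * M)).toReal, ENNReal.toReal_nonneg, fun v => ?_⟩
  have hfin : surf univ * (2 * M) ≠ ⊤ :=
    ENNReal.mul_ne_top (measure_ne_top _ _) (ENNReal.mul_ne_top (by simp) hg.ne)
  rw [ENNReal.ofReal_mul ENNReal.toReal_nonneg, ENNReal.ofReal_toReal hfin]
  calc freq g₀ v ≤ ∫⁻ w, (∫⁻ _ν : S2, ENNReal.ofReal (‖v‖ + ‖w‖) ∂surf) ∂gam g₀ :=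
        lintegral_mono fun w => lintegral_mono fun ν => rate_le v w ν
    _ = ∫⁻ w, surf univ * ENNReal.ofReal (‖v‖ + ‖w‖) ∂gam g₀ := by simp [mul_comm]
    _ ≤ ∫⁻ w, (surf univ * 2 * ENNReal.ofReal (1 + ‖v‖)) * ENNReal.ofReal (1 + ‖w‖ ^ 2)
          ∂gam g₀ := by
        refine lintegral_mono fun w => ?_
        simp only [mul_assoc]
        gcongr
        rw [← ENNReal.ofReal_mul (by positivity), two_mul_ofReal]
        refine ENNReal.ofReal_le_ofReal ?_
        nlinarith [sq_nonneg (‖w‖ - 1), norm_nonneg v, norm_nonneg w,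
          mul_nonneg (norm_nonneg v) (sq_nonneg ‖w‖)]
    _ = _ := by
        rw [lintegral_const_mul _ (by fun_prop)]
        ring

lemma Admissible.freq_lt_top (h : Admissible f₀ g₀) (v : V3) : freq g₀ v < ⊤ := by
  obtain ⟨C, -, hC⟩ := h.exists_freq_le
  exact (hC v).trans_lt ENNReal.ofReal_lt_top

/-- The drift of `1 + |v|`. -/
lemma Admissible.exists_coll_le (h : Admissible f₀ g₀) :
    ∃ C : ℝ, 0 ≤ C ∧ ∀ z : Phase, coll g₀ (fun z => ENNReal.ofReal (1 + ‖z.2‖)) z ≤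
      freq g₀ z.2 * ENNReal.ofReal (1 + ‖z.2‖) + ENNReal.ofReal (C * (1 + ‖z.2‖)) := by
  have hg := h.gam_sq
  set M := ∫⁻ w, ENNReal.ofReal (1 + ‖w‖ ^ 2) ∂gam g₀
  refine ⟨(surf univ * (2 * M)).toReal, ENNReal.toReal_nonneg, fun z => ?_⟩
  have hfin : surf univ * (2 * M) ≠ ⊤ :=
    ENNReal.mul_ne_top (measure_ne_top _ _) (ENNReal.mul_ne_top (by simp) hg.ne)
  rw [ENNReal.ofReal_mul ENNReal.toReal_nonneg, ENNReal.ofReal_toReal hfin]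
  -- A collision raises 1 + ‖v‖ by at most ‖w‖ and occurs at rate at most ‖v‖ + ‖w‖. The product is
  -- linear in ‖v‖ and quadratic in ‖w‖, so second moments of the background give a linear drift.
  -- The term with the collision frequency is kept apart because it cancels against the loss.
  have h1 : ∀ (w : V3) (ν : S2), rate z.2 w ν * ENNReal.ofReal (1 + ‖post z.2 w ν‖) ≤
      rate z.2 w ν * ENNReal.ofReal (1 + ‖z.2‖) + ENNReal.ofReal ((‖z.2‖ + ‖w‖) * ‖w‖) := by
    intro w ν
    rw [ENNReal.ofReal_mul (by positivity)]
    calc _ ≤ rate z.2 w ν * ENNReal.ofReal ((1 + ‖z.2‖) + ‖w‖) := by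
          gcongr rate z.2 w ν * ENNReal.ofReal ?_; linarith [norm_post_le z.2 w ν]
      _ = rate z.2 w ν * ENNReal.ofReal (1 + ‖z.2‖) + rate z.2 w ν * ENNReal.ofReal ‖w‖ := by
          rw [ENNReal.ofReal_add (by positivity) (by positivity), mul_add]
      _ ≤ _ := by gcongr; exact rate_le _ _ _
  calc coll g₀ (fun z => ENNReal.ofReal (1 + ‖z.2‖)) z
      ≤ ∫⁻ w, (∫⁻ ν, (rate z.2 w ν * ENNReal.ofReal (1 + ‖z.2‖) +
          ENNReal.ofReal ((‖z.2‖ + ‖w‖) * ‖w‖)) ∂surf) ∂gam g₀ :=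
        lintegral_mono fun w => lintegral_mono fun ν => h1 w ν
    _ = ∫⁻ w, ((∫⁻ ν, rate z.2 w ν ∂surf) * ENNReal.ofReal (1 + ‖z.2‖) +
          ENNReal.ofReal ((‖z.2‖ + ‖w‖) * ‖w‖) * surf univ) ∂gam g₀ := by
        refine lintegral_congr fun w => ?_
        rw [lintegral_add_left (by fun_prop), lintegral_mul_const _ (by fun_prop), lintegral_const]
    _ = freq g₀ z.2 * ENNReal.ofReal (1 + ‖z.2‖) +
          (∫⁻ w, ENNReal.ofReal ((‖z.2‖ + ‖w‖) * ‖w‖) ∂gam g₀) * surf univ := by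
        have hm : Measurable fun w => ∫⁻ ν, rate z.2 w ν ∂surf :=
          Measurable.lintegral_prod_right' (f := fun q : V3 × S2 => rate z.2 q.1 q.2) (by fun_prop)
        rw [lintegral_add_left (by fun_prop), lintegral_mul_const _ hm,
          lintegral_mul_const _ (by fun_prop)]
        rfl
    _ ≤ _ := by
        refine add_le_add le_rfl ?_
        have h2 : ∫⁻ w, ENNReal.ofReal ((‖z.2‖ + ‖w‖) * ‖w‖) ∂gam g₀ ≤
            ∫⁻ w, (2 * ENNReal.ofReal (1 + ‖z.2‖)) * ENNReal.ofReal (1 + ‖w‖ ^ 2) ∂gam g₀ := by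
          refine lintegral_mono fun w => ?_
          simp only [mul_assoc]
          rw [← ENNReal.ofReal_mul (by positivity), two_mul_ofReal]
          refine ENNReal.ofReal_le_ofReal ?_
          nlinarith [sq_nonneg (‖w‖ - 1), norm_nonneg z.2, norm_nonneg w,
            mul_nonneg (norm_nonneg z.2) (sq_nonneg (‖w‖ - 1)),
            mul_nonneg (norm_nonneg z.2) (sq_nonneg ‖w‖)]
        rw [lintegral_const_mul _ (by fun_prop)] at h2
        calc _ ≤ (2 * ENNReal.ofReal (1 + ‖z.2‖) * M) * surf univ := mul_le_mul_left h2 _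
          _ = _ := by ring

/-- The collision frequency agrees with its lower integral. -/
lemma Admissible.ofReal_collFreq (h : Admissible f₀ g₀) (v : V3) :
    ENNReal.ofReal (collFreq g₀ v) = freq g₀ v := by
  have hfr := h.freq_lt_top v
  have hmeas : Measurable fun q : S2 × V3 => ENNReal.ofReal (g₀ q.2) * rate v q.2 q.1 :=
    ((measurable_ofReal_L1V g₀).comp measurable_snd).mul (by fun_prop)
  have h1 : freq g₀ v = ∫⁻ ν, (∫⁻ w, ENNReal.ofReal (g₀ w) * rate v w ν) ∂surf := by
    rw [lintegral_lintegral_swap hmeas.aemeasurable, freq, lintegral_gam g₀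
      (Measurable.lintegral_prod_right' (f := fun q : V3 × S2 => rate v q.1 q.2) (by fun_prop))]
    refine lintegral_congr fun w => ?_
    rw [lintegral_const_mul _ (by fun_prop)]
  have h2 : ∀ ν : S2, ∫ w, g₀ w * max (inner ℝ (v - w) (ν : V3)) 0
      = (∫⁻ w, ENNReal.ofReal (g₀ w) * rate v w ν).toReal := by
    intro ν
    rw [integral_eq_lintegral_of_nonneg_ae]
    · congr 1
      refine lintegral_congr_ae ?_
      filter_upwards [h.g_nonneg] with w hw
      rw [ENNReal.ofReal_mul hw, ENNReal.ofReal_max]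
      simp [rate]
    · filter_upwards [h.g_nonneg] with w hw
      exact mul_nonneg hw (le_max_right _ _)
    · have := measurable_L1V g₀
      exact (this.mul (by fun_prop)).aestronglyMeasurable
  rw [h1] at hfr
  have hm2 : Measurable fun ν : S2 => ∫⁻ w, ENNReal.ofReal (g₀ w) * rate v w ν :=
    Measurable.lintegral_prod_right' hmeas
  rw [collFreq]
  simp only [h2]
  rw [integral_toReal hm2.aemeasurable (ae_lt_top hm2 hfr.ne), ENNReal.ofReal_toReal hfr.ne, h1]

lemma Admissible.collFreq_eq (h : Admissible f₀ g₀) (v : V3) :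
    collFreq g₀ v = (freq g₀ v).toReal := by
  rw [← h.ofReal_collFreq, ENNReal.toReal_ofReal]
  refine integral_nonneg fun ν => integral_nonneg_of_ae ?_
  filter_upwards [h.g_nonneg] with w hw
  exact mul_nonneg hw (le_max_right _ _)

lemma Admissible.collFreq_nonneg (h : Admissible f₀ g₀) (v : V3) : 0 ≤ collFreq g₀ v := by
  rw [h.collFreq_eq]; exact ENNReal.toReal_nonneg

lemma Admissible.measurable_collFreq (h : Admissible f₀ g₀) : Measurable (collFreq g₀) := by
  rw [funext h.collFreq_eq]
  exact measurable_freq.ennreal_toReal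

lemma Admissible.exists_collFreq_le (h : Admissible f₀ g₀) :
    ∃ C : ℝ, 0 ≤ C ∧ ∀ v, collFreq g₀ v ≤ C * (1 + ‖v‖) := by
  obtain ⟨C, hC0, hC⟩ := h.exists_freq_le
  refine ⟨C, hC0, fun v => ?_⟩
  rw [h.collFreq_eq]
  exact ENNReal.toReal_le_of_le_ofReal (by positivity) (hC v)

/-! ### Duality of gain and collision operators -/

/-- The scattering map in the direction `ν`. -/
def scatter (ν : V3) : (V3 × V3) →ₗ[ℝ] (V3 × V3) where
  toFun q := (q.1 - (inner ℝ ν (q.1 - q.2)) • ν, q.2 + (inner ℝ ν (q.1 - q.2)) • ν)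
  map_add' q r := by
    ext1
    · simp only [Prod.fst_add, Prod.snd_add, inner_sub_right, inner_add_right]; module
    · simp only [Prod.fst_add, Prod.snd_add, inner_sub_right, inner_add_right]; module
  map_smul' c q := by
    ext1
    · simp only [Prod.smul_fst, Prod.smul_snd, inner_sub_right, inner_smul_right,
        RingHom.id_apply]; module
    · simp only [Prod.smul_fst, Prod.smul_snd, inner_sub_right, inner_smul_right,
        RingHom.id_apply]; module

lemma scatter_scatter {ν : V3} (hν : ‖ν‖ = 1) (q : V3 × V3) : scatter ν (scatter ν q) = q := by
  have h1 : inner ℝ ν ν = (1 : ℝ) := by rw [real_inner_self_eq_norm_sq, hν]; norm_num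
  ext1
  · simp only [scatter, LinearMap.coe_mk, AddHom.coe_mk, inner_sub_right, inner_add_right,
      inner_smul_right, h1]; module
  · simp only [scatter, LinearMap.coe_mk, AddHom.coe_mk, inner_sub_right, inner_add_right,
      inner_smul_right, h1]; module

/-- Scattering is a linear involution, so its determinant is ±1. -/
lemma measurePreserving_scatter {ν : V3} (hν : ‖ν‖ = 1) :
    MeasurePreserving (scatter ν) (volume : Measure (V3 × V3)) volume := by
  have hcomp : scatter ν ∘ₗ scatter ν = LinearMap.id := LinearMap.ext (scatter_scatter hν)
  have hdet : LinearMap.det (scatter ν) * LinearMap.det (scatter ν) = 1 := by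
    rw [← LinearMap.det_comp, hcomp, LinearMap.det_id]
  have habs : |LinearMap.det (scatter ν)| = 1 := by
    rcases mul_self_eq_one_iff.1 hdet with h | h <;> simp [h]
  have hne : LinearMap.det (scatter ν) ≠ 0 := fun h => by simp [h] at hdet
  have : (volume : Measure (V3 × V3)).IsAddHaarMeasure := Measure.prod.instIsAddHaarMeasure _ _
  refine ⟨(LinearMap.continuous_of_finiteDimensional _).measurable, ?_⟩
  rw [Measure.map_linearMap_addHaar_eq_smul_addHaar _ hne, abs_inv, habs]
  simp

/-- The gain operator as a lower integral. -/
def gainL (G : V3 → ENNReal) (F : Phase → ENNReal) (z : Phase) : ENNReal :=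
  ∫⁻ ν, (∫⁻ w, F (z.1, z.2 + (inner ℝ (ν : V3) (w - z.2)) • (ν : V3)) *
    G (w - (inner ℝ (ν : V3) (w - z.2)) • (ν : V3)) * rate z.2 w ν) ∂surf

lemma measurable_gain_integrand {G : V3 → ENNReal} (hG : Measurable G) {F : Phase → ENNReal}
    (hF : Measurable F) : Measurable fun q : (Phase × S2) × V3 =>
      F (q.1.1.1, q.1.1.2 + (inner ℝ (q.1.2 : V3) (q.2 - q.1.1.2)) • (q.1.2 : V3)) *
    G (q.2 - (inner ℝ (q.1.2 : V3) (q.2 - q.1.1.2)) • (q.1.2 : V3)) * rate q.1.1.2 q.2 q.1.2 := by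
  fun_prop

lemma measurable_gainL {G : V3 → ENNReal} (hG : Measurable G) {F : Phase → ENNReal}
    (hF : Measurable F) : Measurable (gainL G F) :=
  Measurable.lintegral_prod_right' (f := fun _ : Phase × S2 => _)
    (Measurable.lintegral_prod_right' (measurable_gain_integrand hG hF))

/-- Duality between the gain operator and the jump operator. -/
lemma lintegral_gainL_mul_general {G : V3 → ENNReal} {F φ : Phase → ENNReal} (hG : Measurable G)
    (hF : Measurable F) (hφ : Measurable φ) : ∫⁻ z, φ z * gainL G F z =
      ∫⁻ z, F z * ∫⁻ w, G w * ∫⁻ ν, rate z.2 w ν * φ (z.1, post z.2 w ν) ∂surf := by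
  set A : Phase → S2 → V3 → ENNReal := fun z ν w => φ z * (F (z.1, z.2 + (inner ℝ (ν : V3)
      (w - z.2)) • (ν : V3)) * G (w - (inner ℝ (ν : V3) (w - z.2)) • (ν : V3)) * rate z.2 w ν)
    with hA
  set B : Phase → S2 → V3 → ENNReal := fun z ν w => F z * (G w * (rate z.2 w ν *
      φ (z.1, post z.2 w ν))) with hB
  have hL : ∀ z, φ z * gainL G F z = ∫⁻ ν, (∫⁻ w, A z ν w) ∂surf := by
    intro z
    rw [gainL, ← lintegral_const_mul]
    · refine lintegral_congr fun ν => ?_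
      rw [← lintegral_const_mul]
      fun_prop
    · exact Measurable.lintegral_prod_right' (f := fun q : S2 × V3 =>
        F (z.1, z.2 + (inner ℝ (q.1 : V3) (q.2 - z.2)) • (q.1 : V3)) *
        G (q.2 - (inner ℝ (q.1 : V3) (q.2 - z.2)) • (q.1 : V3)) * rate z.2 q.2 q.1) (by fun_prop)
  have hR : ∀ z, F z * (∫⁻ w, G w * ∫⁻ ν, rate z.2 w ν * φ (z.1, post z.2 w ν) ∂surf) =
      ∫⁻ ν, (∫⁻ w, B z ν w) ∂surf := by
    intro z
    have hmz : Measurable fun w => ∫⁻ ν, rate z.2 w ν * φ (z.1, post z.2 w ν) ∂surf :=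
      Measurable.lintegral_prod_right' (f := fun q : V3 × S2 =>
        rate z.2 q.1 q.2 * φ (z.1, post z.2 q.1 q.2)) (by fun_prop)
    rw [lintegral_lintegral_swap (f := B z) (by simp only [hB]; fun_prop), ← lintegral_const_mul _
      (by exact hG.mul hmz)]
    refine lintegral_congr fun w => ?_
    rw [← lintegral_const_mul _ (by fun_prop), ← lintegral_const_mul _ (by fun_prop)]
  simp only [hL, hR]
  rw [lintegral_lintegral_swap (f := fun z ν => ∫⁻ w, A z ν w),
    lintegral_lintegral_swap (f := fun z ν => ∫⁻ w, B z ν w)]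
  rotate_left
  · exact (Measurable.lintegral_prod_right' (f := fun q : (Phase × S2) × V3 =>
      F q.1.1 * (G q.2 * (rate q.1.1.2 q.2 q.1.2 * φ (q.1.1.1, post q.1.1.2 q.2 q.1.2))))
      (by fun_prop)).aemeasurable
  · exact (Measurable.lintegral_prod_right' (f := fun q : (Phase × S2) × V3 =>
      φ q.1.1 * (F (q.1.1.1, q.1.1.2 + (inner ℝ (q.1.2 : V3) (q.2 - q.1.1.2)) • (q.1.2 : V3)) *
      G (q.2 - (inner ℝ (q.1.2 : V3) (q.2 - q.1.1.2)) • (q.1.2 : V3)) * rate q.1.1.2 q.2 q.1.2))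
      (by fun_prop)).aemeasurable
  -- For fixed ν the substitution `scatter ν` exchanges velocities before and after the collision
  -- and reverses the sign of the normal relative velocity. It turns the left side into R (-ν), and
  -- the reflection ν ↦ -ν preserves the surface measure.
  set R : V3 → ENNReal := fun ν => ∫⁻ z : Phase, ∫⁻ w, F z * (G w *
    (ENNReal.ofReal (inner ℝ (z.2 - w) ν) * φ (z.1, post z.2 w ν))) with hRdef
  have hRm : Measurable R := by
    refine Measurable.lintegral_prod_right' (f := fun q : V3 × Phase => ∫⁻ w, F q.2 * (G w *
      (ENNReal.ofReal (inner ℝ (q.2.2 - w) q.1) * φ (q.2.1, post q.2.2 w q.1)))) ?_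
    exact Measurable.lintegral_prod_right' (f := fun q : (V3 × Phase) × V3 =>
      F q.1.2 * (G q.2 * (ENNReal.ofReal (inner ℝ (q.1.2.2 - q.2) q.1.1) *
        φ (q.1.2.1, post q.1.2.2 q.2 q.1.1)))) (by fun_prop)
  have hlast : ∫⁻ ν : S2, R (-ν) ∂surf = ∫⁻ ν : S2, R ν ∂surf := lintegral_surf_neg hRm
  refine Eq.trans (lintegral_congr fun ν => ?_) hlast
  simp only [hRdef, hA]
  rw [Measure.volume_eq_prod, lintegral_prod _ (Measurable.lintegral_prod_right' (f := fun q : Phase × V3 =>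
      φ q.1 * (F (q.1.1, q.1.2 + (inner ℝ (ν : V3) (q.2 - q.1.2)) • (ν : V3)) *
      G (q.2 - (inner ℝ (ν : V3) (q.2 - q.1.2)) • (ν : V3)) * rate q.1.2 q.2 ν))
      (by fun_prop)).aemeasurable,
    lintegral_prod _ (Measurable.lintegral_prod_right' (f := fun q : Phase × V3 =>
      F q.1 * (G q.2 * (ENNReal.ofReal (inner ℝ (q.1.2 - q.2) (-ν : V3)) *
        φ (q.1.1, post q.1.2 q.2 (-ν : V3))))) (by fun_prop)).aemeasurable]
  refine lintegral_congr fun x => ?_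
  have hm1 : Measurable fun q : V3 × V3 => φ (x, q.1) * (F (x, q.1 + (inner ℝ (ν : V3)
      (q.2 - q.1)) • (ν : V3)) * G (q.2 - (inner ℝ (ν : V3) (q.2 - q.1)) • (ν : V3)) *
        rate q.1 q.2 ν) := by fun_prop
  have hm2 : Measurable fun q : V3 × V3 => F (x, q.1) * (G q.2 * (ENNReal.ofReal
      (inner ℝ (q.1 - q.2) (-ν : V3)) * φ (x, post q.1 q.2 (-ν : V3)))) := by fun_prop
  rw [← lintegral_prod _ hm1.aemeasurable, ← lintegral_prod _ hm2.aemeasurable, ← Measure.volume_eq_prod,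
    ← (measurePreserving_scatter (norm_S2 ν)).lintegral_comp hm1]
  refine lintegral_congr fun q => ?_
  obtain ⟨v, w⟩ := q
  have h1 : inner ℝ (ν : V3) (ν : V3) = (1 : ℝ) := by
    rw [real_inner_self_eq_norm_sq, norm_S2]; norm_num
  have e1 : v - (inner ℝ (ν : V3) (v - w)) • (ν : V3) = post v w (-ν : V3) := by
    simp [post]
  have e2 : inner ℝ (ν : V3) (w + (inner ℝ (ν : V3) (v - w)) • (ν : V3) -
      (v - (inner ℝ (ν : V3) (v - w)) • (ν : V3))) = inner ℝ (ν : V3) (v - w) := by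
    simp only [inner_sub_right, inner_add_right, inner_smul_right, h1]; ring
  have e3 : inner ℝ (v - (inner ℝ (ν : V3) (v - w)) • (ν : V3) -
      (w + (inner ℝ (ν : V3) (v - w)) • (ν : V3))) (ν : V3) = inner ℝ (v - w) (-ν : V3) := by
    rw [real_inner_comm, inner_neg_right, real_inner_comm (ν : V3) (v - w)]
    simp only [inner_sub_right, inner_add_right, inner_smul_right, h1]; ring
  simp only [scatter, LinearMap.coe_mk, AddHom.coe_mk, rate, e2, e3, sub_add_cancel,
    add_sub_cancel_right]
  rw [e1]
  ring

/-- `∫ φ Q⁺[F] = ∫ F (coll φ)`. -/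
lemma lintegral_gainL_mul {F φ : Phase → ENNReal} (hF : Measurable F) (hφ : Measurable φ) :
    ∫⁻ z, φ z * gainL (fun w => ENNReal.ofReal (g₀ w)) F z = ∫⁻ z, F z * coll g₀ φ z := by
  rw [lintegral_gainL_mul_general (measurable_ofReal_L1V g₀) hF hφ]
  refine lintegral_congr fun z => ?_
  rw [coll, lintegral_gam g₀]
  exact Measurable.lintegral_prod_right' (f := fun q : V3 × S2 =>
    rate z.2 q.1 q.2 * φ (z.1, post z.2 q.1 q.2)) (by fun_prop)

/-- Duality against F = 1: the integral of `coll g₀ φ` is that of φ times a gain term, hence zero.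
This lets absolute continuity pass through a collision. -/
lemma coll_null {φ : Phase → ENNReal} (hφ : Measurable φ) (h0 : ∀ᵐ z, φ z = 0) :
    ∀ᵐ z : Phase, coll g₀ φ z = 0 := by
  have h1 := lintegral_gainL_mul (g₀ := g₀) (F := fun _ => 1) measurable_const hφ
  simp only [one_mul] at h1
  have h2 : ∫⁻ z, φ z * gainL (fun w => ENNReal.ofReal (g₀ w)) (fun _ => 1) z = 0 := by
    refine lintegral_eq_zero_of_ae_eq_zero ?_
    filter_upwards [h0] with z hz
    rw [hz, zero_mul]; rfl
  rw [h2] at h1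
  exact (lintegral_eq_zero_iff (measurable_coll hφ)).1 h1.symm

end Rayleigh

end

/-! ### The limiting jump process: histories, balance equations, conservation of mass, density. -/

noncomputable section

namespace Rayleigh

/-! ### Collision histories -/

/-- A collision: its time, the velocity of the background particle, and the direction from the
tagged to the background particle. -/
abbrev Coll : Type := ℝ × V3 × S2

/-- An initial state together with a sequence of `n` collisions. -/
abbrev Tree (n : ℕ) : Type := Phase × (Fin n → Coll)

/-- All but the last collision. -/
def par {n : ℕ} (Φ : Tree (n + 1)) : Tree n := (Φ.1, fun i => Φ.2 i.castSucc)

/-- The last collision. -/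
def top {n : ℕ} (Φ : Tree (n + 1)) : Coll := Φ.2 (Fin.last n)

/-- Add a collision at the end. -/
def ext {n : ℕ} (Φ : Tree n) (k : Coll) : Tree (n + 1) := (Φ.1, Fin.snoc (α := fun _ => Coll) Φ.2 k)

@[simp] lemma par_ext {n : ℕ} (Φ : Tree n) (k : Coll) : par (ext Φ k) = Φ := by
  ext1
  · rfl
  · funext i; simp [par, ext]

@[simp] lemma top_ext {n : ℕ} (Φ : Tree n) (k : Coll) : top (ext Φ k) = k := by
  simp [top, ext]

lemma ext_par_top {n : ℕ} (Φ : Tree (n + 1)) : ext (par Φ) (top Φ) = Φ := by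
  ext1
  · rfl
  · exact Fin.snoc_init_self Φ.2

/-- Free flow. -/
def fl (s : ℝ) (z : Phase) : Phase := (z.1 + toTorus (s • z.2), z.2)

/-- The effect of a collision; a state `(y, v)` here stands for the free motion `y + s v`. -/
def stp (z : Phase) (k : Coll) : Phase :=
  (z.1 + toTorus (k.1 • z.2 - k.1 • post z.2 k.2.1 k.2.2), post z.2 k.2.1 k.2.2)

lemma fl_zero (z : Phase) : fl 0 z = z := by simp [fl]

lemma fl_fl (s t : ℝ) (z : Phase) : fl s (fl t z) = fl (s + t) z := by
  simp only [fl, add_smul, toTorus_add, Prod.mk.injEq, and_true]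
  abel

/-- The translation in `stp` makes the free motions before and after the collision meet at the
collision time, so that only the velocity jumps. -/
lemma fl_stp (z : Phase) (k : Coll) :
    fl k.1 (stp z k) = ((fl k.1 z).1, post z.2 k.2.1 k.2.2) := by
  simp only [fl, stp, toTorus_sub, Prod.mk.injEq, and_true]
  abel

/-- The free motion after the last collision. -/
def cur : {n : ℕ} → Tree n → Phase
  | 0, Φ => Φ.1
  | _ + 1, Φ => stp (cur (par Φ)) (top Φ)

/-- The time of the last collision. -/
def lastT : {n : ℕ} → Tree n → ℝ
  -- A negative default, so that a history without collisions satisfies `lastT Φ < r` at r = 0 as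
  -- well.
  | 0, _ => -1
  | _ + 1, Φ => (top Φ).1

/-- The accumulated collision frequency up to time `r`. -/
def acc (g₀ : L1V) : {n : ℕ} → Tree n → ℝ → ℝ
  | 0, Φ, r => collFreq g₀ Φ.1.2 * r
  | _ + 1, Φ, r => acc g₀ (par Φ) (top Φ).1 + collFreq g₀ (cur Φ).2 * (r - (top Φ).1)

/-- The motion of the tagged particle. -/
def path : {n : ℕ} → Tree n → ℝ → Phase
  | 0, Φ, s => fl s Φ.1
  | _ + 1, Φ, s => if s < (top Φ).1 then path (par Φ) s else fl s (cur Φ)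

variable {n : ℕ}

lemma cur_ext (Φ : Tree n) (k : Coll) : cur (ext Φ k) = stp (cur Φ) k := by
  simp [cur]

lemma lastT_ext (Φ : Tree n) (k : Coll) : lastT (ext Φ k) = k.1 := by
  simp [lastT]

lemma acc_ext (g₀ : L1V) (Φ : Tree n) (k : Coll) (r : ℝ) :
    acc g₀ (ext Φ k) r = acc g₀ Φ k.1 + collFreq g₀ (stp (cur Φ) k).2 * (r - k.1) := by
  simp [acc, cur_ext]

lemma path_ext (Φ : Tree n) (k : Coll) (s : ℝ) :
    path (ext Φ k) s = if s < k.1 then path Φ s else fl s (stp (cur Φ) k) := by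
  simp [path, cur_ext]

lemma path_of_last {Φ : Tree n} {s : ℝ} (h : lastT Φ < s) : path Φ s = fl s (cur Φ) := by
  cases n with
  | zero => rfl
  | succ n => exact if_neg (not_lt.2 (le_of_lt h))

@[fun_prop]
lemma measurable_fl {α : Type*} [MeasurableSpace α] {a : α → ℝ} {b : α → Phase}
    (ha : Measurable a) (hb : Measurable b) : Measurable fun x => fl (a x) (b x) := by
  unfold fl
  have := measurable_toTorus
  refine Measurable.prodMk (Measurable.add hb.fst (this.comp ?_)) hb.snd
  exact ha.smul hb.snd

@[fun_prop]
lemma measurable_stp {α : Type*} [MeasurableSpace α] {a : α → Phase} {b : α → Coll}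
    (ha : Measurable a) (hb : Measurable b) : Measurable fun x => stp (a x) (b x) := by
  unfold stp
  have := measurable_toTorus
  refine Measurable.prodMk (Measurable.add ha.fst (this.comp ?_)) (by fun_prop)
  fun_prop

@[fun_prop]
lemma measurable_par : Measurable (par : Tree (n + 1) → Tree n) := by
  unfold par; fun_prop

@[fun_prop]
lemma measurable_top : Measurable (top : Tree (n + 1) → Coll) := by
  unfold top; fun_prop

@[fun_prop]
lemma measurable_ext {α : Type*} [MeasurableSpace α] {a : α → Tree n} {b : α → Coll}
    (ha : Measurable a) (hb : Measurable b) : Measurable fun x => ext (a x) (b x) := by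
  unfold ext
  refine Measurable.prodMk (by fun_prop) (measurable_pi_lambda _ fun i => ?_)
  refine Fin.lastCases ?_ (fun j => ?_) i
  · simpa using hb
  · simp only [Fin.snoc_castSucc]; fun_prop

lemma lintegral_wd {α : Type*} [MeasurableSpace α] {μ : Measure α} {w H : α → ENNReal}
    (hw : Measurable w) (hH : Measurable H) :
    ∫⁻ a, H a ∂μ.withDensity w = ∫⁻ a, w a * H a ∂μ :=
  lintegral_withDensity_eq_lintegral_mul _ hw hH

@[fun_prop]
lemma measurable_cur : ∀ {n : ℕ}, Measurable (cur : Tree n → Phase)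
  | 0 => measurable_fst
  | n + 1 => by
    have := measurable_cur (n := n)
    show Measurable fun Φ : Tree (n + 1) => stp (cur (par Φ)) (top Φ)
    fun_prop

@[fun_prop]
lemma measurable_lastT : ∀ {n : ℕ}, Measurable (lastT : Tree n → ℝ)
  | 0 => measurable_const
  | n + 1 => by
    show Measurable fun Φ : Tree (n + 1) => (top Φ).1
    fun_prop

variable {f₀ : L1Phase} {g₀ : L1V}

lemma Admissible.measurable_acc (h : Admissible f₀ g₀) : ∀ {n : ℕ},
    Measurable fun q : Tree n × ℝ => acc g₀ q.1 q.2
  | 0 => by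
    have := h.measurable_collFreq
    show Measurable fun q : Tree 0 × ℝ => collFreq g₀ q.1.1.2 * q.2
    fun_prop
  | n + 1 => by
    have h1 := h.measurable_collFreq
    have h2 := h.measurable_acc (n := n)
    show Measurable fun q : Tree (n + 1) × ℝ => acc g₀ (par q.1) (top q.1).1 +
      collFreq g₀ (cur q.1).2 * (q.2 - (top q.1).1)
    refine Measurable.add (h2.comp (by fun_prop :
      Measurable fun q : Tree (n + 1) × ℝ => (par q.1, (top q.1).1))) (by fun_prop)

lemma measurable_path : ∀ {n : ℕ}, Measurable fun q : Tree n × ℝ => path q.1 q.2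
  | 0 => by
    show Measurable fun q : Tree 0 × ℝ => fl q.2 q.1.1
    fun_prop
  | n + 1 => by
    have h2 := measurable_path (n := n)
    show Measurable fun q : Tree (n + 1) × ℝ =>
      if q.2 < (top q.1).1 then path (par q.1) q.2 else fl q.2 (cur q.1)
    refine Measurable.ite (measurableSet_lt (by fun_prop) (by fun_prop)) ?_ (by fun_prop)
    exact h2.comp (by fun_prop : Measurable fun q : Tree (n + 1) × ℝ => (par q.1, q.2))

/-! ### The measure on collision histories -/

/-- The reference measure for one collision. -/
def rho (T : ℝ) (g₀ : L1V) : Measure Coll := (volume.restrict (Ioc 0 T)).prod ((gam g₀).prod surf)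

instance (T : ℝ) (g₀ : L1V) : IsFiniteMeasure (rho T g₀) := by unfold rho; infer_instance

/-- The density of the next collision, without the survival probability. -/
def wt (Φ : Tree n) (k : Coll) : ENNReal :=
  if lastT Φ < k.1 then rate (cur Φ).2 k.2.1 k.2.2 else 0

lemma measurable_wt : Measurable fun q : Tree n × Coll => wt q.1 q.2 := by
  unfold wt
  exact Measurable.ite (measurableSet_lt (by fun_prop) (by fun_prop)) (by fun_prop) (by fun_prop)

/-- Collision histories on `[0, T]`, weighted without the survival probability. -/
def tau (T : ℝ) (f₀ : L1Phase) (g₀ : L1V) : (n : ℕ) → Measure (Tree n)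
  | 0 => (mu0 f₀).map fun z => (z, Fin.elim0)
  | n + 1 => (((tau T f₀ g₀ n).prod (rho T g₀)).withDensity fun q => wt q.1 q.2).map
      fun q => ext q.1 q.2

variable {T : ℝ}

instance : ∀ n, SFinite (tau T f₀ g₀ n)
  | 0 => by unfold tau; infer_instance
  | n + 1 => by
    have : SFinite (tau T f₀ g₀ n) := instSFiniteTreeTau n
    unfold tau; infer_instance

lemma lintegral_tau_zero {H : Tree 0 → ENNReal} (hH : Measurable H) :
    ∫⁻ Φ, H Φ ∂tau T f₀ g₀ 0 = ∫⁻ z, H (z, Fin.elim0) ∂mu0 f₀ := by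
  rw [tau, lintegral_map hH (by fun_prop)]

lemma lintegral_tau_succ {H : Tree (n + 1) → ENNReal} (hH : Measurable H) :
    ∫⁻ Φ, H Φ ∂tau T f₀ g₀ (n + 1) =
      ∫⁻ q, wt q.1 q.2 * H (ext q.1 q.2) ∂(tau T f₀ g₀ n).prod (rho T g₀) := by
  rw [tau, lintegral_map hH (by fun_prop), lintegral_wd measurable_wt (by fun_prop)]

/-- The survival probability until time `r`. -/
def sw (g₀ : L1V) (Φ : Tree n) (r : ℝ) : ENNReal :=
  if lastT Φ < r then ENNReal.ofReal (Real.exp (-acc g₀ Φ r)) else 0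

lemma Admissible.measurable_sw (h : Admissible f₀ g₀) :
    Measurable fun q : Tree n × ℝ => sw g₀ q.1 q.2 := by
  have := h.measurable_acc (n := n)
  unfold sw
  exact Measurable.ite (measurableSet_lt (by fun_prop) (by fun_prop)) (by fun_prop) (by fun_prop)

/-- The law of the state at time `r` on the event of exactly `n` collisions. -/
def ev (T : ℝ) (f₀ : L1Phase) (g₀ : L1V) (n : ℕ) (r : ℝ) (φ : Phase → ENNReal) : ENNReal :=
  ∫⁻ Φ, sw g₀ Φ r * φ (fl r (cur Φ)) ∂tau T f₀ g₀ n

lemma Admissible.measurable_ev (h : Admissible f₀ g₀) {φ : ℝ → Phase → ENNReal}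
    (hφ : Measurable fun q : ℝ × Phase => φ q.1 q.2) :
    Measurable fun r => ev T f₀ g₀ n r (φ r) := by
  have hs := h.measurable_sw (n := n)
  refine Measurable.lintegral_prod_right' (f := fun q : ℝ × Tree n =>
    sw g₀ q.2 q.1 * φ q.1 (fl q.1 (cur q.2))) ?_
  exact (hs.comp measurable_swap).mul (hφ.comp (by fun_prop :
    Measurable fun q : ℝ × Tree n => (q.1, fl q.1 (cur q.2))))

lemma ev_mono {r : ℝ} {φ ψ : Phase → ENNReal} (hle : ∀ z, φ z ≤ ψ z) :
    ev T f₀ g₀ n r φ ≤ ev T f₀ g₀ n r ψ :=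
  lintegral_mono fun Φ => by gcongr; exact hle _

lemma Admissible.measurable_sw_right (h : Admissible f₀ g₀) (r : ℝ) :
    Measurable fun Φ : Tree n => sw g₀ Φ r :=
  h.measurable_sw.comp (by fun_prop : Measurable fun Φ : Tree n => (Φ, r))

lemma Admissible.ev_add (h : Admissible f₀ g₀) {r : ℝ} {φ ψ : Phase → ENNReal} (hφ : Measurable φ) :
    ev T f₀ g₀ n r (fun z => φ z + ψ z) = ev T f₀ g₀ n r φ + ev T f₀ g₀ n r ψ := by
  have hs := h.measurable_sw_right (n := n) r
  rw [ev, ev, ev, ← lintegral_add_left (by fun_prop)]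
  simp only [mul_add]

lemma Admissible.ev_const_mul (h : Admissible f₀ g₀) {r : ℝ} {φ : Phase → ENNReal}
    (hφ : Measurable φ) (c : ENNReal) :
    ev T f₀ g₀ n r (fun z => c * φ z) = c * ev T f₀ g₀ n r φ := by
  have hs := h.measurable_sw_right (n := n) r
  rw [ev, ev, ← lintegral_const_mul _ (by fun_prop)]
  simp only [mul_left_comm]

/-- The law of the history up to a collision, with the state after it. -/
def pre (T : ℝ) (f₀ : L1Phase) (g₀ : L1V) (n : ℕ) : Measure (Tree n × Coll) :=
  ((tau T f₀ g₀ n).prod (rho T g₀)).withDensity fun q =>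
    wt q.1 q.2 * ENNReal.ofReal (Real.exp (-acc g₀ q.1 q.2.1))

instance : SFinite (pre T f₀ g₀ n) := by unfold pre; infer_instance

/-- The survival probability of a free flight that starts at time `t`. -/
def fsw (g₀ : L1V) (v : V3) (t s : ℝ) : ENNReal :=
  if t < s then ENNReal.ofReal (Real.exp (-(collFreq g₀ v * (s - t)))) else 0

lemma Admissible.measurable_fsw (h : Admissible f₀ g₀) :
    Measurable fun q : V3 × ℝ × ℝ => fsw g₀ q.1 q.2.1 q.2.2 := by
  have := h.measurable_collFreq
  unfold fsw
  exact Measurable.ite (measurableSet_lt (by fun_prop) (by fun_prop)) (by fun_prop) (by fun_prop)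

lemma Admissible.measurable_exp_acc (h : Admissible f₀ g₀) : Measurable fun q : Tree n × Coll =>
    ENNReal.ofReal (Real.exp (-acc g₀ q.1 q.2.1)) := by
  have h2 := h.measurable_acc (n := n)
  have h3 : Measurable fun q : Tree n × Coll => acc g₀ q.1 q.2.1 :=
    h2.comp (by fun_prop : Measurable fun q : Tree n × Coll => (q.1, q.2.1))
  fun_prop

/-- Survival factorizes at the last collision: first along the old history up to the time of k, then
along the new free flight. -/
lemma sw_ext (Φ : Tree n) (k : Coll) (s : ℝ) : sw g₀ (ext Φ k) s =
    ENNReal.ofReal (Real.exp (-acc g₀ Φ k.1)) * fsw g₀ (stp (cur Φ) k).2 k.1 s := by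
  unfold sw fsw
  rw [lastT_ext, acc_ext, neg_add, Real.exp_add, ENNReal.ofReal_mul (Real.exp_pos _).le]
  split_ifs <;> simp

lemma Admissible.lintegral_tau_succ_sw (h : Admissible f₀ g₀) {H : Tree (n + 1) → ENNReal}
    (hH : Measurable H) (r : ℝ) : ∫⁻ Φ, sw g₀ Φ r * H Φ ∂tau T f₀ g₀ (n + 1) =
      ∫⁻ q, fsw g₀ (stp (cur q.1) q.2).2 q.2.1 r * H (ext q.1 q.2) ∂pre T f₀ g₀ n := by
  have hs := h.measurable_sw_right (n := n + 1) r
  have h1 := h.measurable_exp_acc (n := n)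
  have h2 : Measurable fun q : Tree n × Coll => fsw g₀ (stp (cur q.1) q.2).2 q.2.1 r :=
    h.measurable_fsw.comp (by fun_prop :
      Measurable fun q : Tree n × Coll => ((stp (cur q.1) q.2).2, q.2.1, r))
  have h0 := measurable_wt (n := n)
  rw [lintegral_tau_succ (by fun_prop), pre, lintegral_wd (by fun_prop) (by fun_prop)]
  simp only [sw_ext, mul_assoc]

lemma Admissible.ev_succ (h : Admissible f₀ g₀) {φ : Phase → ENNReal} (hφ : Measurable φ) (r : ℝ) :
    ev T f₀ g₀ (n + 1) r φ = ∫⁻ q, fsw g₀ (stp (cur q.1) q.2).2 q.2.1 r *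
      φ (fl r (stp (cur q.1) q.2)) ∂pre T f₀ g₀ n := by
  rw [ev, h.lintegral_tau_succ_sw (H := fun Φ => φ (fl r (cur Φ))) (by fun_prop)]
  simp only [cur_ext]

/-- Disintegration along the time t of the next collision: the history has survived until t, and the
jump is weighted with the rate at the current velocity. -/
lemma Admissible.lintegral_pre (h : Admissible f₀ g₀) {H : Tree n × Coll → ENNReal}
    (hH : Measurable H) : ∫⁻ q, H q ∂pre T f₀ g₀ n = ∫⁻ t in Ioc 0 T, ∫⁻ Φ, sw g₀ Φ t *
      (∫⁻ w, (∫⁻ ν, rate (cur Φ).2 w ν * H (Φ, t, w, ν) ∂surf) ∂gam g₀) ∂tau T f₀ g₀ n := by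
  have h1 := h.measurable_exp_acc (n := n)
  have h0 := measurable_wt (n := n)
  have hs := h.measurable_sw (n := n)
  have hm : Measurable fun q : (Tree n × ℝ) × V3 × S2 =>
      rate (cur q.1.1).2 q.2.1 q.2.2 * H (q.1.1, q.1.2, q.2.1, q.2.2) := by fun_prop
  have hm2 : Measurable fun q : Tree n × ℝ =>
      ∫⁻ p : V3 × S2, rate (cur q.1).2 p.1 p.2 * H (q.1, q.2, p.1, p.2) ∂(gam g₀).prod surf :=
    Measurable.lintegral_prod_right' hm
  rw [pre, lintegral_wd (by fun_prop) hH, lintegral_prod _ (by fun_prop)]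
  refine Eq.trans ?_ (lintegral_lintegral_swap (f := fun (Φ : Tree n) (t : ℝ) => sw g₀ Φ t *
      (∫⁻ w, (∫⁻ ν, rate (cur Φ).2 w ν * H (Φ, t, w, ν) ∂surf) ∂gam g₀)) ?_)
  swap
  · have hm3 : AEMeasurable (fun q : Tree n × ℝ => sw g₀ q.1 q.2 * ∫⁻ p : V3 × S2,
      rate (cur q.1).2 p.1 p.2 * H (q.1, q.2, p.1, p.2) ∂(gam g₀).prod surf)
      ((tau T f₀ g₀ n).prod (volume.restrict (Ioc 0 T))) := (hs.mul hm2).aemeasurable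
    refine hm3.congr (Eventually.of_forall fun q => ?_)
    simp only [Function.uncurry]
    rw [lintegral_prod]
    fun_prop
  refine lintegral_congr fun Φ => ?_
  rw [rho, lintegral_prod]
  swap
  · exact (((h0.mul h1).mul hH).comp (by fun_prop : Measurable fun k : Coll => (Φ, k))).aemeasurable
  refine lintegral_congr fun t => ?_
  have hm4 : Measurable fun p : V3 × S2 => rate (cur Φ).2 p.1 p.2 * H (Φ, t, p.1, p.2) := by
    fun_prop
  rw [← lintegral_prod _ hm4.aemeasurable, ← lintegral_const_mul _ hm4]
  refine lintegral_congr fun p => ?_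
  simp only [sw, wt]
  split_ifs
  · ring
  · simp

end Rayleigh

end

noncomputable section

namespace Rayleigh

/-! ### The evolution identity -/

/-- Integration of a nonnegative function along a free flight with killing rate `σ`. -/
lemma flight {σ k : ℝ} (hσ : 0 ≤ σ) {h h' : ℝ → ℝ} (hd : ∀ s, HasDerivAt h (h' s) s)
    (hc : Continuous h') (h0 : ∀ s, 0 ≤ h s) {a b : ℝ} (hab : a ≤ b) :
    ENNReal.ofReal (Real.exp (-(σ * (b - k)))) * ENNReal.ofReal (h b) +
      ∫⁻ s in Ioc a b, ENNReal.ofReal (Real.exp (-(σ * (s - k)))) *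
        (ENNReal.ofReal σ * ENNReal.ofReal (h s) + ENNReal.ofReal (-h' s))
    = ENNReal.ofReal (Real.exp (-(σ * (a - k)))) * ENNReal.ofReal (h a) +
      ∫⁻ s in Ioc a b, ENNReal.ofReal (Real.exp (-(σ * (s - k)))) * ENNReal.ofReal (h' s) := by
  set E : ℝ → ℝ := fun s => Real.exp (-(σ * (s - k))) with hE
  have hEc : Continuous E := by fun_prop
  have hE0 : ∀ s, 0 < E s := fun s => Real.exp_pos _
  have hhc : Continuous h := continuous_iff_continuousAt.2 fun s => (hd s).continuousAt
  have hEd : ∀ s, HasDerivAt E (-σ * E s) s := by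
    intro s
    have h1 : HasDerivAt (fun s : ℝ => -(σ * (s - k))) (-σ) s := by
      simpa using (((hasDerivAt_id s).sub_const k).const_mul σ).fun_neg
    simpa [hE, mul_comm] using h1.exp
  -- The fundamental theorem of calculus for the product of survival factor and h. Splitting h' into
  -- positive and negative parts and moving the negative terms across then gives an identity of
  -- nonnegative quantities.
  have h_int : ∫ s in a..b, (E s * h' s - E s * (σ * h s)) = E b * h b - E a * h a := by
    refine intervalIntegral.integral_eq_sub_of_hasDerivAt (f := fun s => E s * h s) (fun s _ => ?_)
      ((by fun_prop : Continuous fun s => E s * h' s - E s * (σ * h s)).intervalIntegrable _ _)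
    exact ((hEd s).mul (hd s)).congr_deriv (by ring)
  set P : ℝ := ∫ s in a..b, E s * max (h' s) 0 with hP
  set N : ℝ := ∫ s in a..b, E s * (σ * h s + max (-h' s) 0) with hN
  have hPN : P - N = E b * h b - E a * h a := by
    rw [hP, hN, ← intervalIntegral.integral_sub, ← h_int]
    · refine intervalIntegral.integral_congr fun s _ => ?_
      have : max (h' s) 0 - max (-h' s) 0 = h' s := by
        rcases le_total (h' s) 0 with hs | hs
        · rw [max_eq_right hs, max_eq_left (by linarith)]; ring
        · rw [max_eq_left hs, max_eq_right (by linarith)]; ring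
      linear_combination (E s) * this
    · exact (by fun_prop : Continuous fun s => E s * max (h' s) 0).intervalIntegrable _ _
    · exact (by fun_prop : Continuous fun s =>
        E s * (σ * h s + max (-h' s) 0)).intervalIntegrable _ _
  have hPl : ∫⁻ s in Ioc a b, ENNReal.ofReal (E s) * ENNReal.ofReal (h' s) = ENNReal.ofReal P := by
    rw [hP, intervalIntegral.integral_of_le hab, ofReal_integral_eq_lintegral_ofReal]
    · refine lintegral_congr fun s => ?_
      rw [ENNReal.ofReal_mul (hE0 s).le, ENNReal.ofReal_max]; simp
    · exact (by fun_prop : Continuous fun s => E s * max (h' s) 0).integrableOn_Ioc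
    · exact Eventually.of_forall fun s => mul_nonneg (hE0 s).le (le_max_right _ _)
  have hNl : ∫⁻ s in Ioc a b, ENNReal.ofReal (E s) * (ENNReal.ofReal σ * ENNReal.ofReal (h s) +
      ENNReal.ofReal (-h' s)) = ENNReal.ofReal N := by
    rw [hN, intervalIntegral.integral_of_le hab, ofReal_integral_eq_lintegral_ofReal]
    · refine lintegral_congr fun s => ?_
      rw [ENNReal.ofReal_mul (hE0 s).le, ENNReal.ofReal_add (mul_nonneg hσ (h0 s))
        (le_max_right _ _), ENNReal.ofReal_max, ENNReal.ofReal_mul hσ]; simp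
    · exact (by fun_prop : Continuous fun s =>
        E s * (σ * h s + max (-h' s) 0)).integrableOn_Ioc
    · exact Eventually.of_forall fun s => mul_nonneg (hE0 s).le
        (add_nonneg (mul_nonneg hσ (h0 s)) (le_max_right _ _))
  have hP0 : 0 ≤ P := intervalIntegral.integral_nonneg hab fun s _ =>
    mul_nonneg (hE0 s).le (le_max_right _ _)
  have hN0 : 0 ≤ N := intervalIntegral.integral_nonneg hab fun s _ =>
    mul_nonneg (hE0 s).le (add_nonneg (mul_nonneg hσ (h0 s)) (le_max_right _ _))
  rw [hPl, hNl, ← ENNReal.ofReal_mul (hE0 b).le, ← ENNReal.ofReal_mul (hE0 a).le,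
    ← ENNReal.ofReal_add (mul_nonneg (hE0 b).le (h0 b)) hN0,
    ← ENNReal.ofReal_add (mul_nonneg (hE0 a).le (h0 a)) hP0]
  congr 1
  linarith

/-- Nonnegative functions that are continuously differentiable along the free flow, with
derivative `D`. -/
structure FlowC1 (φ D : Phase → ℝ) : Prop where
  meas : Measurable φ
  meas_deriv : Measurable D
  nonneg : ∀ z, 0 ≤ φ z
  deriv : ∀ z s, HasDerivAt (fun s => φ (fl s z)) (D (fl s z)) s
  cont : ∀ z, Continuous fun s => D (fl s z)

variable {f₀ : L1Phase} {g₀ : L1V} {T : ℝ} {n : ℕ}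

/-- The terms by which the evolution decreases `φ`. -/
def lossOf (g₀ : L1V) (φ D : Phase → ℝ) (z : Phase) : ENNReal :=
  freq g₀ z.2 * ENNReal.ofReal (φ z) + ENNReal.ofReal (-D z)

lemma FlowC1.measurable_lossOf {φ D : Phase → ℝ} (hφ : FlowC1 φ D) :
    Measurable (lossOf g₀ φ D) := by
  have h1 := hφ.meas
  have h2 := hφ.meas_deriv
  unfold lossOf
  fun_prop

/-- This is `flight` started at time t. Before t the survival factor is set to zero, so the
integrals over (0, r] only see (t, r]. -/
lemma Admissible.fsw_flight (h : Admissible f₀ g₀) {φ D : Phase → ℝ} (hφ : FlowC1 φ D) (z : Phase)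
    {t r : ℝ} (ht : 0 ≤ t) :
    fsw g₀ z.2 t r * ENNReal.ofReal (φ (fl r z)) +
      ∫⁻ s in Ioc 0 r, fsw g₀ z.2 t s * lossOf g₀ φ D (fl s z)
    = (if t < r then ENNReal.ofReal (φ (fl t z)) else 0) +
      ∫⁻ s in Ioc 0 r, fsw g₀ z.2 t s * ENNReal.ofReal (D (fl s z)) := by
  have key : ∀ H : ℝ → ENNReal, ∫⁻ s in Ioc 0 r, fsw g₀ z.2 t s * H s =
      ∫⁻ s in Ioc t r, ENNReal.ofReal (Real.exp (-(collFreq g₀ z.2 * (s - t)))) * H s := by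
    intro H
    rw [← lintegral_indicator measurableSet_Ioc, ← lintegral_indicator measurableSet_Ioc]
    refine lintegral_congr fun s => ?_
    by_cases hs : s ∈ Ioc t r
    · rw [indicator_of_mem hs, indicator_of_mem (show s ∈ Ioc 0 r from ⟨ht.trans_lt hs.1, hs.2⟩),
        fsw, if_pos hs.1]
    · rw [indicator_of_notMem hs]
      by_cases hs2 : s ∈ Ioc 0 r
      · rw [indicator_of_mem hs2, fsw, if_neg (fun h => hs ⟨h, hs2.2⟩), zero_mul]
      · rw [indicator_of_notMem hs2]
  rw [key, key]
  by_cases htr : t < r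
  · have := flight (k := t) (h.collFreq_nonneg z.2) (hφ.deriv z) (hφ.cont z)
      (fun s => hφ.nonneg _) htr.le
    simp only [sub_self, mul_zero, neg_zero, Real.exp_zero, ENNReal.ofReal_one, one_mul,
      h.ofReal_collFreq] at this
    rw [if_pos htr, fsw, if_pos htr]
    exact this
  · rw [if_neg htr, fsw, if_neg htr, Ioc_eq_empty htr]
    simp

lemma Admissible.lintegral_ev_succ (h : Admissible f₀ g₀) {χ : Phase → ENNReal} (hχ : Measurable χ)
    (r : ℝ) : ∫⁻ s in Ioc 0 r, ev T f₀ g₀ (n + 1) s χ =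
      ∫⁻ q, (∫⁻ s in Ioc 0 r, fsw g₀ (stp (cur q.1) q.2).2 q.2.1 s *
        χ (fl s (stp (cur q.1) q.2))) ∂pre T f₀ g₀ n := by
  simp only [h.ev_succ hχ]
  rw [lintegral_lintegral_swap]
  have hf : Measurable fun q : ℝ × Tree n × Coll => fsw g₀ (stp (cur q.2.1) q.2.2).2 q.2.2.1 q.1 :=
    h.measurable_fsw.comp (by fun_prop : Measurable fun q : ℝ × Tree n × Coll =>
      ((stp (cur q.2.1) q.2.2).2, q.2.2.1, q.1))
  exact (by fun_prop : Measurable fun q : ℝ × Tree n × Coll =>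
    fsw g₀ (stp (cur q.2.1) q.2.2).2 q.2.2.1 q.1 *
      χ (fl q.1 (stp (cur q.2.1) q.2.2))).aemeasurable

lemma Admissible.pre_time_pos (h : Admissible f₀ g₀) : ∀ᵐ q ∂pre T f₀ g₀ n, 0 < q.2.1 := by
  have hm : MeasurableSet {q : Tree n × Coll | ¬ 0 < q.2.1} :=
    (measurableSet_lt (f := fun _ => 0) (g := fun q : Tree n × Coll => q.2.1) (by fun_prop)
      (by fun_prop)).compl
  rw [ae_iff, ← lintegral_indicator_one hm, h.lintegral_pre (measurable_one.indicator hm)]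
  refine (setLIntegral_congr_fun (g := fun _ => 0) measurableSet_Ioc fun t ht => ?_).trans
    lintegral_zero
  have : ∀ (Φ : Tree n) (w : V3) (ν : S2),
      {q : Tree n × Coll | ¬ 0 < q.2.1}.indicator (1 : Tree n × Coll → ENNReal) (Φ, t, w, ν) = 0 :=
    fun Φ w ν => indicator_of_notMem (by simpa using ht.1) _
  simp only [this, mul_zero, lintegral_zero]

/-- Averaging φ over the outcome of the next collision is what `coll` does. Hence the mass entering
histories with n + 1 collisions is the integral of `coll` over histories with n. -/
lemma Admissible.lintegral_pre_post (h : Admissible f₀ g₀) {φ : Phase → ENNReal} (hφ : Measurable φ)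
    {r : ℝ} (hr : r ≤ T) :
    ∫⁻ q, (if q.2.1 < r then φ (fl q.2.1 (stp (cur q.1) q.2)) else 0) ∂pre T f₀ g₀ n =
      ∫⁻ t in Ioc 0 r, ev T f₀ g₀ n t (coll g₀ φ) := by
  rw [h.lintegral_pre (Measurable.ite (measurableSet_lt (by fun_prop) (by fun_prop))
    (by fun_prop) (by fun_prop))]
  have h1 : ∀ t, ∫⁻ Φ, sw g₀ Φ t * (∫⁻ w, (∫⁻ ν, rate (cur Φ).2 w ν *
      (if t < r then φ (fl t (stp (cur Φ) (t, w, ν))) else 0) ∂surf) ∂gam g₀) ∂tau T f₀ g₀ n =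
      (Iio r).indicator (fun t => ev T f₀ g₀ n t (coll g₀ φ)) t := by
    intro t
    by_cases ht : t < r
    · rw [indicator_of_mem (show t ∈ Iio r from ht), ev]
      refine lintegral_congr fun Φ => ?_
      simp only [if_pos ht, coll]
      congr 2
      refine funext fun w => lintegral_congr fun ν => ?_
      rw [fl_stp (cur Φ) (t, w, ν)]
      rfl
    · rw [indicator_of_notMem (show t ∉ Iio r from ht)]
      simp only [if_neg ht, mul_zero, lintegral_zero]
  simp only [h1]
  rw [lintegral_indicator measurableSet_Iio, Measure.restrict_restrict measurableSet_Iio]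
  refine setLIntegral_congr ?_
  have : Iio r ∩ Ioc 0 T = Ioo 0 r := by
    ext t; simp only [mem_inter_iff, mem_Iio, mem_Ioc, mem_Ioo]
    constructor
    · rintro ⟨a, b, c⟩; exact ⟨b, a⟩
    · rintro ⟨a, b⟩; exact ⟨b, a, b.le.trans hr⟩
  rw [this]
  exact Ioo_ae_eq_Ioc

lemma Admissible.ev_zero_identity (h : Admissible f₀ g₀) {φ D : Phase → ℝ} (hφ : FlowC1 φ D) {r : ℝ}
    (hr : 0 ≤ r) :
    ev T f₀ g₀ 0 r (fun z => ENNReal.ofReal (φ z)) +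
      ∫⁻ s in Ioc 0 r, ev T f₀ g₀ 0 s (lossOf g₀ φ D) =
    ∫⁻ z, ENNReal.ofReal (φ z) ∂mu0 f₀ +
      ∫⁻ s in Ioc 0 r, ev T f₀ g₀ 0 s (fun z => ENNReal.ofReal (D z)) := by
  have hm1 := hφ.meas
  have hm2 := hφ.meas_deriv
  have hm3 := hφ.measurable_lossOf (g₀ := g₀)
  have hcf := h.measurable_collFreq
  have h1 : ∀ {χ : Phase → ENNReal}, Measurable χ → ∀ s, 0 ≤ s → ev T f₀ g₀ 0 s χ =
      ∫⁻ z, ENNReal.ofReal (Real.exp (-(collFreq g₀ z.2 * (s - 0)))) * χ (fl s z) ∂mu0 f₀ := by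
    intro χ hχ s hs
    have := h.measurable_sw_right (n := 0) s
    rw [ev, lintegral_tau_zero (by fun_prop)]
    refine lintegral_congr fun z => ?_
    rw [sw, if_pos (show lastT ((z, Fin.elim0) : Tree 0) < s from lt_of_lt_of_le (by norm_num [lastT]) hs)]
    simp [acc, cur]
  have h2 : ∀ {χ : Phase → ENNReal}, Measurable χ → ∫⁻ s in Ioc 0 r, ev T f₀ g₀ 0 s χ =
      ∫⁻ z, (∫⁻ s in Ioc 0 r, ENNReal.ofReal (Real.exp (-(collFreq g₀ z.2 * (s - 0)))) *
        χ (fl s z)) ∂mu0 f₀ := by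
    intro χ hχ
    rw [setLIntegral_congr_fun measurableSet_Ioc (fun s hs => h1 hχ s hs.1.le),
      lintegral_lintegral_swap]
    exact Measurable.aemeasurable (by fun_prop)
  have hm4 : Measurable fun z => ∫⁻ s in Ioc 0 r,
      ENNReal.ofReal (Real.exp (-(collFreq g₀ z.2 * (s - 0)))) * ENNReal.ofReal (D (fl s z)) :=
    Measurable.lintegral_prod_right' (f := fun q : Phase × ℝ =>
      ENNReal.ofReal (Real.exp (-(collFreq g₀ q.1.2 * (q.2 - 0)))) *
        ENNReal.ofReal (D (fl q.2 q.1))) (by fun_prop)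
  rw [h1 (by fun_prop) r hr, h2 hm3, h2 (by fun_prop), ← lintegral_add_left (by fun_prop),
    ← lintegral_add_left (by fun_prop)]
  refine lintegral_congr fun z => ?_
  have := flight (k := 0) (h.collFreq_nonneg z.2) (hφ.deriv z) (hφ.cont z) (fun s => hφ.nonneg _) hr
  simp only [fl_zero, sub_self, mul_zero, neg_zero, Real.exp_zero, ENNReal.ofReal_one, one_mul,
      h.ofReal_collFreq] at this
  exact this

/-- Balance on the level of n + 1 collisions: the only source is the jump from the level below, and
every flight is transported and killed as in `fsw_flight`. -/
lemma Admissible.ev_succ_identity (h : Admissible f₀ g₀) {φ D : Phase → ℝ} (hφ : FlowC1 φ D) {r : ℝ}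
    (hrT : r ≤ T) :
    ev T f₀ g₀ (n + 1) r (fun z => ENNReal.ofReal (φ z)) +
      ∫⁻ s in Ioc 0 r, ev T f₀ g₀ (n + 1) s (lossOf g₀ φ D) =
    (∫⁻ s in Ioc 0 r, ev T f₀ g₀ n s (coll g₀ fun z => ENNReal.ofReal (φ z))) +
      ∫⁻ s in Ioc 0 r, ev T f₀ g₀ (n + 1) s (fun z => ENNReal.ofReal (D z)) := by
  have hm1 := hφ.meas
  have hm2 := hφ.meas_deriv
  have hm3 := hφ.measurable_lossOf (g₀ := g₀)
  have hf : ∀ s, Measurable fun q : Tree n × Coll => fsw g₀ (stp (cur q.1) q.2).2 q.2.1 s :=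
    fun s => h.measurable_fsw.comp (by fun_prop :
      Measurable fun q : Tree n × Coll => ((stp (cur q.1) q.2).2, q.2.1, s))
  have hfr := hf r
  rw [h.ev_succ (by fun_prop), h.lintegral_ev_succ hm3, h.lintegral_ev_succ (by fun_prop),
    ← h.lintegral_pre_post (by fun_prop) hrT, ← lintegral_add_left (by fun_prop),
    ← lintegral_add_left (Measurable.ite (measurableSet_lt (by fun_prop) (by fun_prop))
    (by fun_prop) (by fun_prop))]
  refine lintegral_congr_ae ?_
  filter_upwards [h.pre_time_pos] with q hq
  exact h.fsw_flight hφ _ hq.le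

/-- The law of the state at time `r`. -/
def Ff (T : ℝ) (f₀ : L1Phase) (g₀ : L1V) (r : ℝ) (φ : Phase → ENNReal) : ENNReal :=
  ∑' n, ev T f₀ g₀ n r φ

lemma Admissible.lintegral_Ff (h : Admissible f₀ g₀) {χ : Phase → ENNReal} (hχ : Measurable χ)
    (S : Set ℝ) : ∫⁻ s in S, Ff T f₀ g₀ s χ = ∑' n, ∫⁻ s in S, ev T f₀ g₀ n s χ :=
  lintegral_tsum fun n => (h.measurable_ev (φ := fun _ => χ) (by fun_prop)).aemeasurable

/-- The weak forward equation, obtained by summing the balances of all levels. Losses stand on the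
left, so all terms lie in [0, ∞] and the summation needs no integrability. -/
lemma Admissible.Ff_identity (h : Admissible f₀ g₀) {φ D : Phase → ℝ} (hφ : FlowC1 φ D) {r : ℝ}
    (hr : r ∈ Icc 0 T) :
    Ff T f₀ g₀ r (fun z => ENNReal.ofReal (φ z)) +
      ∫⁻ s in Ioc 0 r, Ff T f₀ g₀ s (lossOf g₀ φ D) =
    ∫⁻ z, ENNReal.ofReal (φ z) ∂mu0 f₀ +
      (∫⁻ s in Ioc 0 r, Ff T f₀ g₀ s (coll g₀ fun z => ENNReal.ofReal (φ z))) +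
      ∫⁻ s in Ioc 0 r, Ff T f₀ g₀ s (fun z => ENNReal.ofReal (D z)) := by
  have hm1 := hφ.meas
  have hm2 := hφ.meas_deriv
  rw [h.lintegral_Ff hφ.measurable_lossOf, h.lintegral_Ff (measurable_coll (by fun_prop)),
    h.lintegral_Ff (by fun_prop), Ff, ← ENNReal.tsum_add,
    tsum_eq_zero_add' ENNReal.summable, h.ev_zero_identity hφ hr.1,
    tsum_congr (fun n => h.ev_succ_identity hφ hr.2), ENNReal.tsum_add,
    tsum_eq_zero_add' (f := fun n => ∫⁻ s in Ioc 0 r, ev T f₀ g₀ n s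
      (fun z => ENNReal.ofReal (D z))) ENNReal.summable]
  ring

/-! ### Moments and conservation of mass -/

lemma flowC1_of_velocity {φ : V3 → ℝ} (hφ : Measurable φ) (h0 : ∀ v, 0 ≤ φ v) :
    FlowC1 (fun z => φ z.2) fun _ => 0 where
  meas := by fun_prop
  meas_deriv := by fun_prop
  nonneg z := h0 _
  deriv z s := hasDerivAt_const s (φ z.2)
  cont z := continuous_const

lemma lossOf_velocity (φ : V3 → ℝ) :
    lossOf g₀ (fun z => φ z.2) (fun _ => 0) = fun z => freq g₀ z.2 * ENNReal.ofReal (φ z.2) := by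
  funext z; simp [lossOf]

/-- The exponential solves y = a + C ∫ y; it is the supersolution for the induction in
`exists_moment`. -/
lemma lintegral_exp_le (C a : ℝ) (hC : 0 ≤ C) (ha : 0 ≤ a) {r : ℝ} (hr : 0 ≤ r) :
    ENNReal.ofReal a + ENNReal.ofReal C * ∫⁻ s in Ioc 0 r, ENNReal.ofReal (a * Real.exp (C * s))
      ≤ ENNReal.ofReal (a * Real.exp (C * r)) := by
  have h1 : ∫⁻ s in Ioc 0 r, ENNReal.ofReal (a * Real.exp (C * s)) =
      ENNReal.ofReal (∫ s in (0 : ℝ)..r, a * Real.exp (C * s)) := by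
    rw [intervalIntegral.integral_of_le hr, ofReal_integral_eq_lintegral_ofReal]
    · exact (by fun_prop : Continuous fun s => a * Real.exp (C * s)).integrableOn_Ioc
    · exact Eventually.of_forall fun s => by positivity
  rw [h1, ← ENNReal.ofReal_mul hC, ← intervalIntegral.integral_const_mul]
  have h2 : ∫ s in (0 : ℝ)..r, C * (a * Real.exp (C * s)) = a * Real.exp (C * r) - a := by
    have := intervalIntegral.integral_eq_sub_of_hasDerivAt (a := 0) (b := r)
      (f := fun s => a * Real.exp (C * s)) (f' := fun s => C * (a * Real.exp (C * s)))
      (fun s _ => by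
        have h3 : HasDerivAt (fun s : ℝ => C * s) C s := by
          simpa using (hasDerivAt_id s).const_mul C
        exact (h3.exp.const_mul a).congr_deriv (by ring))
      ((by fun_prop : Continuous fun s => C * (a * Real.exp (C * s))).intervalIntegrable _ _)
    simpa using this
  rw [h2, ← ENNReal.ofReal_add ha]
  · exact ENNReal.ofReal_le_ofReal (by linarith)
  · have : 1 ≤ Real.exp (C * r) := Real.one_le_exp (by positivity)
    nlinarith

/-- First moments stay bounded. -/
lemma Admissible.exists_moment (h : Admissible f₀ g₀) : ∃ M : ℝ, 0 ≤ M ∧ ∀ r ∈ Icc 0 T,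
    Ff T f₀ g₀ r (fun z => ENNReal.ofReal (1 + ‖z.2‖)) ≤ ENNReal.ofReal M := by
  obtain ⟨C, hC0, hC⟩ := h.exists_coll_le
  set ψ : Phase → ENNReal := fun z => ENNReal.ofReal (1 + ‖z.2‖) with hψ
  have hψm : Measurable ψ := by fun_prop
  have hflow : FlowC1 (fun z => 1 + ‖z.2‖) fun _ => 0 :=
    flowC1_of_velocity (φ := fun v => 1 + ‖v‖) (by fun_prop) (fun v => by positivity)
  set L : Phase → ENNReal := fun z => freq g₀ z.2 * ψ z with hL
  have hLm : Measurable L := by fun_prop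
  have hloss : lossOf g₀ (fun z => 1 + ‖z.2‖) (fun _ => 0) = L :=
    lossOf_velocity (fun v => 1 + ‖v‖)
  set m := ∫⁻ z, ψ z ∂mu0 f₀ with hm
  have hmt : m ≠ ⊤ := h.mu0_first.ne
  set a := m.toReal
  have hma : m = ENNReal.ofReal a := (ENNReal.ofReal_toReal hmt).symm
  -- The moment and the accumulated loss restricted to fewer than n collisions. The loss must be
  -- finite to be cancelled, which is not known for the full sum. The truncations satisfy A (n+1) +
  -- B (n+1) ≤ m + B n + C ∫ A n, so induction gives finiteness of B and the Gronwall bound for A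
  -- together.
  set A : ℕ → ℝ → ENNReal := fun n r => ∑ k ∈ Finset.range n, ev T f₀ g₀ k r ψ with hA
  set B : ℕ → ℝ → ENNReal := fun n r => ∑ k ∈ Finset.range n, ∫⁻ s in Ioc 0 r, ev T f₀ g₀ k s L
    with hB
  have hev : ∀ k {χ : Phase → ENNReal}, Measurable χ → Measurable fun s => ev T f₀ g₀ k s χ :=
    fun k χ hχ => h.measurable_ev (φ := fun _ => χ) (by fun_prop)
  have hrec : ∀ n, ∀ r ∈ Icc 0 T, A (n + 1) r + B (n + 1) r ≤
      m + (B n r + ENNReal.ofReal C * ∫⁻ s in Ioc 0 r, A n s) := by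
    intro n r hr
    have h0 := h.ev_zero_identity (T := T) hflow hr.1
    have h1 := fun k => h.ev_succ_identity (T := T) (n := k) hflow hr.2
    simp only [hloss, ENNReal.ofReal_zero] at h0 h1
    have hz : ∀ k s, ev T f₀ g₀ k s (fun _ => 0) = 0 := fun k s => by
      simp only [ev, mul_zero, lintegral_zero]
    simp only [hz, lintegral_zero, add_zero] at h0 h1
    have h2 : A (n + 1) r + B (n + 1) r =
        m + ∑ k ∈ Finset.range n, ∫⁻ s in Ioc 0 r, ev T f₀ g₀ k s (coll g₀ ψ) := by
      simp only [hA, hB]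
      rw [← Finset.sum_add_distrib, Finset.sum_range_succ', h0, add_comm,
        Finset.sum_congr rfl fun k _ => h1 k]
    rw [h2]
    gcongr
    have h3 : ∀ k s, ev T f₀ g₀ k s (coll g₀ ψ) ≤
        ev T f₀ g₀ k s L + ENNReal.ofReal C * ev T f₀ g₀ k s ψ := by
      intro k s
      rw [← h.ev_const_mul hψm, ← h.ev_add hLm]
      refine ev_mono fun z => (hC z).trans (le_of_eq ?_)
      simp only [hL, hψ]
      rw [ENNReal.ofReal_mul hC0]
    calc ∑ k ∈ Finset.range n, ∫⁻ s in Ioc 0 r, ev T f₀ g₀ k s (coll g₀ ψ)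
        ≤ ∑ k ∈ Finset.range n, ((∫⁻ s in Ioc 0 r, ev T f₀ g₀ k s L) +
          ENNReal.ofReal C * ∫⁻ s in Ioc 0 r, ev T f₀ g₀ k s ψ) := by
          refine Finset.sum_le_sum fun k _ => ?_
          rw [← lintegral_const_mul _ (hev k hψm), ← lintegral_add_left (hev k hLm)]
          exact lintegral_mono fun s => h3 k s
      _ = _ := by
          rw [Finset.sum_add_distrib, ← Finset.mul_sum, ← lintegral_finsetSum _
            (fun k _ => hev k hψm)]
  have hind : ∀ n, ∀ r ∈ Icc 0 T, A n r ≤ ENNReal.ofReal (a * Real.exp (C * r)) ∧ B n r < ⊤ := by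
    intro n
    induction n with
    | zero => intro r _; simp [hA, hB]
    | succ n ih =>
      intro r hr
      have h1 : ∫⁻ s in Ioc 0 r, A n s ≤ ∫⁻ s in Ioc 0 r, ENNReal.ofReal (a * Real.exp (C * s)) :=
        setLIntegral_mono' measurableSet_Ioc fun s hs => (ih s ⟨hs.1.le, hs.2.trans hr.2⟩).1
      have h2 := lintegral_exp_le C a hC0 ENNReal.toReal_nonneg hr.1
      have h3 : A (n + 1) r + B (n + 1) r ≤ ENNReal.ofReal (a * Real.exp (C * r)) + B n r := by
        calc A (n + 1) r + B (n + 1) r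
            ≤ m + (B n r + ENNReal.ofReal C * ∫⁻ s in Ioc 0 r, A n s) := hrec n r hr
          _ ≤ m + (B n r + ENNReal.ofReal C *
              ∫⁻ s in Ioc 0 r, ENNReal.ofReal (a * Real.exp (C * s))) := by gcongr
          _ = (ENNReal.ofReal a + ENNReal.ofReal C *
              ∫⁻ s in Ioc 0 r, ENNReal.ofReal (a * Real.exp (C * s))) + B n r := by
              rw [hma]; ring
          _ ≤ _ := by gcongr
      have hBn := (ih r hr).2
      have hBfin : B (n + 1) r < ⊤ := lt_of_le_of_lt le_add_self
        (h3.trans_lt (ENNReal.add_lt_top.2 ⟨ENNReal.ofReal_lt_top, hBn⟩))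
      refine ⟨?_, hBfin⟩
      have hmono : B n r ≤ B (n + 1) r := by
        simp only [hB, Finset.sum_range_succ]; exact le_self_add
      exact ENNReal.le_of_add_le_add_right hBfin.ne (h3.trans (by gcongr))
  refine ⟨a * Real.exp (C * T), mul_nonneg ENNReal.toReal_nonneg (Real.exp_pos _).le,
    fun r hr => ?_⟩
  rw [Ff, ENNReal.tsum_eq_iSup_nat]
  refine iSup_le fun n => ((hind n r hr).1).trans (ENNReal.ofReal_le_ofReal ?_)
  have := hr.2
  have h0 : 0 ≤ a := ENNReal.toReal_nonneg
  gcongr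

lemma Ff_mono {r : ℝ} {φ ψ : Phase → ENNReal} (hle : ∀ z, φ z ≤ ψ z) :
    Ff T f₀ g₀ r φ ≤ Ff T f₀ g₀ r ψ :=
  ENNReal.tsum_le_tsum fun _ => ev_mono hle

lemma Admissible.Ff_const_mul (h : Admissible f₀ g₀) {r : ℝ} {φ : Phase → ENNReal}
    (hφ : Measurable φ) (c : ENNReal) :
    Ff T f₀ g₀ r (fun z => c * φ z) = c * Ff T f₀ g₀ r φ := by
  simp only [Ff, h.ev_const_mul hφ, ENNReal.tsum_mul_left]

lemma Admissible.exists_Ff_freq_le (h : Admissible f₀ g₀) : ∃ M : ℝ, 0 ≤ M ∧ ∀ r ∈ Icc 0 T,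
    Ff T f₀ g₀ r (fun z => freq g₀ z.2) ≤ ENNReal.ofReal M := by
  obtain ⟨C, hC0, hC⟩ := h.exists_freq_le
  obtain ⟨M, hM0, hM⟩ := h.exists_moment (T := T)
  refine ⟨C * M, by positivity, fun r hr => ?_⟩
  calc _ ≤ Ff T f₀ g₀ r (fun z => ENNReal.ofReal C * ENNReal.ofReal (1 + ‖z.2‖)) :=
        Ff_mono fun z => (hC z.2).trans (by rw [ENNReal.ofReal_mul hC0])
    _ = ENNReal.ofReal C * Ff T f₀ g₀ r (fun z => ENNReal.ofReal (1 + ‖z.2‖)) :=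
        h.Ff_const_mul (by fun_prop) _
    _ ≤ _ := by rw [ENNReal.ofReal_mul hC0]; gcongr; exact hM r hr

lemma Admissible.lintegral_Ff_freq_lt_top (h : Admissible f₀ g₀) {S : Set ℝ} (hS : S ⊆ Ioc 0 T) :
    ∫⁻ s in S, Ff T f₀ g₀ s (fun z => freq g₀ z.2) < ⊤ := by
  obtain ⟨M, hM0, hM⟩ := h.exists_Ff_freq_le (T := T)
  refine (lintegral_mono_set hS).trans_lt ?_
  calc _ ≤ ∫⁻ _s in Ioc 0 T, ENNReal.ofReal M :=
        setLIntegral_mono' measurableSet_Ioc fun s hs => hM s ⟨hs.1.le, hs.2⟩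
    _ < ⊤ := by simp [ENNReal.mul_lt_top]

/-- Conservation of mass. -/
lemma Admissible.Ff_one (h : Admissible f₀ g₀) {r : ℝ} (hr : r ∈ Icc 0 T) :
    Ff T f₀ g₀ r (fun _ => 1) = 1 := by
  have h1 := h.Ff_identity (T := T) (flowC1_of_velocity (φ := fun _ => 1) measurable_const
    (fun _ => zero_le_one)) hr
  rw [lossOf_velocity (fun _ => 1)] at h1
  have hz : ∀ s, Ff T f₀ g₀ s (fun _ => 0) = 0 := fun s => by
    simp only [Ff, ev, mul_zero, lintegral_zero, tsum_zero]
  simp only [ENNReal.ofReal_one, mul_one, ENNReal.ofReal_zero, hz, lintegral_zero, add_zero,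
    lintegral_const, h.mu0_univ] at h1
  have h2 : (coll g₀ fun _ => 1) = fun z => freq g₀ z.2 := funext coll_one
  rw [h2] at h1
  -- For φ = 1 gain and loss are the same integral of the collision frequency. The moment bound
  -- makes it finite, so it can be cancelled.
  have hfin := h.lintegral_Ff_freq_lt_top (T := T) (S := Ioc 0 r) (Ioc_subset_Ioc_right hr.2)
  exact (ENNReal.add_left_inj hfin.ne).1 h1

end Rayleigh

end

noncomputable section

namespace Rayleigh

variable {f₀ : L1Phase} {g₀ : L1V} {T : ℝ} {n : ℕ}

/-! ### The law of the whole path -/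

/-- A flight alive at t either survives until r or is killed in between, and the last integral
counts the killing. A flight that starts strictly between t and r contributes its full mass one. -/
lemma Admissible.fsw_lower (h : Admissible f₀ g₀) (v : V3) (k t r : ℝ) (htr : t ≤ r) :
    fsw g₀ v k t + (if t < k ∧ k < r then 1 else 0) ≤
      fsw g₀ v k r + ∫⁻ s in Ioc t r, fsw g₀ v k s * freq g₀ v := by
  have key : ∀ a, k ≤ a → a ≤ r → ENNReal.ofReal (Real.exp (-(collFreq g₀ v * (r - k)))) +
      ∫⁻ s in Ioc a r, fsw g₀ v k s * freq g₀ v =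
        ENNReal.ofReal (Real.exp (-(collFreq g₀ v * (a - k)))) := by
    intro a hka har
    have := flight (k := k) (h.collFreq_nonneg v) (h := fun _ => 1) (h' := fun _ => 0)
      (fun s => hasDerivAt_const s 1) continuous_const (fun _ => zero_le_one) har
    simp only [ENNReal.ofReal_one, mul_one, neg_zero, ENNReal.ofReal_zero, add_zero, mul_zero,
      lintegral_zero, h.ofReal_collFreq] at this
    rw [← this]
    congr 1
    refine setLIntegral_congr_fun measurableSet_Ioc fun s hs => ?_
    simp only [fsw, if_pos (hka.trans_lt hs.1)]
  rcases lt_or_ge k t with hkt | hkt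
  · have hk := key t hkt.le htr
    rw [if_neg (fun h => lt_asymm h.1 hkt), add_zero, fsw, if_pos hkt, fsw,
      if_pos (hkt.trans_le htr), hk]
  · rw [fsw, if_neg (not_lt.2 hkt), zero_add]
    split_ifs with hc
    · have hk := key k le_rfl hc.2.le
      simp only [sub_self, mul_zero, neg_zero, Real.exp_zero, ENNReal.ofReal_one] at hk
      rw [← hk]
      conv_rhs => rw [fsw, if_pos hc.2]
      gcongr
    · exact zero_le

/-- The event that the path is in A at time t is not affected by collisions after t. Between t and
T, mass in this event only moves from n to n + 1 collisions; the outflow `L n` of one level is the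
inflow of the next, and the sum over n telescopes. -/
lemma Admissible.le_path_law (h : Admissible f₀ g₀) {t : ℝ} (ht : t ∈ Icc 0 T) {A : Set Phase}
    (hA : MeasurableSet A) : Ff T f₀ g₀ t (A.indicator 1) ≤
      ∑' n, ∫⁻ Φ, sw g₀ Φ T * A.indicator 1 (path Φ t) ∂tau T f₀ g₀ n := by
  set θ : (n : ℕ) → Tree n → ENNReal := fun n Φ => A.indicator 1 (path Φ t) with hθ
  have hpm : ∀ n, Measurable fun Φ : Tree n => path Φ t := fun n =>
    measurable_path.comp (by fun_prop : Measurable fun Φ : Tree n => (Φ, t))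
  have hθm : ∀ n, Measurable (θ n) := fun n => (measurable_one.indicator hA).comp (hpm n)
  have hθ1 : ∀ n Φ, θ n Φ ≤ 1 := fun n Φ =>
    indicator_le_self' (f := 1) (fun _ _ => zero_le) _
  set L : ℕ → ℝ → ENNReal := fun n s => ∫⁻ Φ, sw g₀ Φ s * (freq g₀ (cur Φ).2 * θ n Φ)
    ∂tau T f₀ g₀ n with hL
  set G : ℕ → ℝ → ENNReal := fun n s => ∫⁻ Φ, sw g₀ Φ s * θ n Φ ∂tau T f₀ g₀ n with hG
  have hGt : ∀ n, G n t = ev T f₀ g₀ n t (A.indicator 1) := by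
    intro n
    refine lintegral_congr fun Φ => ?_
    by_cases hs : lastT Φ < t
    · simp only [hθ, path_of_last hs]
    · simp only [sw, if_neg hs, zero_mul]
  have hLle : ∀ n s, L n s ≤ ev T f₀ g₀ n s (fun z => freq g₀ z.2) := by
    intro n s
    refine lintegral_mono fun Φ => ?_
    simp only [fl]
    gcongr
    exact mul_le_of_le_one_right' (hθ1 n Φ)
  have hsm := fun n => h.measurable_sw (n := n)
  have h0 : G 0 t ≤ G 0 T + ∫⁻ s in Ioc t T, L 0 s := by
    simp only [hG, hL]
    have hθ0 := hθm 0
    have hs0 := hsm 0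
    have hs1 := fun r => h.measurable_sw_right (n := 0) r
    rw [lintegral_lintegral_swap, ← lintegral_add_left]
    · refine lintegral_mono fun Φ => ?_
      have hfl := flight (k := 0) (h.collFreq_nonneg Φ.1.2) (h := fun _ => 1) (h' := fun _ => 0)
        (fun s => hasDerivAt_const s 1) continuous_const (fun _ => zero_le_one) ht.2
      simp only [ENNReal.ofReal_one, mul_one, neg_zero, ENNReal.ofReal_zero, add_zero, mul_zero,
        lintegral_zero, h.ofReal_collFreq, sub_zero] at hfl
      have hsw : ∀ s, 0 ≤ s → sw g₀ Φ s = ENNReal.ofReal (Real.exp (-(collFreq g₀ Φ.1.2 * s))) := by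
        intro s hs
        rw [sw, if_pos (lt_of_lt_of_le (by norm_num [lastT]) hs)]; rfl
      rw [setLIntegral_congr_fun (g := fun s => (ENNReal.ofReal (Real.exp (-(collFreq g₀ Φ.1.2 * s)))
        * freq g₀ Φ.1.2) * θ 0 Φ) measurableSet_Ioc (fun s hs => by
          rw [hsw s (ht.1.trans hs.1.le)]; exact (mul_assoc _ _ _).symm), lintegral_mul_const _ (by fun_prop),
        hsw t ht.1, hsw T (ht.1.trans ht.2), ← add_mul, hfl]
    · fun_prop
    · exact (by fun_prop : Measurable fun q : ℝ × Tree 0 => sw g₀ q.2 q.1 *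
        (freq g₀ (cur q.2).2 * θ 0 q.2)).aemeasurable
  have hS : ∀ n, G (n + 1) t + ∫⁻ s in Ioc t T, L n s ≤
      G (n + 1) T + ∫⁻ s in Ioc t T, L (n + 1) s := by
    intro n
    have hθn := hθm n
    have hθn1 := hθm (n + 1)
    have hLp : ∫⁻ s in Ioc t T, L n s =
        ∫⁻ q, (if t < q.2.1 ∧ q.2.1 < T then θ n q.1 else 0) ∂pre T f₀ g₀ n := by
      have hms : MeasurableSet {q : Tree n × Coll | t < q.2.1 ∧ q.2.1 < T} := by
        have h1 : Measurable fun q : Tree n × Coll => q.2.1 := by fun_prop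
        exact h1 measurableSet_Ioo
      rw [h.lintegral_pre (Measurable.ite hms (by fun_prop) (by fun_prop))]
      have h1 : ∀ s, ∫⁻ Φ, sw g₀ Φ s * (∫⁻ w, (∫⁻ ν, rate (cur Φ).2 w ν *
          (if t < s ∧ s < T then θ n Φ else 0) ∂surf) ∂gam g₀) ∂tau T f₀ g₀ n =
          (Ioo t T).indicator (L n) s := by
        intro s
        by_cases hs : t < s ∧ s < T
        · rw [indicator_of_mem (show s ∈ Ioo t T from hs)]
          simp only [if_pos hs, hL]
          refine lintegral_congr fun Φ => ?_
          congr 1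
          have : ∀ w, Measurable fun ν : S2 => rate (cur Φ).2 w ν := fun w => by fun_prop
          simp only [lintegral_mul_const _ (this _)]
          rw [lintegral_mul_const]
          · rfl
          · exact Measurable.lintegral_prod_right' (f := fun q : V3 × S2 =>
              rate (cur Φ).2 q.1 q.2) (by fun_prop)
        · rw [indicator_of_notMem (show s ∉ Ioo t T from hs)]
          simp only [if_neg hs, mul_zero, lintegral_zero]
      simp only [h1]
      rw [lintegral_indicator measurableSet_Ioo, Measure.restrict_restrict measurableSet_Ioo,
        inter_eq_left.2 (show Ioo t T ⊆ Ioc 0 T from fun s hs => ⟨ht.1.trans_lt hs.1, hs.2.le⟩)]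
      exact setLIntegral_congr Ioo_ae_eq_Ioc.symm
    have hGq : ∀ s, G (n + 1) s = ∫⁻ q, fsw g₀ (stp (cur q.1) q.2).2 q.2.1 s *
        θ (n + 1) (ext q.1 q.2) ∂pre T f₀ g₀ n := fun s => h.lintegral_tau_succ_sw hθn1 s
    have hLq : ∀ s, L (n + 1) s = ∫⁻ q, fsw g₀ (stp (cur q.1) q.2).2 q.2.1 s *
        (freq g₀ (stp (cur q.1) q.2).2 * θ (n + 1) (ext q.1 q.2)) ∂pre T f₀ g₀ n := by
      intro s
      have := h.lintegral_tau_succ_sw (T := T) (n := n)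
        (H := fun Φ => freq g₀ (cur Φ).2 * θ (n + 1) Φ) (by fun_prop) s
      simpa only [cur_ext] using this
    have hf3 : Measurable fun q : ℝ × Tree n × Coll =>
        fsw g₀ (stp (cur q.2.1) q.2.2).2 q.2.2.1 q.1 :=
      h.measurable_fsw.comp (by fun_prop : Measurable fun q : ℝ × Tree n × Coll =>
        ((stp (cur q.2.1) q.2.2).2, q.2.2.1, q.1))
    have hf2 : ∀ s, Measurable fun q : Tree n × Coll => fsw g₀ (stp (cur q.1) q.2).2 q.2.1 s :=
      fun s => hf3.comp (by fun_prop : Measurable fun q : Tree n × Coll => (s, q))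
    have hf1 : ∀ q : Tree n × Coll, Measurable fun s => fsw g₀ (stp (cur q.1) q.2).2 q.2.1 s :=
      fun q => hf3.comp (by fun_prop : Measurable fun s : ℝ => (s, q))
    rw [hLp, hGq, hGq]
    simp only [hLq]
    have hft := hf2 t
    have hfT := hf2 T
    rw [lintegral_lintegral_swap, ← lintegral_add_left (by fun_prop),
      ← lintegral_add_left (by fun_prop)]
    · refine lintegral_mono fun q => ?_
      -- If the last collision comes after t, the extended history passes through the same state at
      -- time t as the old one.
      have h2 : (if t < q.2.1 ∧ q.2.1 < T then θ n q.1 else 0) =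
          (if t < q.2.1 ∧ q.2.1 < T then 1 else 0) * θ (n + 1) (ext q.1 q.2) := by
        split_ifs with hc
        · simp only [hθ, path_ext, if_pos hc.1, one_mul]
        · rw [zero_mul]
      simp only [← mul_assoc]
      rw [h2, lintegral_mul_const _ ((hf1 q).mul_const _), ← add_mul, ← add_mul]
      exact mul_le_mul_left (h.fsw_lower _ _ _ _ ht.2) _
    · exact (by fun_prop : Measurable fun q : ℝ × Tree n × Coll =>
        fsw g₀ (stp (cur q.2.1) q.2.2).2 q.2.2.1 q.1 * (freq g₀ (stp (cur q.2.1) q.2.2).2 *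
          θ (n + 1) (ext q.2.1 q.2.2))).aemeasurable
  -- The total flux between levels. It is bounded by the integrated collision frequency, hence
  -- finite, and is cancelled at the end.
  set X := ∑' n, ∫⁻ s in Ioc t T, L n s with hX
  have hXfin : X < ⊤ := by
    refine lt_of_le_of_lt ?_ (h.lintegral_Ff_freq_lt_top (T := T) (S := Ioc t T)
      (Ioc_subset_Ioc_left ht.1))
    rw [h.lintegral_Ff (by fun_prop)]
    exact ENNReal.tsum_le_tsum fun n => lintegral_mono fun s => hLle n s
  have hsum : Ff T f₀ g₀ t (A.indicator 1) + X ≤ (∑' n, G n T) + X := by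
    have e1 : Ff T f₀ g₀ t (A.indicator 1) + X =
        G 0 t + ∑' n, (G (n + 1) t + ∫⁻ s in Ioc t T, L n s) := by
      rw [Ff, ← tsum_congr hGt, tsum_eq_zero_add' ENNReal.summable, ENNReal.tsum_add, add_assoc]
    have e2 : (∑' n, G n T) + X = (G 0 T + ∫⁻ s in Ioc t T, L 0 s) +
        ∑' n, (G (n + 1) T + ∫⁻ s in Ioc t T, L (n + 1) s) := by
      rw [hX, ← ENNReal.tsum_add, tsum_eq_zero_add' ENNReal.summable]
    rw [e1, e2]
    exact add_le_add h0 (ENNReal.tsum_le_tsum hS)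
  exact ENNReal.le_of_add_le_add_right hXfin.ne hsum

/-! ### Densities -/

lemma measurePreserving_fl (s : ℝ) : MeasurePreserving (fl s) := by
  have : MeasurePreserving (fun z : V3 × Torus => (z.1, z.2 + toTorus (s • z.1)))
      ((volume : Measure V3).prod (volume : Measure Torus)) (volume.prod volume) := by
    refine (MeasurePreserving.id _).skew_product (g := fun v x => x + toTorus (s • v)) ?_ ?_
    · have := measurable_toTorus
      exact Measurable.add measurable_snd (this.comp (measurable_fst.const_smul s))
    · exact Eventually.of_forall fun v => (measurePreserving_add_right volume _).map_eq
  exact (Measure.measurePreserving_swap.comp this).comp Measure.measurePreserving_swap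

lemma mu0_absolutelyContinuous : mu0 f₀ ≪ volume := withDensity_absolutelyContinuous _ _

/-- Induction on the number of collisions. At a fixed time of the last collision the state arises
from the previous level by `coll` and free flow; by `coll_null` and invariance of the volume,
neither sees a null set. -/
lemma Admissible.ev_eq_zero (h : Admissible f₀ g₀) : ∀ (n : ℕ) {φ : Phase → ENNReal},
    Measurable φ → (∀ᵐ z, φ z = 0) → ∀ r, ev T f₀ g₀ n r φ = 0
  | 0, φ, hφ, h0, r => by
    have := h.measurable_sw_right (n := 0) r
    rw [ev, lintegral_tau_zero (by fun_prop)]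
    refine (lintegral_congr_ae ?_).trans lintegral_zero
    filter_upwards [mu0_absolutelyContinuous.ae_le
      ((measurePreserving_fl r).quasiMeasurePreserving.ae h0)] with z hz
    rw [show fl r (cur ((z, Fin.elim0) : Tree 0)) = fl r z from rfl, hz, mul_zero]
  | n + 1, φ, hφ, h0, r => by
    have hf : Measurable fun q : Tree n × Coll => fsw g₀ (stp (cur q.1) q.2).2 q.2.1 r :=
      h.measurable_fsw.comp (by fun_prop :
        Measurable fun q : Tree n × Coll => ((stp (cur q.1) q.2).2, q.2.1, r))
    rw [h.ev_succ hφ, h.lintegral_pre (by fun_prop)]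
    refine (lintegral_congr fun t => ?_).trans lintegral_zero
    have hB : ∀ᵐ z, φ (fl (r - t) z) = 0 :=
      (measurePreserving_fl (r - t)).quasiMeasurePreserving.ae h0
    have hK := coll_null (g₀ := g₀) (φ := fun z => φ (fl (r - t) z)) (by fun_prop) hB
    have hev := h.ev_eq_zero n (measurable_coll (g₀ := g₀)
      (φ := fun z => φ (fl (r - t) z)) (by fun_prop)) hK t
    refine le_antisymm (le_trans (lintegral_mono fun Φ => ?_) hev.le) zero_le
    refine mul_le_mul' le_rfl (lintegral_mono fun w => lintegral_mono fun ν => ?_)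
    refine mul_le_mul' le_rfl ?_
    have e : fl r (stp (cur Φ) (t, w, ν)) =
        fl (r - t) ((fl t (cur Φ)).1, post (fl t (cur Φ)).2 w ν) := by
      have h1 := fl_stp (cur Φ) (t, w, ν)
      rw [show post (fl t (cur Φ)).2 w ν = post (cur Φ).2 w ν from rfl, ← h1, fl_fl]
      congr 1; ring
    rw [e]
    refine mul_le_of_le_one_left' ?_
    rw [fsw]
    split_ifs with hc
    · refine ENNReal.ofReal_le_one.2 (Real.exp_le_one_iff.2 ?_)
      have := mul_nonneg (h.collFreq_nonneg (stp (cur Φ) (t, w, ν)).2) (sub_nonneg.2 hc.le)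
      linarith
    · exact zero_le

lemma acc_add (Φ : Tree n) (r s : ℝ) : acc g₀ Φ (r + s) = acc g₀ Φ r + collFreq g₀ (cur Φ).2 * s := by
  cases n with
  | zero => simp only [acc, cur]; ring
  | succ n => simp only [acc]; ring

/-- The evolution dominates the free flow with killing. -/
lemma Ff_add_ge {r s : ℝ} (hs : 0 ≤ s) (φ : Phase → ENNReal) :
    Ff T f₀ g₀ r (fun z => ENNReal.ofReal (Real.exp (-(collFreq g₀ z.2 * s))) * φ (fl s z)) ≤
      Ff T f₀ g₀ (r + s) φ := by
  refine ENNReal.tsum_le_tsum fun n => lintegral_mono fun Φ => ?_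
  simp only [sw]
  split_ifs with h1 h2
  · rw [fl_fl, add_comm s r, acc_add, neg_add, Real.exp_add, ENNReal.ofReal_mul (Real.exp_pos _).le]
    simp only [fl, mul_assoc]
    exact le_rfl
  · exact absurd (h1.trans_le (by linarith)) h2
  · simp
  · simp

/-- The law of the state at time `r`, as a measure. -/
def Fm (T : ℝ) (f₀ : L1Phase) (g₀ : L1V) (r : ℝ) : Measure Phase :=
  Measure.sum fun n => ((tau T f₀ g₀ n).withDensity fun Φ => sw g₀ Φ r).map fun Φ => fl r (cur Φ)

lemma Admissible.lintegral_Fm (h : Admissible f₀ g₀) {r : ℝ} {φ : Phase → ENNReal}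
    (hφ : Measurable φ) : ∫⁻ z, φ z ∂Fm T f₀ g₀ r = Ff T f₀ g₀ r φ := by
  rw [Fm, lintegral_sum_measure, Ff]
  refine tsum_congr fun n => ?_
  rw [lintegral_map hφ (by fun_prop), lintegral_wd (h.measurable_sw_right r) (by fun_prop), ev]

lemma Admissible.Fm_univ (h : Admissible f₀ g₀) {r : ℝ} (hr : r ∈ Icc 0 T) :
    Fm T f₀ g₀ r univ = 1 := by
  rw [← h.Ff_one hr, ← h.lintegral_Fm measurable_const, lintegral_one]

lemma Admissible.Fm_absolutelyContinuous (h : Admissible f₀ g₀) (r : ℝ) :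
    Fm T f₀ g₀ r ≪ volume := by
  refine Measure.AbsolutelyContinuous.mk fun B hB h0 => ?_
  rw [← lintegral_indicator_one hB, h.lintegral_Fm (measurable_one.indicator hB), Ff]
  refine ENNReal.tsum_eq_zero.2 fun n => h.ev_eq_zero n (measurable_one.indicator hB) ?_ r
  filter_upwards [measure_eq_zero_iff_ae_notMem.1 h0] with z hz
  exact indicator_of_notMem hz _

/-- The density of the state at time `r`. -/
def dens (T : ℝ) (f₀ : L1Phase) (g₀ : L1V) (r : ℝ) (z : Phase) : ENNReal :=
  (Fm T f₀ g₀ r).rnDeriv volume z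

lemma measurable_dens (r : ℝ) : Measurable (dens T f₀ g₀ r) := Measure.measurable_rnDeriv _ _

lemma Admissible.lintegral_dens (h : Admissible f₀ g₀) {r : ℝ} (hr : r ∈ Icc 0 T)
    {φ : Phase → ENNReal} (hφ : Measurable φ) :
    ∫⁻ z, dens T f₀ g₀ r z * φ z = Ff T f₀ g₀ r φ := by
  have : IsFiniteMeasure (Fm T f₀ g₀ r) := ⟨by rw [h.Fm_univ hr]; simp⟩
  have h1 := Measure.withDensity_rnDeriv_eq _ _ (h.Fm_absolutelyContinuous (T := T) r)
  rw [← h.lintegral_Fm hφ, ← h1, lintegral_wd (Measure.measurable_rnDeriv _ _) hφ]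
  rfl

lemma Admissible.lintegral_dens_eq_one (h : Admissible f₀ g₀) {r : ℝ} (hr : r ∈ Icc 0 T) :
    ∫⁻ z, dens T f₀ g₀ r z = 1 := by
  rw [← h.Ff_one hr, ← h.lintegral_dens hr measurable_const]
  simp only [mul_one]

lemma Admissible.integrable_dens (h : Admissible f₀ g₀) {r : ℝ} (hr : r ∈ Icc 0 T) :
    Integrable fun z => (dens T f₀ g₀ r z).toReal :=
  integrable_toReal_of_lintegral_ne_top (measurable_dens r).aemeasurable
    (by rw [h.lintegral_dens_eq_one hr]; simp)

open Classical in
/-- The solution of the linear Boltzmann equation. -/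
def sol (T : ℝ) (f₀ : L1Phase) (g₀ : L1V) (r : ℝ) : L1Phase :=
  if hr : Integrable fun z => (dens T f₀ g₀ r z).toReal then hr.toL1 _ else 0

lemma Admissible.sol_ae (h : Admissible f₀ g₀) {r : ℝ} (hr : r ∈ Icc 0 T) :
    ∀ᵐ z, sol T f₀ g₀ r z = (dens T f₀ g₀ r z).toReal := by
  rw [sol, dif_pos (h.integrable_dens hr)]
  exact (h.integrable_dens hr).coeFn_toL1

lemma Admissible.ofReal_sol_ae (h : Admissible f₀ g₀) {r : ℝ} (hr : r ∈ Icc 0 T) :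
    ∀ᵐ z, ENNReal.ofReal (sol T f₀ g₀ r z) = dens T f₀ g₀ r z := by
  have hfin : ∀ᵐ z, dens T f₀ g₀ r z < ⊤ := ae_lt_top (measurable_dens r)
    (by rw [h.lintegral_dens_eq_one hr]; simp)
  filter_upwards [h.sol_ae hr, hfin] with z hz hz2
  rw [hz, ENNReal.ofReal_toReal hz2.ne]

lemma Admissible.sol_nonneg (h : Admissible f₀ g₀) {r : ℝ} (hr : r ∈ Icc 0 T) :
    ∀ᵐ z, 0 ≤ sol T f₀ g₀ r z := by
  filter_upwards [h.sol_ae hr] with z hz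
  rw [hz]; exact ENNReal.toReal_nonneg

lemma Admissible.lintegral_sol (h : Admissible f₀ g₀) {r : ℝ} (hr : r ∈ Icc 0 T)
    {φ : Phase → ENNReal} (hφ : Measurable φ) :
    ∫⁻ z, ENNReal.ofReal (sol T f₀ g₀ r z) * φ z = Ff T f₀ g₀ r φ := by
  rw [← h.lintegral_dens hr hφ]
  refine lintegral_congr_ae ?_
  filter_upwards [h.ofReal_sol_ae hr] with z hz
  rw [hz]

lemma Admissible.integral_sol (h : Admissible f₀ g₀) {r : ℝ} (hr : r ∈ Icc 0 T) :
    ∫ z, sol T f₀ g₀ r z = 1 := by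
  rw [integral_eq_lintegral_of_nonneg_ae (h.sol_nonneg hr)
    (measurable_L1Phase _).aestronglyMeasurable]
  have := h.lintegral_sol (T := T) hr (φ := fun _ => 1) measurable_const
  simp only [mul_one] at this
  rw [this, h.Ff_one hr, ENNReal.toReal_one]

lemma Admissible.setIntegral_sol (h : Admissible f₀ g₀) {r : ℝ} (hr : r ∈ Icc 0 T) {A : Set Phase}
    (hA : MeasurableSet A) :
    ENNReal.ofReal (∫ z in A, sol T f₀ g₀ r z) = Ff T f₀ g₀ r (A.indicator 1) := by
  rw [ofReal_integral_eq_lintegral_ofReal (L1.integrable_coeFn _).integrableOn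
    (ae_restrict_of_ae (h.sol_nonneg hr)), ← h.lintegral_sol hr (measurable_one.indicator hA),
    ← lintegral_indicator hA]
  refine lintegral_congr fun z => ?_
  by_cases hz : z ∈ A <;> simp [hz]

end Rayleigh

end

/-! ### The density of the jump process is a mild solution. -/

noncomputable section

namespace Rayleigh

variable {f₀ : L1Phase} {g₀ : L1V} {T : ℝ} {n : ℕ}

/-! ### The gain term -/

/-- The integrand of the gain term for a general density of the background. -/
def gi (g : V3 → ℝ) (f : Phase → ℝ) (z : Phase) (q : S2 × V3) : ℝ :=
  f (z.1, z.2 + (inner ℝ (q.1 : V3) (q.2 - z.2)) • (q.1 : V3)) *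
    g (q.2 - (inner ℝ (q.1 : V3) (q.2 - z.2)) • (q.1 : V3)) *
    max (inner ℝ (z.2 - q.2) (q.1 : V3)) 0

lemma measurable_gi {g : V3 → ℝ} (hg : Measurable g) {f : Phase → ℝ} (hf : Measurable f)
    (z : Phase) : Measurable (gi g f z) := by
  unfold gi; fun_prop

lemma lintegral_prod_gainL {G : V3 → ENNReal} (hG : Measurable G) {F : Phase → ENNReal}
    (hF : Measurable F) (z : Phase) : ∫⁻ q : S2 × V3,
      F (z.1, z.2 + (inner ℝ (q.1 : V3) (q.2 - z.2)) • (q.1 : V3)) *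
      G (q.2 - (inner ℝ (q.1 : V3) (q.2 - z.2)) • (q.1 : V3)) * rate z.2 q.2 q.1
      ∂surf.prod volume = gainL G F z := by
  rw [gainL, lintegral_prod]
  exact (by fun_prop : Measurable fun q : S2 × V3 =>
    F (z.1, z.2 + (inner ℝ (q.1 : V3) (q.2 - z.2)) • (q.1 : V3)) *
      G (q.2 - (inner ℝ (q.1 : V3) (q.2 - z.2)) • (q.1 : V3)) * rate z.2 q.2 q.1).aemeasurable

/-- By duality with φ = 1 the integral of the gain term vanishes. This is why the gain operator is
well defined on almost everywhere classes. -/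
lemma gainL_eq_zero {G : V3 → ENNReal} (hG : Measurable G) {F : Phase → ENNReal}
    (hF : Measurable F) (h0 : (∀ᵐ z, F z = 0) ∨ ∀ᵐ w, G w = 0) : ∀ᵐ z, gainL G F z = 0 := by
  have h1 := lintegral_gainL_mul_general (φ := fun _ => 1) hG hF measurable_const
  simp only [one_mul] at h1
  refine (lintegral_eq_zero_iff (measurable_gainL hG hF)).1 (h1.trans ?_)
  rcases h0 with h0 | h0
  · refine (lintegral_congr_ae ?_).trans lintegral_zero
    filter_upwards [h0] with z hz
    rw [hz, zero_mul]
  · refine (lintegral_congr fun z => ?_).trans lintegral_zero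
    have : ∫⁻ w, G w * ∫⁻ ν, rate z.2 w ν * 1 ∂surf = 0 := by
      refine (lintegral_congr_ae ?_).trans lintegral_zero
      filter_upwards [h0] with w hw
      rw [hw, zero_mul]
    rw [this, mul_zero]

/-- Apply `gainL_eq_zero` to the indicators of the sets where the representatives differ. Where the
collision rate vanishes both integrands are zero, so nothing is lost. -/
lemma gi_congr {f f' : Phase → ℝ} {g g' : V3 → ℝ} (hf : Measurable f) (hf' : Measurable f')
    (hg : Measurable g) (hg' : Measurable g') (h1 : f =ᵐ[volume] f') (h2 : g =ᵐ[volume] g') :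
    ∀ᵐ z, gi g f z =ᵐ[surf.prod volume] gi g' f' z := by
  have hA : MeasurableSet {z | f z ≠ f' z} := (measurableSet_eq_fun hf hf').compl
  have hB : MeasurableSet {z | g z ≠ g' z} := (measurableSet_eq_fun hg hg').compl
  have hF : Measurable ({z | f z ≠ f' z}.indicator (1 : Phase → ENNReal)) :=
    measurable_one.indicator hA
  have hG : Measurable ({z | g z ≠ g' z}.indicator (1 : V3 → ENNReal)) :=
    measurable_one.indicator hB
  have e1 := gainL_eq_zero (G := fun _ => 1) measurable_const hF (Or.inl (by
    filter_upwards [h1] with z hz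
    exact indicator_of_notMem (by simpa using hz) _))
  have e2 := gainL_eq_zero (F := fun _ => 1) hG measurable_const (Or.inr (by
    filter_upwards [h2] with z hz
    exact indicator_of_notMem (by simpa using hz) _))
  filter_upwards [e1, e2] with z hz1 hz2
  rw [← lintegral_prod_gainL (by fun_prop) (by fun_prop), lintegral_eq_zero_iff (by fun_prop)]
    at hz1 hz2
  filter_upwards [hz1, hz2] with q hq1 hq2
  simp only [Pi.zero_apply, mul_one, one_mul, mul_eq_zero, rate, ENNReal.ofReal_eq_zero]
    at hq1 hq2
  unfold gi
  by_cases hr : inner ℝ (z.2 - q.2) (q.1 : V3) ≤ 0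
  · rw [max_eq_right hr, mul_zero, mul_zero]
  · have a1 := hq1.resolve_right hr
    have a2 := hq2.resolve_right hr
    simp only [indicator_apply_eq_zero, mem_ofPred_eq, Pi.one_apply, one_ne_zero, imp_false,
      not_not] at a1 a2
    rw [a1, a2]

lemma enorm_gi (g : V3 → ℝ) (f : Phase → ℝ) (z : Phase) (q : S2 × V3) : ‖gi g f z q‖ₑ =
    ‖f (z.1, z.2 + (inner ℝ (q.1 : V3) (q.2 - z.2)) • (q.1 : V3))‖ₑ *
    ‖g (q.2 - (inner ℝ (q.1 : V3) (q.2 - z.2)) • (q.1 : V3))‖ₑ * rate z.2 q.2 q.1 := by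
  rw [gi, enorm_mul, enorm_mul, rate, Real.enorm_of_nonneg (le_max_right _ _), ENNReal.ofReal_max]
  simp

lemma lintegral_enorm_gi {g : V3 → ℝ} (hg : Measurable g) {f : Phase → ℝ} (hf : Measurable f)
    (z : Phase) : ∫⁻ q, ‖gi g f z q‖ₑ ∂surf.prod volume =
      gainL (fun w => ‖g w‖ₑ) (fun z => ‖f z‖ₑ) z := by
  rw [← lintegral_prod_gainL (by fun_prop) (by fun_prop)]
  simp only [enorm_gi]

lemma Admissible.lintegral_gainL_enorm (h : Admissible f₀ g₀) {f : Phase → ℝ} (hf : Measurable f) :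
    ∫⁻ z, gainL (fun w => ‖g₀ w‖ₑ) (fun z => ‖f z‖ₑ) z = ∫⁻ z, ‖f z‖ₑ * freq g₀ z.2 := by
  have hg := measurable_L1V g₀
  have h1 := lintegral_gainL_mul_general (G := fun w => ‖g₀ w‖ₑ) (F := fun z => ‖f z‖ₑ)
    (φ := fun _ => 1) (by fun_prop) (by fun_prop) measurable_const
  simp only [one_mul, mul_one] at h1
  rw [h1]
  refine lintegral_congr fun z => ?_
  rw [freq, lintegral_gam]
  · congr 1
    refine lintegral_congr_ae ?_
    filter_upwards [h.g_nonneg] with w hw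
    rw [Real.enorm_of_nonneg hw]
  · exact Measurable.lintegral_prod_right' (f := fun q : V3 × S2 => rate z.2 q.1 q.2) (by fun_prop)

/-- A function whose collision frequency is integrable has an integrable gain term. -/
lemma Admissible.ae_integrable_gi (h : Admissible f₀ g₀) {f : Phase → ℝ} (hf : Measurable f)
    (hfin : ∫⁻ z, ‖f z‖ₑ * freq g₀ z.2 ≠ ⊤) :
    ∀ᵐ z, Integrable (gi g₀ f z) (surf.prod volume) := by
  have hg := measurable_L1V g₀
  rw [← h.lintegral_gainL_enorm hf] at hfin
  filter_upwards [ae_lt_top (measurable_gainL (by fun_prop) (by fun_prop)) hfin] with z hz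
  refine ⟨(measurable_gi hg hf z).aestronglyMeasurable, ?_⟩
  rw [HasFiniteIntegral, lintegral_enorm_gi hg hf]
  exact hz

lemma gainTerm_eq {f : Phase → ℝ} {z : Phase} (hi : Integrable (gi g₀ f z) (surf.prod volume)) :
    gainTerm g₀ f z = ∫ q, gi g₀ f z q ∂surf.prod volume := by
  rw [integral_prod _ hi]; rfl

lemma Admissible.ofReal_gainTerm (h : Admissible f₀ g₀) {f : Phase → ℝ} (hf : Measurable f)
    (hfin : ∫⁻ z, ‖f z‖ₑ * freq g₀ z.2 ≠ ⊤) (h0 : ∀ᵐ z, 0 ≤ f z) :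
    ∀ᵐ z, 0 ≤ gainTerm g₀ f z ∧ ENNReal.ofReal (gainTerm g₀ f z) =
      gainL (fun w => ENNReal.ofReal (g₀ w)) (fun z => ENNReal.ofReal (f z)) z := by
  have hg := measurable_L1V g₀
  -- Passing to positive parts makes both factors nonnegative at every point, as needed to take
  -- `ENNReal.ofReal` inside the product.
  have e := gi_congr hf (hf.max measurable_const) hg (hg.max measurable_const)
    (f' := fun z => max (f z) 0) (g' := fun w => max (g₀ w) 0)
    (by filter_upwards [h0] with z hz; rw [max_eq_left hz])
    (by filter_upwards [h.g_nonneg] with z hz; rw [max_eq_left hz])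
  filter_upwards [h.ae_integrable_gi hf hfin, e] with z hz hez
  have hpos : ∀ q, 0 ≤ gi (fun w => max (g₀ w) 0) (fun z => max (f z) 0) z q := fun q =>
    mul_nonneg (mul_nonneg (le_max_right _ _) (le_max_right _ _)) (le_max_right _ _)
  rw [gainTerm_eq hz, integral_congr_ae hez]
  refine ⟨integral_nonneg hpos, ?_⟩
  rw [ofReal_integral_eq_lintegral_ofReal (hz.congr hez) (Eventually.of_forall hpos),
    ← lintegral_prod_gainL (by fun_prop) (by fun_prop)]
  refine lintegral_congr fun q => ?_
  rw [gi, ENNReal.ofReal_mul (mul_nonneg (le_max_right _ _) (le_max_right _ _)),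
    ENNReal.ofReal_mul (le_max_right _ _)]
  simp [ENNReal.ofReal_max, rate]

lemma Admissible.exists_isB (h : Admissible f₀ g₀) (f : L1Phase)
    (hfin : ∫⁻ z, ‖f z‖ₑ * freq g₀ z.2 ≠ ⊤) (h0 : ∀ᵐ z, 0 ≤ f z) : ∃ b : L1Phase, IsB g₀ f b ∧
      (∀ᵐ z, 0 ≤ b z) ∧ ∀ φ : Phase → ENNReal, Measurable φ →
        ∫⁻ z, ENNReal.ofReal (b z) * φ z = ∫⁻ z, ENNReal.ofReal (f z) * coll g₀ φ z := by
  have hf := measurable_L1Phase f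
  have hg := measurable_L1V g₀
  set G : Phase → ENNReal :=
    gainL (fun w => ENNReal.ofReal (g₀ w)) (fun z => ENNReal.ofReal (f z)) with hGdef
  have hGm : Measurable G := measurable_gainL (by fun_prop) (by fun_prop)
  have hb := h.ofReal_gainTerm hf hfin h0
  have hGint : ∫⁻ z, G z ≠ ⊤ := by
    have h1 := lintegral_gainL_mul (g₀ := g₀) (F := fun z => ENNReal.ofReal (f z))
      (φ := fun _ => 1) (by fun_prop) measurable_const
    simp only [one_mul, coll_one] at h1
    rw [h1, lintegral_congr_ae (g := fun z => ‖f z‖ₑ * freq g₀ z.2)]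
    · exact hfin
    · filter_upwards [h0] with z hz
      rw [Real.enorm_of_nonneg hz]
  have hGi : Integrable fun z => (G z).toReal :=
    integrable_toReal_of_lintegral_ne_top hGm.aemeasurable hGint
  have hbG : ∀ᵐ z, hGi.toL1 _ z = gainTerm g₀ f z := by
    filter_upwards [hGi.coeFn_toL1, hb] with z hz1 hz2
    rw [hz1, hGdef, ← hz2.2, ENNReal.toReal_ofReal hz2.1]
  refine ⟨hGi.toL1 _, ⟨h.ae_integrable_gi hf hfin, hbG⟩, ?_, fun φ hφ => ?_⟩
  · filter_upwards [hbG, hb] with z hz1 hz2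
    rw [hz1]; exact hz2.1
  · rw [← lintegral_gainL_mul (by fun_prop) hφ]
    refine lintegral_congr_ae ?_
    filter_upwards [hbG, hb] with z hz1 hz2
    rw [hz1, hz2.2, mul_comm]

/-! ### Continuity in time -/

lemma continuous_fl : Continuous fun q : ℝ × Phase => fl q.1 q.2 := by
  have := continuous_toTorus
  unfold fl
  fun_prop

/-- The free flow as a continuous map. -/
def flC (s : ℝ) : C(Phase, Phase) := 
  ⟨fl s, continuous_fl.comp (by fun_prop : Continuous fun z : Phase => (s, z))⟩

lemma continuous_flC : Continuous flC :=
  (ContinuousMap.curry ⟨fun q : ℝ × Phase => fl q.1 q.2, continuous_fl⟩).continuous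

/-- The free flow on densities. -/
def flow (s : ℝ) (f : L1Phase) : L1Phase :=
  Lp.compMeasurePreserving (flC (-s)) (measurePreserving_fl (-s)) f

instance : (volume : Measure Phase).Regular := by
  have : IsLocallyFiniteMeasure (volume : Measure Phase) := by
    rw [Measure.volume_eq_prod]; infer_instance
  infer_instance

lemma continuous_flow (f : L1Phase) : Continuous fun s => flow s f :=
  Continuous.compMeasurePreservingLp continuous_const
    (continuous_flC.comp continuous_neg) (fun s => measurePreserving_fl (-s)) (by simp)

lemma flow_ae (s : ℝ) (f : L1Phase) : ∀ᵐ z, flow s f z = f (fl (-s) z) :=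
  Lp.coeFn_compMeasurePreserving f (measurePreserving_fl (-s))

lemma flow_flow (s t : ℝ) (f : L1Phase) : flow s (flow t f) = flow (s + t) f := by
  refine Lp.ext ?_
  filter_upwards [flow_ae s (flow t f), flow_ae (s + t) f,
    (measurePreserving_fl (-s)).quasiMeasurePreserving.ae (flow_ae t f)] with z h1 h2 h3
  rw [h1, h2, h3, fl_fl]
  congr 2; ring

lemma flow_zero (f : L1Phase) : flow 0 f = f := by
  refine Lp.ext ?_
  filter_upwards [flow_ae 0 f] with z h1
  rw [h1, neg_zero, fl_zero]

lemma norm_flow_sub (s : ℝ) (f g : L1Phase) : ‖flow s f - flow s g‖ = ‖f - g‖ := by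
  have := (Lp.isometry_compMeasurePreserving (E := ℝ) (p := 1)
    (measurePreserving_fl (-s))).dist_eq f g
  rw [dist_eq_norm, dist_eq_norm] at this
  exact this

/-- Both the solution at time r + s and the freely transported solution are probability densities
that dominate G, the free transport with killing. As exp(-x) ≥ 1 - x, the mass of G is at least 1 -
s M, so each density differs from G by at most s M in L¹. -/
lemma Admissible.norm_sol_sub_flow_le (h : Admissible f₀ g₀) {M : ℝ} (hM0 : 0 ≤ M)
    (hM : ∀ r ∈ Icc 0 T, Ff T f₀ g₀ r (fun z => freq g₀ z.2) ≤ ENNReal.ofReal M) {r s : ℝ}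
    (hs : 0 ≤ s) (hr : r ∈ Icc 0 T) (hrs : r + s ∈ Icc 0 T) :
    ‖sol T f₀ g₀ (r + s) - flow s (sol T f₀ g₀ r)‖ ≤ 2 * (s * M) := by
  have hcf := h.measurable_collFreq
  have hfm := measurable_L1Phase (sol T f₀ g₀ r)
  set E : Phase → ℝ := fun z => Real.exp (-(collFreq g₀ z.2 * s)) with hE
  have hEm : Measurable E := by fun_prop
  have hE1 : ∀ z, E z ≤ 1 := fun z => Real.exp_le_one_iff.2
    (by have := mul_nonneg (h.collFreq_nonneg z.2) hs; linarith)
  have hflE : ∀ t z, E (fl t z) = E z := fun t z => rfl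
  set f := sol T f₀ g₀ r
  set f' := sol T f₀ g₀ (r + s)
  set G : Phase → ℝ := fun z => E z * f (fl (-s) z) with hG
  have hGm : Measurable G := by fun_prop
  have hcomp : ∀ φ : Phase → ENNReal, Measurable φ → ∫⁻ z, ENNReal.ofReal (G z) * φ z =
      Ff T f₀ g₀ r (fun z => ENNReal.ofReal (E z) * φ (fl s z)) := by
    intro φ hφ
    rw [← h.lintegral_sol hr (by fun_prop), ← (measurePreserving_fl s).lintegral_comp (by fun_prop)]
    refine lintegral_congr fun z => ?_
    simp only [hG, hflE, fl_fl, neg_add_cancel, fl_zero]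
    rw [ENNReal.ofReal_mul (Real.exp_pos _).le]; ring
  have hle : ∀ φ : Phase → ENNReal, Measurable φ → ∫⁻ z, ENNReal.ofReal (G z) * φ z ≤
      ∫⁻ z, ENNReal.ofReal (f' z) * φ z := by
    intro φ hφ
    rw [hcomp φ hφ, h.lintegral_sol hrs hφ]
    exact Ff_add_ge hs φ
  have hf'm := measurable_L1Phase f'
  have hGf' : ∀ᵐ z, ENNReal.ofReal (G z) ≤ ENNReal.ofReal (f' z) := by
    refine ae_le_of_forall_setLIntegral_le_of_sigmaFinite₀ (by fun_prop) (fun A hA _ => ?_)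
    have := hle (A.indicator 1) (measurable_one.indicator hA)
    rw [← lintegral_indicator hA, ← lintegral_indicator hA]
    convert this using 2 <;>
    · funext z; by_cases hz : z ∈ A <;> simp [hz]
  have hfl0 : ∀ᵐ z, 0 ≤ f (fl (-s) z) :=
    (measurePreserving_fl (-s)).quasiMeasurePreserving.ae (h.sol_nonneg hr)
  have hfi : Integrable fun z => f (fl (-s) z) :=
    (measurePreserving_fl (-s)).integrable_comp_of_integrable (L1.integrable_coeFn f)
  have hf'i : Integrable f' := L1.integrable_coeFn f'
  have hGi : Integrable G := by
    refine hfi.mono hGm.aestronglyMeasurable (Eventually.of_forall fun z => ?_)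
    rw [hG, norm_mul, Real.norm_of_nonneg (Real.exp_pos _).le]
    exact mul_le_of_le_one_left (norm_nonneg _) (hE1 z)
  have hG0 : ∀ᵐ z, 0 ≤ G z := by
    filter_upwards [hfl0] with z hz; exact mul_nonneg (Real.exp_pos _).le hz
  have hfint : ∫ z, f (fl (-s) z) = 1 := by
    have h1 := integral_map (μ := volume) (f := f) (measurePreserving_fl (-s)).aemeasurable
      hfm.aestronglyMeasurable
    rw [(measurePreserving_fl (-s)).map_eq] at h1
    exact h1.symm.trans (h.integral_sol hr)
  have hGint : 1 - s * M ≤ ∫ z, G z := by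
    have h1 : ∫ z, f (fl (-s) z) - G z ≤ s * M := by
      have h2 : ∀ᵐ z, 0 ≤ f (fl (-s) z) - G z := by
        filter_upwards [hfl0] with z hz
        exact sub_nonneg.2 (mul_le_of_le_one_left hz (hE1 z))
      refine (ENNReal.ofReal_le_ofReal_iff (by positivity)).1 ?_
      rw [ofReal_integral_eq_lintegral_ofReal (f := fun z => f (fl (-s) z) - G z)
        (hfi.sub hGi) h2]
      calc ∫⁻ z, ENNReal.ofReal (f (fl (-s) z) - G z)
          = ∫⁻ z, ENNReal.ofReal (f z) * ENNReal.ofReal (1 - E z) := by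
            rw [← (measurePreserving_fl s).lintegral_comp (by fun_prop)]
            refine lintegral_congr_ae ?_
            filter_upwards [h.sol_nonneg hr] with z hz
            simp only [hG, hflE, fl_fl, neg_add_cancel, fl_zero]
            rw [← ENNReal.ofReal_mul hz]
            congr 1; ring
        _ = Ff T f₀ g₀ r (fun z => ENNReal.ofReal (1 - E z)) := h.lintegral_sol hr (by fun_prop)
        _ ≤ Ff T f₀ g₀ r (fun z => ENNReal.ofReal s * freq g₀ z.2) := by
            refine Ff_mono fun z => ?_
            rw [← h.ofReal_collFreq, ← ENNReal.ofReal_mul hs]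
            refine ENNReal.ofReal_le_ofReal ?_
            have := Real.add_one_le_exp (-(collFreq g₀ z.2 * s))
            simp only [hE]; linarith
        _ ≤ _ := by
            rw [h.Ff_const_mul (by fun_prop), ENNReal.ofReal_mul hs]
            gcongr
            exact hM r hr
    rw [integral_sub hfi hGi, hfint] at h1
    linarith
  have hnorm : ‖f' - flow s f‖ = ∫ z, ‖(f' - flow s f) z‖ := L1.norm_eq_integral_norm _
  rw [hnorm]
  calc ∫ z, ‖(f' - flow s f) z‖ ≤ ∫ z, ((f' z - G z) + (f (fl (-s) z) - G z)) := by
        refine integral_mono_ae (L1.integrable_coeFn _).norm ((hf'i.sub hGi).add (hfi.sub hGi)) ?_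
        filter_upwards [Lp.coeFn_sub f' (flow s f), flow_ae s f, hGf', hG0, hfl0,
          h.sol_nonneg hrs] with z h1 h2 h3 h4 h5 h6
        rw [h1, Pi.sub_apply, h2]
        have h7 : G z ≤ f' z := (ENNReal.ofReal_le_ofReal_iff h6).1 h3
        have h8 : G z ≤ f (fl (-s) z) := mul_le_of_le_one_left h5 (hE1 z)
        rw [Real.norm_eq_abs]
        rw [abs_le]; constructor <;> linarith
    _ = (1 - ∫ z, G z) + (1 - ∫ z, G z) := by
        have e := integral_add (f := fun z => f' z - G z) (g := fun z => f (fl (-s) z) - G z)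
          (hf'i.sub hGi) (hfi.sub hGi)
        rw [e, integral_sub hf'i hGi, integral_sub hfi hGi, hfint, h.integral_sol hrs]
    _ ≤ _ := by linarith

lemma Admissible.continuousOn_sol (h : Admissible f₀ g₀) :
    ContinuousOn (sol T f₀ g₀) (Icc 0 T) := by
  obtain ⟨M, hM0, hM⟩ := h.exists_Ff_freq_le (T := T)
  -- Free flow is a group of isometries, so the one-sided estimate holds for both signs of t - r.
  -- Strong continuity of the flow then gives continuity at r.
  have key : ∀ r ∈ Icc 0 T, ∀ t ∈ Icc 0 T,
      ‖sol T f₀ g₀ t - flow (t - r) (sol T f₀ g₀ r)‖ ≤ 2 * (|t - r| * M) := by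
    intro r hr t ht
    rcases le_total r t with hrt | hrt
    · have := h.norm_sol_sub_flow_le hM0 hM (sub_nonneg.2 hrt) hr (by simpa using ht)
      rw [abs_of_nonneg (sub_nonneg.2 hrt)]
      simpa using this
    · have := h.norm_sol_sub_flow_le hM0 hM (sub_nonneg.2 hrt) ht (by simpa using hr)
      rw [abs_sub_comm, abs_of_nonneg (sub_nonneg.2 hrt), ← norm_flow_sub (r - t), flow_flow,
        norm_sub_rev]
      simpa [flow_zero] using this
  intro r hr
  have h1 : Tendsto (fun t => 2 * (|t - r| * M) + ‖flow (t - r) (sol T f₀ g₀ r) - sol T f₀ g₀ r‖)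
      (𝓝[Icc 0 T] r) (𝓝 0) := by
    have hc : Continuous fun t => 2 * (|t - r| * M) +
        ‖flow (t - r) (sol T f₀ g₀ r) - sol T f₀ g₀ r‖ := by
      have := (continuous_flow (sol T f₀ g₀ r)).comp (continuous_sub_right r)
      exact Continuous.add (by fun_prop) (this.sub continuous_const).norm
    have := (hc.tendsto r).mono_left (nhdsWithin_le_nhds (s := Icc 0 T))
    simpa [flow_zero] using this
  refine tendsto_iff_norm_sub_tendsto_zero.2 (squeeze_zero' (Eventually.of_forall fun _ =>
    norm_nonneg _) ?_ h1)
  filter_upwards [self_mem_nhdsWithin] with t ht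
  calc _ ≤ ‖sol T f₀ g₀ t - flow (t - r) (sol T f₀ g₀ r)‖ +
        ‖flow (t - r) (sol T f₀ g₀ r) - sol T f₀ g₀ r‖ := norm_sub_le_norm_sub_add_norm_sub _ _ _
    _ ≤ _ := by gcongr; exact key r hr t ht

end Rayleigh

end

noncomputable section

namespace Rayleigh

variable {f₀ : L1Phase} {g₀ : L1V} {T : ℝ} {n : ℕ}

/-! ### The time integral of the solution -/

/-- Integration over a set as a continuous linear functional. -/
def setIntCLM (A : Set Phase) : L1Phase →L[ℝ] ℝ :=
  (L1.integralCLM (μ := volume.restrict A)).comp (LpToLpRestrictCLM Phase ℝ ℝ volume 1 A)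

lemma setIntCLM_apply (A : Set Phase) (f : L1Phase) : setIntCLM A f = ∫ z in A, f z := by
  have h1 : setIntCLM A f = L1.integralCLM (μ := volume.restrict A)
    (LpToLpRestrictCLM Phase ℝ ℝ volume 1 A f) := rfl
  rw [h1, ← L1.integral_eq, L1.integral_eq_integral]
  exact integral_congr_ae (LpToLpRestrictCLM_coeFn ℝ A f)

lemma Admissible.setIntegral_timeInt (h : Admissible f₀ g₀) {t : ℝ} (ht : t ∈ Icc 0 T)
    {A : Set Phase} (hA : MeasurableSet A) :
    0 ≤ ∫ z in A, (∫ θ in (0 : ℝ)..t, sol T f₀ g₀ θ : L1Phase) z ∧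
    ENNReal.ofReal (∫ z in A, (∫ θ in (0 : ℝ)..t, sol T f₀ g₀ θ : L1Phase) z) =
      ∫⁻ θ in Ioc 0 t, Ff T f₀ g₀ θ (A.indicator 1) := by
  have hc : ContinuousOn (sol T f₀ g₀) (Icc 0 t) :=
    h.continuousOn_sol.mono (Icc_subset_Icc_right ht.2)
  have hi : IntervalIntegrable (sol T f₀ g₀) volume 0 t := by
    refine ContinuousOn.intervalIntegrable ?_
    rwa [uIcc_of_le ht.1]
  have hsub : ∀ θ ∈ Ioc 0 t, θ ∈ Icc 0 T := fun θ hθ => ⟨hθ.1.le, hθ.2.trans ht.2⟩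
  have hnn : ∀ θ ∈ Ioc 0 t, 0 ≤ ∫ z in A, sol T f₀ g₀ θ z := fun θ hθ =>
    integral_nonneg_of_ae (ae_restrict_of_ae (h.sol_nonneg (hsub θ hθ)))
  have e1 : ∫ z in A, (∫ θ in (0 : ℝ)..t, sol T f₀ g₀ θ : L1Phase) z =
      ∫ θ in Ioc 0 t, ∫ z in A, sol T f₀ g₀ θ z := by
    rw [← setIntCLM_apply, ← ContinuousLinearMap.intervalIntegral_comp_comm _ hi,
      intervalIntegral.integral_of_le ht.1]
    simp only [setIntCLM_apply]
  rw [e1]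
  refine ⟨setIntegral_nonneg measurableSet_Ioc hnn, ?_⟩
  rw [ofReal_integral_eq_lintegral_ofReal]
  · exact setLIntegral_congr_fun measurableSet_Ioc fun θ hθ => h.setIntegral_sol (hsub θ hθ) hA
  · have := ((setIntCLM A).integrable_comp hi.1)
    simpa only [setIntCLM_apply] using this
  · exact (ae_restrict_iff' measurableSet_Ioc).2 (Eventually.of_forall hnn)

lemma Admissible.timeInt_nonneg (h : Admissible f₀ g₀) {t : ℝ} (ht : t ∈ Icc 0 T) :
    ∀ᵐ z, 0 ≤ (∫ θ in (0 : ℝ)..t, sol T f₀ g₀ θ : L1Phase) z :=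
  ae_nonneg_of_forall_setIntegral_nonneg (L1.integrable_coeFn _)
    fun _ hA _ => (h.setIntegral_timeInt ht hA).1

lemma Admissible.measurable_Ff (h : Admissible f₀ g₀) {φ : Phase → ENNReal} (hφ : Measurable φ) :
    Measurable fun r => Ff T f₀ g₀ r φ :=
  Measurable.tsum fun _ => h.measurable_ev (φ := fun _ => φ) (by fun_prop)

lemma Admissible.measurable_Fm (h : Admissible f₀ g₀) : Measurable (Fm T f₀ g₀) := by
  refine Measure.measurable_of_measurable_coe _ fun A hA => ?_
  have : ∀ r, Fm T f₀ g₀ r A = Ff T f₀ g₀ r (A.indicator 1) := fun r => by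
    rw [← h.lintegral_Fm (measurable_one.indicator hA), lintegral_indicator_one hA]
  simp only [this]
  exact h.measurable_Ff (measurable_one.indicator hA)

/-- The time integral in L¹ and the mixture of the laws `Fm` over time agree on measurable sets,
hence as measures. This allows unbounded φ, such as the collision frequency. -/
lemma Admissible.lintegral_timeInt (h : Admissible f₀ g₀) {t : ℝ} (ht : t ∈ Icc 0 T)
    {φ : Phase → ENNReal} (hφ : Measurable φ) :
    ∫⁻ z, ENNReal.ofReal ((∫ θ in (0 : ℝ)..t, sol T f₀ g₀ θ : L1Phase) z) * φ z =
      ∫⁻ θ in Ioc 0 t, Ff T f₀ g₀ θ φ := by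
  set H : L1Phase := ∫ θ in (0 : ℝ)..t, sol T f₀ g₀ θ
  have hH := measurable_L1Phase H
  have heq : volume.withDensity (fun z => ENNReal.ofReal (H z)) =
      (volume.restrict (Ioc 0 t)).bind (Fm T f₀ g₀) := by
    refine Measure.ext fun A hA => ?_
    rw [withDensity_apply _ hA, Measure.bind_apply hA h.measurable_Fm.aemeasurable,
      ← ofReal_integral_eq_lintegral_ofReal (L1.integrable_coeFn _).integrableOn
      (ae_restrict_of_ae (h.timeInt_nonneg ht)), (h.setIntegral_timeInt ht hA).2]
    refine lintegral_congr fun θ => ?_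
    rw [← h.lintegral_Fm (measurable_one.indicator hA), lintegral_indicator_one hA]
  rw [← lintegral_wd (by fun_prop) hφ, heq, Measure.lintegral_bind h.measurable_Fm.aemeasurable
    hφ.aemeasurable]
  simp only [h.lintegral_Fm hφ]

/-! ### The weak equation -/

lemma ofReal_integral_mul {u χ : Phase → ℝ} (hu : Integrable u) (hu0 : ∀ᵐ z, 0 ≤ u z)
    (hχ : Measurable χ) (hχ0 : ∀ z, 0 ≤ χ z) {C : ℝ} (hC : ∀ z, χ z ≤ C) :
    Integrable (fun z => u z * χ z) ∧
    ENNReal.ofReal (∫ z, u z * χ z) = ∫⁻ z, ENNReal.ofReal (u z) * ENNReal.ofReal (χ z) := by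
  have hi : Integrable fun z => u z * χ z := hu.mul_bdd (c := C) hχ.aestronglyMeasurable
    (Eventually.of_forall fun z => by rw [Real.norm_of_nonneg (hχ0 z)]; exact hC z)
  refine ⟨hi, ?_⟩
  rw [ofReal_integral_eq_lintegral_ofReal hi]
  · refine lintegral_congr_ae ?_
    filter_upwards [hu0] with z hz
    rw [ENNReal.ofReal_mul hz]
  · filter_upwards [hu0] with z hz
    exact mul_nonneg hz (hχ0 z)

/-- What the mild solution needs at one time. -/
structure Balance (g₀ : L1V) (f₀ ft H b : L1Phase) : Prop where
  loss : Integrable fun z => H z * collFreq g₀ z.2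
  eqn : ∀ {φ D : Phase → ℝ}, FlowC1 φ D → ∀ {C : ℝ}, (∀ z, φ z ≤ C) → (∀ z, |D z| ≤ C) →
    (∫ z, ft z * φ z) + (∫ z, H z * collFreq g₀ z.2 * φ z) =
      (∫ z, f₀ z * φ z) + (∫ z, b z * φ z) + ∫ z, H z * D z

/-- The terms of `Ff_identity` become integrals against the time integral of the solution. The
moment bound makes them finite for bounded φ and D, so the identity in [0, ∞] becomes one of real
integrals, with D split into positive and negative parts. -/
lemma Admissible.exists_balance (h : Admissible f₀ g₀) {t : ℝ} (ht : t ∈ Icc 0 T) : ∃ b,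
    IsB g₀ (∫ θ in (0 : ℝ)..t, sol T f₀ g₀ θ) b ∧
    Balance g₀ f₀ (sol T f₀ g₀ t) (∫ θ in (0 : ℝ)..t, sol T f₀ g₀ θ) b := by
  have hH := fun {φ : Phase → ENNReal} (hφ : Measurable φ) => h.lintegral_timeInt ht hφ
  have hH0 := h.timeInt_nonneg ht
  set H : L1Phase := ∫ θ in (0 : ℝ)..t, sol T f₀ g₀ θ
  have hHm := measurable_L1Phase H
  have hcf := h.measurable_collFreq
  have hfin : ∫⁻ z, ‖H z‖ₑ * freq g₀ z.2 ≠ ⊤ := by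
    have := (h.lintegral_Ff_freq_lt_top (T := T) (S := Ioc 0 t) (Ioc_subset_Ioc_right ht.2)).ne
    rw [← hH (by fun_prop)] at this
    rwa [lintegral_congr_ae]
    filter_upwards [hH0] with z hz
    rw [Real.enorm_of_nonneg hz]
  obtain ⟨b, hb, hb0, hbφ⟩ := h.exists_isB H hfin hH0
  have hL : Integrable fun z => H z * collFreq g₀ z.2 := by
    refine ⟨by fun_prop, ?_⟩
    rw [HasFiniteIntegral]
    refine lt_of_le_of_lt (le_of_eq (lintegral_congr fun z => ?_)) hfin.lt_top
    rw [enorm_mul, Real.enorm_of_nonneg (h.collFreq_nonneg _), h.ofReal_collFreq]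
  refine ⟨b, hb, hL, ?_⟩
  intro φ D hφ C hC hD
  have hφm := hφ.meas
  have hDm := hφ.meas_deriv
  have hHi : Integrable H := L1.integrable_coeFn H
  obtain ⟨i1, e1⟩ := ofReal_integral_mul (L1.integrable_coeFn (sol T f₀ g₀ t)) (h.sol_nonneg ht)
    hφm hφ.nonneg hC
  obtain ⟨i2, e2⟩ := ofReal_integral_mul (L1.integrable_coeFn f₀) h.f_nonneg hφm hφ.nonneg hC
  obtain ⟨i3, e3⟩ := ofReal_integral_mul (L1.integrable_coeFn b) hb0 hφm hφ.nonneg hC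
  have hL0 : ∀ᵐ z, 0 ≤ H z * collFreq g₀ z.2 := by
    filter_upwards [hH0] with z hz using mul_nonneg hz (h.collFreq_nonneg _)
  obtain ⟨i4, e4⟩ := ofReal_integral_mul hL hL0 hφm hφ.nonneg hC
  obtain ⟨i5, e5⟩ := ofReal_integral_mul hHi hH0 (χ := fun z => max (D z) 0) (by fun_prop)
    (fun z => le_max_right _ _) (C := C)
    (fun z => max_le ((le_abs_self _).trans (hD z)) ((abs_nonneg _).trans (hD z)))
  obtain ⟨i6, e6⟩ := ofReal_integral_mul hHi hH0 (χ := fun z => max (-D z) 0) (by fun_prop)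
    (fun z => le_max_right _ _) (C := C)
    (fun z => max_le ((neg_le_abs _).trans (hD z)) ((abs_nonneg _).trans (hD z)))
  have key := h.Ff_identity hφ ht
  rw [← hH hφ.measurable_lossOf, ← hH (measurable_coll (by fun_prop)), ← hH (by fun_prop),
    ← hbφ _ (by fun_prop), ← h.lintegral_sol ht (by fun_prop), ← e1, ← e3] at key
  have l1 : ∫⁻ z, ENNReal.ofReal (H z) * lossOf g₀ φ D z =
      ENNReal.ofReal (∫ z, H z * collFreq g₀ z.2 * φ z) +
      ENNReal.ofReal (∫ z, H z * max (-D z) 0) := by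
    have e6' : ENNReal.ofReal (∫ z, H z * max (-D z) 0) =
      ∫⁻ z, ENNReal.ofReal (H z) * ENNReal.ofReal (max (-D z) 0) := e6
    rw [e4, e6', ← lintegral_add_left (by fun_prop)]
    refine lintegral_congr_ae ?_
    filter_upwards [hH0] with z hz
    rw [lossOf, ENNReal.ofReal_mul hz, h.ofReal_collFreq, ENNReal.ofReal_max]
    simp [mul_add, mul_assoc]
  have l2 : ∫⁻ z, ENNReal.ofReal (φ z) ∂mu0 f₀ = ENNReal.ofReal (∫ z, f₀ z * φ z) := by
    have := measurable_L1Phase f₀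
    rw [e2, mu0, lintegral_wd (by fun_prop) (by fun_prop)]
  have l3 : ∫⁻ z, ENNReal.ofReal (H z) * ENNReal.ofReal (D z) =
      ENNReal.ofReal (∫ z, H z * max (D z) 0) := by
    rw [e5]
    refine lintegral_congr fun z => ?_
    rw [ENNReal.ofReal_max]; simp
  rw [l1, l2, l3] at key
  have p1 : 0 ≤ ∫ z, sol T f₀ g₀ t z * φ z := integral_nonneg_of_ae (by
    filter_upwards [h.sol_nonneg ht] with z hz using mul_nonneg hz (hφ.nonneg z))
  have p2 : 0 ≤ ∫ z, f₀ z * φ z := integral_nonneg_of_ae (by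
    filter_upwards [h.f_nonneg] with z hz using mul_nonneg hz (hφ.nonneg z))
  have p3 : 0 ≤ ∫ z, b z * φ z := integral_nonneg_of_ae (by
    filter_upwards [hb0] with z hz using mul_nonneg hz (hφ.nonneg z))
  have p4 : 0 ≤ ∫ z, H z * collFreq g₀ z.2 * φ z := integral_nonneg_of_ae (by
    filter_upwards [hL0] with z hz using mul_nonneg hz (hφ.nonneg z))
  have p5 : 0 ≤ ∫ z, H z * max (D z) 0 := integral_nonneg_of_ae (by
    filter_upwards [hH0] with z hz using mul_nonneg hz (le_max_right _ _))
  have p6 : 0 ≤ ∫ z, H z * max (-D z) 0 := integral_nonneg_of_ae (by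
    filter_upwards [hH0] with z hz using mul_nonneg hz (le_max_right _ _))
  rw [← ENNReal.ofReal_add p4 p6, ← ENNReal.ofReal_add p1 (add_nonneg p4 p6),
    ← ENNReal.ofReal_add p2 p3, ← ENNReal.ofReal_add (add_nonneg p2 p3) p5,
    ENNReal.ofReal_eq_ofReal_iff (by positivity) (by positivity)] at key
  have l4 : ∫ z, H z * D z = (∫ z, H z * max (D z) 0) - ∫ z, H z * max (-D z) 0 := by
    rw [← integral_sub i5 i6]
    refine integral_congr_ae (Eventually.of_forall fun z => ?_)
    have : max (D z) 0 - max (-D z) 0 = D z := by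
      rcases le_total (D z) 0 with hs | hs
      · rw [max_eq_right hs, max_eq_left (by linarith)]; ring
      · rw [max_eq_left hs, max_eq_right (by linarith)]; ring
    show H z * D z = H z * max (D z) 0 - H z * max (-D z) 0
    rw [← mul_sub, this]
  rw [l4]
  linarith

/-! ### Test functions -/

lemma isOpenQuotientMap_toTorus : IsOpenQuotientMap toTorus := by
  have h1 : IsOpenQuotientMap (Pi.map fun (_ : Fin 3) (x : ℝ) => (x : UnitAddCircle)) :=
    IsOpenQuotientMap.piMap fun _ => QuotientAddGroup.isOpenQuotientMap_mk
  exact h1.comp (EuclideanSpace.equiv (Fin 3) ℝ).toHomeomorph.isOpenQuotientMap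

lemma continuous_of_lift {X : Type*} [TopologicalSpace X] {φ : Phase → X}
    (h : Continuous fun q : V3 × V3 => φ (toTorus q.1, q.2)) : Continuous φ :=
  (isOpenQuotientMap_toTorus.prodMap IsOpenQuotientMap.id).continuous_comp_iff.1 h

lemma IsTest.continuous {φ : Phase → ℝ} (h : IsTest φ) : Continuous φ :=
  continuous_of_lift h.smooth.continuous

lemma IsTest.hasDerivAt_lift {φ : Phase → ℝ} (h : IsTest φ) (x v : V3) (s : ℝ) :
    HasDerivAt (fun s => φ (fl s (toTorus x, v)))
      (fderiv ℝ (fun q : V3 × V3 => φ (toTorus q.1, q.2)) (x + s • v, v) (v, 0)) s := by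
  have h1 := (h.smooth.differentiable (by simp) (x + s • v, v)).hasFDerivAt
  have h2 : HasDerivAt (fun s : ℝ => (x + s • v, v)) (v, (0 : V3)) s := by
    have := ((hasDerivAt_id s).smul_const v).const_add x
    simpa using this.prodMk (hasDerivAt_const s v)
  have h3 := h1.comp_hasDerivAt s h2
  refine h3.congr_of_eventuallyEq (Eventually.of_forall fun s => ?_)
  simp [fl, toTorus_add]

lemma IsTest.stream_lift {φ : Phase → ℝ} (h : IsTest φ) (x v : V3) : stream φ (toTorus x, v) =
    fderiv ℝ (fun q : V3 × V3 => φ (toTorus q.1, q.2)) (x, v) (v, 0) := by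
  have := (h.hasDerivAt_lift x v 0).deriv
  simp only [zero_smul, add_zero] at this
  exact this

lemma IsTest.hasDerivAt {φ : Phase → ℝ} (h : IsTest φ) (z : Phase) (s : ℝ) :
    HasDerivAt (fun s => φ (fl s z)) (stream φ (fl s z)) s := by
  obtain ⟨x, hx⟩ := toTorus_surjective z.1
  have hz : z = (toTorus x, z.2) := by rw [hx]
  have h1 := h.hasDerivAt_lift x z.2 s
  rw [← h.stream_lift] at h1
  rw [hz]
  convert! h1 using 2

lemma IsTest.continuous_stream {φ : Phase → ℝ} (h : IsTest φ) : Continuous (stream φ) := by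
  refine continuous_of_lift ?_
  simp only [h.stream_lift]
  have h1 := h.smooth.continuous_fderiv (by simp)
  exact h1.clm_apply (by fun_prop)

lemma IsTest.hasCompactSupport_stream {φ : Phase → ℝ} (h : IsTest φ) :
    HasCompactSupport (stream φ) := by
  refine h.compact.mono' fun z hz => ?_
  by_contra hc
  refine hz ?_
  have h1 : ∀ᶠ y in 𝓝 z, φ y = 0 := by
    filter_upwards [(isClosed_tsupport φ).isOpen_compl.mem_nhds hc] with y hy
    exact image_eq_zero_of_notMem_tsupport hy
  have h2 : Tendsto (fun s : ℝ => fl s z) (𝓝 0) (𝓝 z) := by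
    have := (continuous_fl.comp (by fun_prop : Continuous fun s : ℝ => (s, z))).tendsto 0
    simpa [fl_zero, Function.comp_def] using this
  have h3 : (fun s : ℝ => φ (fl s z)) =ᶠ[𝓝 0] fun _ => 0 := h2.eventually h1
  have h4 : stream φ z = deriv (fun s : ℝ => φ (fl s z)) 0 := rfl
  rw [h4, h3.deriv_eq, deriv_const]

lemma IsTest.exists_bound {φ : Phase → ℝ} (h : IsTest φ) :
    ∃ C, ∀ z, |φ z| ≤ C ∧ |stream φ z| ≤ C := by
  obtain ⟨C₁, h1⟩ := h.compact.exists_bound_of_continuous h.continuous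
  obtain ⟨C₂, h2⟩ := h.hasCompactSupport_stream.exists_bound_of_continuous h.continuous_stream
  exact ⟨max C₁ C₂, fun z => ⟨(h1 z).trans (le_max_left _ _), (h2 z).trans (le_max_right _ _)⟩⟩

/-- With b the gain term of the time integral, a is forced to be u(t) - f₀ - b, and `Balance` tested
against φ is the distributional equation for a. -/
theorem Admissible.isMildSolution (h : Admissible f₀ g₀) : IsMildSolution T g₀ f₀ (sol T f₀ g₀) where
  cont := h.continuousOn_sol
  eqn t ht := by
    obtain ⟨b, hb, hL, hbal⟩ := h.exists_balance ht
    refine ⟨sol T f₀ g₀ t - f₀ - b, b, fun φ hφ => ?_, hb, by abel⟩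
    set H : L1Phase := ∫ θ in (0 : ℝ)..t, sol T f₀ g₀ θ
    obtain ⟨C, hC⟩ := hφ.exists_bound
    have hC0 : 0 ≤ C := (abs_nonneg _).trans (hC (toTorus 0, 0)).1
    have hφm := hφ.continuous.measurable
    -- The balance is available for nonnegative functions only, so it is applied to φ + C and to the
    -- constant C, and the two are subtracted.
    have hflow : FlowC1 (fun z => φ z + C) (stream φ) :=
      { meas := by fun_prop
        meas_deriv := hφ.continuous_stream.measurable
        nonneg := fun z => by have := neg_abs_le (φ z); have := (hC z).1; linarith
        deriv := fun z s => (hφ.hasDerivAt z s).add_const C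
        cont := fun z => hφ.continuous_stream.comp
          (continuous_fl.comp (by fun_prop : Continuous fun s : ℝ => (s, z))) }
    have e1 := hbal hflow (C := 2 * C) (fun z => by
      have := le_abs_self (φ z); have := (hC z).1; linarith) (fun z => by
      have := (hC z).2; linarith)
    have e2 := hbal (flowC1_of_velocity (φ := fun _ => C) measurable_const fun _ => hC0)
      (C := C) (fun _ => le_rfl) (fun _ => by simpa using hC0)
    have hi : ∀ {u : Phase → ℝ}, Integrable u → Integrable fun z => u z * φ z := fun hu =>
      hu.mul_bdd (c := C) hφm.aestronglyMeasurable (Eventually.of_forall fun z => (hC z).1)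
    have hsplit : ∀ {u : Phase → ℝ}, Integrable u → ∫ z, u z * (φ z + C) =
        (∫ z, u z * φ z) + ∫ z, u z * C := fun {u} hu => by
      rw [← integral_add (hi hu) (hu.mul_const C)]
      simp only [mul_add]
    rw [hsplit (L1.integrable_coeFn _), hsplit hL, hsplit (L1.integrable_coeFn _),
      hsplit (L1.integrable_coeFn _)] at e1
    simp only [mul_zero, integral_zero, add_zero] at e2
    have e3 : ∫ z, ((sol T f₀ g₀ t - f₀ - b : L1Phase) z + lossTerm g₀ H z) * φ z =
        (∫ z, sol T f₀ g₀ t z * φ z) - (∫ z, f₀ z * φ z) - (∫ z, b z * φ z) +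
        ∫ z, H z * collFreq g₀ z.2 * φ z := by
      have i1 := hi (L1.integrable_coeFn (sol T f₀ g₀ t))
      have i2 := hi (L1.integrable_coeFn f₀)
      have i3 := hi (L1.integrable_coeFn b)
      have i4 := hi hL
      have i5 : Integrable fun z => sol T f₀ g₀ t z * φ z - f₀ z * φ z := i1.sub i2
      have i6 : Integrable fun z => sol T f₀ g₀ t z * φ z - f₀ z * φ z - b z * φ z := i5.sub i3
      rw [← integral_sub i1 i2, ← integral_sub i5 i3, ← integral_add i6 i4]
      refine integral_congr_ae ?_
      filter_upwards [Lp.coeFn_sub (sol T f₀ g₀ t - f₀) b, Lp.coeFn_sub (sol T f₀ g₀ t) f₀]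
        with z h1 h2
      rw [h1, Pi.sub_apply, h2, Pi.sub_apply, lossTerm]
      ring
    rw [e3]
    linarith

end Rayleigh

end

/-! ### Uniqueness of mild solutions by dissipativity in L¹. -/

noncomputable section

namespace Rayleigh

/-! ### Fourier coefficients on the torus -/

/-- The phase of the `k`-th character. -/
def ang (k : Fin 3 → ℤ) (x : V3) : ℝ := 2 * Real.pi * ∑ i, k i * x i

/-- The characters of the torus. -/
def chr (k : Fin 3 → ℤ) : C(Torus, ℂ) := UnitAddTorus.mFourier k

lemma chr_toTorus (k : Fin 3 → ℤ) (x : V3) :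
    chr k (toTorus x) = Complex.exp (ang k x * Complex.I) := by
  have h1 : chr k (toTorus x) = ∏ i, fourier (k i) ((x i : ℝ) : UnitAddCircle) := rfl
  rw [h1]
  simp only [fourier_coe_apply]
  rw [← Complex.exp_sum]
  congr 1
  simp only [ang]
  push_cast
  rw [Finset.mul_sum, Finset.sum_mul]
  refine Finset.sum_congr rfl fun i _ => ?_
  simp; ring

lemma ang_add (k : Fin 3 → ℤ) (x y : V3) : ang k (x + y) = ang k x + ang k y := by
  simp only [ang, PiLp.add_apply, mul_add, Finset.sum_add_distrib]

lemma ang_smul (k : Fin 3 → ℤ) (s : ℝ) (x : V3) : ang k (s • x) = s * ang k x := by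
  simp only [ang, PiLp.smul_apply, smul_eq_mul, Finset.mul_sum]
  exact Finset.sum_congr rfl fun i _ => by ring

lemma chr_add (k : Fin 3 → ℤ) (x : Torus) (y : V3) :
    chr k (x + toTorus y) = chr k x * Complex.exp (ang k y * Complex.I) := by
  obtain ⟨x, rfl⟩ := toTorus_surjective x
  rw [← toTorus_add, chr_toTorus, chr_toTorus, ang_add, ← Complex.exp_add]
  congr 1; push_cast; ring

lemma norm_chr (k : Fin 3 → ℤ) (x : Torus) : ‖chr k x‖ = 1 := by
  obtain ⟨x, rfl⟩ := toTorus_surjective x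
  rw [chr_toTorus, Complex.norm_exp_ofReal_mul_I]

/-- Integrable functions on the torus. -/
abbrev L1T : Type := Torus →₁[(volume : Measure Torus)] ℝ

lemma integrable_smul_continuous (p : L1T) (φ : C(Torus, ℂ)) :
    Integrable fun x => p x • φ x := by
  have h1 : Integrable fun x => (p x : ℂ) := (L1.integrable_coeFn p).ofReal
  simp only [Complex.real_smul]
  exact h1.mul_bdd (c := ‖φ‖) φ.continuous.aestronglyMeasurable
    (Eventually.of_forall fun x => φ.norm_coe_le_norm x)

/-- Integration against a continuous function. -/
def pairing (φ : C(Torus, ℂ)) : L1T →L[ℝ] ℂ :=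
  LinearMap.mkContinuous
    { toFun := fun p => ∫ x, p x • φ x
      map_add' := fun p q => by
        rw [← integral_add (integrable_smul_continuous p φ) (integrable_smul_continuous q φ)]
        refine integral_congr_ae ?_
        filter_upwards [Lp.coeFn_add p q] with x hx
        rw [hx, Pi.add_apply, add_smul]
      map_smul' := fun c p => by
        rw [RingHom.id_apply, ← integral_smul]
        refine integral_congr_ae ?_
        filter_upwards [Lp.coeFn_smul c p] with x hx
        rw [hx, Pi.smul_apply, smul_assoc] } ‖φ‖ fun p => by
    refine (norm_integral_le_integral_norm _).trans ?_
    rw [L1.norm_eq_integral_norm, ← integral_const_mul]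
    refine integral_mono (integrable_smul_continuous p φ).norm
      ((L1.integrable_coeFn p).norm.const_mul _) fun x => ?_
    rw [norm_smul, mul_comm]
    gcongr
    exact φ.norm_coe_le_norm x

lemma pairing_apply (φ : C(Torus, ℂ)) (p : L1T) : pairing φ p = ∫ x, p x • φ x := rfl

/-- An integrable function is determined by its Fourier coefficients. -/
lemma eq_zero_of_pairing_chr {p : L1T} (h : ∀ k, pairing (chr k) p = 0) : p = 0 := by
  have hadd : ∀ φ ψ : C(Torus, ℂ), pairing (φ + ψ) p = pairing φ p + pairing ψ p := by
    intro φ ψ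
    simp only [pairing_apply, ContinuousMap.add_apply, smul_add]
    rw [integral_add (integrable_smul_continuous p φ) (integrable_smul_continuous p ψ)]
  have hsmul : ∀ (c : ℂ) (φ : C(Torus, ℂ)), pairing (c • φ) p = c * pairing φ p := by
    intro c φ
    simp only [pairing_apply, ContinuousMap.smul_apply]
    rw [← integral_const_mul]
    refine integral_congr_ae (Eventually.of_forall fun x => ?_)
    simp only [smul_eq_mul, Complex.real_smul]; ring
  let Λ : C(Torus, ℂ) →L[ℂ] ℂ := LinearMap.mkContinuous
    { toFun := fun φ => pairing φ p, map_add' := hadd, map_smul' := hsmul } ‖p‖ fun φ => by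
      have h1 : ‖pairing φ‖ ≤ ‖φ‖ := LinearMap.mkContinuous_norm_le _ (norm_nonneg φ) _
      calc ‖pairing φ p‖ ≤ ‖pairing φ‖ * ‖p‖ := (pairing φ).le_opNorm p
        _ ≤ ‖φ‖ * ‖p‖ := by gcongr
        _ = _ := mul_comm _ _
  have hΛ : ∀ φ, Λ φ = pairing φ p := fun φ => rfl
  -- Trigonometric polynomials are dense in the continuous functions and the pairing is continuous
  -- in φ.
  have hall : ∀ φ : C(Torus, ℂ), pairing φ p = 0 := by
    intro φ
    have h1 : (Submodule.span ℂ (range (UnitAddTorus.mFourier (d := Fin 3)))).topologicalClosure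
        ≤ LinearMap.ker (Λ : C(Torus, ℂ) →ₗ[ℂ] ℂ) := by
      refine Submodule.topologicalClosure_minimal _ ?_ Λ.isClosed_ker
      rw [Submodule.span_le]
      rintro _ ⟨k, rfl⟩
      exact h k
    rw [UnitAddTorus.span_mFourier_closure_eq_top] at h1
    exact h1 (Submodule.mem_top : φ ∈ ⊤)
  have hpi : Integrable p := L1.integrable_coeFn p
  have hpm : Measurable p := (Lp.stronglyMeasurable p).measurable
  have : IsFiniteMeasure ((volume : Measure Torus).withDensity fun x => ENNReal.ofReal (p x)) :=
    isFiniteMeasure_withDensity_ofReal hpi.2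
  have : IsFiniteMeasure ((volume : Measure Torus).withDensity fun x => ENNReal.ofReal (-p x)) :=
    isFiniteMeasure_withDensity_ofReal hpi.neg.2
  -- The positive and negative parts of p define finite measures with equal integrals of continuous
  -- functions, so they coincide.
  have hmeas : (volume : Measure Torus).withDensity (fun x => ENNReal.ofReal (p x)) =
      volume.withDensity fun x => ENNReal.ofReal (-p x) := by
    refine ext_of_forall_integral_eq_of_IsFiniteMeasure fun φ => ?_
    rw [integral_withDensity_eq_integral_toReal_smul (by fun_prop) (by simp),
      integral_withDensity_eq_integral_toReal_smul (by fun_prop) (by simp), ← sub_eq_zero]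
    have hb : ∀ {u : Torus → ℝ}, Integrable u → Integrable fun x => u x • φ x := fun hu =>
      hu.mul_bdd (c := ‖φ‖) φ.continuous.aestronglyMeasurable
        (Eventually.of_forall φ.norm_coe_le_norm)
    rw [← integral_sub]
    · have h2 := hall ⟨fun x => (φ x : ℂ), by fun_prop⟩
      rw [pairing_apply] at h2
      have h3 : ∫ x, p x * φ x = 0 := by
        have : ∫ x, ((p x * φ x : ℝ) : ℂ) = 0 := by
          rw [← h2]
          refine integral_congr_ae (Eventually.of_forall fun x => ?_)
          simp
        rw [integral_complex_ofReal] at this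
        exact_mod_cast this
      rw [← h3]
      refine integral_congr_ae (Eventually.of_forall fun x => ?_)
      simp only [smul_eq_mul, ENNReal.toReal_ofReal']
      rcases le_total (p x) 0 with hs | hs
      · rw [max_eq_right hs, max_eq_left (by linarith)]; ring
      · rw [max_eq_left hs, max_eq_right (by linarith)]; ring
    · refine hb ?_
      simp only [ENNReal.toReal_ofReal']
      exact hpi.pos_part
    · refine hb ?_
      simp only [ENNReal.toReal_ofReal']
      exact hpi.neg.pos_part
  rw [withDensity_eq_iff (by fun_prop) (by fun_prop) ?_] at hmeas
  swap
  · exact (lt_of_le_of_lt (lintegral_ofReal_le_lintegral_enorm _) hpi.2).ne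
  refine Lp.ext ?_
  filter_upwards [hmeas, Lp.coeFn_zero ℝ 1 (volume : Measure Torus)] with x hx h0
  rw [h0, Pi.zero_apply]
  rcases le_total (p x) 0 with hs | hs
  · rw [ENNReal.ofReal_of_nonpos hs, eq_comm, ENNReal.ofReal_eq_zero] at hx
    linarith
  · rw [ENNReal.ofReal_of_nonpos (by linarith : -p x ≤ 0), ENNReal.ofReal_eq_zero] at hx
    linarith

/-- Translation of functions on the torus. -/
def shift (y : Torus) (p : L1T) : L1T :=
  Lp.compMeasurePreserving (⟨fun x => x - y, by fun_prop⟩ : C(Torus, Torus))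
    (measurePreserving_sub_right volume y) p

lemma norm_shift (y : Torus) (p : L1T) : ‖shift y p‖ = ‖p‖ := Lp.norm_compMeasurePreserving _ _

lemma continuous_shift (p : L1T) : Continuous fun y => shift y p :=
  Continuous.compMeasurePreservingLp continuous_const
    (ContinuousMap.curry ⟨fun q : Torus × Torus => q.2 - q.1, by fun_prop⟩).continuous
    (fun y => measurePreserving_sub_right volume y) (by simp)

lemma pairing_shift (k : Fin 3 → ℤ) (y : V3) (p : L1T) : pairing (chr k) (shift (toTorus y) p) =
    Complex.exp (ang k y * Complex.I) * pairing (chr k) p := by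
  rw [pairing_apply, pairing_apply, ← integral_const_mul]
  have h1 : ∫ x, shift (toTorus y) p x • chr k x = ∫ x, p (x - toTorus y) • chr k x := by
    refine integral_congr_ae ?_
    filter_upwards [Lp.coeFn_compMeasurePreserving p (measurePreserving_sub_right volume (toTorus y))]
      with x hx
    rw [shift]
    exact congrArg (· • chr k x) hx
  rw [h1, ← integral_add_right_eq_self _ (toTorus y)]
  refine integral_congr_ae (Eventually.of_forall fun x => ?_)
  simp only [add_sub_cancel_right, chr_add, Complex.real_smul]
  ring

/-- The resolvent estimate for transport with damping on the torus. -/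
lemma resolvent_torus {p q : L1T} {v : V3} {μ : ℝ} (hμ : 0 < μ)
    (h : ∀ k, ((μ : ℂ) - ang k v * Complex.I) * pairing (chr k) p = pairing (chr k) q) :
    μ * ‖p‖ ≤ ‖q‖ := by
  have hc : Continuous fun s : ℝ => Real.exp (-(μ * s)) • shift (toTorus (s • v)) q := by
    have h1 : Continuous fun s : ℝ => shift (toTorus (s • v)) q := (continuous_shift q).comp
      (continuous_toTorus.comp (by fun_prop : Continuous fun s : ℝ => s • v))
    have h2 : Continuous fun s : ℝ => Real.exp (-(μ * s)) := by fun_prop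
    exact h2.smul h1
  -- The hypothesis says that μ p + v·∂ₓ p = q. This is its Duhamel formula over a unit of time,
  -- checked on Fourier coefficients. Taking norms, (1 - e^(-μ)) ‖p‖ ≤ (1 - e^(-μ)) ‖q‖ / μ.
  have heq : p - Real.exp (-μ) • shift (toTorus v) p =
      ∫ s in (0 : ℝ)..1, Real.exp (-(μ * s)) • shift (toTorus (s • v)) q := by
    rw [← sub_eq_zero]
    refine eq_zero_of_pairing_chr fun k => ?_
    rw [map_sub, map_sub, map_smul, ← ContinuousLinearMap.intervalIntegral_comp_comm _
      (hc.intervalIntegrable _ _)]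
    simp only [map_smul, pairing_shift, ang_smul]
    set c : ℂ := -((μ : ℂ) - ang k v * Complex.I) with hcdef
    have hc0 : c ≠ 0 := by
      intro h0
      have := congrArg Complex.re h0
      simp [hcdef] at this
      exact hμ.ne' this
    have e1 : ∀ s : ℝ, Real.exp (-(μ * s)) • (Complex.exp ((s * ang k v : ℝ) * Complex.I) *
        pairing (chr k) q) = Complex.exp (c * s) * pairing (chr k) q := by
      intro s
      rw [Complex.real_smul, ← mul_assoc, Complex.ofReal_exp, ← Complex.exp_add]
      congr 2
      rw [hcdef]; push_cast; ring
    have e2 : Real.exp (-μ) • (Complex.exp (ang k v * Complex.I) * pairing (chr k) p) =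
        Complex.exp c * pairing (chr k) p := by
      rw [Complex.real_smul, ← mul_assoc, Complex.ofReal_exp, ← Complex.exp_add]
      congr 2
      rw [hcdef]; push_cast; ring
    simp only [e1]
    rw [e2, intervalIntegral.integral_mul_const, integral_exp_mul_complex hc0, ← h k,
      show (μ : ℂ) - ang k v * Complex.I = -c by rw [hcdef]; ring]
    simp only [Complex.ofReal_one, Complex.ofReal_zero, mul_one, mul_zero, Complex.exp_zero]
    field_simp
    ring
  have h1 : ‖∫ s in (0 : ℝ)..1, Real.exp (-(μ * s)) • shift (toTorus (s • v)) q‖ ≤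
      (1 - Real.exp (-μ)) / μ * ‖q‖ := by
    refine (intervalIntegral.norm_integral_le_integral_norm zero_le_one).trans (le_of_eq ?_)
    simp only [norm_smul, norm_shift, Real.norm_eq_abs, Real.abs_exp]
    rw [intervalIntegral.integral_mul_const]
    congr 1
    have : ∀ s : ℝ, HasDerivAt (fun s => -Real.exp (-(μ * s)) / μ) (Real.exp (-(μ * s))) s := by
      intro s
      have h1 : HasDerivAt (fun s : ℝ => -(μ * s)) (-μ) s := by
        simpa using ((hasDerivAt_id s).const_mul μ).fun_neg
      have h2 := (h1.exp.fun_neg).div_const μ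
      refine h2.congr_deriv ?_
      field_simp
    rw [intervalIntegral.integral_eq_sub_of_hasDerivAt (fun s _ => this s)
      ((by fun_prop : Continuous fun s => Real.exp (-(μ * s))).intervalIntegrable _ _)]
    simp; ring
  rw [← heq] at h1
  have h2 : ‖p‖ ≤ ‖p - Real.exp (-μ) • shift (toTorus v) p‖ + Real.exp (-μ) * ‖p‖ := by
    calc ‖p‖ = ‖(p - Real.exp (-μ) • shift (toTorus v) p) + Real.exp (-μ) • shift (toTorus v) p‖ := by
          rw [sub_add_cancel]
      _ ≤ _ := (norm_add_le _ _).trans (le_of_eq (by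
          rw [norm_smul, norm_shift, Real.norm_eq_abs, Real.abs_exp]))
  have h3 : 0 < 1 - Real.exp (-μ) := by
    have : Real.exp (-μ) < 1 := Real.exp_lt_one_iff.2 (by linarith)
    linarith
  have h4 : (1 - Real.exp (-μ)) * ‖p‖ ≤ (1 - Real.exp (-μ)) * (‖q‖ / μ) := by
    calc _ ≤ (1 - Real.exp (-μ)) / μ * ‖q‖ := by linarith
      _ = _ := by ring
  have h5 := le_of_mul_le_mul_left h4 h3
  rwa [le_div_iff₀ hμ, mul_comm] at h5

end Rayleigh

end

noncomputable section

namespace Rayleigh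

variable {f₀ : L1Phase} {g₀ : L1V} {T : ℝ}

/-! ### Integrability over bounded sets of velocities -/

/-- Functions that are integrable over bounded sets of velocities. -/
def LocInt {E : Type*} [NormedAddCommGroup E] (ξ : Phase → E) : Prop :=
  ∀ R : ℝ, IntegrableOn ξ {z | ‖z.2‖ ≤ R}

lemma measurableSet_ball (R : ℝ) : MeasurableSet {z : Phase | ‖z.2‖ ≤ R} :=
  measurableSet_le (by fun_prop) measurable_const

lemma locInt_L1 (f : L1Phase) : LocInt f := fun _ => (L1.integrable_coeFn f).integrableOn

lemma LocInt.mul {ξ m : Phase → ℝ} (h : LocInt ξ) (hm : Measurable m) {C : ℝ}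
    (hC : ∀ z, |m z| ≤ C * (1 + ‖z.2‖)) : LocInt fun z => ξ z * m z := by
  intro R
  refine (h R).mul_bdd (c := |C| * (1 + R)) hm.aestronglyMeasurable ?_
  refine (ae_restrict_iff' (measurableSet_ball R)).2 (Eventually.of_forall fun z hz => ?_)
  have hz' : ‖z.2‖ ≤ R := hz
  refine (hC z).trans ?_
  have := le_abs_self C
  gcongr

lemma LocInt.integrable_mul {E : Type*} [NormedAddCommGroup E] [NormedSpace ℝ E] {ξ : Phase → E}
    (h : LocInt ξ) {χ : V3 → ℝ} (hχ : Continuous χ) (hc : HasCompactSupport χ) :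
    Integrable fun z => χ z.2 • ξ z := by
  obtain ⟨C, hC⟩ := hc.exists_bound_of_continuous hχ
  obtain ⟨R, hR⟩ := hc.isCompact.isBounded.subset_closedBall 0
  have h1 : Integrable ({z : Phase | ‖z.2‖ ≤ R}.indicator ξ) :=
    (integrable_indicator_iff (measurableSet_ball R)).2 (h R)
  have h2 := h1.bdd_smul (φ := fun z : Phase => χ z.2) C
    (by fun_prop : Continuous fun z : Phase => χ z.2).aestronglyMeasurable
    (Eventually.of_forall fun z => hC z.2)
  refine h2.congr (Eventually.of_forall fun z => ?_)
  by_cases hz : ‖z.2‖ ≤ R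
  · simp [hz]
  · have : χ z.2 = 0 := by
      refine image_eq_zero_of_notMem_tsupport fun hm => hz ?_
      simpa using hR hm
    simp [this]

/-- The fundamental lemma of the calculus of variations in the velocity variable, after integrating
over the position. -/
lemma ae_integral_eq_zero {ξ : Phase → ℂ} (h : LocInt ξ)
    (h0 : ∀ χ : V3 → ℝ, ContDiff ℝ ((⊤ : ℕ∞) : WithTop ℕ∞) χ → HasCompactSupport χ →
      ∫ z, χ z.2 • ξ z = 0) : ∀ᵐ v, ∫ x, ξ (x, v) = 0 := by
  refine ae_eq_zero_of_integral_contDiff_smul_eq_zero ?_ fun χ hχ hc => ?_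
  · rw [locallyIntegrable_iff]
    intro K hK
    obtain ⟨R, hR⟩ := hK.isBounded.subset_closedBall (0 : V3)
    refine IntegrableOn.mono_set ?_ hR
    have h1 := h R
    have h2 : (volume : Measure Phase).restrict {z | ‖z.2‖ ≤ R} =
        (volume : Measure Torus).prod (volume.restrict (Metric.closedBall (0 : V3) R)) := by
      have : {z : Phase | ‖z.2‖ ≤ R} = univ ×ˢ Metric.closedBall (0 : V3) R := by
        ext z; simp
      rw [this, Measure.volume_eq_prod, ← Measure.prod_restrict, Measure.restrict_univ]
    rw [IntegrableOn, h2] at h1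
    exact h1.integral_prod_right
  · rw [← h0 χ hχ hc, Measure.volume_eq_prod, integral_prod_symm]
    · simp only [integral_smul]
    · exact h.integrable_mul hχ.continuous hc

/-! ### Fourier analysis of the transport operator -/

lemma chr_re_toTorus (k : Fin 3 → ℤ) (x : V3) : (chr k (toTorus x)).re = Real.cos (ang k x) := by
  rw [chr_toTorus, Complex.exp_ofReal_mul_I_re]

lemma chr_im_toTorus (k : Fin 3 → ℤ) (x : V3) : (chr k (toTorus x)).im = Real.sin (ang k x) := by
  rw [chr_toTorus, Complex.exp_ofReal_mul_I_im]

lemma contDiff_ang (k : Fin 3 → ℤ) {n : WithTop ℕ∞} : ContDiff ℝ n (ang k) := by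
  unfold ang
  refine contDiff_const.mul (ContDiff.sum fun i _ => contDiff_const.mul ?_)
  exact (EuclideanSpace.proj (𝕜 := ℝ) i : V3 →L[ℝ] ℝ).contDiff

lemma hasCompactSupport_mul_velocity {η : Torus → ℝ} {χ : V3 → ℝ} (hc : HasCompactSupport χ) :
    HasCompactSupport fun z : Phase => η z.1 * χ z.2 := by
  refine HasCompactSupport.intro (isCompact_univ.prod hc) fun z hz => ?_
  have : χ z.2 = 0 := image_eq_zero_of_notMem_tsupport fun h => hz ⟨mem_univ _, h⟩
  rw [this, mul_zero]

lemma isTest_re (k : Fin 3 → ℤ) {χ : V3 → ℝ} (hχ : ContDiff ℝ ((⊤ : ℕ∞) : WithTop ℕ∞) χ)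
    (hc : HasCompactSupport χ) : IsTest fun z : Phase => (chr k z.1).re * χ z.2 where
  smooth := by
    simp only [chr_re_toTorus]
    exact (Real.contDiff_cos.comp ((contDiff_ang k).comp contDiff_fst)).mul (hχ.comp contDiff_snd)
  compact := hasCompactSupport_mul_velocity (η := fun x => (chr k x).re) hc

lemma isTest_im (k : Fin 3 → ℤ) {χ : V3 → ℝ} (hχ : ContDiff ℝ ((⊤ : ℕ∞) : WithTop ℕ∞) χ)
    (hc : HasCompactSupport χ) : IsTest fun z : Phase => (chr k z.1).im * χ z.2 where
  smooth := by
    simp only [chr_im_toTorus]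
    exact (Real.contDiff_sin.comp ((contDiff_ang k).comp contDiff_fst)).mul (hχ.comp contDiff_snd)
  compact := hasCompactSupport_mul_velocity (η := fun x => (chr k x).im) hc

lemma hasDerivAt_ang (k : Fin 3 → ℤ) (x v : V3) :
    HasDerivAt (fun s : ℝ => ang k (x + s • v)) (ang k v) 0 := by
  simp only [ang_add, ang_smul]
  simpa using ((hasDerivAt_id (0 : ℝ)).mul_const (ang k v)).const_add (ang k x)

lemma stream_re (k : Fin 3 → ℤ) (χ : V3 → ℝ) (z : Phase) :
    stream (fun z => (chr k z.1).re * χ z.2) z = -(ang k z.2 * (chr k z.1).im * χ z.2) := by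
  obtain ⟨x, v⟩ := z
  obtain ⟨x, rfl⟩ := toTorus_surjective x
  have h1 := ((hasDerivAt_ang k x v).cos).mul_const (χ v)
  have h2 := h1.deriv
  simp only [stream, ← toTorus_add, chr_re_toTorus, chr_im_toTorus]
  rw [h2, zero_smul, add_zero]
  ring

lemma stream_im (k : Fin 3 → ℤ) (χ : V3 → ℝ) (z : Phase) :
    stream (fun z => (chr k z.1).im * χ z.2) z = ang k z.2 * (chr k z.1).re * χ z.2 := by
  obtain ⟨x, v⟩ := z
  obtain ⟨x, rfl⟩ := toTorus_surjective x
  have h1 := ((hasDerivAt_ang k x v).sin).mul_const (χ v)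
  have h2 := h1.deriv
  simp only [stream, ← toTorus_add, chr_re_toTorus, chr_im_toTorus]
  rw [h2, zero_smul, add_zero]
  ring

lemma exists_ang_le (k : Fin 3 → ℤ) : ∃ C : ℝ, ∀ v, |ang k v| ≤ C * (1 + ‖v‖) := by
  refine ⟨2 * Real.pi * ∑ i, |(k i : ℝ)|, fun v => ?_⟩
  rw [ang, abs_mul, abs_of_pos (by positivity), mul_assoc (2 * Real.pi)]
  refine mul_le_mul_of_nonneg_left ?_ (by positivity)
  refine (Finset.abs_sum_le_sum_abs (fun i => (k i : ℝ) * v i) _).trans ?_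
  rw [Finset.sum_mul]
  refine Finset.sum_le_sum fun i _ => ?_
  rw [abs_mul]
  gcongr
  have := abs_apply_le_norm v i
  linarith

lemma continuous_ang (k : Fin 3 → ℤ) : Continuous (ang k) := (contDiff_ang (n := 0) k).continuous

/-- The equation `a = - v · ∂ₓ f - Q⁻[f]` for Fourier coefficients. -/
lemma IsA.fourier (h : Admissible f₀ g₀) {f a : L1Phase} (hA : IsA g₀ f a) (k : Fin 3 → ℤ) :
    ∀ᵐ v, ∫ x, ((a (x, v) + f (x, v) * collFreq g₀ v : ℝ) : ℂ) * chr k x -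
      (ang k v * Complex.I) * (f (x, v) * chr k x) = 0 := by
  obtain ⟨Ca, hCa⟩ := exists_ang_le k
  obtain ⟨Cf, hCf0, hCf⟩ := h.exists_collFreq_le
  have hfm := measurable_L1Phase f
  have ham := measurable_L1Phase a
  have hcf := h.measurable_collFreq
  have hang := (continuous_ang k).measurable
  have hchr : Measurable (chr k) := (chr k).continuous.measurable
  have hre : ∀ x, |(chr k x).re| ≤ 1 := fun x =>
    (Complex.abs_re_le_norm _).trans (norm_chr k x).le
  have him : ∀ x, |(chr k x).im| ≤ 1 := fun x =>
    (Complex.abs_im_le_norm _).trans (norm_chr k x).le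
  set u : Phase → ℝ := fun z => a z + f z * collFreq g₀ z.2 with hu
  set w : Phase → ℝ := fun z => f z * ang k z.2 with hw
  have hu1 : LocInt u := fun R => (locInt_L1 a R).add
    ((locInt_L1 f).mul (C := Cf) (by fun_prop) (fun z => by
      rw [abs_of_nonneg (h.collFreq_nonneg _)]; exact hCf z.2) R)
  have hw1 : LocInt w := (locInt_L1 f).mul (by fun_prop) fun z => hCa z.2
  have hmul1 : ∀ {ξ m : Phase → ℝ}, LocInt ξ → Measurable m → (∀ z, |m z| ≤ 1) →
      LocInt fun z => ξ z * m z := fun hξ hm h1 => hξ.mul (C := 1) hm fun z => by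
    have := norm_nonneg z.2
    linarith [h1 z]
  have huc := hmul1 hu1 (m := fun z => (chr k z.1).re) (by fun_prop) (fun z => hre _)
  have hus := hmul1 hu1 (m := fun z => (chr k z.1).im) (by fun_prop) (fun z => him _)
  have hwc := hmul1 hw1 (m := fun z => (chr k z.1).re) (by fun_prop) (fun z => hre _)
  have hws := hmul1 hw1 (m := fun z => (chr k z.1).im) (by fun_prop) (fun z => him _)
  set ξ : Phase → ℂ := fun z => (u z : ℂ) * chr k z.1 - (ang k z.2 * Complex.I) *
    (f z * chr k z.1) with hξ
  have hξre : ∀ z, (ξ z).re = u z * (chr k z.1).re + w z * (chr k z.1).im := by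
    intro z; simp [hξ, hw]; ring
  have hξim : ∀ z, (ξ z).im = u z * (chr k z.1).im - w z * (chr k z.1).re := by
    intro z; simp [hξ, hw]; ring
  have hξeq : ξ = fun z => ((u z * (chr k z.1).re + w z * (chr k z.1).im : ℝ) : ℂ) +
      ((u z * (chr k z.1).im - w z * (chr k z.1).re : ℝ) : ℂ) * Complex.I := by
    funext z
    rw [← hξre, ← hξim, Complex.re_add_im]
  have hξ1 : LocInt ξ := by
    intro R
    rw [hξeq]
    exact ((huc R).add (hws R)).ofReal.add (((hus R).sub (hwc R)).ofReal.mul_const _)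
  refine ae_integral_eq_zero hξ1 fun χ hχ hc => ?_
  have h_int := hξ1.integrable_mul hχ.continuous hc
  have iuc := huc.integrable_mul hχ.continuous hc
  have ius := hus.integrable_mul hχ.continuous hc
  have iwc := hwc.integrable_mul hχ.continuous hc
  have iws := hws.integrable_mul hχ.continuous hc
  -- Test functions are real, so the equation is tested with the real and imaginary parts of a
  -- character times a cutoff in v.
  have eA1 := hA _ (isTest_re k hχ hc)
  have eA2 := hA _ (isTest_im k hχ hc)
  simp only [stream_re, stream_im, lossTerm] at eA1 eA2
  refine Complex.ext ?_ ?_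
  · have e1 : (∫ z, χ z.2 • ξ z).re = ∫ z, (χ z.2 • ξ z).re :=
      (Complex.reCLM.integral_comp_comm h_int).symm
    rw [e1, Complex.zero_re]
    have e2 : ∀ z, (χ z.2 • ξ z).re = χ z.2 • (u z * (chr k z.1).re) +
        χ z.2 • (w z * (chr k z.1).im) := fun z => by
      rw [Complex.smul_re, hξre, smul_add]
    simp only [e2]
    rw [integral_add iuc iws, add_eq_zero_iff_eq_neg, ← integral_neg]
    rw [show (∫ z, χ z.2 • (u z * (chr k z.1).re)) =
      ∫ z, (a z + f z * collFreq g₀ z.2) * ((chr k z.1).re * χ z.2) from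
      integral_congr_ae (Eventually.of_forall fun z => by simp only [smul_eq_mul, hu]; ring), ← eA1]
    exact integral_congr_ae (Eventually.of_forall fun z => by simp only [smul_eq_mul, hw]; ring)
  · have e1 : (∫ z, χ z.2 • ξ z).im = ∫ z, (χ z.2 • ξ z).im :=
      (Complex.imCLM.integral_comp_comm h_int).symm
    rw [e1, Complex.zero_im]
    have e2 : ∀ z, (χ z.2 • ξ z).im = χ z.2 • (u z * (chr k z.1).im) -
        χ z.2 • (w z * (chr k z.1).re) := fun z => by
      rw [Complex.smul_im, hξim, smul_sub]
    simp only [e2]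
    rw [integral_sub ius iwc, sub_eq_zero]
    rw [show (∫ z, χ z.2 • (u z * (chr k z.1).im)) =
      ∫ z, (a z + f z * collFreq g₀ z.2) * ((chr k z.1).im * χ z.2) from
      integral_congr_ae (Eventually.of_forall fun z => by simp only [smul_eq_mul, hu]; ring), ← eA2]
    exact integral_congr_ae (Eventually.of_forall fun z => by simp only [smul_eq_mul, hw]; ring)

lemma L1T.ofReal_norm {p : Torus → ℝ} (hp : Integrable p) :
    ENNReal.ofReal ‖hp.toL1 p‖ = ∫⁻ x, ‖p x‖ₑ := by
  rw [Integrable.norm_toL1]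
  simp only [edist_zero_right]
  exact ENNReal.ofReal_toReal hp.2.ne

lemma pairing_toL1 (φ : C(Torus, ℂ)) {p : Torus → ℝ} (hp : Integrable p) :
    pairing φ (hp.toL1 p) = ∫ x, (p x : ℂ) * φ x := by
  rw [pairing_apply]
  refine integral_congr_ae ?_
  filter_upwards [hp.coeFn_toL1] with x hx
  rw [hx, Complex.real_smul]

lemma integrable_ofReal_mul_chr (k : Fin 3 → ℤ) {p : Torus → ℝ} (hp : Integrable p) :
    Integrable fun x => (p x : ℂ) * chr k x := by
  have h1 : Integrable fun x => (p x : ℂ) := hp.ofReal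
  exact h1.mul_bdd (c := 1) (chr k).continuous.aestronglyMeasurable
    (Eventually.of_forall fun x => (norm_chr k x).le)

lemma lintegral_phase_symm {F : Phase → ENNReal} (hF : Measurable F) :
    ∫⁻ z, F z = ∫⁻ v, ∫⁻ x, F (x, v) := by
  rw [Measure.volume_eq_prod, lintegral_prod_symm _ hF.aemeasurable]

/-- The resolvent estimate for `A`. -/
lemma IsA.resolvent (h : Admissible f₀ g₀) {f a : L1Phase} (hA : IsA g₀ f a) {l : ℝ} (hl : 0 < l) :
    ∫⁻ z, ENNReal.ofReal (l + collFreq g₀ z.2) * ‖f z‖ₑ ≤ ∫⁻ z, ‖l * f z - a z‖ₑ := by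
  have hfm := measurable_L1Phase f
  have ham := measurable_L1Phase a
  have hcf := h.measurable_collFreq
  have hfi : Integrable f ((volume : Measure Torus).prod (volume : Measure V3)) :=
    L1.integrable_coeFn f
  have hai : Integrable a ((volume : Measure Torus).prod (volume : Measure V3)) :=
    L1.integrable_coeFn a
  rw [lintegral_phase_symm (by fun_prop), lintegral_phase_symm (by fun_prop)]
  refine lintegral_mono_ae ?_
  have hF : ∀ᵐ v, ∀ k, _ := ae_all_iff.2 fun k => hA.fourier h k
  filter_upwards [hF, hfi.prod_left_ae, hai.prod_left_ae] with v hv hf ha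
  have hμ : 0 < l + collFreq g₀ v := by have := h.collFreq_nonneg v; linarith
  have hq : Integrable fun x => l * f (x, v) - a (x, v) := (hf.const_mul l).sub ha
  -- At fixed v the collision frequency is a constant on the torus, so l - A becomes transport with
  -- damping l + `collFreq g₀ v`.
  have key := resolvent_torus (p := hf.toL1 _) (q := hq.toL1 _) (v := v) hμ fun k => by
    rw [pairing_toL1, pairing_toL1]
    have i1 := integrable_ofReal_mul_chr k hf
    have i2 := integrable_ofReal_mul_chr k ha
    have e1 : ∫ x, ((l * f (x, v) - a (x, v) : ℝ) : ℂ) * chr k x =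
        l * (∫ x, (f (x, v) : ℂ) * chr k x) - ∫ x, (a (x, v) : ℂ) * chr k x := by
      rw [← integral_const_mul, ← integral_sub (i1.const_mul _) i2]
      refine integral_congr_ae (Eventually.of_forall fun x => ?_)
      simp only; push_cast; ring
    have e2 : ∫ x, ((a (x, v) + f (x, v) * collFreq g₀ v : ℝ) : ℂ) * chr k x -
        (ang k v * Complex.I) * (f (x, v) * chr k x) = (∫ x, (a (x, v) : ℂ) * chr k x) +
        (collFreq g₀ v - ang k v * Complex.I) * ∫ x, (f (x, v) : ℂ) * chr k x := by
      rw [← integral_const_mul, ← integral_add i2 (i1.const_mul _)]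
      refine integral_congr_ae (Eventually.of_forall fun x => ?_)
      simp only; push_cast; ring
    have e3 := hv k
    rw [e2] at e3
    rw [e1]
    push_cast
    linear_combination e3
  have h2 : ENNReal.ofReal (l + collFreq g₀ v) * ENNReal.ofReal ‖hf.toL1 _‖ ≤
      ENNReal.ofReal ‖hq.toL1 _‖ := by
    rw [← ENNReal.ofReal_mul hμ.le]; exact ENNReal.ofReal_le_ofReal key
  rw [L1T.ofReal_norm, L1T.ofReal_norm] at h2
  rwa [lintegral_const_mul _ (by fun_prop)]

/-! ### Uniqueness of mild solutions -/

lemma L1Phase.ofReal_norm (f : L1Phase) : ENNReal.ofReal ‖f‖ = ∫⁻ z, ‖f z‖ₑ := by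
  rw [L1.norm_def, ENNReal.ofReal_toReal]
  exact (L1.integrable_coeFn f).2.ne

/-- By duality with φ = 1, the gain of |f| has the same integral as its loss. -/
lemma IsB.lintegral_le (h : Admissible f₀ g₀) {f b : L1Phase} (hB : IsB g₀ f b) :
    ∫⁻ z, ‖b z‖ₑ ≤ ∫⁻ z, ENNReal.ofReal (collFreq g₀ z.2) * ‖f z‖ₑ := by
  have hfm := measurable_L1Phase f
  simp only [h.ofReal_collFreq, mul_comm (freq g₀ _)]
  rw [← h.lintegral_gainL_enorm hfm]
  refine lintegral_mono_ae ?_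
  filter_upwards [hB.1, hB.2] with z h1 h2
  have h1' : Integrable (gi g₀ f z) (surf.prod volume) := h1
  rw [h2, gainTerm_eq h1', ← lintegral_enorm_gi (measurable_L1V g₀) hfm]
  exact enorm_integral_le_lintegral_enorm _

/-- `A + B` is dissipative. -/
lemma dissipative (h : Admissible f₀ g₀) {f a b : L1Phase} (hA : IsA g₀ f a) (hB : IsB g₀ f b)
    {l : ℝ} (hl : 0 < l) : l * ‖f‖ ≤ ‖l • f - (a + b)‖ := by
  have hfm := measurable_L1Phase f
  have hcf := h.measurable_collFreq
  have h1 := hA.resolvent h hl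
  have h2 := hB.lintegral_le h
  set S := ∫⁻ z, ENNReal.ofReal (collFreq g₀ z.2) * ‖f z‖ₑ with hS
  have e1 : ∫⁻ z, ENNReal.ofReal (l + collFreq g₀ z.2) * ‖f z‖ₑ =
      ENNReal.ofReal (l * ‖f‖) + S := by
    rw [ENNReal.ofReal_mul hl.le, L1Phase.ofReal_norm, ← lintegral_const_mul _ (by fun_prop), hS,
      ← lintegral_add_left (by fun_prop)]
    refine lintegral_congr fun z => ?_
    rw [ENNReal.ofReal_add hl.le (h.collFreq_nonneg _), add_mul]
  have e2 : ∫⁻ z, ‖l * f z - a z‖ₑ = ENNReal.ofReal ‖l • f - a‖ := by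
    rw [L1Phase.ofReal_norm]
    refine lintegral_congr_ae ?_
    filter_upwards [Lp.coeFn_sub (l • f) a, Lp.coeFn_smul l f] with z hz1 hz2
    rw [hz1, Pi.sub_apply, hz2, Pi.smul_apply, smul_eq_mul]
  rw [e1, e2] at h1
  -- The resolvent estimate bounds the loss S by a finite norm. It can therefore be cancelled
  -- against the same bound for the gain.
  have hSfin : S ≠ ⊤ := (lt_of_le_of_lt (le_add_self.trans h1) ENNReal.ofReal_lt_top).ne
  have h3 : ENNReal.ofReal (l * ‖f‖) + S ≤ ENNReal.ofReal ‖l • f - (a + b)‖ + S := by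
    refine h1.trans ?_
    calc ENNReal.ofReal ‖l • f - a‖ ≤ ENNReal.ofReal (‖l • f - (a + b)‖ + ‖b‖) := by
          refine ENNReal.ofReal_le_ofReal ?_
          calc ‖l • f - a‖ = ‖(l • f - (a + b)) + b‖ := by congr 1; abel
            _ ≤ _ := norm_add_le _ _
      _ = ENNReal.ofReal ‖l • f - (a + b)‖ + ∫⁻ z, ‖b z‖ₑ := by
          rw [ENNReal.ofReal_add (norm_nonneg _) (norm_nonneg _), L1Phase.ofReal_norm b]
      _ ≤ _ := by gcongr
  exact (ENNReal.ofReal_le_ofReal_iff (norm_nonneg _)).1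
    (ENNReal.le_of_add_le_add_right hSfin h3)

/-- Linearity is clear once the loss term is integrable against a test function, whose bounded
velocity support bounds the collision frequency. -/
lemma IsA.sub (h : Admissible f₀ g₀) {f a f' a' : L1Phase} (hA : IsA g₀ f a) (hA' : IsA g₀ f' a') :
    IsA g₀ (f - f') (a - a') := by
  intro φ hφ
  obtain ⟨C, hC⟩ := hφ.exists_bound
  have hφc := hφ.continuous
  have hφm := hφc.measurable
  have hsm := hφ.continuous_stream
  obtain ⟨Cf, hCf0, hCf⟩ := h.exists_collFreq_le
  have hcf := h.measurable_collFreq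
  obtain ⟨R, hR⟩ := (hφ.compact.isCompact.image continuous_snd).isBounded.subset_closedBall (0 : V3)
  have hm : ∀ z, |collFreq g₀ z.2 * φ z| ≤ Cf * (1 + |R|) * C := by
    intro z
    have hC0 : 0 ≤ C := (abs_nonneg _).trans (hC z).1
    by_cases hz : z ∈ tsupport φ
    · have hz2 : ‖z.2‖ ≤ R := by simpa using hR (mem_image_of_mem _ hz)
      rw [abs_mul, abs_of_nonneg (h.collFreq_nonneg _)]
      have h0 := norm_nonneg z.2
      have := hCf z.2
      have h2 : Cf * (1 + ‖z.2‖) ≤ Cf * (1 + |R|) := by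
        gcongr; exact hz2.trans (le_abs_self R)
      exact mul_le_mul (this.trans h2) (hC z).1 (abs_nonneg _) (by positivity)
    · rw [image_eq_zero_of_notMem_tsupport hz, mul_zero, abs_zero]
      positivity
  have i1 : ∀ u : L1Phase, Integrable fun z => u z * stream φ z := fun u =>
    (L1.integrable_coeFn u).mul_bdd (c := C) hsm.aestronglyMeasurable
      (Eventually.of_forall fun z => (hC z).2)
  have i2 : ∀ u : L1Phase, Integrable fun z => u z * φ z := fun u =>
    (L1.integrable_coeFn u).mul_bdd (c := C) hφc.aestronglyMeasurable
      (Eventually.of_forall fun z => (hC z).1)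
  have i3 : ∀ u : L1Phase, Integrable fun z => u z * (collFreq g₀ z.2 * φ z) := fun u =>
    (L1.integrable_coeFn u).mul_bdd (c := Cf * (1 + |R|) * C)
      (by fun_prop : Measurable fun z : Phase => collFreq g₀ z.2 * φ z).aestronglyMeasurable (Eventually.of_forall hm)
  have i4 : ∀ u w : L1Phase, Integrable fun z => (w z + lossTerm g₀ u z) * φ z := fun u w => by
    refine ((i2 w).add (i3 u)).congr (Eventually.of_forall fun z => ?_)
    simp only [Pi.add_apply, lossTerm]; ring
  have e1 : ∫ z, (f - f' : L1Phase) z * stream φ z =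
      (∫ z, f z * stream φ z) - ∫ z, f' z * stream φ z := by
    rw [← integral_sub (i1 f) (i1 f')]
    refine integral_congr_ae ?_
    filter_upwards [Lp.coeFn_sub f f'] with z hz
    rw [hz, Pi.sub_apply, sub_mul]
  rw [e1, hA φ hφ, hA' φ hφ, ← integral_sub (i4 f a) (i4 f' a')]
  refine integral_congr_ae ?_
  filter_upwards [Lp.coeFn_sub f f', Lp.coeFn_sub a a'] with z hz hz2
  rw [hz2, lossTerm, lossTerm, lossTerm, hz, Pi.sub_apply, Pi.sub_apply]
  ring

lemma IsB.sub {f b f' b' : L1Phase} (hB : IsB g₀ f b) (hB' : IsB g₀ f' b') :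
    IsB g₀ (f - f') (b - b') := by
  have hg := measurable_L1V g₀
  have e := gi_congr (f := (f - f' : L1Phase)) (f' := fun z => f z - f' z) (measurable_L1Phase _)
    ((measurable_L1Phase f).sub (measurable_L1Phase f')) hg hg (Lp.coeFn_sub f f') (ae_eq_refl _)
  have e2 : ∀ z q, gi g₀ (fun z => f z - f' z) z q = gi g₀ f z q - gi g₀ f' z q := fun z q => by
    simp only [gi]; ring
  have hi : ∀ᵐ z, Integrable (gi g₀ (f - f' : L1Phase) z) (surf.prod volume) := by
    filter_upwards [e, hB.1, hB'.1] with z h1 h2 h3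
    refine (Integrable.sub (f := gi g₀ f z) (g := gi g₀ f' z) h2 h3).congr ?_
    filter_upwards [h1] with q hq
    rw [hq, e2]; rfl
  refine ⟨hi, ?_⟩
  filter_upwards [hi, e, hB.1, hB'.1, hB.2, hB'.2, Lp.coeFn_sub b b'] with z h1 h2 h3 h4 h5 h6 h7
  have h3' : Integrable (gi g₀ f z) (surf.prod volume) := h3
  have h4' : Integrable (gi g₀ f' z) (surf.prod volume) := h4
  rw [h7, Pi.sub_apply, h5, h6, gainTerm_eq h1, gainTerm_eq h3', gainTerm_eq h4',
    integral_congr_ae h2, ← integral_sub h3' h4']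
  simp only [e2]

/-- The time integral H of the difference w satisfies (A + B) H(t) = w(t) = H'(t). Dissipativity at
1 / s gives ‖H(t)‖ ≤ ‖H(t) - s w(t)‖, and the right side is ‖H(t - s)‖ up to o(s). So the norm of H
cannot grow from H(0) = 0, and then its derivative w vanishes. -/
theorem IsMildSolution.unique (h : Admissible f₀ g₀) {u₁ u₂ : ℝ → L1Phase}
    (h1 : IsMildSolution T g₀ f₀ u₁) (h2 : IsMildSolution T g₀ f₀ u₂) (hT : 0 < T) :
    ∀ t ∈ Icc 0 T, u₁ t = u₂ t := by
  set w : ℝ → L1Phase := fun t => u₁ t - u₂ t with hw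
  have hwc : ContinuousOn w (Icc 0 T) := h1.cont.sub h2.cont
  have hii : ∀ {u : ℝ → L1Phase}, ContinuousOn u (Icc 0 T) → ∀ r ∈ Icc 0 T, ∀ t ∈ Icc 0 T,
      IntervalIntegrable u volume r t := fun hu r hr t ht =>
    (hu.mono (uIcc_subset_Icc hr ht)).intervalIntegrable
  have h0 : (0 : ℝ) ∈ Icc 0 T := ⟨le_rfl, hT.le⟩
  set H : ℝ → L1Phase := fun t => ∫ θ in (0 : ℝ)..t, w θ with hH
  have hdis : ∀ t ∈ Icc 0 T, ∀ s : ℝ, 0 < s → ‖H t‖ ≤ ‖H t - s • w t‖ := by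
    intro t ht s hs
    obtain ⟨a₁, b₁, hA₁, hB₁, e₁⟩ := h1.eqn t ht
    obtain ⟨a₂, b₂, hA₂, hB₂, e₂⟩ := h2.eqn t ht
    have eH : H t = (∫ θ in (0 : ℝ)..t, u₁ θ) - ∫ θ in (0 : ℝ)..t, u₂ θ :=
      intervalIntegral.integral_sub (hii h1.cont 0 h0 t ht) (hii h2.cont 0 h0 t ht)
    have hA := hA₁.sub h hA₂
    have hB := hB₁.sub hB₂
    rw [← eH] at hA hB
    have hd := dissipative h hA hB (inv_pos.2 hs)
    have ew : (a₁ - a₂) + (b₁ - b₂) = w t := by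
      rw [show (a₁ - a₂) + (b₁ - b₂) = (a₁ + b₁) - (a₂ + b₂) by abel, e₁, e₂]
      exact sub_sub_sub_cancel_right _ _ _
    rw [ew] at hd
    have e3 : H t - s • w t = s • (s⁻¹ • H t - w t) := by
      rw [smul_sub s (s⁻¹ • H t), smul_smul, mul_inv_cancel₀ hs.ne', one_smul]
    rw [e3, norm_smul, Real.norm_of_nonneg hs.le]
    calc ‖H t‖ = s * (s⁻¹ * ‖H t‖) := by field_simp
      _ ≤ _ := by gcongr
  -- Differentiability of H with derivative w, uniformly in time, by uniform continuity of w. The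
  -- point c is free: it is the right endpoint in the Euler step, and the time in question at the
  -- end.
  have hbound : ∀ ε, 0 < ε → ∃ δ, 0 < δ ∧ ∀ r ∈ Icc 0 T, ∀ t ∈ Icc 0 T, r ≤ t → t - r ≤ δ →
      ∀ c ∈ Icc r t, ‖H t - H r - (t - r) • w c‖ ≤ (t - r) * ε := by
    intro ε hε
    have huc := isCompact_Icc.uniformContinuousOn_of_continuous hwc
    obtain ⟨δ, hδ, hδ2⟩ := Metric.uniformContinuousOn_iff_le.1 huc ε hε
    refine ⟨δ, hδ, fun r hr t ht hrt htr c hc => ?_⟩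
    have hcT : c ∈ Icc 0 T := ⟨hr.1.trans hc.1, hc.2.trans ht.2⟩
    have e1 : H t - H r = ∫ θ in r..t, w θ :=
      intervalIntegral.integral_interval_sub_left (hii hwc 0 h0 t ht) (hii hwc 0 h0 r hr)
    have e2 : H t - H r - (t - r) • w c = ∫ θ in r..t, (w θ - w c) := by
      rw [intervalIntegral.integral_sub (hii hwc r hr t ht) intervalIntegrable_const,
        intervalIntegral.integral_const, e1]
    rw [e2]
    refine (intervalIntegral.norm_integral_le_of_norm_le_const (C := ε) fun θ hθ => ?_).trans
      (le_of_eq (by rw [abs_of_nonneg (by linarith), mul_comm]))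
    rw [uIoc_of_le hrt] at hθ
    rw [← dist_eq_norm]
    refine hδ2 θ ⟨hr.1.trans hθ.1.le, hθ.2.trans ht.2⟩ c hcT ?_
    rw [Real.dist_eq, abs_le]
    constructor <;> linarith [hc.1, hc.2, hθ.1, hθ.2]
  have hH0 : ∀ t ∈ Icc 0 T, H t = 0 := by
    intro t ht
    refine norm_le_zero_iff.1 (le_of_forall_pos_le_add fun ε hε => ?_)
    obtain ⟨δ, hδ, hb⟩ := hbound (ε / T) (by positivity)
    obtain ⟨n, hn⟩ := exists_nat_gt (T / δ)
    have hn0 : (0 : ℝ) < n := lt_of_le_of_lt (by positivity) hn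
    -- Implicit Euler with steps t / n ≤ δ. Each step adds at most (t / n)(ε / T), so the total
    -- error up to T is at most ε.
    have hstep : ∀ j : ℕ, j ≤ n → ‖H (j * (t / n))‖ ≤ j * (t / n) * (ε / T) := by
      intro j
      induction j with
      | zero => intro _; simp [hH]
      | succ j ih =>
        intro hj
        have ih' := ih (by omega)
        have htn : 0 ≤ t / n := div_nonneg ht.1 hn0.le
        have hmem : ∀ i : ℕ, i ≤ n → (i : ℝ) * (t / n) ∈ Icc 0 T := by
          intro i hi
          refine ⟨by positivity, le_trans ?_ ht.2⟩
          calc (i : ℝ) * (t / n) ≤ n * (t / n) := by gcongr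
            _ = t := by field_simp
        have hr := hmem j (by omega)
        have ht' := hmem (j + 1) hj
        have hstep' : ((j + 1 : ℕ) : ℝ) * (t / n) - j * (t / n) = t / n := by push_cast; ring
        rcases htn.eq_or_lt with h00 | hpos
        · rw [← h00]; simp [hH]
        have h3 := hb _ hr _ ht' (by linarith) (by
          rw [hstep', div_le_iff₀ hn0]
          rw [div_lt_iff₀ hδ] at hn
          linarith [ht.2]) _ (right_mem_Icc.2 (by linarith))
        rw [hstep'] at h3
        have h4 := hdis _ ht' _ hpos
        calc ‖H ((j + 1 : ℕ) * (t / n))‖ ≤ _ := h4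
          _ = ‖(H ((j + 1 : ℕ) * (t / n)) - H (j * (t / n)) -
              (t / n) • w ((j + 1 : ℕ) * (t / n))) + H (j * (t / n))‖ := by congr 1; abel
          _ ≤ (t / n) * (ε / T) + j * (t / n) * (ε / T) :=
              (norm_add_le _ _).trans (add_le_add h3 ih')
          _ = _ := by push_cast; ring
    have h5 := hstep n le_rfl
    have e : (n : ℝ) * (t / n) = t := by field_simp
    rw [e] at h5
    calc ‖H t‖ ≤ t * (ε / T) := h5
      _ ≤ T * (ε / T) := by gcongr; exact ht.2
      _ = 0 + ε := by field_simp; ring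
  intro t ht
  have hwt : w t = 0 := by
    refine norm_le_zero_iff.1 (le_of_forall_pos_le_add fun ε hε => ?_)
    obtain ⟨δ, hδ, hb⟩ := hbound ε hε
    obtain ⟨r, s, hr, hs, hrs, hsr, htrs⟩ : ∃ r s, r ∈ Icc 0 T ∧ s ∈ Icc 0 T ∧ r < s ∧
        s - r ≤ δ ∧ t ∈ Icc r s := by
      rcases ht.1.eq_or_lt with h00 | hpos
      · refine ⟨0, min T δ, h0, ⟨by positivity, min_le_left _ _⟩, by positivity, ?_, ?_⟩
        · simp
        · rw [← h00]; exact ⟨le_rfl, by positivity⟩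
      · refine ⟨max 0 (t - δ), t, ⟨le_max_left _ _, max_le hT.le (by linarith [ht.2])⟩, ht,
          max_lt hpos (by linarith), ?_, max_le ht.1 (by linarith), le_rfl⟩
        have := le_max_right 0 (t - δ)
        linarith
    have h3 := hb r hr s hs hrs.le hsr t htrs
    rw [hH0 r hr, hH0 s hs, sub_zero, zero_sub, norm_neg, norm_smul,
      Real.norm_of_nonneg (by linarith)] at h3
    have := le_of_mul_le_mul_left h3 (by linarith)
    linarith
  exact sub_eq_zero.1 hwt

end Rayleigh

end

/-! ### Deterministic particle dynamics: the path of a regular history is the motion. -/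

noncomputable section

namespace Rayleigh

variable {n : ℕ}

/-! ### Regular collision histories -/

lemma exists_ext (Φ : Tree (n + 1)) : ∃ (Ψ : Tree n) (k : Coll), Φ = ext Ψ k :=
  ⟨par Φ, top Φ, (ext_par_top Φ).symm⟩

@[simp] lemma ext_fst (Φ : Tree n) (k : Coll) : (ext Φ k).1 = Φ.1 := rfl

@[simp] lemma ext_castSucc (Φ : Tree n) (k : Coll) (i : Fin n) : (ext Φ k).2 i.castSucc = Φ.2 i := by
  simp [ext]

@[simp] lemma ext_last (Φ : Tree n) (k : Coll) : (ext Φ k).2 (Fin.last n) = k := by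
  simp [ext]

/-- Collisions are separated in time, with positive collision rates and bounded relative
velocities. -/
def GoodT (γ : ℝ) : {n : ℕ} → Tree n → Prop
  | 0, _ => True
  -- The bound `γ ≤ (top Φ).1` is needed for the first collision, since the empty history has last
  -- time -1.
  | _ + 1, Φ => GoodT γ (par Φ) ∧ lastT (par Φ) + γ ≤ (top Φ).1 ∧ γ ≤ (top Φ).1 ∧
      0 < inner ℝ ((cur (par Φ)).2 - (top Φ).2.1) ((top Φ).2.2 : V3) ∧
      ‖(cur (par Φ)).2 - (top Φ).2.1‖ ≤ γ⁻¹

lemma goodT_ext {γ : ℝ} {Φ : Tree n} {k : Coll} : GoodT γ (ext Φ k) ↔ GoodT γ Φ ∧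
    lastT Φ + γ ≤ k.1 ∧ γ ≤ k.1 ∧ 0 < inner ℝ ((cur Φ).2 - k.2.1) (k.2.2 : V3) ∧
      ‖(cur Φ).2 - k.2.1‖ ≤ γ⁻¹ := by
  simp [GoodT]

lemma GoodT.anti {γ γ' : ℝ} (hγ : 0 < γ') (h : γ' ≤ γ) : ∀ {n : ℕ} {Φ : Tree n}, GoodT γ Φ →
    GoodT γ' Φ
  | 0, _, _ => trivial
  | n + 1, Φ, hΦ => by
    obtain ⟨h1, h2, h3, h4, h5⟩ := hΦ
    exact ⟨h1.anti hγ h, by linarith, by linarith, h4, h5.trans (inv_anti₀ hγ h)⟩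

lemma GoodT.time_le_lastT {γ : ℝ} (hγ : 0 < γ) : ∀ {n : ℕ} {Φ : Tree n}, GoodT γ Φ →
    ∀ i, (Φ.2 i).1 ≤ lastT Φ
  | 0, _, _, i => i.elim0
  | n + 1, Φ, h, i => by
    obtain ⟨Φ, k, rfl⟩ := exists_ext Φ
    rw [goodT_ext] at h
    rw [lastT_ext]
    refine Fin.lastCases ?_ (fun j => ?_) i
    · simp
    · rw [ext_castSucc]
      have := h.1.time_le_lastT hγ j
      linarith

lemma GoodT.time_ge {γ : ℝ} : ∀ {n : ℕ} {Φ : Tree n}, GoodT γ Φ → ∀ i, γ ≤ (Φ.2 i).1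
  | 0, _, _, i => i.elim0
  | n + 1, Φ, h, i => by
    obtain ⟨Φ, k, rfl⟩ := exists_ext Φ
    rw [goodT_ext] at h
    refine Fin.lastCases ?_ (fun j => ?_) i
    · rw [ext_last]; exact h.2.2.1
    · rw [ext_castSucc]; exact h.1.time_ge j

lemma GoodT.strictMono {γ : ℝ} (hγ : 0 < γ) : ∀ {n : ℕ} {Φ : Tree n}, GoodT γ Φ →
    StrictMono fun i => (Φ.2 i).1
  | 0, _, _ => fun i => i.elim0
  | n + 1, Φ, h => by
    obtain ⟨Φ, k, rfl⟩ := exists_ext Φ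
    rw [goodT_ext] at h
    intro i j hij
    induction i using Fin.lastCases with
    | last => exact absurd hij (not_lt.2 (Fin.le_last j))
    | cast i =>
      simp only [ext_castSucc]
      induction j using Fin.lastCases with
      | last =>
        rw [ext_last]
        have := h.1.time_le_lastT hγ i
        linarith
      | cast j =>
        rw [ext_castSucc]
        exact h.1.strictMono hγ (Fin.castSucc_lt_castSucc_iff.1 hij)

/-- The position of the `i`-th collision. -/
def pos (Φ : Tree n) (i : Fin n) : Torus := (path Φ (Φ.2 i).1).1

lemma pos_ext_castSucc {γ : ℝ} (hγ : 0 < γ) {Φ : Tree n} {k : Coll} (h : GoodT γ (ext Φ k))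
    (i : Fin n) : pos (ext Φ k) i.castSucc = pos Φ i := by
  rw [goodT_ext] at h
  have := h.1.time_le_lastT hγ i
  rw [pos, pos, ext_castSucc, path_ext, if_pos (by linarith)]

lemma pos_ext_last (Φ : Tree n) (k : Coll) :
    pos (ext Φ k) (Fin.last n) = (fl k.1 (cur Φ)).1 := by
  rw [pos, ext_last, path_ext, if_neg (lt_irrefl _), fl_stp]

/-- The motion near the `i`-th collision, with incoming velocity `v`. -/
structure LocalAt (γ : ℝ) (Φ : Tree n) (i : Fin n) (v : V3) : Prop where
  rate : 0 < inner ℝ (v - (Φ.2 i).2.1) ((Φ.2 i).2.2 : V3)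
  speed : ‖v - (Φ.2 i).2.1‖ ≤ γ⁻¹
  before : ∀ s, (Φ.2 i).1 - γ ≤ s → s < (Φ.2 i).1 →
    path Φ s = (pos Φ i + toTorus ((s - (Φ.2 i).1) • v), v)
  after : ∀ s, (Φ.2 i).1 ≤ s → s < (Φ.2 i).1 + γ →
    path Φ s = (pos Φ i + toTorus ((s - (Φ.2 i).1) • post v (Φ.2 i).2.1 (Φ.2 i).2.2),
      post v (Φ.2 i).2.1 (Φ.2 i).2.2)

lemma path_of_last_le {Φ : Tree n} {s : ℝ} (h : lastT Φ ≤ s) : path Φ s = fl s (cur Φ) := by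
  cases n with
  | zero => rfl
  | succ n => exact if_neg (not_lt.2 h)

lemma GoodT.exists_localAt {γ : ℝ} (hγ : 0 < γ) : ∀ {n : ℕ} {Φ : Tree n}, GoodT γ Φ →
    ∀ i, ∃ v, LocalAt γ Φ i v
  | 0, _, _, i => i.elim0
  | n + 1, Φ, h, i => by
    obtain ⟨Φ, k, rfl⟩ := exists_ext Φ
    have h' := goodT_ext.1 h
    induction i using Fin.lastCases with
    | last =>
      refine ⟨(cur Φ).2, ?_, ?_, fun s hs1 hs2 => ?_, fun s hs1 hs2 => ?_⟩
      · rw [ext_last]; exact h'.2.2.2.1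
      · rw [ext_last]; exact h'.2.2.2.2
      · rw [ext_last] at hs1 hs2 ⊢
        rw [pos_ext_last, path_ext, if_pos hs2, path_of_last_le (by linarith)]
        simp only [fl, sub_smul, toTorus_sub, Prod.mk.injEq, and_true]
        abel
      · rw [ext_last] at hs1 hs2 ⊢
        rw [pos_ext_last, path_ext, if_neg (not_lt.2 hs1)]
        simp only [fl, stp, sub_smul, toTorus_sub, Prod.mk.injEq, and_true]
        abel
    | cast i =>
      obtain ⟨v, hv⟩ := h'.1.exists_localAt hγ i
      have hle := h'.1.time_le_lastT hγ i
      have hp := pos_ext_castSucc hγ h i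
      refine ⟨v, ?_, ?_, fun s hs1 hs2 => ?_, fun s hs1 hs2 => ?_⟩
      · rw [ext_castSucc]; exact hv.rate
      · rw [ext_castSucc]; exact hv.speed
      · rw [ext_castSucc] at hs1 hs2 ⊢
        rw [hp, path_ext, if_pos (by linarith)]
        exact hv.before s hs1 hs2
      · rw [ext_castSucc] at hs1 hs2 ⊢
        rw [hp, path_ext, if_pos (by linarith)]
        exact hv.after s hs1 hs2

lemma path_zero {γ : ℝ} (hγ : 0 < γ) : ∀ {n : ℕ} {Φ : Tree n}, GoodT γ Φ → path Φ 0 = Φ.1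
  | 0, Φ, _ => fl_zero Φ.1
  | n + 1, Φ, h => by
    obtain ⟨Φ, k, rfl⟩ := exists_ext Φ
    have h' := goodT_ext.1 h
    rw [path_ext, if_pos (by linarith), path_zero hγ h'.1, ext_fst]

/-- Between collisions the motion is free. -/
lemma GoodT.free_flight {γ : ℝ} (hγ : 0 < γ) : ∀ {n : ℕ} {Φ : Tree n}, GoodT γ Φ →
    ∀ s t, s < t → (∀ i, (Φ.2 i).1 ∉ Ioo s t) →
      (∀ r ∈ Icc s t, (path Φ r).1 = (path Φ s).1 + toTorus ((r - s) • (path Φ s).2)) ∧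
      (∀ r ∈ Ico s t, (path Φ r).2 = (path Φ s).2)
  | 0, Φ, _, s, t, _, _ => by
    refine ⟨fun r _ => ?_, fun r _ => rfl⟩
    simp only [path, fl, sub_smul, toTorus_sub]
    abel
  | n + 1, Φ, h, s, t, hst, hC => by
    obtain ⟨Φ, k, rfl⟩ := exists_ext Φ
    have h' := goodT_ext.1 h
    have hk : k.1 ≤ s ∨ t ≤ k.1 := by
      have := hC (Fin.last n)
      rw [ext_last, mem_Ioo, not_and_or, not_lt, not_lt] at this
      exact this
    rcases hk with hk | hk
    · have e : ∀ r, s ≤ r → path (ext Φ k) r = fl r (stp (cur Φ) k) := fun r hr => by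
        rw [path_ext, if_neg (not_lt.2 (hk.trans hr))]
      refine ⟨fun r hr => ?_, fun r hr => ?_⟩
      · rw [e r hr.1, e s le_rfl]
        simp only [fl, sub_smul, toTorus_sub]
        abel
      · rw [e r hr.1, e s le_rfl]; rfl
    · have ih := h'.1.free_flight hγ s t hst (fun i hi => hC i.castSucc (by rwa [ext_castSucc]))
      have e : ∀ r, r < t → path (ext Φ k) r = path Φ r := fun r hr => by
        rw [path_ext, if_pos (hr.trans_le hk)]
      have et : (path (ext Φ k) t).1 = (path Φ t).1 := by
        rcases hk.lt_or_eq with hk | hk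
        · rw [path_ext, if_pos hk]
        · rw [hk, path_ext, if_neg (lt_irrefl _), fl_stp, path_of_last_le (by linarith)]
      refine ⟨fun r hr => ?_, fun r hr => ?_⟩
      · rw [e s hst]
        rcases hr.2.lt_or_eq with hr2 | hr2
        · rw [e r hr2]; exact ih.1 r hr
        · rw [hr2, et]; exact ih.1 t ⟨hst.le, le_rfl⟩
      · rw [e s hst, e r hr.2]; exact ih.2 r hr

lemma GoodT.continuous_pos {γ : ℝ} (hγ : 0 < γ) : ∀ {n : ℕ} {Φ : Tree n}, GoodT γ Φ →
    Continuous fun s => (path Φ s).1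
  | 0, Φ, _ => continuous_fst.comp (continuous_fl.comp (by fun_prop : Continuous fun s => (s, Φ.1)))
  | n + 1, Φ, h => by
    obtain ⟨Φ, k, rfl⟩ := exists_ext Φ
    have h' := goodT_ext.1 h
    have e : (fun s => (path (ext Φ k) s).1) =
        fun s => if k.1 ≤ s then (fl s (stp (cur Φ) k)).1 else (path Φ s).1 := by
      funext s
      rw [path_ext]
      by_cases hs : s < k.1
      · rw [if_pos hs, if_neg (not_le.2 hs)]
      · rw [if_neg hs, if_pos (not_lt.1 hs)]
    rw [e]
    refine Continuous.if_le ?_ (h'.1.continuous_pos hγ) continuous_const continuous_id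
      fun s hs => ?_
    · exact continuous_fst.comp (continuous_fl.comp
        (by fun_prop : Continuous fun s => (s, stp (cur Φ) k)))
    · rw [← show k.1 = s from hs, fl_stp, path_of_last_le (by linarith)]

/-! ### Background particles of a collision history -/

/-- The initial state of the background particle of the `i`-th collision, for diameter `ε`. -/
def bgi (ε : ℝ) (Φ : Tree n) (i : Fin n) : Phase :=
  (pos Φ i + toTorus (ε • ((Φ.2 i).2.2 : V3) - (Φ.2 i).1 • (Φ.2 i).2.1), (Φ.2 i).2.1)

lemma bgPos_bgi (ε : ℝ) (Φ : Tree n) (i : Fin n) (s : ℝ) : bgPos (bgi ε Φ i) s =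
    pos Φ i + toTorus (ε • ((Φ.2 i).2.2 : V3) + (s - (Φ.2 i).1) • (Φ.2 i).2.1) := by
  simp only [bgPos, bgi, toTorus_add, toTorus_sub, sub_smul]
  abel

/-- The distance of the tagged particle from the background particle of the `i`-th collision in
the limit of point particles. -/
def gap (Φ : Tree n) (i : Fin n) (s : ℝ) : ℝ :=
  torusDist (path Φ s).1 (pos Φ i + toTorus ((s - (Φ.2 i).1) • (Φ.2 i).2.1))

/-- The tagged particle takes over the normal component of w, while the background particle keeps w.
The relative velocity after the collision is thus tangent to the sphere of contact. -/
lemma inner_post_sub (v w : V3) (ν : S2) : inner ℝ (post v w ν - w) (ν : V3) = (0 : ℝ) := by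
  have h1 : inner ℝ (ν : V3) (ν : V3) = (1 : ℝ) := by
    rw [real_inner_self_eq_norm_sq, norm_S2]; norm_num
  rw [real_inner_comm, post]
  simp only [inner_sub_right, inner_smul_right, h1]; ring

lemma norm_post_sub_le (v w : V3) (ν : S2) : ‖post v w ν - w‖ ≤ ‖v - w‖ := by
  have e : v - w = (post v w ν - w) + (inner ℝ (ν : V3) (v - w)) • (ν : V3) := by
    simp only [post]; abel
  have h0 : inner ℝ (post v w ν - w) ((inner ℝ (ν : V3) (v - w)) • (ν : V3)) = (0 : ℝ) := by
    rw [inner_smul_right, inner_post_sub, mul_zero]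
  have h1 := norm_add_sq_eq_norm_sq_add_norm_sq_of_inner_eq_zero _ _ h0
  rw [← e] at h1
  nlinarith [norm_nonneg (post v w ν - w), norm_nonneg (v - w),
    norm_nonneg ((inner ℝ (ν : V3) (v - w)) • (ν : V3))]

/-- A nonzero velocity that points outward from a sphere, or is tangent to it, leaves the closed
ball at once. -/
lemma norm_lt_add_smul {a b : V3} {ε s : ℝ} (ha : ‖a‖ = 1) (hε : 0 < ε) (hs : 0 < s) (hb : b ≠ 0)
    (h : 0 ≤ inner ℝ b a) : ε < ‖ε • a + s • b‖ := by
  have h1 : ‖ε • a + s • b‖ ^ 2 = ε ^ 2 + 2 * (ε * s * inner ℝ b a) + s ^ 2 * ‖b‖ ^ 2 := by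
    rw [norm_add_sq_real, norm_smul, norm_smul, inner_smul_left, inner_smul_right, ha,
      Real.norm_of_nonneg hε.le, Real.norm_of_nonneg hs.le, real_inner_comm]
    simp; ring
  have h2 : 0 < s ^ 2 * ‖b‖ ^ 2 := by have := norm_pos_iff.2 hb; positivity
  have h3 : 0 ≤ ε * s * inner ℝ b a := by positivity
  nlinarith [norm_nonneg (ε • a + s • b)]

/-- Relative positions near a collision as images of explicit vectors. The shift x is 0 for point
particles and εν for particles of diameter ε. -/
lemma gap_local {γ : ℝ} {Φ : Tree n} {i : Fin n} {v : V3} (h : LocalAt γ Φ i v) {s : ℝ} (x : V3) :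
    (s < (Φ.2 i).1 → (Φ.2 i).1 - γ ≤ s → pos Φ i + toTorus (x + (s - (Φ.2 i).1) • (Φ.2 i).2.1) =
      (path Φ s).1 + toTorus (x + ((Φ.2 i).1 - s) • (v - (Φ.2 i).2.1))) ∧
    ((Φ.2 i).1 ≤ s → s < (Φ.2 i).1 + γ →
      (path Φ s).1 = pos Φ i + toTorus (x + (s - (Φ.2 i).1) • (Φ.2 i).2.1) +
        toTorus ((s - (Φ.2 i).1) • (post v (Φ.2 i).2.1 (Φ.2 i).2.2 - (Φ.2 i).2.1) - x)) := by
  refine ⟨fun h1 h2 => ?_, fun h1 h2 => ?_⟩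
  · rw [h.before s h2 h1]
    simp only [add_assoc, ← toTorus_add]
    congr 2
    module
  · rw [h.after s h1 h2]
    simp only [add_assoc, ← toTorus_add]
    congr 2
    module

/-- Away from the time of collision the particles are separated. -/
lemma GoodT.lt_dist_bgi {γ ε : ℝ} (hγ : 0 < γ) (hγ1 : γ ≤ 1) (hε : 0 < ε) (hεγ : ε < γ ^ 2 / 8)
    {Φ : Tree n} (h : GoodT γ Φ) {i : Fin n} {s : ℝ} (hs : s ≠ (Φ.2 i).1)
    (hgap : γ * |s - (Φ.2 i).1| ≤ gap Φ i s) :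
    ε < torusDist (path Φ s).1 (bgPos (bgi ε Φ i) s) := by
  obtain ⟨v, hv⟩ := h.exists_localAt hγ i
  have hpos : 0 < |s - (Φ.2 i).1| := abs_pos.2 (sub_ne_zero.2 hs)
  have hg0 : 0 < gap Φ i s := lt_of_lt_of_le (by positivity) hgap
  rw [bgPos_bgi]
  -- Far from the collision in time the gap of point particles exceeds 2ε, and the displacement εν
  -- costs at most ε. Otherwise |s - tᵢ| ≤ 2ε / γ, and since relative speeds are at most 1 / γ and ε
  -- < γ² / 8, the relative position is shorter than 1/2, so torus distances are Euclidean norms.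
  by_cases hfar : 2 * ε < γ * |s - (Φ.2 i).1|
  · have h1 := torusDist_triangle (path Φ s).1
      (pos Φ i + toTorus (ε • ((Φ.2 i).2.2 : V3) + (s - (Φ.2 i).1) • (Φ.2 i).2.1))
      (pos Φ i + toTorus ((s - (Φ.2 i).1) • (Φ.2 i).2.1))
    have h2 := torusDist_self_add_le (pos Φ i + toTorus ((s - (Φ.2 i).1) • (Φ.2 i).2.1))
      (ε • ((Φ.2 i).2.2 : V3))
    rw [norm_smul, norm_S2, mul_one, Real.norm_of_nonneg hε.le, add_assoc, ← toTorus_add,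
      add_comm ((s - (Φ.2 i).1) • (Φ.2 i).2.1), torusDist_comm] at h2
    have h3 : gap Φ i s ≤ torusDist (path Φ s).1 (pos Φ i + toTorus (ε • ((Φ.2 i).2.2 : V3) +
        (s - (Φ.2 i).1) • (Φ.2 i).2.1)) + ε := by
      unfold gap; linarith
    linarith
  · push Not at hfar
    have h8 : ε ≤ 1 / 8 := by nlinarith
    have hsg : |s - (Φ.2 i).1| * γ⁻¹ ≤ 2 * ε / γ ^ 2 := by
      rw [← div_eq_mul_inv, div_le_div_iff₀ hγ (by positivity)]
      nlinarith
    have h4 : 2 * ε / γ ^ 2 ≤ 1 / 4 := by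
      rw [div_le_iff₀ (by positivity)]; linarith
    have hsγ : |s - (Φ.2 i).1| < γ := by
      have : γ * |s - (Φ.2 i).1| < γ * γ := by nlinarith
      exact lt_of_mul_lt_mul_left this hγ.le
    have hnorm : ∀ (b : V3), ‖b‖ ≤ γ⁻¹ → ‖ε • ((Φ.2 i).2.2 : V3) + |s - (Φ.2 i).1| • b‖ ≤ 1 / 2 := by
      intro b hb
      refine (norm_add_le _ _).trans ?_
      rw [norm_smul, norm_smul, norm_S2, mul_one, Real.norm_of_nonneg hε.le, Real.norm_eq_abs,
        abs_abs]
      have : |s - (Φ.2 i).1| * ‖b‖ ≤ |s - (Φ.2 i).1| * γ⁻¹ := by gcongr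
      linarith
    rcases lt_or_gt_of_ne hs with hlt | hgt
    · have habs : |s - (Φ.2 i).1| = (Φ.2 i).1 - s := by rw [abs_of_neg (by linarith)]; ring
      rw [habs] at hsγ hnorm
      rw [((gap_local hv (s := s) _).1 hlt (by linarith)), torusDist_self_add _ (hnorm _ hv.speed)]
      refine norm_lt_add_smul (norm_S2 _) hε (by linarith) (fun h0 => ?_) hv.rate.le
      have := hv.rate
      rw [h0, inner_zero_left] at this
      exact lt_irrefl _ this
    · have habs : |s - (Φ.2 i).1| = s - (Φ.2 i).1 := abs_of_pos (by linarith)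
      have hb := (norm_post_sub_le v (Φ.2 i).2.1 (Φ.2 i).2.2).trans hv.speed
      rw [habs] at hsγ hnorm
      have key := (gap_local hv (s := s) (ε • ((Φ.2 i).2.2 : V3))).2 hgt.le (by linarith)
      have e : (s - (Φ.2 i).1) • (post v (Φ.2 i).2.1 (Φ.2 i).2.2 - (Φ.2 i).2.1) -
          ε • ((Φ.2 i).2.2 : V3) = -(ε • ((Φ.2 i).2.2 : V3) + (s - (Φ.2 i).1) •
            -(post v (Φ.2 i).2.1 (Φ.2 i).2.2 - (Φ.2 i).2.1)) := by module
      rw [key, e, torusDist_comm, torusDist_self_add _ (by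
        rw [norm_neg]; exact hnorm _ (by rwa [norm_neg])), norm_neg]
      -- If both particles had the same velocity after the collision, the gap would stay zero,
      -- against the assumed positive gap.
      refine norm_lt_add_smul (norm_S2 _) hε (by linarith) (fun h0 => hg0.ne' ?_) ?_
      · have key0 := (gap_local hv (s := s) 0).2 hgt.le (by linarith)
        rw [neg_eq_zero.1 h0] at key0
        simp only [zero_add, smul_zero, sub_zero, toTorus_zero, add_zero] at key0
        rw [gap, key0]
        simp [torusDist]
      · rw [inner_neg_left, inner_post_sub, neg_zero]

lemma torusDist_bgi {ε : ℝ} (hε : 0 < ε) (hε2 : ε ≤ 1 / 2) (Φ : Tree n) (i : Fin n) :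
    torusDist (path Φ (Φ.2 i).1).1 (bgPos (bgi ε Φ i) (Φ.2 i).1) = ε := by
  have hn : ‖ε • ((Φ.2 i).2.2 : V3)‖ = ε := by
    rw [norm_smul, norm_S2, mul_one, Real.norm_of_nonneg hε.le]
  rw [bgPos_bgi, sub_self, zero_smul, add_zero, ← pos, torusDist_self_add _ (by rwa [hn]), hn]

end Rayleigh

end

noncomputable section

namespace Rayleigh

variable {n : ℕ}

/-! ### Uniqueness of the particle dynamics -/

lemma exists_left_avoid (C : Finset ℝ) {a t : ℝ} (h : a < t) :
    ∃ s, a ≤ s ∧ s < t ∧ ∀ c ∈ C, c ∉ Ioo s t := by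
  have h1 : ((C : Set ℝ) \ {t})ᶜ ∈ 𝓝 t :=
    ((C.finite_toSet.subset sdiff_subset).isClosed.isOpen_compl).mem_nhds (by simp)
  obtain ⟨l, hl, hs⟩ := exists_Ioc_subset_of_mem_nhds h1 ⟨a, h⟩
  refine ⟨max l a, le_max_right _ _, max_lt hl h, fun c hc hc2 => ?_⟩
  exact hs ⟨(le_max_left _ _).trans_lt hc2.1, hc2.2.le⟩ ⟨hc, hc2.2.ne⟩

lemma exists_right_avoid (C : Finset ℝ) {t b : ℝ} (h : t < b) :
    ∃ s, t < s ∧ s ≤ b ∧ ∀ c ∈ C, c ∉ Ioo t s := by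
  have h1 : ((C : Set ℝ) \ {t})ᶜ ∈ 𝓝 t :=
    ((C.finite_toSet.subset sdiff_subset).isClosed.isOpen_compl).mem_nhds (by simp)
  obtain ⟨l, hl, hs⟩ := exists_Ico_subset_of_mem_nhds h1 ⟨b, h⟩
  refine ⟨min l b, lt_min hl h, min_le_right _ _, fun c hc hc2 => ?_⟩
  exact hs ⟨hc2.1.le, hc2.2.trans_le (min_le_left _ _)⟩ ⟨hc, hc2.1.ne'⟩

variable {T ε : ℝ} {N : ℕ} {ω : Config N}

lemma tendsto_of_eqOn_Ico {p : ℝ → V3} {s t : ℝ} {w : V3} (hst : s < t)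
    (h : ∀ r ∈ Ico s t, p r = w) : Tendsto p (𝓝[<] t) (𝓝 w) := by
  refine tendsto_nhds_of_eventually_eq ?_
  filter_upwards [Ico_mem_nhdsLT hst] with r hr using h r hr

/-- Position and left limit of the velocity at t are determined by the past. The velocity then
follows from the rule without contact or, if there is a contact, from the collision rule of any one
touching particle, applied to both motions. -/
lemma IsTrajectory.eq_of_eqOn_Ico {p q : ℝ → Phase} (hε : 0 < ε) (hp : IsTrajectory T ε ω p)
    (hq : IsTrajectory T ε ω q) {t : ℝ} (ht : t ∈ Ioc 0 T) (h : ∀ r ∈ Ico 0 t, p r = q r) :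
    p t = q t := by
  obtain ⟨C, hC⟩ := hp.free_flight
  obtain ⟨D, hD⟩ := hq.free_flight
  obtain ⟨s, h0s, hst, hav⟩ := exists_left_avoid (C ∪ D) ht.1
  have hp1 := hC s t h0s hst ht.2 fun c hc => hav c (Finset.mem_union_left _ hc)
  have hq1 := hD s t h0s hst ht.2 fun c hc => hav c (Finset.mem_union_right _ hc)
  have hs := h s ⟨h0s, hst⟩
  have hx : (p t).1 = (q t).1 := by
    rw [hp1.1 t ⟨hst.le, le_rfl⟩, hq1.1 t ⟨hst.le, le_rfl⟩, hs]
  have lp := tendsto_of_eqOn_Ico hst hp1.2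
  have lq := tendsto_of_eqOn_Ico hst hq1.2
  rw [← hs] at lq
  refine Prod.ext hx ?_
  by_cases hj : ∀ j, ε < torusDist (p t).1 (bgPos (ω.2 j) t)
  · rw [hp.no_contact t ht hj _ lp, hq.no_contact t ht (by rwa [← hx]) _ lq]
  · push Not at hj
    obtain ⟨j, hj⟩ := hj
    have hj := le_antisymm hj (hp.exclusion t ⟨ht.1.le, ht.2⟩ j)
    obtain ⟨a, ha, ha'⟩ := exists_lift_torusDist (bgPos (ω.2 j) t) (p t).1
    rw [torusDist_comm, hj] at ha'
    have e : ε • (ε⁻¹ • a) = a := by rw [smul_smul, mul_inv_cancel₀ hε.ne', one_smul]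
    have hν : ‖ε⁻¹ • a‖ = 1 := by
      rw [norm_smul, ha', norm_inv, Real.norm_of_nonneg hε.le, inv_mul_cancel₀ hε.ne']
    have hd : (p t).1 - bgPos (ω.2 j) t = toTorus (ε • (ε⁻¹ • a)) := by
      rw [e, ha, add_sub_cancel_left]
    rw [hp.contact t ht j _ hν hd _ lp, hq.contact t ht j _ hν (by rwa [← hx]) _ lq]

/-- The motion is determined by the initial configuration. -/
theorem IsTrajectory.unique {p q : ℝ → Phase} (hε : 0 < ε) (hp : IsTrajectory T ε ω p)
    (hq : IsTrajectory T ε ω q) : ∀ t ∈ Icc 0 T, p t = q t := by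
  by_contra hne
  push Not at hne
  set B := {t | t ∈ Icc 0 T ∧ p t ≠ q t} with hB
  have hBne : B.Nonempty := by obtain ⟨t, h1, h2⟩ := hne; exact ⟨t, h1, h2⟩
  have hBb : BddBelow B := ⟨0, fun t ht => ht.1.1⟩
  -- The infimum of the times of disagreement. The motions agree at t₀ itself, and both are free on
  -- a common short interval afterwards, a contradiction.
  set t₀ := sInf B with ht₀
  have h0 : 0 ≤ t₀ := le_csInf hBne fun t ht => ht.1.1
  have hbefore : ∀ r ∈ Ico 0 t₀, p r = q r := fun r hr => by
    by_contra h
    obtain ⟨t, ht⟩ := hBne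
    have := csInf_le hBb (show r ∈ B from ⟨⟨hr.1, hr.2.le.trans ((csInf_le hBb ht).trans ht.1.2)⟩, h⟩)
    exact absurd hr.2 (not_lt.2 this)
  have hT : t₀ ≤ T := by obtain ⟨t, ht⟩ := hBne; exact (csInf_le hBb ht).trans ht.1.2
  have heq : p t₀ = q t₀ := by
    rcases h0.eq_or_lt with h | h
    · rw [← h, hp.init, hq.init]
    · exact hp.eq_of_eqOn_Ico hε hq ⟨h, hT⟩ hbefore
  have hlt : t₀ < T := by
    refine lt_of_le_of_ne hT fun h => ?_
    obtain ⟨t, ht⟩ := hBne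
    have h2 : t₀ ≤ t := csInf_le hBb ht
    have h3 : t = t₀ := le_antisymm (by rw [h]; exact ht.1.2) h2
    exact ht.2 (h3 ▸ heq)
  obtain ⟨C, hC⟩ := hp.free_flight
  obtain ⟨D, hD⟩ := hq.free_flight
  obtain ⟨s, hst, hsT, hav⟩ := exists_right_avoid (C ∪ D) hlt
  have hp1 := hC t₀ s h0 hst hsT fun c hc => hav c (Finset.mem_union_left _ hc)
  have hq1 := hD t₀ s h0 hst hsT fun c hc => hav c (Finset.mem_union_right _ hc)
  have hge : s ≤ t₀ := by
    refine le_csInf hBne fun t ht => ?_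
    by_contra hts
    push Not at hts
    have h2 : t₀ ≤ t := csInf_le hBb ht
    refine ht.2 (Prod.ext ?_ ?_)
    · rw [hp1.1 t ⟨h2, hts.le⟩, hq1.1 t ⟨h2, hts.le⟩, heq]
    · rw [hp1.2 t ⟨h2, hts⟩, hq1.2 t ⟨h2, hts⟩, heq]
  exact absurd hst (not_lt.2 hge)

/-! ### Configurations that realize a collision history -/

/-- Apart from the collisions themselves the particles keep a distance, quantitatively. -/
def Sep (γ T : ℝ) (Φ : Tree n) : Prop :=
  ∀ i, ∀ s ∈ Icc 0 T, γ * |s - (Φ.2 i).1| ≤ gap Φ i s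

/-- In the configuration `ω` the background particles `ι i` are those of the history `Φ`, and the
other ones are not met. -/
structure Realizes (γ ε T : ℝ) (ω : Config N) (ι : Fin n → Fin N) (Φ : Tree n) : Prop where
  good : GoodT γ Φ
  sep : Sep γ T Φ
  time_le : ∀ i, (Φ.2 i).1 ≤ T
  fst : ω.1 = Φ.1
  bg : ∀ i, ω.2 (ι i) = bgi ε Φ i
  far : ∀ j ∉ range ι, ∀ s ∈ Icc 0 T, ε < torusDist (path Φ s).1 (bgPos (ω.2 j) s)

variable {γ : ℝ} {ι : Fin n → Fin N} {Φ : Tree n}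

/-- The contacts of the true particles are exactly the collisions recorded in the history, by
`GoodT.lt_dist_bgi` for the labelled particles and by `far` for the others. -/
lemma Realizes.contact_iff (hγ : 0 < γ) (hγ1 : γ ≤ 1) (hε : 0 < ε) (hεγ : ε < γ ^ 2 / 8)
    (h : Realizes γ ε T ω ι Φ) {s : ℝ} (hs : s ∈ Icc 0 T) (j : Fin N) :
    torusDist (path Φ s).1 (bgPos (ω.2 j) s) ≤ ε ↔ ∃ i, j = ι i ∧ s = (Φ.2 i).1 := by
  have hε2 : ε ≤ 1 / 2 := by nlinarith
  constructor
  · intro hd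
    by_cases hj : j ∈ range ι
    · obtain ⟨i, rfl⟩ := hj
      refine ⟨i, rfl, ?_⟩
      by_contra hne
      rw [h.bg] at hd
      exact absurd (h.good.lt_dist_bgi hγ hγ1 hε hεγ hne (h.sep i s hs)) (not_lt.2 hd)
    · exact absurd (h.far j hj s hs) (not_lt.2 hd)
  · rintro ⟨i, rfl, rfl⟩
    rw [h.bg, torusDist_bgi hε hε2]

lemma Realizes.le_torusDist (hγ : 0 < γ) (hγ1 : γ ≤ 1) (hε : 0 < ε) (hεγ : ε < γ ^ 2 / 8)
    (h : Realizes γ ε T ω ι Φ) {s : ℝ} (hs : s ∈ Icc 0 T) (j : Fin N) :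
    ε ≤ torusDist (path Φ s).1 (bgPos (ω.2 j) s) := by
  by_contra hlt
  push Not at hlt
  obtain ⟨i, rfl, rfl⟩ := (h.contact_iff hγ hγ1 hε hεγ hs j).1 hlt.le
  rw [h.bg, torusDist_bgi hε (by nlinarith)] at hlt
  exact lt_irrefl _ hlt

/-- The path of the collision history is the motion of the tagged particle. -/
theorem Realizes.isTrajectory (hγ : 0 < γ) (hγ1 : γ ≤ 1) (hε : 0 < ε) (hεγ : ε < γ ^ 2 / 8)
    (h : Realizes γ ε T ω ι Φ) : IsTrajectory T ε ω (path Φ) := by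
  have hε2 : ε < 1 / 2 := by nlinarith
  refine ⟨(path_zero hγ h.good).trans h.fst.symm, ?_,
    fun t ht j => h.le_torusDist hγ hγ1 hε hεγ ht j, fun t ht hj w hw => ?_,
    fun t ht j ν hν hd w hw => ?_⟩
  · refine ⟨Finset.univ.image fun i => (Φ.2 i).1, fun s t _ hst _ hC => ?_⟩
    exact h.good.free_flight hγ s t hst fun i => hC _ (Finset.mem_image_of_mem _ (Finset.mem_univ i))
  · have hni : ∀ i, (Φ.2 i).1 ≠ t := fun i hi => by
      have := (h.contact_iff hγ hγ1 hε hεγ ⟨ht.1.le, ht.2⟩ (ι i)).2 ⟨i, rfl, hi.symm⟩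
      exact absurd (hj (ι i)) (not_lt.2 this)
    obtain ⟨s, -, hst, hav⟩ := exists_left_avoid (Finset.univ.image fun i => (Φ.2 i).1)
      (show t - 1 < t by linarith)
    obtain ⟨s', hst', -, hav'⟩ := exists_right_avoid (Finset.univ.image fun i => (Φ.2 i).1)
      (show t < t + 1 by linarith)
    have hf := h.good.free_flight hγ s s' (hst.trans hst') fun i hi => by
      have h1 := hav _ (Finset.mem_image_of_mem (fun i => (Φ.2 i).1) (Finset.mem_univ i))
      have h2 := hav' _ (Finset.mem_image_of_mem (fun i => (Φ.2 i).1) (Finset.mem_univ i))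
      rcases lt_or_gt_of_ne (hni i) with h3 | h3
      · exact h1 ⟨hi.1, h3⟩
      · exact h2 ⟨h3, hi.2⟩
    have hl := tendsto_of_eqOn_Ico hst fun r hr => hf.2 r ⟨hr.1, hr.2.trans hst'⟩
    rw [tendsto_nhds_unique hw hl]
    exact hf.2 t ⟨hst.le, hst'⟩
  · have hn : ∀ a : V3, ‖a‖ = 1 → ‖ε • a‖ = ε := fun a ha => by
      rw [norm_smul, ha, mul_one, Real.norm_of_nonneg hε.le]
    have hdist : torusDist (path Φ t).1 (bgPos (ω.2 j) t) ≤ ε := by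
      rw [torusDist_sub, hd]
      exact (torusDist_toTorus_le _).trans (hn ν hν).le
    obtain ⟨i, rfl, rfl⟩ := (h.contact_iff hγ hγ1 hε hεγ ⟨ht.1.le, ht.2⟩ j).1 hdist
    -- The collision rule uses the direction towards the tagged particle, the history the opposite
    -- one. Vectors shorter than 1/2 are determined by their image in the torus, and the rule is
    -- even in ν.
    have hνi : ε • ν = ε • (-((Φ.2 i).2.2 : V3)) := by
      refine eq_of_toTorus_eq (by rwa [hn ν hν]) (by rwa [hn _ (by rw [norm_neg, norm_S2])]) ?_
      rw [← hd, h.bg, bgPos_bgi, sub_self, zero_smul, add_zero, ← pos, smul_neg, toTorus_neg]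
      abel
    have hνi' : ν = -((Φ.2 i).2.2 : V3) := smul_right_injective V3 hε.ne' hνi
    obtain ⟨v, hv⟩ := h.good.exists_localAt hγ i
    have hl : Tendsto (fun s => (path Φ s).2) (𝓝[<] (Φ.2 i).1) (𝓝 v) :=
      tendsto_of_eqOn_Ico (s := (Φ.2 i).1 - γ) (by linarith) fun r hr => by
        rw [hv.before r hr.1 hr.2]
    rw [tendsto_nhds_unique hw hl, hv.after _ le_rfl (by linarith), h.bg, hνi']
    simp [post, bgi]

/-- A configuration realizes at most one collision history. -/
theorem Realizes.unique (hγ : 0 < γ) (hγ1 : γ ≤ 1) (hε : 0 < ε) (hεγ : ε < γ ^ 2 / 8)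
    {n' : ℕ} {ι' : Fin n' → Fin N} {Φ' : Tree n'} (h : Realizes γ ε T ω ι Φ)
    (h' : Realizes γ ε T ω ι' Φ') :
    (⟨n, ι, Φ⟩ : Σ n, (Fin n → Fin N) × Tree n) = ⟨n', ι', Φ'⟩ := by
  have hε2 : ε < 1 / 2 := by nlinarith
  have hp := (h.isTrajectory hγ hγ1 hε hεγ).unique hε (h'.isTrajectory hγ hγ1 hε hεγ)
  have hmem : ∀ i, (Φ.2 i).1 ∈ Icc 0 T := fun i => ⟨hγ.le.trans (h.good.time_ge i), h.time_le i⟩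
  have hmem' : ∀ i, (Φ'.2 i).1 ∈ Icc 0 T := fun i =>
    ⟨hγ.le.trans (h'.good.time_ge i), h'.time_le i⟩
  -- Both paths are the unique motion of ω, so the times and labels of contacts can be read off from
  -- either. As times increase strictly, they fix the number and order of collisions.
  have h1 : ∀ i, ∃ i', ι i = ι' i' ∧ (Φ.2 i).1 = (Φ'.2 i').1 := fun i => by
    have := (h.contact_iff hγ hγ1 hε hεγ (hmem i) (ι i)).2 ⟨i, rfl, rfl⟩
    rw [hp _ (hmem i)] at this
    exact (h'.contact_iff hγ hγ1 hε hεγ (hmem i) (ι i)).1 this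
  have h2 : ∀ i', ∃ i, ι' i' = ι i ∧ (Φ'.2 i').1 = (Φ.2 i).1 := fun i => by
    have := (h'.contact_iff hγ hγ1 hε hεγ (hmem' i) (ι' i)).2 ⟨i, rfl, rfl⟩
    rw [← hp _ (hmem' i)] at this
    exact (h.contact_iff hγ hγ1 hε hεγ (hmem' i) (ι' i)).1 this
  have hr : range (fun i => (Φ.2 i).1) = range fun i => (Φ'.2 i).1 := by
    ext s
    constructor
    · rintro ⟨i, rfl⟩; obtain ⟨i', -, hi⟩ := h1 i; exact ⟨i', hi.symm⟩
    · rintro ⟨i, rfl⟩; obtain ⟨i', -, hi⟩ := h2 i; exact ⟨i', hi.symm⟩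
  have hm := h.good.strictMono hγ
  have hm' := h'.good.strictMono hγ
  obtain rfl : n = n' := by
    have e1 := Set.ncard_range_of_injective hm.injective
    have e2 := Set.ncard_range_of_injective hm'.injective
    rw [hr, e2] at e1
    simpa using e1.symm
  have ht := congrFun ((hm.range_inj hm').1 hr)
  have hι : ∀ i, ι i = ι' i := fun i => by
    obtain ⟨i', h3, h4⟩ := h1 i
    rw [ht i] at h4
    rw [h3, hm'.injective h4]
  -- The initial state of the particle gives its velocity w. Position and time of the collision are
  -- known, so the displacement εν is known modulo the lattice, and hence ν.
  have hk : ∀ i, Φ.2 i = Φ'.2 i := fun i => by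
    have hb : bgi ε Φ i = bgi ε Φ' i := by rw [← h.bg, ← h'.bg, hι]
    have hw : (Φ.2 i).2.1 = (Φ'.2 i).2.1 := congrArg Prod.snd hb
    have hpos : pos Φ i = pos Φ' i := by rw [pos, pos, hp _ (hmem i), ht i]
    have hν : toTorus (ε • ((Φ.2 i).2.2 : V3)) = toTorus (ε • ((Φ'.2 i).2.2 : V3)) := by
      have := congrArg Prod.fst hb
      simp only [bgi, hpos, hw, ht i, toTorus_sub] at this
      simpa using this
    have hn : ∀ a : S2, ‖ε • (a : V3)‖ < 1 / 2 := fun a => by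
      rwa [norm_smul, norm_S2, mul_one, Real.norm_of_nonneg hε.le]
    have := smul_right_injective V3 hε.ne' (eq_of_toTorus_eq (hn _) (hn _) hν)
    exact Prod.ext (ht i) (Prod.ext hw (Subtype.ext this))
  have hΦ : Φ = Φ' := Prod.ext (h.fst.symm.trans h'.fst) (funext hk)
  rw [hΦ, show ι = ι' from funext hι]

lemma Realizes.wellPosed (hγ : 0 < γ) (hγ1 : γ ≤ 1) (hε : 0 < ε) (hεγ : ε < γ ^ 2 / 8)
    (h : Realizes γ ε T ω ι Φ) : WellPosed T ε ω := ⟨_, h.isTrajectory hγ hγ1 hε hεγ⟩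

lemma Realizes.taggedState_eq (hγ : 0 < γ) (hγ1 : γ ≤ 1) (hε : 0 < ε) (hεγ : ε < γ ^ 2 / 8)
    (h : Realizes γ ε T ω ι Φ) {t : ℝ} (ht : t ∈ Icc 0 T) : taggedState T ε ω t = path Φ t := by
  have hw := h.wellPosed hγ hγ1 hε hεγ
  rw [taggedState, dif_pos hw]
  exact hw.choose_spec.unique hε (h.isTrajectory hγ hγ1 hε hεγ) t ht

end Rayleigh

end

/-! ### From histories to configurations: lower bounds for their probabilities. -/

noncomputable section

namespace Rayleigh

variable {n : ℕ} {γ T ε : ℝ}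

/-! ### Measurable regularity conditions -/

/-- It suffices to test continuous inequalities at rational points. The separation conditions thus
become countable, hence measurable. -/
lemma le_on_Icc_of_rat {f g : ℝ → ℝ} (hf : Continuous f) (hg : Continuous g)
    (h : ∀ q : ℚ, 0 ≤ q → q ≤ 1 → f q ≤ g q) {x : ℝ} (hx : x ∈ Icc (0 : ℝ) 1) : f x ≤ g x := by
  have hd : Dense (range ((↑) : ℚ → ℝ)) := Rat.denseRange_cast
  have h1 := hd.open_subset_closure_inter (isOpen_Ioo (a := (0 : ℝ)) (b := 1))
  have h2 : Icc (0 : ℝ) 1 ⊆ closure (Ioo 0 1 ∩ range ((↑) : ℚ → ℝ)) := by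
    rw [← closure_Ioo zero_ne_one]
    exact closure_minimal h1 isClosed_closure
  have h3 : closure (Ioo 0 1 ∩ range ((↑) : ℚ → ℝ)) ⊆ {x | f x ≤ g x} := by
    refine closure_minimal ?_ (isClosed_le hf hg)
    rintro _ ⟨hx, q, rfl⟩
    exact h q (by exact_mod_cast hx.1.le) (by exact_mod_cast hx.2.le)
  exact h3 (h2 hx)

lemma GoodT.continuous_gap (hγ : 0 < γ) {Φ : Tree n} (h : GoodT γ Φ) (i : Fin n) :
    Continuous (gap Φ i) := by
  have h1 := h.continuous_pos hγ
  have h2 := continuous_toTorus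
  unfold gap
  refine Continuous.torusDist h1 (continuous_const.add (h2.comp (by fun_prop)))

lemma measurable_gap (i : Fin n) : Measurable fun q : Tree n × ℝ => gap q.1 i q.2 := by
  have h1 := measurable_path (n := n)
  have h2 := measurable_toTorus
  have h3 : Measurable fun q : Tree n × ℝ => pos q.1 i := by
    unfold pos
    exact (h1.comp (by fun_prop : Measurable fun q : Tree n × ℝ => (q.1, (q.1.2 i).1))).fst
  unfold gap
  exact Measurable.torusDist h1.fst (h3.add (h2.comp (by fun_prop)))

lemma measurable_gap_comp (i : Fin n) {s : Tree n → ℝ} (hs : Measurable s) :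
    Measurable fun Φ : Tree n => gap Φ i (s Φ) := by
  have := (measurable_gap i).comp (measurable_id.prodMk hs)
  exact this

lemma measurableSet_goodT : ∀ {n : ℕ}, MeasurableSet {Φ : Tree n | GoodT γ Φ}
  | 0 => by simp [GoodT]
  | n + 1 => by
    have h1 := measurableSet_goodT (n := n)
    have h2 : MeasurableSet {Φ : Tree (n + 1) | GoodT γ (par Φ)} := measurable_par h1
    simp only [GoodT, ofPred_and]
    refine h2.inter (MeasurableSet.inter (measurableSet_le (by fun_prop) (by fun_prop))
      (MeasurableSet.inter (measurableSet_le (by fun_prop) (by fun_prop))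
      (MeasurableSet.inter (measurableSet_lt (by fun_prop) (by fun_prop))
        (measurableSet_le (by fun_prop) (by fun_prop)))))

/-- Until its collision, each background particle keeps a distance. -/
def Pre (γ : ℝ) (Φ : Tree n) : Prop := GoodT γ Φ ∧ ∀ i, ∀ q : ℚ, 0 ≤ q → q ≤ 1 →
  γ * ((Φ.2 i).1 - q * (Φ.2 i).1) ≤ gap Φ i (q * (Φ.2 i).1)

lemma measurableSet_pre : MeasurableSet {Φ : Tree n | Pre γ Φ} := by
  simp only [Pre, ofPred_and, ofPred_forall]
  refine measurableSet_goodT.inter ?_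
  refine MeasurableSet.iInter fun i => MeasurableSet.iInter fun q => MeasurableSet.iInter fun _ =>
    MeasurableSet.iInter fun _ => measurableSet_le (f := fun Φ : Tree n =>
      γ * ((Φ.2 i).1 - q * (Φ.2 i).1)) (g := fun Φ : Tree n => gap Φ i (q * (Φ.2 i).1))
      (by fun_prop) (measurable_gap_comp i (by fun_prop))

lemma Pre.gap_ge (hγ : 0 < γ) {Φ : Tree n} (h : Pre γ Φ) {i : Fin n} {s : ℝ} (hs : 0 ≤ s)
    (hs2 : s ≤ (Φ.2 i).1) : γ * ((Φ.2 i).1 - s) ≤ gap Φ i s := by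
  have ht : 0 < (Φ.2 i).1 := hγ.trans_le (h.1.time_ge i)
  have := le_on_Icc_of_rat (f := fun x => γ * ((Φ.2 i).1 - x * (Φ.2 i).1))
    (g := fun x => gap Φ i (x * (Φ.2 i).1)) (by fun_prop)
    ((h.1.continuous_gap hγ i).comp (by fun_prop)) (h.2 i) (x := s / (Φ.2 i).1)
    ⟨by positivity, (div_le_one ht).2 hs2⟩
  simpa only [div_mul_cancel₀ _ ht.ne'] using this

/-- Before the new collision the paths agree, so conditions on the past are inherited. `Sep` refers
to all of [0, T] and is not inherited, so the induction over collisions is run with `Pre`. -/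
lemma Pre.of_ext (hγ : 0 < γ) {Φ : Tree n} {k : Coll} (h : Pre γ (ext Φ k)) : Pre γ Φ := by
  have h1 := goodT_ext.1 h.1
  refine ⟨h1.1, fun i q hq hq1 => ?_⟩
  have h2 := h.2 i.castSucc q hq hq1
  have hq1' : (q : ℝ) ≤ 1 := by exact_mod_cast hq1
  have ht : (Φ.2 i).1 < k.1 := by have := h1.1.time_le_lastT hγ i; linarith
  have ht0 : 0 < (Φ.2 i).1 := hγ.trans_le (h1.1.time_ge i)
  rw [ext_castSucc] at h2
  rwa [gap, pos_ext_castSucc hγ h.1, ext_castSucc, path_ext, if_pos (by nlinarith), ← gap] at h2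

lemma sep_iff (hγ : 0 < γ) (hT : 0 < T) {Φ : Tree n} (h : GoodT γ Φ) : Sep γ T Φ ↔
    ∀ i, ∀ q : ℚ, 0 ≤ q → q ≤ 1 → γ * |q * T - (Φ.2 i).1| ≤ gap Φ i (q * T) := by
  constructor
  · intro hs i q hq hq1
    have hq' : (0 : ℝ) ≤ q := by exact_mod_cast hq
    have hq1' : (q : ℝ) ≤ 1 := by exact_mod_cast hq1
    exact hs i _ ⟨by positivity, by nlinarith⟩
  · intro hs i s hsT
    have := le_on_Icc_of_rat (f := fun x => γ * |x * T - (Φ.2 i).1|)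
      (g := fun x => gap Φ i (x * T)) (by fun_prop)
      ((h.continuous_gap hγ i).comp (by fun_prop)) (hs i) (x := s / T)
      ⟨div_nonneg hsT.1 hT.le, (div_le_one hT).2 hsT.2⟩
    simpa only [div_mul_cancel₀ _ hT.ne'] using this

lemma measurableSet_sep (hγ : 0 < γ) (hT : 0 < T) :
    MeasurableSet {Φ : Tree n | GoodT γ Φ ∧ Sep γ T Φ} := by
  have e : {Φ : Tree n | GoodT γ Φ ∧ Sep γ T Φ} = {Φ : Tree n | GoodT γ Φ ∧
      ∀ i, ∀ q : ℚ, 0 ≤ q → q ≤ 1 → γ * |q * T - (Φ.2 i).1| ≤ gap Φ i (q * T)} := by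
    ext Φ
    exact and_congr_right fun h => sep_iff hγ hT h
  rw [e]
  simp only [ofPred_and, ofPred_forall]
  refine measurableSet_goodT.inter ?_
  refine MeasurableSet.iInter fun i => MeasurableSet.iInter fun q => MeasurableSet.iInter fun _ =>
    MeasurableSet.iInter fun _ => measurableSet_le (f := fun Φ : Tree n =>
      γ * |q * T - (Φ.2 i).1|) (g := fun Φ : Tree n => gap Φ i (q * T)) ?_
      (measurable_gap_comp i (by fun_prop))
  have : Measurable fun Φ : Tree n => q * T - (Φ.2 i).1 := by fun_prop
  exact (this.abs).const_mul γ

lemma Sep.pre {Φ : Tree n} (hγ : 0 < γ) (h : GoodT γ Φ) (hT : ∀ i, (Φ.2 i).1 ≤ T)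
    (hs : Sep γ T Φ) : Pre γ Φ := by
  refine ⟨h, fun i q hq hq1 => ?_⟩
  have hq' : (0 : ℝ) ≤ q := by exact_mod_cast hq
  have hq1' : (q : ℝ) ≤ 1 := by exact_mod_cast hq1
  have ht0 : 0 < (Φ.2 i).1 := hγ.trans_le (h.time_ge i)
  have hle : q * (Φ.2 i).1 ≤ (Φ.2 i).1 := by nlinarith
  have := hs i (q * (Φ.2 i).1) ⟨by positivity, hle.trans (hT i)⟩
  rwa [abs_sub_comm, abs_of_nonneg (by linarith)] at this

end Rayleigh

end

noncomputable section

namespace Rayleigh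

variable {n : ℕ} {γ T ε : ℝ}

/-! ### Change of variables from collision histories to configurations -/

lemma lintegral_comp_toTorus_le {G : Set V3} (hG : MeasurableSet G) (hinj : InjOn toTorus G)
    {H : Torus → ENNReal} (hH : Measurable H) : ∫⁻ y in G, H (toTorus y) ≤ ∫⁻ x, H x := by
  rw [← lintegral_map hH measurable_toTorus]
  refine lintegral_mono' (Measure.le_iff.2 fun S hS => ?_) le_rfl
  rw [Measure.map_apply measurable_toTorus hS, Measure.restrict_apply (measurable_toTorus hS),
    inter_comm]
  exact volume_inter_preimage_toTorus_le hG hinj hS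

lemma bgi_ext_last (Φ : Tree n) (t : ℝ) (w : V3) (ν : S2) :
    bgi ε (ext Φ (t, w, ν)) (Fin.last n) =
      ((cur Φ).1 + toTorus (t • ((cur Φ).2 - w) + ε • (ν : V3)), w) := by
  rw [bgi, pos_ext_last, ext_last]
  simp only [fl, toTorus_add, toTorus_sub, smul_sub, Prod.mk.injEq, and_true]
  abel

lemma bgi_ext_castSucc (hγ : 0 < γ) {Φ : Tree n} {k : Coll} (h : GoodT γ (ext Φ k)) (i : Fin n) :
    bgi ε (ext Φ k) i.castSucc = bgi ε Φ i := by
  rw [bgi, bgi, pos_ext_castSucc hγ h, ext_castSucc]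

/-- The first contact determines the collision. -/
lemma Pre.first_contact (hγ : 0 < γ) (hγ1 : γ ≤ 1) (hε : 0 < ε) (hεγ : ε < γ ^ 2 / 8)
    {Φ : Tree n} {w : V3} {k k' : ℝ × S2} (h : Pre γ (ext Φ (k.1, w, k.2)))
    (h' : Pre γ (ext Φ (k'.1, w, k'.2)))
    (e : toTorus (k.1 • ((cur Φ).2 - w) + ε • (k.2 : V3)) =
      toTorus (k'.1 • ((cur Φ).2 - w) + ε • (k'.2 : V3))) : k = k' := by
  have hε2 : ε < 1 / 2 := by nlinarith
  -- Suppose one initial position led to contacts at times k.1 < k'.1. The paths agree before k.1,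
  -- where the first history has distance exactly ε, while the regularity of the second one requires
  -- more than ε.
  have key : ∀ k k' : ℝ × S2, Pre γ (ext Φ (k.1, w, k.2)) → Pre γ (ext Φ (k'.1, w, k'.2)) →
      toTorus (k.1 • ((cur Φ).2 - w) + ε • (k.2 : V3)) =
      toTorus (k'.1 • ((cur Φ).2 - w) + ε • (k'.2 : V3)) → ¬ k.1 < k'.1 := by
    intro k k' h h' e hlt
    have h1 := goodT_ext.1 h.1
    have ht0 : 0 ≤ k.1 := hγ.le.trans h1.2.2.1
    have h2 := h'.gap_ge hγ (i := Fin.last n) ht0 (by rw [ext_last]; exact hlt.le)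
    have h3 := h'.1.lt_dist_bgi hγ hγ1 hε hεγ (i := Fin.last n) (s := k.1)
      (by rw [ext_last]; exact hlt.ne) (by
        rwa [abs_sub_comm, abs_of_pos (by rw [ext_last]; exact sub_pos.2 hlt)])
    have h4 := torusDist_bgi hε hε2.le (ext Φ (k.1, w, k.2)) (Fin.last n)
    rw [bgi_ext_last, ext_last] at h4
    rw [bgi_ext_last, ← e] at h3
    have h5 : (path (ext Φ (k.1, w, k.2)) k.1).1 = (path (ext Φ (k'.1, w, k'.2)) k.1).1 := by
      rw [path_ext, path_ext, if_neg (lt_irrefl _), if_pos hlt,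
        path_of_last_le (by have := h1.2.1; simp only at this; linarith)]
      have := fl_stp (cur Φ) (k.1, w, k.2)
      simp only at this
      rw [this]
    rw [h5] at h4
    exact absurd h4 h3.ne'
  have ht : k.1 = k'.1 := le_antisymm (not_lt.1 (key k' k h' h e.symm)) (not_lt.1 (key k k' h h' e))
  have hn : ∀ a : S2, ‖ε • (a : V3)‖ < 1 / 2 := fun a => by
    rwa [norm_smul, norm_S2, mul_one, Real.norm_of_nonneg hε.le]
  rw [toTorus_add, toTorus_add, ht, add_right_inj] at e
  exact Prod.ext ht (Subtype.ext (smul_right_injective V3 hε.ne' (eq_of_toTorus_eq (hn _) (hn _) e)))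

/-- The measure of the positions of a background particle that will collide. -/
lemma lintegral_collision_le (hγ : 0 < γ) (hγ1 : γ ≤ 1) (hε : 0 < ε) (hεγ : ε < γ ^ 2 / 8)
    (Φ : Tree n) (w : V3) {H : Torus → ENNReal} (hH : Measurable H) :
    ENNReal.ofReal (ε ^ 2) * ∫⁻ t : ℝ, (∫⁻ ν : S2, rate (cur Φ).2 w ν *
      {k : ℝ × S2 | Pre γ (ext Φ (k.1, w, k.2))}.indicator (fun k => H ((cur Φ).1 +
        toTorus (k.1 • ((cur Φ).2 - w) + ε • (k.2 : V3)))) (t, ν) ∂surf) ≤ ∫⁻ x, H x := by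
  set u := (cur Φ).2 - w with hu
  set K := {k : ℝ × S2 | Pre γ (ext Φ (k.1, w, k.2))} with hK
  have hKm : MeasurableSet K := (by fun_prop : Measurable fun k : ℝ × S2 => ext Φ (k.1, w, k.2))
    measurableSet_pre
  by_cases hu0 : u = 0
  · have : ∀ ν : S2, rate (cur Φ).2 w ν = 0 := fun ν => by
      rw [rate, ← hu, hu0, inner_zero_left, ENNReal.ofReal_zero]
    simp [this]
  -- The flux formula turns ε² times the rate into volume in ℝ³. Injectivity modulo the lattice
  -- ensures that every position in the torus is counted once only.
  have hinj : InjOn (fun k : ℝ × S2 => toTorus (k.1 • u + ε • (k.2 : V3))) K :=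
    fun k hk k' hk' e => hk.first_contact hγ hγ1 hε hεγ hk' e
  have hjm : Measurable fun k : ℝ × S2 => k.1 • u + ε • (k.2 : V3) := by fun_prop
  set G := (fun k : ℝ × S2 => k.1 • u + ε • (k.2 : V3)) '' K with hG
  have hGm : MeasurableSet G := hKm.image_of_measurable_injOn hjm
    fun k hk k' hk' e => hinj hk hk' (congrArg toTorus e)
  have hGinj : InjOn toTorus G := by
    rintro _ ⟨k, hk, rfl⟩ _ ⟨k', hk', rfl⟩ e
    rw [hinj hk hk' e]
  set H' : Torus → ENNReal := fun x => H ((cur Φ).1 + x) with hH'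
  have hH'm : Measurable H' := hH.comp (by fun_prop)
  set F : V3 → ENNReal := G.indicator fun y => H' (toTorus y) with hF
  have hFm : Measurable F := (hH'm.comp measurable_toTorus).indicator hGm
  have hc := lintegral_cylinder hu0 hε hFm
  have hm : Measurable fun q : ℝ × S2 => ENNReal.ofReal (ε ^ 2 * max (inner ℝ u (q.2 : V3)) 0) *
      F (q.1 • u + ε • (q.2 : V3)) := by fun_prop
  calc _ = ∫⁻ t : ℝ, (∫⁻ ν : S2, ENNReal.ofReal (ε ^ 2) * (rate (cur Φ).2 w ν *
      K.indicator (fun k => H' (toTorus (k.1 • u + ε • (k.2 : V3)))) (t, ν)) ∂surf) := by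
        rw [← lintegral_const_mul']
        · refine lintegral_congr fun t => ?_
          rw [← lintegral_const_mul' _ _ ENNReal.ofReal_ne_top]
        · exact ENNReal.ofReal_ne_top
    _ ≤ ∫⁻ t : ℝ, (∫⁻ ν : S2, ENNReal.ofReal (ε ^ 2 * max (inner ℝ u (ν : V3)) 0) *
      F (t • u + ε • (ν : V3)) ∂surf) := by
        refine lintegral_mono fun t => lintegral_mono fun ν => ?_
        simp only
        by_cases hk : (t, ν) ∈ K
        · have hg : t • u + ε • (ν : V3) ∈ G := ⟨(t, ν), hk, rfl⟩
          rw [indicator_of_mem hk, hF, indicator_of_mem hg, ← mul_assoc, rate,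
            ← ENNReal.ofReal_mul (by positivity)]
          refine mul_le_mul' (ENNReal.ofReal_le_ofReal ?_) le_rfl
          exact mul_le_mul_of_nonneg_left (le_max_left _ _) (by positivity)
        · rw [indicator_of_notMem hk]; simp
    _ = ∫⁻ ν : S2, (∫⁻ t : ℝ, ENNReal.ofReal (ε ^ 2 * max (inner ℝ u (ν : V3)) 0) *
      F (t • u + ε • (ν : V3))) ∂surf := lintegral_lintegral_swap (f := fun (t : ℝ) (ν : S2) =>
        ENNReal.ofReal (ε ^ 2 * max (inner ℝ u (ν : V3)) 0) * F (t • u + ε • (ν : V3)))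
        hm.aemeasurable
    _ ≤ ∫⁻ y, F y := by rw [hc]; exact setLIntegral_le_lintegral _ _
    _ = ∫⁻ y in G, H' (toTorus y) := lintegral_indicator hGm _
    _ ≤ ∫⁻ x, H' x := lintegral_comp_toTorus_le hGm hGinj hH'm
    _ = ∫⁻ x, H x := lintegral_add_left_eq_self H (cur Φ).1

/-- The initial law of a background particle. -/
def bm (g₀ : L1V) : Measure Phase := (volume : Measure Torus).prod (gam g₀)

instance (g₀ : L1V) : IsFiniteMeasure (bm g₀) := by unfold bm; infer_instance

variable {f₀ : L1Phase} {g₀ : L1V}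

lemma initialLaw_eq (N : ℕ) : initialLaw f₀ g₀ N =
    (mu0 f₀).prod (Measure.pi fun _ : Fin N => bm g₀) := rfl

@[fun_prop]
lemma measurable_snoc {α : Type*} [MeasurableSpace α] {a : α → Fin n → Phase} {b : α → Phase}
    (ha : Measurable a) (hb : Measurable b) :
    Measurable fun x => (Fin.snoc (α := fun _ => Phase) (a x) (b x) : Fin (n + 1) → Phase) := by
  refine measurable_pi_lambda _ fun i => ?_
  refine Fin.lastCases ?_ (fun j => ?_) i
  · simpa using hb
  · simp only [Fin.snoc_castSucc]; fun_prop

lemma lintegral_pi_succ {F : (Fin (n + 1) → Phase) → ENNReal} (hF : Measurable F) :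
    ∫⁻ ω, F ω ∂(Measure.pi fun _ : Fin (n + 1) => bm g₀) =
      ∫⁻ ω, (∫⁻ b, F (Fin.snoc (α := fun _ => Phase) ω b) ∂bm g₀)
        ∂(Measure.pi fun _ : Fin n => bm g₀) := by
  have h := measurePreserving_piFinSuccAbove (fun _ : Fin (n + 1) => bm g₀) (Fin.last n)
  have h2 := h.symm.lintegral_comp hF
  rw [← h2, lintegral_prod_symm]
  · refine lintegral_congr fun ω => lintegral_congr fun b => ?_
    congr 1
    exact Fin.insertNth_last' b ω
  · exact (hF.comp (MeasurableEquiv.measurable _)).aemeasurable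

lemma lintegral_initialLaw_succ {F : Config (n + 1) → ENNReal} (hF : Measurable F) :
    ∫⁻ ω, F ω ∂initialLaw f₀ g₀ (n + 1) =
      ∫⁻ ω, (∫⁻ b, F (ω.1, Fin.snoc (α := fun _ => Phase) ω.2 b) ∂bm g₀) ∂initialLaw f₀ g₀ n := by
  have hm : Measurable fun ω : Config n =>
      ∫⁻ b, F (ω.1, Fin.snoc (α := fun _ => Phase) ω.2 b) ∂bm g₀ :=
    Measurable.lintegral_prod_right' (f := fun q : Config n × Phase =>
      F (q.1.1, Fin.snoc (α := fun _ => Phase) q.1.2 q.2)) (by fun_prop)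
  rw [initialLaw_eq, initialLaw_eq, lintegral_prod _ hF.aemeasurable,
    lintegral_prod _ hm.aemeasurable]
  refine lintegral_congr fun z => ?_
  exact lintegral_pi_succ (F := fun ω => F (z, ω)) (by fun_prop)

/-- The configuration of the particles of a collision history. -/
def conf (ε : ℝ) (Φ : Tree n) : Config n := (Φ.1, bgi ε Φ)

@[fun_prop]
lemma measurable_conf : Measurable (conf ε : Tree n → Config n) := by
  have h1 := measurable_path (n := n)
  have h2 := measurable_toTorus
  refine measurable_fst.prodMk (measurable_pi_lambda _ fun i => Measurable.prodMk ?_ (by fun_prop))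
  refine Measurable.add ?_ (h2.comp (by fun_prop))
  exact (h1.comp (by fun_prop : Measurable fun Φ : Tree n => (Φ, (Φ.2 i).1))).fst

lemma conf_ext (hγ : 0 < γ) {Φ : Tree n} {t : ℝ} {w : V3} {ν : S2} (h : GoodT γ (ext Φ (t, w, ν))) :
    conf ε (ext Φ (t, w, ν)) = (Φ.1, Fin.snoc (α := fun _ => Phase) (bgi ε Φ)
      ((cur Φ).1 + toTorus (t • ((cur Φ).2 - w) + ε • (ν : V3)), w)) := by
  refine Prod.ext rfl (funext fun i => ?_)
  induction i using Fin.lastCases with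
  | last => simp [conf, bgi_ext_last]
  | cast i => simp [conf, bgi_ext_castSucc hγ h]

/-- The law of the configuration dominates that of the collision history. -/
theorem lintegral_conf_le (hγ : 0 < γ) (hγ1 : γ ≤ 1) (hε : 0 < ε) (hεγ : ε < γ ^ 2 / 8) :
    ∀ {n : ℕ} {F : Config n → ENNReal}, Measurable F → ENNReal.ofReal (ε ^ 2) ^ n *
      ∫⁻ Φ, {Φ | Pre γ Φ}.indicator (fun Φ => F (conf ε Φ)) Φ ∂tau T f₀ g₀ n ≤
      ∫⁻ ω, F ω ∂initialLaw f₀ g₀ n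
  | 0, F, hF => by
    rw [pow_zero, one_mul]
    refine (lintegral_mono (indicator_le_self _ _)).trans ?_
    rw [lintegral_tau_zero (by fun_prop), initialLaw_eq, lintegral_prod _ hF.aemeasurable]
    refine lintegral_mono fun z => ?_
    rw [Measure.pi_of_empty (fun _ : Fin 0 => bm g₀) (bgi ε (z, Fin.elim0)),
      lintegral_dirac' _ (by fun_prop)]
    exact le_rfl
  | n + 1, F, hF => by
    -- Integrating out the last particle reduces the claim to n collisions; given the earlier
    -- history and w, `lintegral_collision_le` compares the last one.
    set F' : Config n → ENNReal :=
      fun ω => ∫⁻ b, F (ω.1, Fin.snoc (α := fun _ => Phase) ω.2 b) ∂bm g₀ with hF'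
    have hF'm : Measurable F' :=
      Measurable.lintegral_prod_right' (f := fun q : Config n × Phase =>
        F (q.1.1, Fin.snoc (α := fun _ => Phase) q.1.2 q.2)) (by fun_prop)
    have ih := lintegral_conf_le hγ hγ1 hε hεγ (n := n) hF'm
    rw [lintegral_initialLaw_succ hF]
    refine le_trans ?_ ih
    have hm1 : Measurable ({Φ : Tree (n + 1) | Pre γ Φ}.indicator fun Φ => F (conf ε Φ)) :=
      Measurable.indicator (by fun_prop) measurableSet_pre
    have hm2 : Measurable fun q : Tree n × Coll => wt q.1 q.2 *
        {Φ : Tree (n + 1) | Pre γ Φ}.indicator (fun Φ => F (conf ε Φ)) (ext q.1 q.2) :=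
      measurable_wt.mul (hm1.comp (by fun_prop))
    rw [pow_succ, mul_assoc, lintegral_tau_succ hm1, lintegral_prod _ hm2.aemeasurable]
    refine mul_le_mul' le_rfl ?_
    rw [← lintegral_const_mul' _ _ ENNReal.ofReal_ne_top]
    refine lintegral_mono fun Φ => ?_
    simp only
    by_cases hΦ : Pre γ Φ
    swap
    · have : ∀ k, {Φ : Tree (n + 1) | Pre γ Φ}.indicator (fun Φ => F (conf ε Φ)) (ext Φ k) = 0 :=
        fun k => indicator_of_notMem (fun h => hΦ (Pre.of_ext hγ (mem_ofPred_eq ▸ h))) _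
      simp [this]
    rw [indicator_of_mem (show Φ ∈ {Φ | Pre γ Φ} from hΦ)]
    have hm3 : Measurable fun k : Coll => wt Φ k *
        {Φ : Tree (n + 1) | Pre γ Φ}.indicator (fun Φ => F (conf ε Φ)) (ext Φ k) :=
      hm2.comp (by fun_prop : Measurable fun k : Coll => (Φ, k))
    have hm4 : Measurable fun q : (ℝ × V3) × S2 => wt Φ (q.1.1, q.1.2, q.2) *
        {Φ : Tree (n + 1) | Pre γ Φ}.indicator (fun Φ => F (conf ε Φ)) (ext Φ (q.1.1, q.1.2, q.2)) :=
      hm3.comp (by fun_prop : Measurable fun q : (ℝ × V3) × S2 => (q.1.1, q.1.2, q.2))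
    have hm5 : Measurable fun q : ℝ × V3 => ∫⁻ ν, wt Φ (q.1, q.2, ν) *
        {Φ : Tree (n + 1) | Pre γ Φ}.indicator (fun Φ => F (conf ε Φ)) (ext Φ (q.1, q.2, ν)) ∂surf :=
      Measurable.lintegral_prod_right' hm4
    have hb : Measurable fun b => F (Φ.1, Fin.snoc (α := fun _ => Phase) (bgi ε Φ) b) := by fun_prop
    have e1 : ∫⁻ k, wt Φ k * {Φ : Tree (n + 1) | Pre γ Φ}.indicator (fun Φ => F (conf ε Φ))
        (ext Φ k) ∂rho T g₀ = ∫⁻ w, (∫⁻ t in Ioc 0 T, (∫⁻ ν, wt Φ (t, w, ν) *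
        {Φ : Tree (n + 1) | Pre γ Φ}.indicator (fun Φ => F (conf ε Φ)) (ext Φ (t, w, ν)) ∂surf))
          ∂gam g₀ := by
      rw [rho, lintegral_prod _ hm3.aemeasurable]
      refine Eq.trans (lintegral_congr fun t => ?_) (lintegral_lintegral_swap
        (f := fun (t : ℝ) (w : V3) => ∫⁻ ν, wt Φ (t, w, ν) * {Φ : Tree (n + 1) | Pre γ Φ}.indicator
          (fun Φ => F (conf ε Φ)) (ext Φ (t, w, ν)) ∂surf) hm5.aemeasurable)
      rw [lintegral_prod]
      exact (hm3.comp (by fun_prop : Measurable fun p : V3 × S2 => (t, p))).aemeasurable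
    have e2 : F' (conf ε Φ) = ∫⁻ w, (∫⁻ x, F (Φ.1, Fin.snoc (α := fun _ => Phase) (bgi ε Φ) (x, w)))
        ∂gam g₀ := by
      show ∫⁻ b, F (Φ.1, Fin.snoc (α := fun _ => Phase) (bgi ε Φ) b) ∂bm g₀ = _
      rw [bm, lintegral_prod_symm _ hb.aemeasurable]
    rw [e1, e2, ← lintegral_const_mul' _ _ ENNReal.ofReal_ne_top]
    refine lintegral_mono fun w => ?_
    refine le_trans (mul_le_mul' le_rfl ((setLIntegral_le_lintegral _ _).trans
      (lintegral_mono fun t => lintegral_mono fun ν => ?_)))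
      (lintegral_collision_le hγ hγ1 hε hεγ Φ w
        (H := fun x => F (Φ.1, Fin.snoc (α := fun _ => Phase) (bgi ε Φ) (x, w))) (by fun_prop))
    simp only
    refine mul_le_mul' ?_ ?_
    · unfold wt; split_ifs
      · exact le_rfl
      · exact zero_le
    · by_cases hk : Pre γ (ext Φ (t, w, ν))
      · rw [indicator_of_mem (show ext Φ (t, w, ν) ∈ {Φ : Tree (n + 1) | Pre γ Φ} from hk),
          indicator_of_mem (show (t, ν) ∈ {k : ℝ × S2 | Pre γ (ext Φ (k.1, w, k.2))} from hk),
          conf_ext hγ hk.1]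
      · rw [indicator_of_notMem (show ext Φ (t, w, ν) ∉ {Φ : Tree (n + 1) | Pre γ Φ} from hk)]
        exact zero_le

end Rayleigh

end

noncomputable section

namespace Rayleigh

variable {n : ℕ} {γ T ε : ℝ} {f₀ : L1Phase} {g₀ : L1V}

/-! ### Background particles that are not met -/

/-- The points that are met by a ball of radius `ε` moving with velocity `u`. -/
def tube (ε : ℝ) (u : V3) (a b : ℝ) : Set V3 := {y | ∃ s ∈ Icc a b, ‖y - s • u‖ < ε}

lemma isOpen_tube (u : V3) (a b : ℝ) : IsOpen (tube ε u a b) := by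
  have : tube ε u a b = ⋃ s ∈ Icc a b, {y | ‖y - s • u‖ < ε} := by ext; simp [tube]
  rw [this]
  exact isOpen_biUnion fun s _ => isOpen_lt (by fun_prop) continuous_const

lemma mem_Icc_of_mem_tube (hε : 0 < ε) {u : V3} {a b τ : ℝ} {ν : S2} (hν : 0 < inner ℝ u (ν : V3))
    (h : τ • u + ε • (ν : V3) ∈ tube ε u a b \ {y | ‖y - a • u‖ < ε}) : τ ∈ Icc a b := by
  -- A point reached by the front of the ball at time τ is inside the ball exactly for s between τ
  -- and τ + 2ε(u·ν) / ‖u‖². If it is inside at some s in [a, b] but not at a, then τ lies in [a,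
  -- b].
  have key : ∀ s : ℝ, ‖τ • u + ε • (ν : V3) - s • u‖ < ε ↔
      (τ - s) * ((τ - s) * ‖u‖ ^ 2 + 2 * ε * inner ℝ u (ν : V3)) < 0 := by
    intro s
    have e : τ • u + ε • (ν : V3) - s • u = (τ - s) • u + ε • (ν : V3) := by module
    have h1 : ‖(τ - s) • u + ε • (ν : V3)‖ ^ 2 =
        (τ - s) * ((τ - s) * ‖u‖ ^ 2 + 2 * ε * inner ℝ u (ν : V3)) + ε ^ 2 := by
      rw [norm_add_sq_real, norm_smul, norm_smul, inner_smul_left, inner_smul_right, norm_S2,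
        Real.norm_eq_abs, Real.norm_eq_abs, mul_one, mul_pow, sq_abs, sq_abs]
      simp; ring
    rw [e, ← abs_of_nonneg (norm_nonneg ((τ - s) • u + ε • (ν : V3))), ← abs_of_pos hε,
      ← sq_lt_sq, abs_of_pos hε, h1]
    constructor <;> intro <;> linarith
  obtain ⟨⟨s, hs, hs2⟩, ha⟩ := h
  rw [key] at hs2
  rw [mem_ofPred_eq, key, not_lt] at ha
  have hU : 0 ≤ ‖u‖ ^ 2 := by positivity
  have hm : 0 < ε * inner ℝ u (ν : V3) := by positivity
  have hτs : τ < s := by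
    by_contra hc
    push Not at hc
    have h1 : 0 ≤ τ - s := by linarith
    have h2 : 0 ≤ (τ - s) * ‖u‖ ^ 2 := by positivity
    exact absurd hs2 (not_lt.2 (mul_nonneg h1 (by linarith)))
  refine ⟨?_, hτs.le.trans hs.2⟩
  by_contra hc
  push Not at hc
  have h1 : 0 < (τ - s) * ‖u‖ ^ 2 + 2 * ε * inner ℝ u (ν : V3) := by
    by_contra h'
    push Not at h'
    exact absurd hs2 (not_lt.2 (mul_nonneg_of_nonpos_of_nonpos (by linarith) h'))
  have h2 : (τ - s) * ‖u‖ ^ 2 ≤ (τ - a) * ‖u‖ ^ 2 :=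
    mul_le_mul_of_nonneg_right (by linarith [hs.1]) hU
  exact absurd ha (not_le.2 (mul_neg_of_neg_of_pos (by linarith) (by linarith)))

/-- A point met by the moving ball either lies in the ball at the initial time or is reached by its
front during [a, b]. By `lintegral_cylinder` the front sweeps at most ε² times the collision rate
per unit of time. -/
lemma volume_tube_le (hε : 0 < ε) (v w : V3) (a b : ℝ) : volume (tube ε (v - w) a b) ≤
    ENNReal.ofReal (ε ^ 2) * (∫⁻ ν, rate v w ν ∂surf) * ENNReal.ofReal (b - a) +
      volume (Metric.ball (0 : V3) ε) := by
  set u := v - w with hu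
  by_cases hu0 : u = 0
  · refine le_trans (measure_mono ?_) le_add_self
    rintro y ⟨s, -, hs⟩
    simpa [hu0] using hs
  set D := tube ε u a b \ {y | ‖y - a • u‖ < ε} with hD
  have hDm : MeasurableSet D := (isOpen_tube u a b).measurableSet.diff
    (isOpen_lt (by fun_prop) continuous_const).measurableSet
  have hsub : tube ε u a b ⊆ D ∪ {y | ‖y - a • u‖ < ε} := fun y hy => by
    by_cases h : ‖y - a • u‖ < ε
    · exact Or.inr h
    · exact Or.inl ⟨hy, h⟩
  have hball : volume {y : V3 | ‖y - a • u‖ < ε} = volume (Metric.ball (0 : V3) ε) := by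
    have : {y : V3 | ‖y - a • u‖ < ε} = Metric.ball (a • u) ε := by
      ext y; simp [dist_eq_norm]
    rw [this, EuclideanSpace.volume_ball, EuclideanSpace.volume_ball]
  refine (measure_mono hsub).trans ((measure_union_le _ _).trans ?_)
  rw [hball]
  refine add_le_add ?_ le_rfl
  have hc := lintegral_cylinder hu0 hε (F := D.indicator 1) (measurable_one.indicator hDm)
  have hDc : D ⊆ {y : V3 | ∃ τ : ℝ, ‖y - τ • u‖ < ε} := fun y hy => by
    obtain ⟨⟨s, -, hs⟩, -⟩ := hy
    exact ⟨s, hs⟩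
  rw [lintegral_indicator_one hDm, Measure.restrict_apply hDm, inter_eq_left.2 hDc] at hc
  rw [← hc]
  calc _ ≤ ∫⁻ ν : S2, (∫⁻ τ : ℝ, ENNReal.ofReal (ε ^ 2) * rate v w ν *
        (Icc a b).indicator 1 τ) ∂surf := by
        refine lintegral_mono fun ν => lintegral_mono fun τ => ?_
        simp only
        by_cases hν : 0 < inner ℝ u (ν : V3)
        · rw [max_eq_left hν.le, rate, ← hu, ENNReal.ofReal_mul (by positivity)]
          refine mul_le_mul' le_rfl ?_
          by_cases hm : τ • u + ε • (ν : V3) ∈ D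
          · rw [indicator_of_mem hm, indicator_of_mem (mem_Icc_of_mem_tube hε hν hm)]
            exact le_rfl
          · rw [indicator_of_notMem hm]; exact zero_le
        · rw [max_eq_right (not_lt.1 hν), mul_zero, ENNReal.ofReal_zero, zero_mul]; exact zero_le
    _ = _ := by
        have : ∀ ν : S2, ∫⁻ τ : ℝ, ENNReal.ofReal (ε ^ 2) * rate v w ν *
            (Icc a b).indicator 1 τ = ENNReal.ofReal (ε ^ 2) * rate v w ν *
              ENNReal.ofReal (b - a) := fun ν => by
          rw [lintegral_const_mul _ (measurable_one.indicator measurableSet_Icc),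
            lintegral_indicator_one measurableSet_Icc, Real.volume_Icc]
        simp only [this]
        rw [lintegral_mul_const _ (by fun_prop), lintegral_const_mul _ (by fun_prop)]

lemma Admissible.bm_univ (h : Admissible f₀ g₀) : bm g₀ univ = 1 := by
  rw [bm, ← univ_prod_univ, Measure.prod_prod, h.gam_univ, mul_one, volume_pi, Measure.pi_univ]
  simp

/-- Initial data of background particles that are met by a free flight. -/
def hitFree (ε : ℝ) (z : Phase) (a b : ℝ) : Set Phase :=
  {y | ∃ s ∈ Icc a b, torusDist (fl s z).1 (bgPos y s) < ε}

lemma continuous_bgPos : Continuous fun q : Phase × ℝ => bgPos q.1 q.2 := by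
  have := continuous_toTorus
  unfold bgPos
  exact continuous_fst.fst.add (this.comp (by fun_prop))

lemma measurableSet_hitFree (z : Phase) (a b : ℝ) : MeasurableSet (hitFree ε z a b) := by
  have : hitFree ε z a b = ⋃ s ∈ Icc a b, {y | torusDist (fl s z).1 (bgPos y s) < ε} := by
    ext; simp [hitFree]
  rw [this]
  refine (isOpen_biUnion fun s _ => isOpen_lt ?_ continuous_const).measurableSet
  exact Continuous.torusDist continuous_const (continuous_bgPos.comp (by fun_prop :
    Continuous fun y : Phase => (y, s)))

lemma Admissible.bm_hitFree_le (h : Admissible f₀ g₀) (hε : 0 < ε) (z : Phase) (a b : ℝ) :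
    bm g₀ (hitFree ε z a b) ≤ ENNReal.ofReal (ε ^ 2) * freq g₀ z.2 * ENNReal.ofReal (b - a) +
      volume (Metric.ball (0 : V3) ε) := by
  have hslice : ∀ w : V3, volume ((fun x => (x, w)) ⁻¹' hitFree ε z a b) ≤
      volume (tube ε (z.2 - w) a b) := by
    intro w
    have h1 : (fun x : Torus => (x, w)) ⁻¹' hitFree ε z a b ⊆
        (fun x => x - z.1) ⁻¹' (toTorus '' tube ε (z.2 - w) a b) := by
      rintro x ⟨s, hs, hd⟩
      obtain ⟨p, hp, hp2⟩ := exists_lift_torusDist (fl s z).1 (bgPos (x, w) s)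
      rw [← hp2] at hd
      refine ⟨s • (z.2 - w) + p, ⟨s, hs, by rwa [add_sub_cancel_left]⟩, ?_⟩
      simp only [fl, bgPos] at hp
      have e := eq_sub_of_add_eq hp
      rw [e]
      simp only [toTorus_add, toTorus_sub, smul_sub]
      abel
    refine (measure_mono h1).trans ?_
    have h2 := measure_preimage_add_right (volume : Measure Torus) (-z.1)
      (toTorus '' tube ε (z.2 - w) a b)
    simp only [← sub_eq_add_neg] at h2
    rw [h2]
    exact volume_le_of_subset_image (isOpen_tube _ _ _).measurableSet subset_rfl
  have hm : Measurable fun w => ∫⁻ ν, rate z.2 w ν ∂surf :=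
    Measurable.lintegral_prod_right' (f := fun q : V3 × S2 => rate z.2 q.1 q.2) (by fun_prop)
  rw [bm, Measure.prod_apply_symm (measurableSet_hitFree z a b)]
  refine (lintegral_mono fun w => (hslice w).trans (volume_tube_le hε z.2 w a b)).trans ?_
  rw [lintegral_add_right _ measurable_const, lintegral_const, h.gam_univ, mul_one,
    lintegral_mul_const _ (by fun_prop), lintegral_const_mul _ hm, freq]

/-- Initial data of background particles that are met by a path. -/
def hitPath (ε : ℝ) (Φ : Tree n) (r : ℝ) : Set Phase :=
  {y | ∃ s ∈ Icc 0 r, torusDist (path Φ s).1 (bgPos y s) < ε}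

lemma Admissible.acc_nonneg (h : Admissible f₀ g₀) (hγ : 0 < γ) : ∀ {n : ℕ} {Φ : Tree n} {r : ℝ},
    GoodT γ Φ → lastT Φ ≤ r → 0 ≤ r → 0 ≤ acc g₀ Φ r
  | 0, Φ, r, _, _, hr => mul_nonneg (h.collFreq_nonneg _) hr
  | n + 1, Φ, r, hΦ, hl, hr => by
    obtain ⟨Φ, k, rfl⟩ := exists_ext Φ
    have h' := goodT_ext.1 hΦ
    rw [lastT_ext] at hl
    rw [acc_ext]
    exact add_nonneg (h.acc_nonneg hγ h'.1 (by linarith) (by linarith))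
      (mul_nonneg (h.collFreq_nonneg _) (by linarith))

/-- Each free flight meets a particle with probability at most ε² times its accumulated collision
frequency plus one ball volume; there are n + 1 flights. -/
lemma Admissible.bm_hitPath_le (h : Admissible f₀ g₀) (hγ : 0 < γ) (hε : 0 < ε) :
    ∀ {n : ℕ} {Φ : Tree n} {r : ℝ}, GoodT γ Φ → lastT Φ ≤ r → 0 ≤ r →
    bm g₀ (hitPath ε Φ r) ≤ ENNReal.ofReal (ε ^ 2) * ENNReal.ofReal (acc g₀ Φ r) +
      (n + 1) * volume (Metric.ball (0 : V3) ε)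
  | 0, Φ, r, _, _, hr => by
    refine (h.bm_hitFree_le hε Φ.1 0 r).trans ?_
    rw [sub_zero, ← h.ofReal_collFreq, mul_assoc, ← ENNReal.ofReal_mul (h.collFreq_nonneg _), acc]
    simp
  | n + 1, Φ, r, hΦ, hl, hr => by
    obtain ⟨Φ, k, rfl⟩ := exists_ext Φ
    have h' := goodT_ext.1 hΦ
    rw [lastT_ext] at hl
    have hk0 : 0 ≤ k.1 := by linarith
    have hkl : lastT Φ ≤ k.1 := by linarith
    have ih := h.bm_hitPath_le hγ hε h'.1 hkl hk0
    have hsub : hitPath ε (ext Φ k) r ⊆ hitPath ε Φ k.1 ∪ hitFree ε (stp (cur Φ) k) k.1 r := by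
      rintro y ⟨s, hs, hd⟩
      rw [path_ext] at hd
      split_ifs at hd with hsk
      · exact Or.inl ⟨s, ⟨hs.1, hsk.le⟩, hd⟩
      · exact Or.inr ⟨s, ⟨not_lt.1 hsk, hs.2⟩, hd⟩
    refine (measure_mono hsub).trans ((measure_union_le _ _).trans ?_)
    refine (add_le_add ih (h.bm_hitFree_le hε _ _ _)).trans ?_
    rw [acc_ext, ENNReal.ofReal_add (h.acc_nonneg hγ h'.1 hkl hk0)
      (mul_nonneg (h.collFreq_nonneg _) (by linarith)), ENNReal.ofReal_mul (h.collFreq_nonneg _),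
      h.ofReal_collFreq]
    push_cast
    apply le_of_eq
    ring

/-- The background particle `y` is not met. -/
def Far (ε T : ℝ) (Φ : Tree n) (y : Phase) : Prop := ∀ q : ℚ, 0 ≤ q → q ≤ 1 →
  ε ≤ torusDist (path Φ (q * T)).1 (bgPos y (q * T))

lemma measurableSet_far : MeasurableSet {p : Tree n × Phase | Far ε T p.1 p.2} := by
  simp only [Far, ofPred_forall]
  refine MeasurableSet.iInter fun q => MeasurableSet.iInter fun _ => MeasurableSet.iInter fun _ => ?_
  have h1 : Measurable fun p : Tree n × Phase => (path p.1 (q * T)).1 :=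
    (measurable_path.comp (by fun_prop : Measurable fun p : Tree n × Phase =>
      (p.1, (q : ℝ) * T))).fst
  have h2 : Measurable fun p : Tree n × Phase => bgPos p.2 (q * T) :=
    continuous_bgPos.measurable.comp (by fun_prop : Measurable fun p : Tree n × Phase =>
      (p.2, (q : ℝ) * T))
  exact measurableSet_le (f := fun _ => ε) measurable_const (Measurable.torusDist h1 h2)

lemma Far.le_torusDist (hγ : 0 < γ) (hT : 0 < T) {Φ : Tree n} (hΦ : GoodT γ Φ) {y : Phase}
    (h : Far ε T Φ y) {s : ℝ} (hs : s ∈ Icc 0 T) : ε ≤ torusDist (path Φ s).1 (bgPos y s) := by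
  have h1 := hΦ.continuous_pos hγ
  have h2 : Continuous fun s => bgPos y s :=
    continuous_bgPos.comp (by fun_prop : Continuous fun s : ℝ => (y, s))
  have h3 := Continuous.torusDist h1 h2
  have := le_on_Icc_of_rat (f := fun _ => ε)
    (g := fun x => torusDist (path Φ (x * T)).1 (bgPos y (x * T))) continuous_const
    (h3.comp (continuous_mul_const T)) h (x := s / T)
    ⟨div_nonneg hs.1 hT.le, (div_le_one hT).2 hs.2⟩
  simpa only [div_mul_cancel₀ _ hT.ne'] using this

lemma Admissible.bm_far_ge (h : Admissible f₀ g₀) (hγ : 0 < γ) (hε : 0 < ε) (hT : 0 < T)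
    {Φ : Tree n} (hΦ : GoodT γ Φ) (hl : lastT Φ ≤ T) :
    1 ≤ bm g₀ {y | Far ε T Φ y} + (ENNReal.ofReal (ε ^ 2) * ENNReal.ofReal (acc g₀ Φ T) +
      (n + 1) * volume (Metric.ball (0 : V3) ε)) := by
  rw [← h.bm_univ]
  refine le_trans (measure_mono ?_) ((measure_union_le {y | Far ε T Φ y} (hitPath ε Φ T)).trans
    (add_le_add le_rfl ((h.bm_hitPath_le hγ hε hΦ hl hT.le).trans_eq (by rw [h.bm_univ]))))
  intro y _
  by_cases hy : Far ε T Φ y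
  · exact Or.inl hy
  · right
    simp only [Far] at hy
    push Not at hy
    obtain ⟨q, hq, hq1, hd⟩ := hy
    have hq' : (0 : ℝ) ≤ q := by exact_mod_cast hq
    have hq1' : (q : ℝ) ≤ 1 := by exact_mod_cast hq1
    exact ⟨q * T, ⟨by positivity, by nlinarith⟩, hd⟩

end Rayleigh

end

noncomputable section

namespace Rayleigh

variable {n N : ℕ} {γ T ε ε' : ℝ} {f₀ : L1Phase} {g₀ : L1V}

/-! ### The probability of a collision history -/

/-- Splitting the labels into those in the range of `ι` and the other ones. -/
def labels (ι : Fin n ↪ Fin N) : Fin n ⊕ {j // j ∉ range ι} ≃ Fin N :=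
  ((Equiv.ofInjective ι ι.injective).sumCongr (Equiv.refl _)).trans (Equiv.Set.sumCompl (range ι))

lemma labels_inl (ι : Fin n ↪ Fin N) (i : Fin n) : labels ι (Sum.inl i) = ι i := rfl

lemma labels_inr (ι : Fin n ↪ Fin N) (j : {j // j ∉ range ι}) : labels ι (Sum.inr j) = j := rfl

/-- Joining the data of the particles in the range of `ι` with those of the other ones. -/
def glue (ι : Fin n ↪ Fin N) (q : (Fin n → Phase) × ({j // j ∉ range ι} → Phase)) : Fin N → Phase :=
  fun j => Sum.elim q.1 q.2 ((labels ι).symm j)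

lemma glue_range (ι : Fin n ↪ Fin N) (q : (Fin n → Phase) × ({j // j ∉ range ι} → Phase))
    (i : Fin n) : glue ι q (ι i) = q.1 i := by
  rw [glue, ← labels_inl, Equiv.symm_apply_apply, Sum.elim_inl]

lemma glue_compl (ι : Fin n ↪ Fin N) (q : (Fin n → Phase) × ({j // j ∉ range ι} → Phase))
    (j : {j // j ∉ range ι}) : glue ι q j = q.2 j := by
  rw [glue, ← labels_inr, Equiv.symm_apply_apply, Sum.elim_inr]

@[fun_prop]
lemma measurable_glue (ι : Fin n ↪ Fin N) : Measurable (glue ι) := by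
  refine measurable_pi_lambda _ fun j => ?_
  obtain ⟨k, rfl⟩ := (labels ι).surjective j
  rcases k with i | i
  · simp only [labels_inl, glue_range]; fun_prop
  · simp only [labels_inr, glue_compl]; fun_prop

lemma measurePreserving_glue (ι : Fin n ↪ Fin N) : MeasurePreserving (glue ι)
    ((Measure.pi fun _ : Fin n => bm g₀).prod (Measure.pi fun _ : {j // j ∉ range ι} => bm g₀))
    (Measure.pi fun _ : Fin N => bm g₀) := by
  refine ⟨measurable_glue ι, (Measure.pi_eq fun s hs => ?_).symm⟩
  have e : glue ι ⁻¹' univ.pi s =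
      (univ.pi fun i => s (ι i)) ×ˢ (univ.pi fun j : {j // j ∉ range ι} => s j) := by
    ext q
    simp only [mem_preimage, Set.mem_pi, mem_univ, true_imp_iff, mem_prod]
    constructor
    · exact fun h => ⟨fun i => by rw [← glue_range ι q]; exact h _,
        fun j => by rw [← glue_compl ι q]; exact h _⟩
    · intro h j
      obtain ⟨k, rfl⟩ := (labels ι).surjective j
      rcases k with i | i
      · rw [labels_inl, glue_range]; exact h.1 i
      · rw [labels_inr, glue_compl]; exact h.2 i
  rw [Measure.map_apply (measurable_glue ι) (MeasurableSet.univ_pi hs), e, Measure.prod_prod,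
    Measure.pi_pi, Measure.pi_pi, ← Equiv.prod_comp (labels ι), Fintype.prod_sum_type]
  rfl

/-- Regular collision histories. -/
structure Nice (γ T : ℝ) (g₀ : L1V) (Φ : Tree n) : Prop where
  good : GoodT γ Φ
  sep : Sep γ T Φ
  last : lastT Φ < T
  acc_le : acc g₀ Φ T ≤ γ⁻¹

lemma Nice.time_le (hγ : 0 < γ) {Φ : Tree n} (h : Nice γ T g₀ Φ) (i : Fin n) : (Φ.2 i).1 ≤ T :=
  (h.good.time_le_lastT hγ i).trans h.last.le

lemma Nice.pre (hγ : 0 < γ) {Φ : Tree n} (h : Nice γ T g₀ Φ) : Pre γ Φ :=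
  h.sep.pre hγ h.good (h.time_le hγ)

lemma Admissible.measurableSet_nice (h : Admissible f₀ g₀) (hγ : 0 < γ) (hT : 0 < T) :
    MeasurableSet {Φ : Tree n | Nice γ T g₀ Φ} := by
  have e : {Φ : Tree n | Nice γ T g₀ Φ} = {Φ | GoodT γ Φ ∧ Sep γ T Φ} ∩
      ({Φ | lastT Φ < T} ∩ {Φ | acc g₀ Φ T ≤ γ⁻¹}) := by
    ext Φ
    exact ⟨fun h => ⟨⟨h.good, h.sep⟩, h.last, h.acc_le⟩, fun h => ⟨h.1.1, h.1.2, h.2.1, h.2.2⟩⟩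
  rw [e]
  have hm : Measurable fun Φ : Tree n => acc g₀ Φ T :=
    h.measurable_acc.comp (by fun_prop : Measurable fun Φ : Tree n => (Φ, T))
  exact (measurableSet_sep hγ hT).inter ((measurableSet_lt (by fun_prop) (by fun_prop)).inter
    (measurableSet_le hm measurable_const))

/-- Histories and data of the other particles, such that the latter are not met. -/
def data (γ ε T t : ℝ) (g₀ : L1V) (ι : Fin n ↪ Fin N) (A : Set Phase) :
    Set (Tree n × ({j // j ∉ range ι} → Phase)) :=
  {q | Nice γ T g₀ q.1 ∧ path q.1 t ∈ A ∧ ∀ j, Far ε T q.1 (q.2 j)}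

/-- The configuration of a history and data of the other particles. -/
def place (ε : ℝ) (ι : Fin n ↪ Fin N) (q : Tree n × ({j // j ∉ range ι} → Phase)) : Config N :=
  (q.1.1, glue ι (bgi ε q.1, q.2))

/-- The configurations that lead to a regular history. -/
def event (γ ε ε' T t : ℝ) (g₀ : L1V) (ι : Fin n ↪ Fin N) (A : Set Phase) : Set (Config N) :=
  place ε ι '' data γ ε' T t g₀ ι A

/-- The larger diameter ε' turns the weak inequality at rational times into a strict inequality for
ε at all times. -/
lemma realizes_place (hγ : 0 < γ) (hT : 0 < T) (hε : ε < ε') {ι : Fin n ↪ Fin N} {t : ℝ}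
    {A : Set Phase} {q : Tree n × ({j // j ∉ range ι} → Phase)}
    (hq : q ∈ data γ ε' T t g₀ ι A) : Realizes γ ε T (place ε ι q) ι q.1 := by
  obtain ⟨h1, -, h3⟩ := hq
  refine ⟨h1.good, h1.sep, h1.time_le hγ, rfl, fun i => glue_range ι _ i, fun j hj s hs => ?_⟩
  refine hε.trans_le ?_
  have := (h3 ⟨j, hj⟩).le_torusDist hγ hT h1.good hs
  rwa [show (place ε ι q).2 j = q.2 ⟨j, hj⟩ from glue_compl ι _ ⟨j, hj⟩]

lemma exists_realizes (hγ : 0 < γ) (hT : 0 < T) (hε : ε < ε') {ι : Fin n ↪ Fin N} {t : ℝ}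
    {A : Set Phase} {ω : Config N} (hω : ω ∈ event γ ε ε' T t g₀ ι A) :
    ∃ Φ : Tree n, Realizes γ ε T ω ι Φ ∧ path Φ t ∈ A := by
  obtain ⟨q, hq, rfl⟩ := hω
  exact ⟨q.1, realizes_place hγ hT hε hq, hq.2.1⟩

lemma Admissible.measurableSet_data (h : Admissible f₀ g₀) (hγ : 0 < γ) (hT : 0 < T)
    (ι : Fin n ↪ Fin N) (t : ℝ) {A : Set Phase} (hA : MeasurableSet A) :
    MeasurableSet (data γ ε T t g₀ ι A) := by
  simp only [data, ofPred_and, ofPred_forall]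
  have h1 : Measurable fun q : Tree n × ({j // j ∉ range ι} → Phase) => path q.1 t :=
    measurable_path.comp (by fun_prop :
      Measurable fun q : Tree n × ({j // j ∉ range ι} → Phase) => (q.1, t))
  refine MeasurableSet.inter (measurable_fst (h.measurableSet_nice hγ hT))
    (MeasurableSet.inter (h1 hA) (MeasurableSet.iInter fun j => ?_))
  exact (by fun_prop : Measurable fun q : Tree n × ({j // j ∉ range ι} → Phase) => (q.1, q.2 j))
    measurableSet_far

instance : StandardBorelSpace Phase := inferInstance

instance : StandardBorelSpace Coll := inferInstance

instance (N : ℕ) : MeasurableSpace.CountablySeparated (Config N) :=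
  have : StandardBorelSpace (Config N) := inferInstance
  have : MeasurableSpace.CountablyGenerated (Config N) := inferInstance
  inferInstance

/-- An injective measurable image between standard Borel spaces is measurable. The map is injective
because the configuration determines the history. -/
lemma Admissible.measurableSet_event (h : Admissible f₀ g₀) (hγ : 0 < γ) (hγ1 : γ ≤ 1) (hT : 0 < T)
    (hε : 0 < ε) (hεγ : ε < γ ^ 2 / 8) (hε' : ε < ε') (ι : Fin n ↪ Fin N) (t : ℝ) {A : Set Phase}
    (hA : MeasurableSet A) : MeasurableSet (event γ ε ε' T t g₀ ι A) := by
  refine (h.measurableSet_data hγ hT ι t hA).image_of_measurable_injOn ?_ fun q hq q' hq' e => ?_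
  · have hm : Measurable fun Φ : Tree n => bgi ε Φ := measurable_conf.snd
    unfold place
    fun_prop
  · have r := realizes_place hγ hT hε' hq
    have r' := realizes_place hγ hT hε' hq'
    rw [← e] at r'
    have h1 := r.unique hγ hγ1 hε hεγ r'
    simp only [Sigma.mk.injEq, heq_eq_eq, Prod.mk.injEq, true_and] at h1
    refine Prod.ext h1 (funext fun j => ?_)
    have h2 := congrFun (congrArg Prod.snd e) j
    simpa only [place, glue_compl] using h2

/-- A lower bound for the probability of the histories in which the particles `ι` take part. -/
theorem Admissible.event_ge (h : Admissible f₀ g₀) (hγ : 0 < γ) (hγ1 : γ ≤ 1) (hT : 0 < T)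
    (hε : 0 < ε) (hεγ : ε < γ ^ 2 / 8) (hε' : ε < ε') (ι : Fin n ↪ Fin N) (t : ℝ) {A : Set Phase}
    (hA : MeasurableSet A) :
    ENNReal.ofReal (ε ^ 2) ^ n * ∫⁻ Φ, {Φ : Tree n | Nice γ T g₀ Φ}.indicator 1 Φ *
      (A.indicator 1 (path Φ t) * bm g₀ {y | Far ε' T Φ y} ^ (N - n)) ∂tau T f₀ g₀ n ≤
      initialLaw f₀ g₀ N (event γ ε ε' T t g₀ ι A) := by
  have hE := h.measurableSet_event hγ hγ1 hT hε hεγ hε' ι t hA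
  set E := event γ ε ε' T t g₀ ι A with hEdef
  set P := Measure.pi fun _ : {j // j ∉ range ι} => bm g₀ with hP
  -- Integrates out the particles without a label in the history. They are independent, so for a
  -- given history they are all missed with the probability of one, to the power N - n.
  set F : Config n → ENNReal := fun ω => ∫⁻ r, E.indicator 1 (ω.1, glue ι (ω.2, r)) ∂P with hF
  have hEm : Measurable (E.indicator (1 : Config N → ENNReal)) := measurable_one.indicator hE
  have hFm : Measurable F := Measurable.lintegral_prod_right'
    (f := fun q : Config n × ({j // j ∉ range ι} → Phase) =>
      E.indicator (1 : Config N → ENNReal) (q.1.1, glue ι (q.1.2, q.2))) (by fun_prop)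
  have hlaw : initialLaw f₀ g₀ N E = ∫⁻ ω, F ω ∂initialLaw f₀ g₀ n := by
    rw [← lintegral_indicator_one hE, initialLaw_eq, initialLaw_eq,
      lintegral_prod _ hEm.aemeasurable, lintegral_prod _ hFm.aemeasurable]
    refine lintegral_congr fun z => ?_
    have hz : Measurable fun ω : Fin N → Phase => E.indicator (1 : Config N → ENNReal) (z, ω) := by
      fun_prop
    rw [← (measurePreserving_glue ι).lintegral_comp hz, lintegral_prod]
    exact (hz.comp (measurable_glue ι)).aemeasurable
  rw [hlaw]
  refine le_trans (mul_le_mul' le_rfl (lintegral_mono fun Φ => ?_))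
    (lintegral_conf_le (T := T) hγ hγ1 hε hεγ hFm)
  by_cases hΦ : Nice γ T g₀ Φ
  swap
  · rw [indicator_of_notMem (show Φ ∉ {Φ : Tree n | Nice γ T g₀ Φ} from hΦ), zero_mul]
    exact zero_le
  by_cases hp : path Φ t ∈ A
  swap
  · rw [indicator_of_notMem hp, zero_mul, mul_zero]; exact zero_le
  rw [indicator_of_mem (show Φ ∈ {Φ : Tree n | Nice γ T g₀ Φ} from hΦ), indicator_of_mem hp,
    indicator_of_mem (show Φ ∈ {Φ : Tree n | Pre γ Φ} from hΦ.pre hγ), Pi.one_apply, one_mul,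
    Pi.one_apply, one_mul]
  have hfar : MeasurableSet {y | Far ε' T Φ y} :=
    (by fun_prop : Measurable fun y : Phase => (Φ, y)) measurableSet_far
  have hcard : Fintype.card {j // j ∉ range ι} = N - n := by
    have := Fintype.card_congr (labels ι)
    simp only [Fintype.card_sum, Fintype.card_fin] at this
    omega
  have h1 : P (univ.pi fun _ => {y | Far ε' T Φ y}) = bm g₀ {y | Far ε' T Φ y} ^ (N - n) := by
    rw [hP, Measure.pi_pi, Finset.prod_const, Finset.card_univ, hcard]
  rw [← h1, ← lintegral_indicator_one (MeasurableSet.univ_pi fun _ => hfar)]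
  refine lintegral_mono fun r => ?_
  by_cases hr : r ∈ univ.pi fun _ : {j // j ∉ range ι} => {y | Far ε' T Φ y}
  · rw [indicator_of_mem hr, indicator_of_mem]
    · exact le_rfl
    · exact ⟨(Φ, r), ⟨hΦ, hp, fun j => hr j (mem_univ j)⟩, rfl⟩
  · rw [indicator_of_notMem hr]; exact zero_le

/-- The configurations that lead to a regular history with at most `M` collisions. -/
def events (γ ε ε' T t : ℝ) (g₀ : L1V) (M N : ℕ) (A : Set Phase) : Set (Config N) :=
  ⋃ n ∈ Finset.range (M + 1), ⋃ ι : Fin n ↪ Fin N, event γ ε ε' T t g₀ ι A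

lemma mem_events {M : ℕ} {t : ℝ} {A : Set Phase} {ω : Config N} (hγ : 0 < γ) (hγ1 : γ ≤ 1)
    (hT : 0 < T) (hε : 0 < ε) (hεγ : ε < γ ^ 2 / 8) (hε' : ε < ε') (ht : t ∈ Icc 0 T)
    (hω : ω ∈ events γ ε ε' T t g₀ M N A) : WellPosed T ε ω ∧ taggedState T ε ω t ∈ A := by
  simp only [events, mem_iUnion] at hω
  obtain ⟨n, -, ι, hω⟩ := hω
  obtain ⟨Φ, hΦ, hA⟩ := exists_realizes hγ hT hε' hω
  refine ⟨hΦ.wellPosed hγ hγ1 hε hεγ, ?_⟩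
  rwa [hΦ.taggedState_eq hγ hγ1 hε hεγ ht]

/-- Events with different numbers or labels are disjoint, because a configuration realizes one
history only. The descending factorial counts the ordered choices of labels. -/
theorem Admissible.events_ge (h : Admissible f₀ g₀) (hγ : 0 < γ) (hγ1 : γ ≤ 1) (hT : 0 < T)
    (hε : 0 < ε) (hεγ : ε < γ ^ 2 / 8) (hε' : ε < ε') (M : ℕ) (t : ℝ) {A : Set Phase}
    (hA : MeasurableSet A) :
    ∑ n ∈ Finset.range (M + 1), (N.descFactorial n : ENNReal) * (ENNReal.ofReal (ε ^ 2) ^ n *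
      ∫⁻ Φ, {Φ : Tree n | Nice γ T g₀ Φ}.indicator 1 Φ *
      (A.indicator 1 (path Φ t) * bm g₀ {y | Far ε' T Φ y} ^ (N - n)) ∂tau T f₀ g₀ n) ≤
      initialLaw f₀ g₀ N (events γ ε ε' T t g₀ M N A) := by
  have hE : ∀ n, ∀ ι : Fin n ↪ Fin N, MeasurableSet (event γ ε ε' T t g₀ ι A) := fun n ι =>
    h.measurableSet_event hγ hγ1 hT hε hεγ hε' ι t hA
  have huniq : ∀ {n n' : ℕ} {ι : Fin n ↪ Fin N} {ι' : Fin n' ↪ Fin N} {ω : Config N},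
      ω ∈ event γ ε ε' T t g₀ ι A → ω ∈ event γ ε ε' T t g₀ ι' A →
      (⟨n, ι⟩ : Σ n, Fin n → Fin N) = ⟨n', ι'⟩ := by
    intro n n' ι ι' ω h1 h2
    obtain ⟨Φ, hΦ, -⟩ := exists_realizes hγ hT hε' h1
    obtain ⟨Φ', hΦ', -⟩ := exists_realizes hγ hT hε' h2
    exact congrArg (fun x : Σ n, (Fin n → Fin N) × Tree n => (⟨x.1, x.2.1⟩ : Σ n, Fin n → Fin N))
      (hΦ.unique hγ hγ1 hε hεγ hΦ')
  rw [events, measure_biUnion_finset]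
  · refine Finset.sum_le_sum fun n _ => ?_
    rw [measure_iUnion (fun ι ι' hne => disjoint_left.2 fun ω h1 h2 => hne ?_) (hE n), tsum_fintype]
    · have hcard : (Finset.univ : Finset (Fin n ↪ Fin N)).card = N.descFactorial n := by
        rw [Finset.card_univ, Fintype.card_embedding_eq, Fintype.card_fin, Fintype.card_fin]
      rw [← hcard, ← nsmul_eq_mul]
      exact Finset.card_nsmul_le_sum _ _ _ fun ι _ => h.event_ge hγ hγ1 hT hε hεγ hε' ι t hA
    · have := huniq h1 h2
      simp only [Sigma.mk.injEq, heq_eq_eq, true_and] at this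
      exact DFunLike.coe_injective this
  · intro n _ n' _ hne
    refine disjoint_left.2 fun ω h1 h2 => hne ?_
    simp only [mem_iUnion] at h1 h2
    obtain ⟨ι, h1⟩ := h1
    obtain ⟨ι', h2⟩ := h2
    exact congrArg Sigma.fst (huniq h1 h2)
  · exact fun n _ => MeasurableSet.iUnion (hE n)

end Rayleigh

end

/-! ### Almost every history is regular, and the limit N → ∞. -/

noncomputable section

namespace Rayleigh

variable {n : ℕ} {γ T : ℝ} {f₀ : L1Phase} {g₀ : L1V}

/-! ### Almost every collision history is regular -/

lemma Sep.anti {γ' : ℝ} (h : γ' ≤ γ) {Φ : Tree n} (hs : Sep γ T Φ) : Sep γ' T Φ := fun i s hsT =>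
  (mul_le_mul_of_nonneg_right h (abs_nonneg _)).trans (hs i s hsT)

lemma gap_eq_before {Φ : Tree n} {i : Fin n} {v : V3} (hγ : 0 < γ) (h : LocalAt γ Φ i v) {s : ℝ}
    (h1 : s < (Φ.2 i).1) (h2 : (Φ.2 i).1 - γ / 2 ≤ s) :
    gap Φ i s = |s - (Φ.2 i).1| * ‖v - (Φ.2 i).2.1‖ := by
  have key := (gap_local h (s := s) 0).1 h1 (by linarith)
  rw [zero_add, zero_add] at key
  have hn : ‖((Φ.2 i).1 - s) • (v - (Φ.2 i).2.1)‖ = |s - (Φ.2 i).1| * ‖v - (Φ.2 i).2.1‖ := by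
    rw [norm_smul, Real.norm_eq_abs, abs_sub_comm]
  rw [gap, key, torusDist_self_add, hn]
  rw [hn, abs_of_neg (by linarith)]
  calc _ ≤ γ / 2 * γ⁻¹ := mul_le_mul (by linarith) h.speed (norm_nonneg _) (by linarith)
    _ = 1 / 2 := by field_simp

lemma gap_eq_after {Φ : Tree n} {i : Fin n} {v : V3} (hγ : 0 < γ) (h : LocalAt γ Φ i v) {s : ℝ}
    (h1 : (Φ.2 i).1 ≤ s) (h2 : s ≤ (Φ.2 i).1 + γ / 2) :
    gap Φ i s = |s - (Φ.2 i).1| * ‖post v (Φ.2 i).2.1 (Φ.2 i).2.2 - (Φ.2 i).2.1‖ := by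
  have key := (gap_local h (s := s) 0).2 h1 (by linarith)
  rw [zero_add, sub_zero] at key
  have hn : ‖(s - (Φ.2 i).1) • (post v (Φ.2 i).2.1 (Φ.2 i).2.2 - (Φ.2 i).2.1)‖ =
      |s - (Φ.2 i).1| * ‖post v (Φ.2 i).2.1 (Φ.2 i).2.2 - (Φ.2 i).2.1‖ := by
    rw [norm_smul, Real.norm_eq_abs]
  rw [gap, key, torusDist_comm, torusDist_self_add, hn]
  rw [hn, abs_of_nonneg (by linarith)]
  calc _ ≤ γ / 2 * γ⁻¹ := mul_le_mul (by linarith) ((norm_post_sub_le _ _ _).trans h.speed)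
        (norm_nonneg _) (by linarith)
    _ = 1 / 2 := by field_simp

/-- A history without recollisions of point particles is quantitatively separated. -/
lemma GoodT.exists_sep (hγ : 0 < γ) {Φ : Tree n} (h : GoodT γ Φ)
    (hne : ∀ i, ∀ s ∈ Icc 0 T, s ≠ (Φ.2 i).1 → 0 < gap Φ i s) : ∃ η > 0, Sep η T Φ := by
  have key : ∀ i, ∃ η > 0, ∀ s ∈ Icc 0 T, η * |s - (Φ.2 i).1| ≤ gap Φ i s := by
    intro i
    -- Local bounds suffice by compactness. Away from the collision the gap is positive and
    -- continuous; near it, the gap is exactly linear with slopes the relative speeds before and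
    -- after.
    refine isCompact_Icc.induction_on (p := fun S => ∃ η > 0, ∀ s ∈ S,
      η * |s - (Φ.2 i).1| ≤ gap Φ i s) ⟨1, one_pos, by simp⟩ ?_ ?_ ?_
    · rintro S S' hSS ⟨η, hη, hS⟩
      exact ⟨η, hη, fun s hs => hS s (hSS hs)⟩
    · rintro S S' ⟨η, hη, hS⟩ ⟨η', hη', hS'⟩
      refine ⟨min η η', lt_min hη hη', fun s hs => ?_⟩
      rcases hs with hs | hs
      · exact (mul_le_mul_of_nonneg_right (min_le_left _ _) (abs_nonneg _)).trans (hS s hs)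
      · exact (mul_le_mul_of_nonneg_right (min_le_right _ _) (abs_nonneg _)).trans (hS' s hs)
    · intro x hx
      by_cases hxt : x = (Φ.2 i).1
      · obtain ⟨v, hv⟩ := h.exists_localAt hγ i
        have hvpos : 0 < ‖v - (Φ.2 i).2.1‖ := by
          refine norm_pos_iff.2 fun h0 => ?_
          have := hv.rate
          rw [h0, inner_zero_left] at this
          exact lt_irrefl _ this
        refine ⟨Icc 0 T ∩ Ioo (x - γ / 2) (x + γ / 2), inter_mem self_mem_nhdsWithin
          (mem_nhdsWithin_of_mem_nhds (Ioo_mem_nhds (by linarith) (by linarith))), ?_⟩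
        rw [hxt]
        -- If the relative velocity after the collision is zero, the gap vanishes afterwards. By
        -- `hne` this leaves no nearby later times in [0, T].
        by_cases hp : post v (Φ.2 i).2.1 (Φ.2 i).2.2 - (Φ.2 i).2.1 = 0
        · refine ⟨_, hvpos, fun s hs => ?_⟩
          rcases lt_trichotomy s (Φ.2 i).1 with h1 | h1 | h1
          · rw [gap_eq_before hγ hv h1 hs.2.1.le, mul_comm]
          · rw [h1, sub_self, abs_zero, mul_zero]; exact torusDist_nonneg _ _
          · have := hne i s hs.1 h1.ne'
            rw [gap_eq_after hγ hv h1.le hs.2.2.le, hp, norm_zero, mul_zero] at this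
            exact absurd this (lt_irrefl _)
        · refine ⟨min ‖v - (Φ.2 i).2.1‖ ‖post v (Φ.2 i).2.1 (Φ.2 i).2.2 - (Φ.2 i).2.1‖,
            lt_min hvpos (norm_pos_iff.2 hp), fun s hs => ?_⟩
          rcases lt_or_ge s (Φ.2 i).1 with h1 | h1
          · rw [gap_eq_before hγ hv h1 hs.2.1.le, mul_comm]
            exact mul_le_mul_of_nonneg_left (min_le_left _ _) (abs_nonneg _)
          · rw [gap_eq_after hγ hv h1 hs.2.2.le, mul_comm]
            exact mul_le_mul_of_nonneg_left (min_le_right _ _) (abs_nonneg _)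
      · have hg := hne i x hx hxt
        have hpos : 0 < 2 * |x - (Φ.2 i).1| := by
          have := abs_pos.2 (sub_ne_zero.2 hxt); linarith
        have h1 : ∀ᶠ s in 𝓝 x, gap Φ i x / 2 < gap Φ i s :=
          (h.continuous_gap hγ i).continuousAt.eventually_const_lt (by linarith)
        have h2 : ∀ᶠ s in 𝓝 x, |s - (Φ.2 i).1| < 2 * |x - (Φ.2 i).1| := by
          have : Continuous fun s : ℝ => |s - (Φ.2 i).1| := by fun_prop
          exact this.continuousAt.eventually_lt_const (by linarith)
        refine ⟨_, mem_nhdsWithin_of_mem_nhds (h1.and h2),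
          gap Φ i x / 2 / (2 * |x - (Φ.2 i).1|), by positivity, fun s hs => ?_⟩
        refine le_trans (mul_le_mul_of_nonneg_left hs.2.le (by positivity)) ?_
        rw [div_mul_cancel₀ _ hpos.ne']
        exact hs.1.le
  choose η hη hη2 using key
  obtain ⟨c, hc, hc2⟩ : ∃ c > 0, ∀ i, c ≤ η i := by
    rcases isEmpty_or_nonempty (Fin n) with he | hne
    · exact ⟨1, one_pos, fun i => he.elim i⟩
    · obtain ⟨i, hi⟩ := Finite.exists_min η
      exact ⟨η i, hη i, hi⟩
  exact ⟨c, hc, fun i s hs => (mul_le_mul_of_nonneg_right (hc2 i) (abs_nonneg _)).trans (hη2 i s hs)⟩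

/-- Histories that are quantitatively regular for some parameter. -/
def Regular (T : ℝ) (Φ : Tree n) : Prop :=
  ∃ m : ℕ, GoodT (1 / ((m : ℝ) + 1)) Φ ∧ Sep (1 / ((m : ℝ) + 1)) T Φ

lemma measurableSet_regular (hT : 0 < T) : MeasurableSet {Φ : Tree n | Regular T Φ} := by
  simp only [Regular, ofPred_exists]
  exact MeasurableSet.iUnion fun m => measurableSet_sep (by positivity) hT

lemma GoodT.regular (hγ : 0 < γ) {Φ : Tree n} (h : GoodT γ Φ)
    (hne : ∀ i, ∀ s ∈ Icc 0 T, s ≠ (Φ.2 i).1 → 0 < gap Φ i s) : Regular T Φ := by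
  obtain ⟨η, hη, hs⟩ := h.exists_sep hγ hne
  obtain ⟨m, hm⟩ := exists_nat_one_div_lt (lt_min hγ hη)
  exact ⟨m, h.anti (by positivity) (hm.le.trans (min_le_left _ _)),
    hs.anti (hm.le.trans (min_le_right _ _))⟩

/-- Only countably many free flights matter, so countably many null sets suffice in `ae_not_met`. -/
lemma exists_flights : ∀ {n : ℕ} (Φ : Tree n), ∃ Z : Set Phase, Z.Countable ∧
    ∀ s, ∃ z ∈ Z, path Φ s = fl s z
  | 0, Φ => ⟨{Φ.1}, countable_singleton _, fun s => ⟨Φ.1, rfl, rfl⟩⟩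
  | n + 1, Φ => by
    obtain ⟨Φ, k, rfl⟩ := exists_ext Φ
    obtain ⟨Z, hZ, hZ2⟩ := exists_flights Φ
    refine ⟨insert (stp (cur Φ) k) Z, hZ.insert _, fun s => ?_⟩
    rw [path_ext]
    split_ifs
    · obtain ⟨z, hz, e⟩ := hZ2 s
      exact ⟨z, mem_insert_of_mem _ hz, e⟩
    · exact ⟨_, mem_insert _ _, rfl⟩

lemma gam_line (a d : V3) : gam g₀ {w | w - a ∈ Submodule.span ℝ {d}} = 0 := by
  refine withDensity_absolutelyContinuous _ _ ?_
  have h1 : Submodule.span ℝ {d} ≠ ⊤ := by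
    have := span_pair_ne_top d d
    rwa [pair_eq_singleton] at this
  have h2 := measure_preimage_add_right (volume : Measure V3) (-a)
    (Submodule.span ℝ {d} : Set V3)
  rw [Measure.addHaar_submodule _ _ h1] at h2
  simp only [← sub_eq_add_neg] at h2
  exact h2

lemma exists_torus_eq (x y : Torus) : ∃ d : V3, y = x + toTorus d :=
  let ⟨a, ha, _⟩ := exists_lift_torusDist x y
  ⟨a, ha⟩

/-- Almost every background particle was not met in the past. -/
lemma ae_not_met (Φ : Tree n) (x : Torus) (t : ℝ) : ∀ᵐ w ∂gam g₀, ∀ s < t,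
    (path Φ s).1 ≠ x + toTorus ((s - t) • w) := by
  obtain ⟨Z, hZ, hZ2⟩ := exists_flights Φ
  -- D z is the displacement of the flight z from x at time t. A meeting at time s forces (s - t)(w
  -- - z.2) to equal D z modulo the lattice, so w lies on one of countably many lines.
  choose D hD using fun z : Phase => exists_torus_eq x (z.1 + toTorus (t • z.2))
  have h1 : ∀ᵐ w ∂gam g₀, ∀ z ∈ Z, ∀ m : Fin 3 → ℤ,
      w - z.2 ∉ Submodule.span ℝ {D z + lat m} := by
    rw [ae_ball_iff hZ]
    intro z _
    rw [ae_all_iff]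
    intro m
    rw [ae_iff]
    simpa only [not_not] using gam_line (g₀ := g₀) z.2 (D z + lat m)
  filter_upwards [h1] with w hw s hst e
  obtain ⟨z, hz, hzs⟩ := hZ2 s
  rw [hzs] at e
  have e2 : toTorus ((s - t) • (w - z.2)) = toTorus (D z) := by
    have h3 : toTorus (D z) = z.1 + toTorus (t • z.2) - x := by rw [hD z]; abel
    have h4 : toTorus ((s - t) • w) = (fl s z).1 - x := by rw [e]; abel
    rw [h3, smul_sub, toTorus_sub, h4]
    simp only [fl, sub_smul, toTorus_sub]
    abel
  obtain ⟨m, hm⟩ := (toTorus_eq_iff _ _).1 e2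
  refine hw z hz m (Submodule.mem_span_singleton.2 ⟨(s - t)⁻¹, ?_⟩)
  rw [← hm, smul_smul, inv_mul_cancel₀ (sub_ne_zero.2 hst.ne), one_smul]

/-- For almost every scattering direction a given particle will not be met in the future. -/
lemma ae_not_meeting (x y : Torus) (v w w' : V3) (t : ℝ) : ∀ᵐ ν : S2 ∂surf,
    0 < inner ℝ (v - w) (ν : V3) → ∀ s, t < s →
      x + toTorus ((s - t) • post v w ν) ≠ y + toTorus ((s - t) • w') := by
  obtain ⟨d, hd⟩ := exists_torus_eq x y
  -- A later meeting forces (s - t)(`post v w ν` - w') = d + m with a lattice vector m. Since `post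
  -- v w ν` differs from v by a nonzero multiple of ν, this puts ν into the span of v - w' and d +
  -- m, a proper subspace.
  have h1 : ∀ᵐ ν : S2 ∂surf, ∀ m : Fin 3 → ℤ, (ν : V3) ∉ Submodule.span ℝ {v - w', d + lat m} := by
    rw [ae_all_iff]
    intro m
    rw [ae_iff]
    simpa only [not_not] using surf_submodule _ (span_pair_ne_top (v - w') (d + lat m))
  filter_upwards [h1] with ν hν hpos s hs e
  have e2 : toTorus ((s - t) • (post v w ν - w')) = toTorus d := by
    rw [hd, add_assoc] at e
    have := add_left_cancel e
    rw [smul_sub, toTorus_sub, this]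
    abel
  obtain ⟨m, hm⟩ := (toTorus_eq_iff _ _).1 e2
  have hst : s - t ≠ 0 := sub_ne_zero.2 hs.ne'
  refine hν m (Submodule.mem_span_pair.2 ⟨(inner ℝ (ν : V3) (v - w))⁻¹,
    -((inner ℝ (ν : V3) (v - w))⁻¹ * (s - t)⁻¹), ?_⟩)
  rw [real_inner_comm] at hpos
  have h3 : post v w ν - w' = (s - t)⁻¹ • (d + lat m) := by
    rw [← hm, smul_smul, inv_mul_cancel₀ hst, one_smul]
  have h4 : (v - w') - (post v w ν - w') = (inner ℝ (ν : V3) (v - w)) • (ν : V3) := by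
    simp only [post]; abel
  have h5 : (ν : V3) = (inner ℝ (ν : V3) (v - w))⁻¹ • ((v - w') - (post v w ν - w')) := by
    rw [h4, smul_smul, inv_mul_cancel₀ hpos.ne', one_smul]
  rw [h3, smul_sub, smul_smul, sub_eq_add_neg, ← neg_smul] at h5
  exact h5.symm

lemma exists_goodT_ext (hγ : 0 < γ) {Φ : Tree n} {k : Coll} (h : GoodT γ Φ) (h1 : lastT Φ < k.1)
    (h2 : 0 < k.1) (h3 : 0 < inner ℝ ((cur Φ).2 - k.2.1) (k.2.2 : V3)) :
    ∃ γ' > 0, GoodT γ' (ext Φ k) := by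
  set a := (‖(cur Φ).2 - k.2.1‖ + 1)⁻¹ with ha
  have ha0 : 0 < a := by positivity
  set c := min (min γ (k.1 - lastT Φ)) (min k.1 a) with hc
  have hc0 : 0 < c := lt_min (lt_min hγ (by linarith)) (lt_min h2 ha0)
  have c1 : c ≤ γ := (min_le_left _ _).trans (min_le_left _ _)
  have c2 : c ≤ k.1 - lastT Φ := (min_le_left _ _).trans (min_le_right _ _)
  have c3 : c ≤ k.1 := (min_le_right _ _).trans (min_le_left _ _)
  have c4 : c ≤ a := (min_le_right _ _).trans (min_le_right _ _)
  refine ⟨c, hc0, goodT_ext.2 ⟨h.anti hc0 c1, by linarith, c3, h3, ?_⟩⟩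
  have := inv_anti₀ hc0 c4
  rw [ha, inv_inv] at this
  linarith

/-- Adding a generic collision keeps a history regular. -/
lemma Regular.ae_ext {Φ : Tree n} (h : Regular T Φ) (t : ℝ) (ht : t ∈ Ioc 0 T) :
    ∀ᵐ w ∂gam g₀, ∀ᵐ ν ∂surf, wt Φ (t, w, ν) ≠ 0 → Regular T (ext Φ (t, w, ν)) := by
  obtain ⟨m, hgood, hsep⟩ := h
  have hγ : 0 < 1 / ((m : ℝ) + 1) := by positivity
  -- The choice of w excludes earlier encounters with the new particle. The choice of ν excludes
  -- later ones with it (`h1`) and with the previous background particles (`h2`). Up to time t the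
  -- latter are handled by the regularity of Φ.
  filter_upwards [ae_not_met (g₀ := g₀) Φ (fl t (cur Φ)).1 t] with w hw
  have h1 := ae_not_meeting (fl t (cur Φ)).1 (fl t (cur Φ)).1 (cur Φ).2 w w t
  have h2 : ∀ᵐ ν : S2 ∂surf, ∀ i, 0 < inner ℝ ((cur Φ).2 - w) (ν : V3) → ∀ s, t < s →
      (fl t (cur Φ)).1 + toTorus ((s - t) • post (cur Φ).2 w ν) ≠
        pos Φ i + toTorus ((t - (Φ.2 i).1) • (Φ.2 i).2.1) + toTorus ((s - t) • (Φ.2 i).2.1) :=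
    ae_all_iff.2 fun i => ae_not_meeting _ _ _ _ _ _
  filter_upwards [h1, h2] with ν hν1 hν2 hwt
  have hlast : lastT Φ < t := by
    by_contra hc
    exact hwt (if_neg hc)
  have hrate : 0 < inner ℝ ((cur Φ).2 - w) (ν : V3) := by
    by_contra hc
    refine hwt ?_
    rw [wt, if_pos hlast]
    exact ENNReal.ofReal_of_nonpos (not_lt.1 hc)
  obtain ⟨γ', hγ', hg'⟩ := exists_goodT_ext hγ hgood (k := (t, w, ν)) hlast ht.1 hrate
  have hafter : ∀ s, t ≤ s → (path (ext Φ (t, w, ν)) s).1 =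
      (fl t (cur Φ)).1 + toTorus ((s - t) • post (cur Φ).2 w ν) := fun s hs => by
    rw [path_ext, if_neg (not_lt.2 hs)]
    simp only [fl, stp, toTorus_sub, sub_smul]
    abel
  refine hg'.regular hγ' fun i s hs hsi => torusDist_pos ?_
  induction i using Fin.lastCases with
  | last =>
    rw [ext_last] at hsi ⊢
    rw [pos_ext_last]
    rcases lt_or_gt_of_ne hsi with hlt | hgt
    · rw [path_ext, if_pos hlt]
      exact hw s hlt
    · rw [hafter s (le_of_lt hgt)]
      exact hν1 hrate s hgt
  | cast i =>
    rw [ext_castSucc] at hsi ⊢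
    rw [pos_ext_castSucc hγ' hg']
    have hti : (Φ.2 i).1 < t := (hgood.time_le_lastT hγ i).trans_lt hlast
    have hgap : ∀ r ∈ Icc 0 T, r ≠ (Φ.2 i).1 →
        (path Φ r).1 ≠ pos Φ i + toTorus ((r - (Φ.2 i).1) • (Φ.2 i).2.1) := fun r hr hri e => by
      have h3 := hsep i r hr
      rw [gap, e] at h3
      have h4 : 0 < 1 / ((m : ℝ) + 1) * |r - (Φ.2 i).1| :=
        mul_pos hγ (abs_pos.2 (sub_ne_zero.2 hri))
      simp [torusDist] at h3
      simp at h4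
      linarith
    rcases lt_trichotomy s t with hlt | heq | hgt
    · rw [path_ext, if_pos hlt]
      exact hgap s hs hsi
    · subst heq
      have := hgap s hs hsi
      rw [path_of_last_le hlast.le] at this
      rw [hafter s le_rfl]
      simpa using this
    · rw [hafter s hgt.le]
      have := hν2 i hrate s hgt
      rwa [add_assoc, ← toTorus_add, ← add_smul, sub_add_sub_cancel'] at this

/-- Almost every collision history is regular. -/
theorem ae_regular (hT : 0 < T) : ∀ {n : ℕ}, ∀ᵐ Φ ∂tau T f₀ g₀ n, Regular T Φ
  | 0 => Eventually.of_forall fun Φ =>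
    GoodT.regular (γ := 1) one_pos trivial fun i => i.elim0
  | n + 1 => by
    have ih := ae_regular hT (n := n)
    have hm : MeasurableSet {q : Tree n × Coll | wt q.1 q.2 ≠ 0 → Regular T (ext q.1 q.2)} := by
      have h1 : MeasurableSet {q : Tree n × Coll | wt q.1 q.2 = 0} :=
        measurable_wt (measurableSet_singleton 0)
      have h2 : MeasurableSet {q : Tree n × Coll | Regular T (ext q.1 q.2)} :=
        (by fun_prop : Measurable fun q : Tree n × Coll => ext q.1 q.2) (measurableSet_regular hT)
      have e : {q : Tree n × Coll | wt q.1 q.2 ≠ 0 → Regular T (ext q.1 q.2)} =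
          {q | wt q.1 q.2 = 0} ∪ {q | Regular T (ext q.1 q.2)} := by
        ext q
        simp only [mem_ofPred_eq, mem_union]
        tauto
      rw [e]
      exact h1.union h2
    rw [tau, ae_map_iff (by fun_prop) (measurableSet_regular hT), ae_withDensity_iff measurable_wt,
      Measure.ae_prod_iff_ae_ae hm]
    filter_upwards [ih] with Φ hΦ
    have hm2 : MeasurableSet {k : Coll | wt Φ k ≠ 0 → Regular T (ext Φ k)} :=
      (by fun_prop : Measurable fun k : Coll => (Φ, k)) hm
    rw [rho, Measure.ae_prod_iff_ae_ae hm2]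
    filter_upwards [ae_restrict_mem measurableSet_Ioc] with t ht
    have hm3 : MeasurableSet {q : V3 × S2 | wt Φ (t, q) ≠ 0 → Regular T (ext Φ (t, q))} :=
      (by fun_prop : Measurable fun q : V3 × S2 => (t, q)) hm2
    rw [Measure.ae_prod_iff_ae_ae hm3]
    exact hΦ.ae_ext t ht

end Rayleigh

end

noncomputable section

namespace Rayleigh

variable {n N : ℕ} {γ T : ℝ} {f₀ : L1Phase} {g₀ : L1V}

/-! ### The limit of many particles -/

lemma exp_le_one_sub {x : ℝ} (h1 : x ≤ 1 / 2) :
    Real.exp (-(x + 2 * x ^ 2)) ≤ 1 - x := by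
  have hp : 0 < 1 - x := by linarith
  rw [← Real.le_log_iff_exp_le hp]
  refine le_trans ?_ (Real.one_sub_inv_le_log_of_pos hp)
  have : (1 - x)⁻¹ ≤ 1 + x + 2 * x ^ 2 := by
    rw [inv_le_iff_one_le_mul₀ hp]
    nlinarith [sq_nonneg x]
  linarith

/-- The error factor for diameter `e`, at most `M` collisions and total collision frequency at
most `L`. -/
def errorFactor (c L : ℝ) (M : ℕ) (e : ℝ) : ℝ :=
  (1 - M * e ^ 2) ^ M * Real.exp (-((2 * e + e ^ 2) * L + (M + 1) * c * (1 + e) ^ 3 * e +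
    2 * (4 * L + 8 * (M + 1) * c) ^ 2 * e ^ 2))

lemma tendsto_errorFactor (c L : ℝ) (M : ℕ) : Tendsto (errorFactor c L M) (𝓝 0) (𝓝 1) := by
  have h : Continuous (errorFactor c L M) := by unfold errorFactor; fun_prop
  have h0 : errorFactor c L M 0 = 1 := by simp [errorFactor]
  rw [← h0]
  exact h.tendsto 0

/-- The probability of a given collision history of finitely many particles, compared to its
limit. -/
lemma errorFactor_le {c L a e : ℝ} {M : ℕ} (hc : 0 ≤ c) (ha : 0 ≤ a) (haL : a ≤ L) (he : 0 < e)
    (he1 : e ≤ 1) (hN : N * e ^ 2 = 1) (hn : n ≤ M) (hM : M * e ^ 2 ≤ 1)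
    (hK : (4 * L + 8 * (M + 1) * c) * e ^ 2 ≤ 1 / 2) :
    0 ≤ 1 - ((e * (1 + e)) ^ 2 * a + (n + 1) * (c * (e * (1 + e)) ^ 3)) ∧ errorFactor c L M e * Real.exp (-a) ≤ N.descFactorial n * ((e ^ 2) ^ n *
      (1 - ((e * (1 + e)) ^ 2 * a + (n + 1) * (c * (e * (1 + e)) ^ 3))) ^ (N - n)) := by
  set x := (e * (1 + e)) ^ 2 * a + (n + 1) * (c * (e * (1 + e)) ^ 3) with hx
  set K := 4 * L + 8 * (M + 1) * c with hKdef
  have hnM : (n : ℝ) ≤ M := by exact_mod_cast hn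
  have hL : 0 ≤ L := ha.trans haL
  have hx0 : 0 ≤ x := by positivity
  have hNM : (M : ℝ) ≤ N := by
    have : (M : ℝ) * e ^ 2 ≤ N * e ^ 2 := by rw [hN]; exact hM
    exact le_of_mul_le_mul_right this (by positivity)
  have hMN : M ≤ N := by exact_mod_cast hNM
  -- Here x bounds the probability that one particle is met at diameter e (1 + e). As N e² = 1, N x
  -- is a plus terms of order e, and N x² is of order e².
  have hNx : N * x ≤ a + ((2 * e + e ^ 2) * L + (M + 1) * c * (1 + e) ^ 3 * e) := by
    have e1 : N * x = (N * e ^ 2) * ((1 + e) ^ 2 * a + (n + 1) * c * (1 + e) ^ 3 * e) := by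
      rw [hx]; ring
    rw [e1, hN, one_mul]
    have h1 : (2 * e + e ^ 2) * a ≤ (2 * e + e ^ 2) * L :=
      mul_le_mul_of_nonneg_left haL (by positivity)
    have h2 : (n + 1) * c * (1 + e) ^ 3 * e ≤ (M + 1) * c * (1 + e) ^ 3 * e := by gcongr
    nlinarith
  have hxK : x ≤ K * e ^ 2 := by
    have e1 : x = ((1 + e) ^ 2 * a + (n + 1) * c * ((1 + e) ^ 3 * e)) * e ^ 2 := by rw [hx]; ring
    rw [e1]
    refine mul_le_mul_of_nonneg_right ?_ (by positivity)
    have h1 : (1 + e) ^ 2 ≤ 4 := by nlinarith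
    have h3 : (1 + e) ^ 3 * e ≤ 8 * 1 := by
      refine mul_le_mul ?_ he1 he.le (by norm_num)
      calc (1 + e) ^ 3 ≤ 2 ^ 3 := by gcongr; linarith
        _ = 8 := by norm_num
    have h4 : (1 + e) ^ 2 * a ≤ 4 * L := mul_le_mul h1 haL ha (by norm_num)
    have h5 : (n + 1) * c * ((1 + e) ^ 3 * e) ≤ (M + 1) * c * (8 * 1) := by gcongr
    rw [hKdef]; linarith
  have hx2 : N * x ^ 2 ≤ K ^ 2 * e ^ 2 := by
    have h1 : x ^ 2 ≤ (K * e ^ 2) ^ 2 := pow_le_pow_left₀ hx0 hxK 2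
    calc N * x ^ 2 ≤ N * (K * e ^ 2) ^ 2 := by gcongr
      _ = K ^ 2 * e ^ 2 * (N * e ^ 2) := by ring
      _ = K ^ 2 * e ^ 2 := by rw [hN, mul_one]
  have hxh : x ≤ 1 / 2 := hxK.trans hK
  refine ⟨by linarith, ?_⟩
  have hpow : Real.exp (-((2 * e + e ^ 2) * L + (M + 1) * c * (1 + e) ^ 3 * e +
      2 * K ^ 2 * e ^ 2)) * Real.exp (-a) ≤ (1 - x) ^ (N - n) := by
    calc _ ≤ Real.exp (N * -(x + 2 * x ^ 2)) := by
          rw [← Real.exp_add]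
          refine Real.exp_le_exp.2 ?_
          nlinarith
      _ = Real.exp (-(x + 2 * x ^ 2)) ^ N := by rw [← Real.exp_nat_mul]
      _ ≤ (1 - x) ^ N := pow_le_pow_left₀ (Real.exp_pos _).le (exp_le_one_sub hxh) N
      _ ≤ (1 - x) ^ (N - n) := pow_le_pow_of_le_one (by linarith) (by linarith) (Nat.sub_le _ _)
  -- The descending factorial is at least (N + 1 - n)ⁿ, so after multiplication with e²ⁿ it is at
  -- least (1 - M e²)ᴹ.
  have hdesc : (1 - M * e ^ 2) ^ M ≤ N.descFactorial n * (e ^ 2) ^ n := by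
    have h0 : 0 ≤ 1 - M * e ^ 2 := by linarith
    calc (1 - M * e ^ 2) ^ M ≤ (1 - M * e ^ 2) ^ n :=
          pow_le_pow_of_le_one h0 (by have : 0 ≤ M * e ^ 2 := by positivity
                                      linarith) hn
      _ ≤ ((N + 1 - n : ℕ) * e ^ 2) ^ n := by
          refine pow_le_pow_left₀ h0 ?_ n
          rw [Nat.cast_sub (by omega)]
          push_cast
          have : (n : ℝ) * e ^ 2 ≤ M * e ^ 2 := by gcongr
          nlinarith [sq_nonneg e]
      _ = ((N + 1 - n) ^ n : ℕ) * (e ^ 2) ^ n := by rw [mul_pow]; push_cast; rfl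
      _ ≤ N.descFactorial n * (e ^ 2) ^ n := by
          gcongr
          exact Nat.pow_sub_le_descFactorial N n
  rw [errorFactor, mul_assoc, ← mul_assoc (N.descFactorial n : ℝ)]
  exact mul_le_mul hdesc hpow (by positivity) (by positivity)

lemma Nice.anti {γ' : ℝ} (hγ : 0 < γ') (hle : γ' ≤ γ) {Φ : Tree n} (h : Nice γ T g₀ Φ) :
    Nice γ' T g₀ Φ :=
  ⟨h.good.anti hγ hle, h.sep.anti hle, h.last, h.acc_le.trans (inv_anti₀ hγ hle)⟩

/-- The mass of regular histories with at most `M` collisions that lead to `A` at time `t`. -/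
def niceMass (γ T : ℝ) (f₀ : L1Phase) (g₀ : L1V) (M : ℕ) (t : ℝ) (A : Set Phase) : ENNReal :=
  ∑ n ∈ Finset.range (M + 1), ∫⁻ Φ, {Φ : Tree n | Nice γ T g₀ Φ}.indicator 1 Φ *
    (sw g₀ Φ T * A.indicator 1 (path Φ t)) ∂tau T f₀ g₀ n

lemma measurable_path_right (t : ℝ) : Measurable fun Φ : Tree n => path Φ t :=
  measurable_path.comp (by fun_prop : Measurable fun Φ : Tree n => (Φ, t))

lemma Admissible.tsum_sw (h : Admissible f₀ g₀) (hT : 0 < T) :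
    ∑' n, ∫⁻ Φ, sw g₀ Φ T ∂tau T f₀ g₀ n = 1 := by
  have := h.Ff_one (T := T) (r := T) ⟨hT.le, le_rfl⟩
  simpa only [Ff, ev, mul_one] using this

/-- The total mass is one, so finitely many n carry almost all of it. For each n the nice histories
increase, as the parameter decreases, to almost every history with last collision before T; monotone
convergence applies. -/
lemma Admissible.exists_niceMass (h : Admissible f₀ g₀) (hT : 0 < T) {δ : ENNReal} (hδ : 0 < δ) :
    ∃ m M : ℕ, 1 ≤ niceMass (1 / ((m : ℝ) + 1)) T f₀ g₀ M 0 univ + δ := by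
  have hd2 : 0 < δ / 2 := ENNReal.half_pos hδ.ne'
  have hs : ∀ n, Measurable fun Φ : Tree n => sw g₀ Φ T := fun n => h.measurable_sw_right T
  have hγ : ∀ m : ℕ, 0 < 1 / ((m : ℝ) + 1) := fun m => by positivity
  have hlt : (1 : ENNReal) < 1 + δ / 2 := ENNReal.lt_add_right ENNReal.one_ne_top hd2.ne'
  obtain ⟨M, hM⟩ : ∃ M : ℕ, 1 < ∑ n ∈ Finset.range (M + 1), ∫⁻ Φ, sw g₀ Φ T ∂tau T f₀ g₀ n +
      δ / 2 := by
    have h1 := (ENNReal.summable (f := fun n => ∫⁻ Φ, sw g₀ Φ T ∂tau T f₀ g₀ n)).hasSum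
    rw [h.tsum_sw hT] at h1
    have h2 := (h1.tendsto_sum_nat.comp (tendsto_add_atTop_nat 1)).add_const (δ / 2)
    exact (h2.eventually_const_lt hlt).exists
  have hlim : ∀ n, Tendsto (fun m : ℕ => ∫⁻ Φ, {Φ : Tree n | Nice (1 / ((m : ℝ) + 1)) T g₀ Φ}.indicator
      1 Φ * sw g₀ Φ T ∂tau T f₀ g₀ n) atTop (𝓝 (∫⁻ Φ, sw g₀ Φ T ∂tau T f₀ g₀ n)) := by
    intro n
    have hanti : ∀ {a b : ℕ}, a ≤ b → 1 / ((b : ℝ) + 1) ≤ 1 / ((a : ℝ) + 1) := fun hab => by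
      gcongr
    have hmono : ∀ {a b : ℕ} {Φ : Tree n}, a ≤ b → Nice (1 / ((a : ℝ) + 1)) T g₀ Φ →
        Nice (1 / ((b : ℝ) + 1)) T g₀ Φ := fun hab hn => hn.anti (hγ _) (hanti hab)
    refine lintegral_tendsto_of_tendsto_of_monotone (fun m => ?_) ?_ ?_
    · exact ((measurable_one.indicator (h.measurableSet_nice (hγ m) hT)).mul (hs n)).aemeasurable
    · refine Eventually.of_forall fun Φ a b hab => ?_
      refine mul_le_mul' (indicator_le_indicator_of_subset (fun Φ' h' => ?_) (fun _ => zero_le) Φ)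
        le_rfl
      exact hmono hab h'
    · filter_upwards [ae_regular (f₀ := f₀) (g₀ := g₀) hT (n := n)] with Φ hΦ
      by_cases hl : lastT Φ < T
      · obtain ⟨m, h1, h2⟩ := hΦ
        obtain ⟨m', hm'⟩ := exists_nat_ge (acc g₀ Φ T)
        refine tendsto_const_nhds.congr' ?_
        filter_upwards [eventually_ge_atTop (max m m')] with k hk
        have hk1 := hanti ((le_max_left _ _).trans hk)
        have hk2 : (m' : ℝ) ≤ k := by exact_mod_cast (le_max_right _ _).trans hk
        have hnice : Nice (1 / ((k : ℝ) + 1)) T g₀ Φ :=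
          ⟨h1.anti (hγ k) hk1, h2.anti hk1, hl, by rw [one_div, inv_inv]; linarith⟩
        rw [indicator_of_mem (show Φ ∈ {Φ : Tree n | Nice (1 / ((k : ℝ) + 1)) T g₀ Φ} from hnice)]
        simp
      · have : sw g₀ Φ T = 0 := if_neg hl
        simp [this]
  have hsum := (tendsto_finsetSum (Finset.range (M + 1)) fun n _ => hlim n).add_const (δ / 2)
  obtain ⟨m, hm⟩ := (hsum.eventually_const_lt hM).exists
  refine ⟨m, M, hm.le.trans ?_⟩
  simp only [niceMass, indicator_univ, Pi.one_apply, mul_one]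
  exact add_le_add le_rfl ENNReal.half_le_self

lemma Admissible.niceMass_add_compl (h : Admissible f₀ g₀) (hγ : 0 < γ) (hT : 0 < T) (M : ℕ) (t : ℝ)
    {A : Set Phase} (hA : MeasurableSet A) : niceMass γ T f₀ g₀ M t A +
      niceMass γ T f₀ g₀ M t Aᶜ = niceMass γ T f₀ g₀ M 0 univ := by
  simp only [niceMass]
  rw [← Finset.sum_add_distrib]
  refine Finset.sum_congr rfl fun n _ => ?_
  have hs := h.measurable_sw_right (n := n) T
  have hp := measurable_path_right (n := n) t
  have hm1 : Measurable fun Φ : Tree n => A.indicator (1 : Phase → ENNReal) (path Φ t) :=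
    (measurable_one.indicator hA).comp hp
  have hm2 : Measurable ({Φ : Tree n | Nice γ T g₀ Φ}.indicator (1 : Tree n → ENNReal)) :=
    measurable_one.indicator (h.measurableSet_nice hγ hT)
  rw [← lintegral_add_left (by fun_prop)]
  refine lintegral_congr fun Φ => ?_
  rw [← mul_add, ← mul_add]
  congr 2
  by_cases hΦ : path Φ t ∈ A <;> simp [hΦ]

lemma niceMass_le (M : ℕ) (t : ℝ) {A : Set Phase} :
    niceMass γ T f₀ g₀ M t A ≤ ∑' n, ∫⁻ Φ, sw g₀ Φ T * A.indicator 1 (path Φ t) ∂tau T f₀ g₀ n := by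
  refine le_trans (Finset.sum_le_sum fun n _ => lintegral_mono fun Φ => ?_) (ENNReal.sum_le_tsum _)
  exact mul_le_of_le_one_left' (indicator_le_self' (by simp) _)

/-- The law of the path has mass one and dominates the nice mass on A and on its complement. Since
the nice masses miss at most δ altogether, they miss at most δ on A. The set of nice histories
depends on neither t nor A, hence the uniformity. -/
lemma Admissible.Ff_le_niceMass (h : Admissible f₀ g₀) (hγ : 0 < γ) (hT : 0 < T) {M : ℕ}
    {δ : ENNReal} (hM : 1 ≤ niceMass γ T f₀ g₀ M 0 univ + δ) {t : ℝ} (ht : t ∈ Icc 0 T)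
    {A : Set Phase} (hA : MeasurableSet A) :
    Ff T f₀ g₀ t (A.indicator 1) ≤ niceMass γ T f₀ g₀ M t A + δ := by
  refine (h.le_path_law ht hA).trans ?_
  have hs := fun n => h.measurable_sw_right (n := n) T
  have hp := fun n => measurable_path_right (n := n) t
  have hm1 : ∀ n, Measurable fun Φ : Tree n => A.indicator (1 : Phase → ENNReal) (path Φ t) :=
    fun n => (measurable_one.indicator hA).comp (hp n)
  have htot : ∑' n, ∫⁻ Φ, sw g₀ Φ T * A.indicator 1 (path Φ t) ∂tau T f₀ g₀ n +
      ∑' n, ∫⁻ Φ, sw g₀ Φ T * Aᶜ.indicator 1 (path Φ t) ∂tau T f₀ g₀ n = 1 := by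
    rw [← ENNReal.tsum_add, ← h.tsum_sw hT]
    refine tsum_congr fun n => ?_
    have hm2 : Measurable fun Φ : Tree n => sw g₀ Φ T * A.indicator 1 (path Φ t) :=
      (hs n).mul (hm1 n)
    rw [← lintegral_add_left hm2]
    refine lintegral_congr fun Φ => ?_
    by_cases hΦ : path Φ t ∈ A <;> simp [hΦ]
  have hle := niceMass_le (γ := γ) (T := T) (f₀ := f₀) (g₀ := g₀) M t (A := Aᶜ)
  have hfin : niceMass γ T f₀ g₀ M t Aᶜ ≠ ⊤ := by
    refine (hle.trans ?_).trans_lt ENNReal.one_lt_top |>.ne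
    rw [← htot]; exact le_add_self
  refine (ENNReal.add_le_add_iff_right hfin).1 ?_
  calc _ ≤ _ := add_le_add le_rfl hle
    _ = 1 := htot
    _ ≤ niceMass γ T f₀ g₀ M 0 univ + δ := hM
    _ = _ := by rw [← h.niceMass_add_compl hγ hT M t hA]; ring

lemma Admissible.niceMass_le_one (h : Admissible f₀ g₀) (hT : 0 < T) (M : ℕ) (t : ℝ)
    {A : Set Phase} : niceMass γ T f₀ g₀ M t A ≤ 1 := by
  refine (niceMass_le M t).trans ?_
  rw [← h.tsum_sw hT]
  refine ENNReal.tsum_le_tsum fun n => lintegral_mono fun Φ => ?_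
  exact mul_le_of_le_one_right' (indicator_le_self' (by simp) _)

lemma Admissible.ofReal_le_bm_far (h : Admissible f₀ g₀) (hγ : 0 < γ) {ε : ℝ} (hε : 0 < ε)
    (hT : 0 < T) {Φ : Tree n} (hΦ : GoodT γ Φ) (hl : lastT Φ ≤ T) :
    ENNReal.ofReal (1 - (ε ^ 2 * acc g₀ Φ T + (n + 1) *
      ((volume (Metric.ball (0 : V3) 1)).toReal * ε ^ 3))) ≤ bm g₀ {y | Far ε T Φ y} := by
  have hb : volume (Metric.ball (0 : V3) ε) =
      ENNReal.ofReal ((volume (Metric.ball (0 : V3) 1)).toReal * ε ^ 3) := by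
    rw [Measure.addHaar_ball _ _ hε.le, finrank_V3, mul_comm,
      ENNReal.ofReal_mul ENNReal.toReal_nonneg, ENNReal.ofReal_toReal measure_ball_lt_top.ne]
  have h0 := h.acc_nonneg hγ hΦ hl hT.le
  have key := h.bm_far_ge hγ hε hT hΦ hl
  have hn : ((n : ENNReal) + 1) = ENNReal.ofReal ((n : ℝ) + 1) := by
    rw [ENNReal.ofReal_add (by positivity) zero_le_one]; simp
  rw [hb, hn, ← ENNReal.ofReal_mul (by positivity), ← ENNReal.ofReal_mul (by positivity),
    ← ENNReal.ofReal_add (by positivity) (by positivity)] at key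
  rw [ENNReal.ofReal_sub _ (by positivity), ENNReal.ofReal_one]
  exact tsub_le_iff_right.2 key

/-- The law of the particle system dominates the regular histories. -/
lemma Admissible.niceMass_le_events (h : Admissible f₀ g₀) (hγ : 0 < γ) (hγ1 : γ ≤ 1) (hT : 0 < T)
    {e : ℝ} (he : 0 < e) (he1 : e ≤ 1) (heγ : e < γ ^ 2 / 8) (hN : N * e ^ 2 = 1) {M : ℕ}
    (hM : M * e ^ 2 ≤ 1) (hK : (4 * γ⁻¹ + 8 * (M + 1) *
      (volume (Metric.ball (0 : V3) 1)).toReal) * e ^ 2 ≤ 1 / 2) (t : ℝ) {A : Set Phase}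
    (hA : MeasurableSet A) :
    ENNReal.ofReal (errorFactor (volume (Metric.ball (0 : V3) 1)).toReal γ⁻¹ M e) *
      niceMass γ T f₀ g₀ M t A ≤
      initialLaw f₀ g₀ N (events γ e (e * (1 + e)) T t g₀ M N A) := by
  set c := (volume (Metric.ball (0 : V3) 1)).toReal with hc
  have hee : e < e * (1 + e) := by nlinarith
  refine le_trans ?_ (h.events_ge hγ hγ1 hT he heγ hee M t hA)
  rw [niceMass, Finset.mul_sum]
  refine Finset.sum_le_sum fun n hn => ?_
  have hnM : n ≤ M := Nat.lt_succ_iff.1 (Finset.mem_range.1 hn)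
  rw [← lintegral_const_mul' _ _ ENNReal.ofReal_ne_top, ← lintegral_const_mul' _ _ (by simp),
    ← lintegral_const_mul' _ _ (by simp)]
  refine lintegral_mono fun Φ => ?_
  simp only
  by_cases hΦ : Nice γ T g₀ Φ
  swap
  · rw [indicator_of_notMem (show Φ ∉ {Φ : Tree n | Nice γ T g₀ Φ} from hΦ)]; simp
  have hacc := h.acc_nonneg hγ hΦ.good hΦ.last.le hT.le
  have hfar := h.ofReal_le_bm_far hγ (ε := e * (1 + e)) (by positivity) hT hΦ.good hΦ.last.le
  obtain ⟨hx1, hreal⟩ := errorFactor_le (c := c) (n := n) ENNReal.toReal_nonneg hacc hΦ.acc_le he he1 hN hnM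
    hM hK
  rw [indicator_of_mem (show Φ ∈ {Φ : Tree n | Nice γ T g₀ Φ} from hΦ), Pi.one_apply, one_mul,
    one_mul, sw, if_pos hΦ.last]
  calc _ = ENNReal.ofReal (errorFactor c γ⁻¹ M e * Real.exp (-acc g₀ Φ T)) *
        A.indicator 1 (path Φ t) := by
        rw [ENNReal.ofReal_mul' (Real.exp_pos _).le, mul_assoc]
    _ ≤ ENNReal.ofReal (N.descFactorial n * ((e ^ 2) ^ n * (1 - ((e * (1 + e)) ^ 2 * acc g₀ Φ T +
        (n + 1) * (c * (e * (1 + e)) ^ 3))) ^ (N - n))) * A.indicator 1 (path Φ t) :=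
        mul_le_mul' (ENNReal.ofReal_le_ofReal hreal) le_rfl
    _ ≤ (N.descFactorial n * (ENNReal.ofReal (e ^ 2) ^ n * bm g₀ {y | Far (e * (1 + e)) T Φ y} ^
        (N - n))) * A.indicator 1 (path Φ t) := by
        refine mul_le_mul' ?_ le_rfl
        rw [ENNReal.ofReal_mul (by positivity), ENNReal.ofReal_mul (by positivity),
          ENNReal.ofReal_natCast, ENNReal.ofReal_pow (by positivity), ENNReal.ofReal_pow hx1]
        gcongr
    _ = _ := by ring

lemma tendsto_diam : Tendsto diam atTop (𝓝 0) := by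
  unfold diam
  exact tendsto_inv_atTop_zero.comp (Real.tendsto_sqrt_atTop.comp tendsto_natCast_atTop_atTop)

lemma diam_pos (hN : 0 < N) : 0 < diam N := by
  have : (0 : ℝ) < N := by exact_mod_cast hN
  unfold diam; positivity

lemma mul_diam_sq (hN : 0 < N) : N * diam N ^ 2 = 1 := by
  have : (0 : ℝ) < N := by exact_mod_cast hN
  rw [diam, inv_pow, Real.sq_sqrt this.le, mul_inv_cancel₀ (ne_of_gt this)]

/-- Up to a small probability, the dynamics is defined and the tagged particle is distributed
according to the solution of the linear Boltzmann equation. -/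
theorem Admissible.eventually_exists_event (h : Admissible f₀ g₀) (hT : 0 < T) {δ : ℝ} (hδ : 0 < δ) :
    ∀ᶠ N : ℕ in atTop, ∀ t ∈ Icc 0 T, ∀ A : Set Phase, MeasurableSet A →
      ∃ E : Set (Config N), MeasurableSet E ∧
        (∀ ω ∈ E, WellPosed T (diam N) ω ∧ taggedState T (diam N) ω t ∈ A) ∧
        ENNReal.ofReal (∫ z in A, sol T f₀ g₀ t z) ≤ initialLaw f₀ g₀ N E + ENNReal.ofReal δ := by
  have hd2 : 0 < ENNReal.ofReal (δ / 2) := ENNReal.ofReal_pos.2 (by positivity)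
  obtain ⟨m, M, hmass⟩ := h.exists_niceMass hT hd2
  set γ : ℝ := 1 / ((m : ℝ) + 1) with hγdef
  have hγ : 0 < γ := by positivity
  have hγ1 : γ ≤ 1 := by
    rw [hγdef, div_le_one (by positivity)]
    have : (0 : ℝ) ≤ m := by positivity
    linarith
  set c := (volume (Metric.ball (0 : V3) 1)).toReal with hc
  have e1 : ∀ᶠ e : ℝ in 𝓝 0, e ≤ 1 := eventually_le_nhds one_pos
  have e2 : ∀ᶠ e : ℝ in 𝓝 0, e < γ ^ 2 / 8 := eventually_lt_nhds (by positivity)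
  have hsq : ∀ a : ℝ, Tendsto (fun e : ℝ => a * e ^ 2) (𝓝 0) (𝓝 0) := fun a => by
    have : Continuous fun e : ℝ => a * e ^ 2 := by fun_prop
    simpa using this.tendsto 0
  have e3 : ∀ᶠ e : ℝ in 𝓝 0, M * e ^ 2 ≤ 1 := (hsq M).eventually_le_const one_pos
  have e4 : ∀ᶠ e : ℝ in 𝓝 0, (4 * γ⁻¹ + 8 * (M + 1) * c) * e ^ 2 ≤ 1 / 2 :=
    (hsq _).eventually_le_const (by norm_num)
  have e5 : ∀ᶠ e : ℝ in 𝓝 0, 1 - δ / 2 ≤ errorFactor c γ⁻¹ M e :=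
    (tendsto_errorFactor c γ⁻¹ M).eventually_const_le (by linarith)
  filter_upwards [tendsto_diam.eventually e1, tendsto_diam.eventually e2,
    tendsto_diam.eventually e3, tendsto_diam.eventually e4, tendsto_diam.eventually e5,
    eventually_gt_atTop 0] with N h1 h2 h3 h4 h5 hN t ht A hA
  have he := diam_pos hN
  have hee : diam N < diam N * (1 + diam N) := by nlinarith
  refine ⟨events γ (diam N) (diam N * (1 + diam N)) T t g₀ M N A, ?_,
    fun ω hω => mem_events hγ hγ1 hT he h2 hee ht hω, ?_⟩
  · exact Finset.measurableSet_biUnion _ fun n _ => MeasurableSet.iUnion fun ι =>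
      h.measurableSet_event hγ hγ1 hT he h2 hee ι t hA
  · rw [h.setIntegral_sol ht hA]
    have k1 := h.Ff_le_niceMass hγ hT hmass ht hA
    have k2 := h.niceMass_le_events hγ hγ1 hT he h1 h2 (mul_diam_sq hN) h3 h4 t hA
    have k3 : niceMass γ T f₀ g₀ M t A ≤ ENNReal.ofReal (errorFactor c γ⁻¹ M (diam N)) *
        niceMass γ T f₀ g₀ M t A + ENNReal.ofReal (δ / 2) := by
      have k4 : (1 : ENNReal) ≤ ENNReal.ofReal (errorFactor c γ⁻¹ M (diam N)) +
          ENNReal.ofReal (δ / 2) := by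
        rw [← ENNReal.ofReal_one]
        refine le_trans (ENNReal.ofReal_le_ofReal ?_) ENNReal.ofReal_add_le
        linarith
      calc niceMass γ T f₀ g₀ M t A = 1 * niceMass γ T f₀ g₀ M t A := (one_mul _).symm
        _ ≤ _ := mul_le_mul' k4 le_rfl
        _ = _ := add_mul _ _ _
        _ ≤ _ := add_le_add le_rfl (mul_le_of_le_one_right' (h.niceMass_le_one hT M t))
    have k5 : ENNReal.ofReal δ = ENNReal.ofReal (δ / 2) + ENNReal.ofReal (δ / 2) := by
      rw [← ENNReal.ofReal_add (by positivity) (by positivity), add_halves]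
    rw [k5, ← add_assoc]
    exact k1.trans (add_le_add (k3.trans (add_le_add k2 le_rfl)) le_rfl)

lemma Admissible.isProbabilityMeasure_initialLaw (h : Admissible f₀ g₀) (N : ℕ) :
    IsProbabilityMeasure (initialLaw f₀ g₀ N) := by
  have h1 : IsProbabilityMeasure (mu0 f₀) := ⟨h.mu0_univ⟩
  have h2 : IsProbabilityMeasure (bm g₀) := ⟨h.bm_univ⟩
  rw [initialLaw_eq]
  infer_instance

/-- The dynamics is defined with probability tending to one. -/
theorem Admissible.tendsto_not_wellPosed (h : Admissible f₀ g₀) (hT : 0 < T) :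
    Tendsto (fun N : ℕ => initialLaw f₀ g₀ N {ω | ¬ WellPosed T (diam N) ω}) atTop (𝓝 0) := by
  rw [ENNReal.tendsto_nhds_zero]
  intro δ hδ
  obtain ⟨δ', hδ', hle⟩ : ∃ δ' : ℝ, 0 < δ' ∧ ENNReal.ofReal δ' ≤ δ := by
    obtain ⟨r, hr, hr2⟩ := ENNReal.lt_iff_exists_real_btwn.1 hδ
    exact ⟨r, ENNReal.ofReal_pos.1 hr2.1, hr2.2.le⟩
  filter_upwards [h.eventually_exists_event hT hδ'] with N hN
  have := h.isProbabilityMeasure_initialLaw N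
  have h0 : (0 : ℝ) ∈ Icc 0 T := ⟨le_rfl, hT.le⟩
  -- For the whole space the lower bound says that the dynamics exists on a measurable event of
  -- probability at least 1 - δ'.
  obtain ⟨E, hE, hE2, hE3⟩ := hN 0 h0 univ MeasurableSet.univ
  rw [setIntegral_univ, h.integral_sol h0, ENNReal.ofReal_one] at hE3
  have hsub : {ω | ¬ WellPosed T (diam N) ω} ⊆ Eᶜ := fun ω hω hωE => hω (hE2 ω hωE).1
  refine (measure_mono hsub).trans (le_trans ?_ hle)
  rw [prob_compl_eq_one_sub hE]
  exact tsub_le_iff_left.2 hE3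

/-- Convergence in total variation, uniformly in time. -/
theorem Admissible.eventually_abs_taggedLaw_sub_le (h : Admissible f₀ g₀) (hT : 0 < T) {δ : ℝ}
    (hδ : 0 < δ) : ∀ᶠ N : ℕ in atTop, ∀ t ∈ Icc 0 T, ∀ A : Set Phase, MeasurableSet A →
      |taggedLaw T f₀ g₀ N t A - ∫ z in A, sol T f₀ g₀ t z| ≤ δ := by
  filter_upwards [h.eventually_exists_event hT hδ] with N hN t ht A hA
  have := h.isProbabilityMeasure_initialLaw N
  have key : ∀ B : Set Phase, MeasurableSet B → ∃ E : Set (Config N), MeasurableSet E ∧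
      (∀ ω ∈ E, taggedState T (diam N) ω t ∈ B) ∧
      ∫ z in B, sol T f₀ g₀ t z ≤ (initialLaw f₀ g₀ N).real E + δ := fun B hB => by
    obtain ⟨E, hE, hE2, hE3⟩ := hN t ht B hB
    refine ⟨E, hE, fun ω hω => (hE2 ω hω).2, ?_⟩
    rw [← ofReal_measureReal, ← ENNReal.ofReal_add measureReal_nonneg hδ.le] at hE3
    exact (ENNReal.ofReal_le_ofReal_iff (by positivity)).1 hE3
  obtain ⟨E, -, hE2, hE3⟩ := key A hA
  obtain ⟨E', hE', hE'2, hE'3⟩ := key Aᶜ hA.compl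
  have htot : (∫ z in A, sol T f₀ g₀ t z) + ∫ z in Aᶜ, sol T f₀ g₀ t z = 1 := by
    rw [integral_add_compl hA (L1.integrable_coeFn _), h.integral_sol ht]
  have h1 : (initialLaw f₀ g₀ N).real E ≤ taggedLaw T f₀ g₀ N t A :=
    measureReal_mono fun ω hω => hE2 ω hω
  -- The lower bound on the complement of A serves as an upper bound on A. Only E' has to be
  -- measurable; the event that the tagged state lies in A enters through monotonicity alone.
  have h2 : taggedLaw T f₀ g₀ N t A ≤ (initialLaw f₀ g₀ N).real E'ᶜ :=
    measureReal_mono fun ω hω hω' => hE'2 ω hω' hω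
  rw [probReal_compl_eq_one_sub hE'] at h2
  rw [abs_le]
  constructor <;> linarith

end Rayleigh

end
theorem theorem2p3 (T : ℝ) (hT : 0 < T) (f₀ : Rayleigh.L1Phase) (g₀ : Rayleigh.L1V)
    (h : Rayleigh.Admissible f₀ g₀) :
    ∃ f : ℝ → Rayleigh.L1Phase,
      -- `f` is the unique mild solution of the linear Boltzmann equation on `[0,T]`
      Rayleigh.IsMildSolution T g₀ f₀ f ∧
      (∀ u : ℝ → Rayleigh.L1Phase, Rayleigh.IsMildSolution T g₀ f₀ u →
        ∀ t ∈ Set.Icc 0 T, u t = f t) ∧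
      -- each `f t` is a probability density
      (∀ t ∈ Set.Icc 0 T, (∀ᵐ z, 0 ≤ f t z) ∧ ∫ z, f t z = 1) ∧
      -- with probability tending to one the particle dynamics is defined up to time `T`
      Filter.Tendsto (fun N : ℕ => Rayleigh.initialLaw f₀ g₀ N
          {ω | ¬ Rayleigh.WellPosed T (Rayleigh.diam N) ω}) Filter.atTop (nhds 0) ∧
      -- convergence in total variation, uniformly in `t ∈ [0,T]`
      (∀ δ : ℝ, 0 < δ → ∀ᶠ N : ℕ in Filter.atTop, ∀ t ∈ Set.Icc 0 T,
        ∀ A : Set Rayleigh.Phase, MeasurableSet A →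
          |Rayleigh.taggedLaw T f₀ g₀ N t A - ∫ z in A, f t z| ≤ δ) := by
  refine ⟨Rayleigh.sol T f₀ g₀, h.isMildSolution,
    fun u hu t ht => hu.unique h h.isMildSolution hT t ht,
    fun t ht => ⟨h.sol_nonneg ht, h.integral_sol ht⟩, ?_, ?_⟩
  · exact h.tendsto_not_wellPosed hT
  · exact fun δ hδ => h.eventually_abs_taggedLaw_sub_le hT hδ
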